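/- Let $G$ be a compact Lie group. For a manifold $M$ with a smooth left $G$-action, $G\text{-}\mathrm{Grb}(M)$ denotes the 2-groupoid of $G$-equivariant $S^1$-bundle gerbes $\mathcal L=(Y,L,\mu)$ on $M$: $\pi\colon Y\to M$ is a $G$-equivariant surjective submersion, $L$ is a $G$-equivariant principal $S^1$-bundle on $Y^{[2]}=Y\times_M Y$, and $\mu$ is an associative equivariant isomorphism $\pi_{12}^*L\otimes\pi_{23}^*L\to\pi_{13}^*L$ over $Y^{[3]}$. A 1-morphism $\mathcal L_1\to\mathcal L_2$ is a triple $(Z,K,\alpha)$, with $Z\to Y_1\times_M Y_2$ a $G$-equivariant surjective submersion, $K$ a $G$-equivariant $S^1$-bundle on $Z$, and $\alpha\colon L_1\otimes\zeta_2^*K\to\zeta_1^*K\otimes L_2$ an equivariant isomorphism over $Z\times_M Z$ compatible with $\mu_1,\mu_2$. A 2-morphism $(Z_1,K_1,\alpha_1)\Rightarrow(Z_2,K_2,\alpha_2)$ is a class $(W,\beta)$, up to refinement of $W$, with $W\to Z_1\times_{Y_1\times_M Y_2}Z_2$ a $G$-equivariant surjective submersion and $\beta\colon K_1\to K_2$ an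 equivariant isomorphism over $W$ compatible with $\alpha_1,\alpha_2$. Let $\Omega_G(M)=(S\mathfrak g^*\otimes\Lambda\mathfrak g^*\otimes\Omega(M))_{\mathrm{bas}}$ be the Weil model of equivariant forms, with differential $d_G$. $G\text{-}\mathrm{Grb}_\nabla(M)$ is the 2-groupoid of $G$-equivariant bundle gerbes with connection $\widehat{\mathcal L}=(Y,L,\nabla,B,\mu)$: in addition $\nabla$ is a $G$-invariant connection on $L$ preserved by $\mu$, and $B\in\Omega^2_G(Y)$ satisfies $\mathrm{curv}_G(\nabla)=\pi_2^*B-\pi_1^*B$; 1-morphisms carry a $G$-invariant connection $\nabla_K$ on $K$ that is preserved by $\alpha$ and has $\mathrm{curv}_G(\nabla_K)=\zeta^*(B_2-B_1)$, and for 2-morphisms $\beta$ preserves the connections. The curvature $\mathrm{curv}_G(\widehat{\mathcal L})\in\Omega^3_G(M)$ is the unique form with $\pi^*\mathrm{curv}_G(\widehat{\mathcal L})=d_G B$. For the trivial group one writes $\mathrm{Grb}(M)$, $\mathrm{Grb}_\nabla(M)$ and $\mathrm{curv}$. Let $P\to X$ be a principal $G$-bundle. (1) There is a functor of 2-groupoids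 $G\text{-}\mathrm{Grb}(P)\to\mathrm{Grb}(X)$ which takes quotients by $G$: $(Y,L,\mu)\mapsto(Y/G,L/G,\mu/G)$ on objects, $(Z,K,\alpha)\mapsto(Z/G,K/G,\alpha/G)$ on 1-morphisms, and $(W,\beta)\mapsto(W/G,\beta/G)$ on 2-morphisms. (2) For every connection $\Theta$ on $P$, with curvature $\Omega$, there is a functor of 2-groupoids $\Theta^*\colon G\text{-}\mathrm{Grb}_\nabla(P)\to\mathrm{Grb}_\nabla(X)$ which lies over the functor in (1), and which is given by $(Y,L,\nabla,B,\mu)\mapsto(Y/G,L/G,\Theta^*\nabla,\Theta^*B,\mu/G)$ on objects and by $(Z,K,\nabla_K,\alpha)\mapsto(Z/G,K/G,\Theta^*\nabla_K,\alpha/G)$ on 1-morphisms. Here the connection form of $\Theta^*\nabla$ has pullback $(1-\iota_\Theta)A$ to $L$, where $A$ is the connection form of $\nabla$ (similarly for $\nabla_K$), and $\Theta^*\colon\Omega_G^n(Y)\to\Omega^n(Y)_{\mathrm{bas}}\cong\Omega^n(Y/G)$ is the Weil homomorphism $\alpha\otimes\beta\otimes\gamma\mapsto\alpha(\Omega)\wedge\beta(\Theta)\wedge\gamma$,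 with $\Theta$ and $\Omega$ pulled back to $Y$. For every $\widehat{\mathcal L}\in G\text{-}\mathrm{Grb}_\nabla(P)$, $$\mathrm{curv}(\Theta^*\widehat{\mathcal L})=\Theta^*(\mathrm{curv}_G(\widehat{\mathcal L}))\in\Omega^3(X).$$ -/

import Mathlib

universe v u w

open scoped Manifold ContDiff

noncomputable section

namespace GerbeQuot

/-! ## Manifolds, Lie groups, actions -/

/-- A smooth manifold: Hausdorff, second countable, without boundary, of dimension `dim`. -/
structure Mfd : Type (u + 1) where
  carrier : Type u
  dim : ℕ
  [top : TopologicalSpace carrier]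
  [t2 : T2Space carrier]
  [sc : SecondCountableTopology carrier]
  [charted : ChartedSpace (EuclideanSpace ℝ (Fin dim)) carrier]
  [smooth : IsManifold (𝓡 dim) ∞ carrier]

attribute [instance] Mfd.top Mfd.t2 Mfd.sc Mfd.charted Mfd.smooth

instance : CoeSort Mfd.{u} (Type u) := ⟨Mfd.carrier⟩

/-- The model vector space; every tangent space of `M` is a copy of it (in Mathlib, definitionally,
by means of the preferred chart at the point). -/
abbrev Mfd.E (M : Mfd.{u}) : Type := EuclideanSpace ℝ (Fin M.dim)

/-- Smooth maps. -/
def Smooth {M : Mfd.{u}} {N : Mfd.{w}} (f : M → N) : Prop :=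
  ContMDiff (𝓡 M.dim) (𝓡 N.dim) ∞ f

/-- The differential `T_x M → T_{f x} N`. -/
def D {M : Mfd.{u}} {N : Mfd.{w}} (f : M → N) (x : M) : M.E →L[ℝ] N.E :=
  mfderiv (𝓡 M.dim) (𝓡 N.dim) f x

/-- A Lie group. -/
structure LieGrp : Type (v + 1) extends Mfd.{v} where
  [grp : Group carrier]
  [lie : LieGroup (𝓡 dim) ∞ carrier]

attribute [instance] LieGrp.grp LieGrp.lie

instance : CoeSort LieGrp.{v} (Type v) := ⟨fun G => G.carrier⟩

/-- The bracket of the Lie algebra `𝔤 = T_1 G` (computed with left invariant vector fields). -/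
def LieGrp.bracket (G : LieGrp.{v}) (ξ η : G.E) : G.E :=
  Bracket.bracket (L := GroupLieAlgebra (𝓡 G.dim) G.carrier)
    (M := GroupLieAlgebra (𝓡 G.dim) G.carrier) ξ η

/-- The adjoint action of `G` on `𝔤`. -/
def LieGrp.Ad (G : LieGrp.{v}) (g : G) : G.E →L[ℝ] G.E :=
  D (M := G.toMfd) (N := G.toMfd) (fun h : G => g * h * g⁻¹) (1 : G)

/-- The circle group `S¹`. -/
def circleGrp : LieGrp.{0} :=
  haveI : SecondCountableTopology Circle :=
    inferInstanceAs (SecondCountableTopology (Submonoid.unitSphere ℂ))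
  haveI : LieGroup (𝓡 1) ∞ Circle := LieGroup.of_le (n := ω) le_top
  { carrier := Circle, dim := 1 }

/-- The trivial Lie group. -/
def trivialGrp : LieGrp.{0} :=
  letI : ChartedSpace (EuclideanSpace ℝ (Fin 0)) PUnit.{1} := ChartedSpace.ofDiscreteTopology
  haveI : IsManifold (𝓡 0) ∞ PUnit.{1} := IsManifold.of_discreteTopology _
  haveI : LieGroup (𝓡 0) ∞ PUnit.{1} :=
    { contMDiff_mul := contMDiff_of_subsingleton
      contMDiff_inv := contMDiff_of_subsingleton }
  { carrier := PUnit.{1}, dim := 0 }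

/-- A smooth left action of a Lie group on a manifold. -/
structure IsSmoothAction (H : LieGrp.{v}) (P : Mfd.{u}) (a : H → P → P) : Prop where
  one_act : ∀ p, a 1 p = p
  mul_act : ∀ g h p, a (g * h) p = a g (a h p)
  smooth_act : ContMDiff ((𝓡 H.dim).prod (𝓡 P.dim)) (𝓡 P.dim) ∞
    (fun p : H.carrier × P.carrier => a p.1 p.2)

/-- A `G`-manifold (left action). -/
structure GMfd (G : LieGrp.{v}) : Type (max v (u + 1)) extends Mfd.{u} where
  act : G → carrier → carrier
  isAction : IsSmoothAction G toMfd act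

instance {G : LieGrp.{v}} : CoeSort (GMfd.{v, u} G) (Type u) := ⟨fun M => M.carrier⟩

/-- A manifold, regarded as a manifold with an action of the trivial group. -/
def Mfd.triv (X : Mfd.{u}) : GMfd.{0, u} trivialGrp where
  toMfd := X
  act := fun _ x => x
  isAction := ⟨fun _ => rfl, fun _ _ _ => rfl, contMDiff_snd⟩

/-- `q : P → X` is a principal `H`-bundle: the action preserves the fibres, and over an open
neighbourhood `U` of every point there are a smooth section `s` and a smooth map `χ` for which
`(x, h) ↦ h · s x` and `p ↦ (q p, χ p)` are mutually inverse, equivariant trivializations.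
(With a left action `h · p`, the right action of a principal bundle is `p · h = h⁻¹ · p`.) -/
structure IsPrincipal (H : LieGrp.{v}) {P : Mfd.{u}} {X : Mfd.{w}} (a : H → P → P) (q : P → X) :
    Prop where
  isAction : IsSmoothAction H P a
  smooth_proj : Smooth q
  proj_act : ∀ h p, q (a h p) = q p
  locally_trivial : ∀ x : X, ∃ U : Set X, IsOpen U ∧ x ∈ U ∧ ∃ (s : X → P) (χ : P → H),
    ContMDiffOn (𝓡 X.dim) (𝓡 P.dim) ∞ s U ∧
    ContMDiffOn (𝓡 P.dim) (𝓡 H.dim) ∞ χ (q ⁻¹' U) ∧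
    (∀ y ∈ U, q (s y) = y) ∧
    (∀ p, q p ∈ U → a (χ p) (s (q p)) = p) ∧
    (∀ y ∈ U, ∀ h, χ (a h (s y)) = h)

section Basics

variable {G : LieGrp.{v}}

/-- The vector at `x` that generates `t ↦ exp (-t ξ) · x`, in other words the right action
`x ↦ x · exp (t ξ)`; as a linear function of `ξ ∈ 𝔤`. -/
def GMfd.fund (M : GMfd.{v, u} G) (x : M) : G.E →L[ℝ] M.E :=
  D (M := G.toMfd) (N := M.toMfd) (fun g : G => M.act g⁻¹ x) (1 : G)

/-- Smooth equivariant maps. -/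
structure IsGMap {M N : GMfd.{v, u} G} (f : M → N) : Prop where
  smooth : Smooth f
  equivariant : ∀ g x, f (M.act g x) = N.act g (f x)

/-- `G`-covers: equivariant surjective submersions. -/
structure IsGCover {Y M : GMfd.{v, u} G} (π : Y → M) : Prop extends IsGMap π where
  surjective : Function.Surjective π
  submersion : ∀ y, Function.Surjective (D π y)

/-- The equivariant maps `fst, snd : Y₂ → Y` identify `Y₂` with the fibre product `Y ×_M Y` (the
submanifold `{(a, b) | π a = π b}` of `Y × Y`, for a surjective submersion `π`): they induce a
bijection on points, and bijections on tangent spaces. -/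
structure IsFibreSquare {Y M Y₂ : GMfd.{v, u} G} (π : Y → M) (fst snd : Y₂ → Y) : Prop where
  fst_map : IsGMap fst
  snd_map : IsGMap snd
  comm : ∀ p, π (fst p) = π (snd p)
  points : ∀ a b, π a = π b → ∃! p, fst p = a ∧ snd p = b
  tangent : ∀ p (a b : Y.E), D π (fst p) a = D π (snd p) b →
    ∃! c : Y₂.E, D fst p c = a ∧ D snd p c = b

/-! ## Differential forms in the Weil model -/

/-- The differential at `y` of the inverse of the preferred chart around `x₀`. -/
def chartD (M : Mfd.{u}) (x₀ : M) (y : M.E) : M.E →L[ℝ] M.E :=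
  mfderiv 𝓘(ℝ, M.E) (𝓡 M.dim) (extChartAt (𝓡 M.dim) x₀).symm y

/-- The differential at `x` of the preferred chart at `x`. -/
def chartT (M : Mfd.{u}) (x : M) : M.E →L[ℝ] M.E :=
  mfderiv (𝓡 M.dim) 𝓘(ℝ, M.E) (extChartAt (𝓡 M.dim) x) x

/-- The differential at `x` of a real function. -/
def dFun {M : Mfd.{u}} (f : M → ℝ) (x : M) : M.E →L[ℝ] ℝ :=
  mfderiv (𝓡 M.dim) 𝓘(ℝ, ℝ) f x

/-- A 1-form with values in `F`, as a family of linear maps on tangent spaces; its expression in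
the preferred chart around `x₀`. -/
def oneFormChart {M : Mfd.{u}} {F : Type*} [NormedAddCommGroup F] [NormedSpace ℝ F]
    (A : M → (M.E →L[ℝ] F)) (x₀ : M) (y : M.E) : M.E →L[ℝ] F :=
  (A ((extChartAt (𝓡 M.dim) x₀).symm y)).comp (chartD M x₀ y)

/-- Smoothness of a 1-form. -/
def SmoothOneForm {M : Mfd.{u}} {F : Type*} [NormedAddCommGroup F] [NormedSpace ℝ F]
    (A : M → (M.E →L[ℝ] F)) : Prop :=
  ∀ x₀ : M, ContDiffOn ℝ ∞ (oneFormChart A x₀) (extChartAt (𝓡 M.dim) x₀).target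

/-- The value `(dA)_x(a, b)` of the exterior derivative of a 1-form, computed in the preferred
chart at `x`. -/
def dOneForm {M : Mfd.{u}} {F : Type*} [NormedAddCommGroup F] [NormedSpace ℝ F]
    (A : M → (M.E →L[ℝ] F)) (x : M) (a b : M.E) : F :=
  let φ := extChartAt (𝓡 M.dim) x
  let T := chartT M x
  fderiv ℝ (oneFormChart A x) (φ x) (T a) (T b) - fderiv ℝ (oneFormChart A x) (φ x) (T b) (T a)

/-- An element of total degree `n = m + 2 ≤ 3` of the Weil algebra with values in forms,
`(S𝔤* ⊗ Λ𝔤* ⊗ Ω(M))ⁿ = ⨁ Sⁱ𝔤* ⊗ Λʲ𝔤* ⊗ Ωᵏ(M)`, `2 i + j + k = n`. As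
`⨁_{j + k = r} Λʲ𝔤* ⊗ Λᵏ T*_xM = Λʳ (𝔤 × T_xM)*` and as `i ≤ 1` for `n ≤ 3`, this is
* the part `i = 1`, which is linear in `𝔤`: `lin x u ∈ Λᵐ (𝔤 × T_xM)*` for `u ∈ 𝔤`;
* the part `i = 0`: `top x ∈ Λᵐ⁺² (𝔤 × T_xM)*`.
For the trivial group it is just an `(m + 2)`-form on `M`. -/
structure WeilForm (M : GMfd.{v, u} G) (m : ℕ) where
  lin : ∀ _ : M, G.E →L[ℝ] ((G.E × M.E) [⋀^Fin m]→L[ℝ] ℝ)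
  top : ∀ _ : M, (G.E × M.E) [⋀^Fin (m + 2)]→L[ℝ] ℝ

namespace WeilForm

variable {M N : GMfd.{v, u} G} {m : ℕ}

/-- The component `top` in the preferred chart around `x₀`. -/
def topChart (σ : WeilForm M m) (x₀ : M) (y : M.E) : (G.E × M.E) [⋀^Fin (m + 2)]→L[ℝ] ℝ :=
  (σ.top ((extChartAt (𝓡 M.dim) x₀).symm y)).compContinuousLinearMap
    ((ContinuousLinearMap.id ℝ G.E).prodMap (chartD M.toMfd x₀ y))

/-- The component `lin` in the preferred chart around `x₀`. -/
def linChart (σ : WeilForm M m) (x₀ : M) (y : M.E) :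
    G.E →L[ℝ] ((G.E × M.E) [⋀^Fin m]→L[ℝ] ℝ) :=
  (ContinuousAlternatingMap.compContinuousLinearMapCLM
    ((ContinuousLinearMap.id ℝ G.E).prodMap (chartD M.toMfd x₀ y))).comp
    (σ.lin ((extChartAt (𝓡 M.dim) x₀).symm y))

/-- `σ` is an element of `Ω_G(M) = (S𝔤* ⊗ Λ𝔤* ⊗ Ω(M))_bas`: it is smooth, invariant under `G`,
and annihilated by all contractions with `ξ ∈ 𝔤`; these contract `Λ𝔤*` with `ξ` and `Ω(M)` with
the generating vector field of `ξ`, and vanish on `S𝔤*`. -/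
structure IsEquivForm (σ : WeilForm M m) : Prop where
  smooth_lin : ∀ x₀ : M, ContDiffOn ℝ ∞ (σ.linChart x₀) (extChartAt (𝓡 M.dim) x₀).target
  smooth_top : ∀ x₀ : M, ContDiffOn ℝ ∞ (σ.topChart x₀) (extChartAt (𝓡 M.dim) x₀).target
  invariant_lin : ∀ g x u (e : Fin m → G.E × M.E),
    σ.lin (M.act g x) (G.Ad g u) (fun i => (G.Ad g (e i).1, D (M.act g) x (e i).2)) = σ.lin x u e
  invariant_top : ∀ g x (e : Fin (m + 2) → G.E × M.E),
    σ.top (M.act g x) (fun i => (G.Ad g (e i).1, D (M.act g) x (e i).2)) = σ.top x e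
  horizontal_lin : ∀ x u (ξ : G.E) (e : Fin m → G.E × M.E),
    (∃ i, e i = (ξ, M.fund x ξ)) → σ.lin x u e = 0
  horizontal_top : ∀ x (ξ : G.E) (e : Fin (m + 2) → G.E × M.E),
    (∃ i, e i = (ξ, M.fund x ξ)) → σ.top x e = 0

/-- Pullback along an equivariant map. -/
def pull (f : N → M) (σ : WeilForm M m) : WeilForm N m where
  lin := fun x => (ContinuousAlternatingMap.compContinuousLinearMapCLM
    ((ContinuousLinearMap.id ℝ G.E).prodMap (D f x))).comp (σ.lin (f x))
  top := fun x => (σ.top (f x)).compContinuousLinearMap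
    ((ContinuousLinearMap.id ℝ G.E).prodMap (D f x))

instance : Sub (WeilForm M m) :=
  ⟨fun σ η => ⟨fun x => σ.lin x - η.lin x, fun x => σ.top x - η.top x⟩⟩

/-! The differential `d_G` is the derivation which on `Ω(M)` is the exterior derivative, and on the
generators `θ ∈ Λ¹𝔤* ⊗ 𝔤`, `u ∈ S¹𝔤* ⊗ 𝔤` is `dθ = u - ½[θ, θ]`, `du = [u, θ]`. -/

/-- The component in `S¹ ⊗ Λ¹(𝔤 × TM)*` of `d_G B`, for `B` of degree 2, evaluated at `u` and `e`:
`dθ ↦ u` in the component `top`, and `du = [u, θ]` in the component `lin`. -/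
def dLin (B : WeilForm M 0) (x : M) (u : G.E) (e : G.E × M.E) : ℝ :=
  dFun (fun y : M => B.lin y u ![]) x e.2
    + B.lin x (G.bracket u e.1) ![] + B.top x ![(u, 0), e]

/-- The component in `Λ³(𝔤 × TM)*` of `d_G B`, for `B` of degree 2: the exterior derivative (taken
in the preferred chart at `x`, with constant coefficients along `𝔤`) and the Chevalley--Eilenberg
terms due to `dθ ↦ -½[θ, θ]`. -/
def dTop (B : WeilForm M 0) (x : M) (a b c : G.E × M.E) : ℝ :=
  let φ := extChartAt (𝓡 M.dim) x
  let T : (G.E × M.E) →L[ℝ] (G.E × M.E) := 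
    (ContinuousLinearMap.id ℝ G.E).prodMap (chartT M.toMfd x)
  extDeriv (fun p : G.E × M.E => B.topChart x p.2) (0, φ x) ![T a, T b, T c]
    - B.top x ![(G.bracket a.1 b.1, 0), c]
    + B.top x ![(G.bracket a.1 c.1, 0), b]
    - B.top x ![(G.bracket b.1 c.1, 0), a]

/-- `η = d_G B`. -/
def IsDG (η : WeilForm M 1) (B : WeilForm M 0) : Prop :=
  (∀ x u e, η.lin x u ![e] = B.dLin x u e) ∧ ∀ x a b c, η.top x ![a, b, c] = B.dTop x a b c

end WeilForm

/-! ## Connections on principal `G`-bundles and the Weil homomorphism -/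

/-- `Θ ∈ Ω¹(P; 𝔤)` is a connection on the principal `G`-bundle `P`. -/
structure IsConnection (P : GMfd.{v, u} G) (Θ : P → (P.E →L[ℝ] G.E)) : Prop where
  smooth : SmoothOneForm Θ
  vertical : ∀ p ξ, Θ p (P.fund p ξ) = ξ
  equivariant : ∀ g p a, Θ (P.act g p) (D (P.act g) p a) = G.Ad g (Θ p a)

/-- The curvature `dΘ + ½[Θ, Θ]` of a connection. -/
def curvature {P : GMfd.{v, u} G} (Θ : P → (P.E →L[ℝ] G.E)) (p : P) (a b : P.E) : G.E :=
  dOneForm Θ p a b + G.bracket (Θ p a) (Θ p b)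

/-- `σ = Θ^*σ_G ∈ Ω²(Y/G)` for `σ_G ∈ Ω_G²(Y)`. Here `f : Y → P` is equivariant, the principal
bundle `q : Y → Y/G` carries the connection `f^*Θ`, and the condition is that the pullback of `σ`
to `Y` is the image of `σ_G` when the connection is substituted for the generators in `Λ¹𝔤*`, and
its curvature for the generators in `S¹𝔤*`. -/
def IsWeilImageTwo {P Y : GMfd.{v, u} G} {Y₁ : GMfd.{0, u} trivialGrp}
    (Θ : P → (P.E →L[ℝ] G.E)) (f : Y → P) (q : Y → Y₁)
    (σ : WeilForm Y₁ 0) (σG : WeilForm Y 0) : Prop :=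
  ∀ y (a b : Y.E),
    σ.top (q y) ![(0, D q y a), (0, D q y b)] =
      σG.top y ![(Θ (f y) (D f y a), a), (Θ (f y) (D f y b), b)]
        + σG.lin y (curvature Θ (f y) (D f y a) (D f y b)) ![]

/-- The same in degree 3: `σ = Θ^*σ_G ∈ Ω³(Y/G)` for `σ_G ∈ Ω_G³(Y)`. -/
def IsWeilImageThree {P Y : GMfd.{v, u} G} {Y₁ : GMfd.{0, u} trivialGrp}
    (Θ : P → (P.E →L[ℝ] G.E)) (f : Y → P) (q : Y → Y₁)
    (σ : WeilForm Y₁ 1) (σG : WeilForm Y 1) : Prop :=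
  ∀ y (a b c : Y.E),
    let h : Y.E → G.E × Y.E := fun z => (Θ (f y) (D f y z), z)
    let Ω : Y.E → Y.E → G.E := fun z z₁ => curvature Θ (f y) (D f y z) (D f y z₁)
    σ.top (q y) ![(0, D q y a), (0, D q y b), (0, D q y c)] =
      σG.top y ![h a, h b, h c]
        + σG.lin y (Ω a b) ![h c] + σG.lin y (Ω b c) ![h a] + σG.lin y (Ω c a) ![h b]

/-! ## Equivariant circle bundles -/

/-- A `G`-equivariant principal `S¹`-bundle on `Z`. -/
structure GBun (Z : GMfd.{v, u} G) where
  tot : GMfd.{v, u} G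
  proj : tot → Z
  proj_map : IsGMap proj
  circ : circleGrp → tot → tot
  principal : IsPrincipal circleGrp (P := tot.toMfd) (X := Z.toMfd) circ proj
  circ_act : ∀ c g k, circ c (tot.act g k) = tot.act g (circ c k)

namespace GBun

variable {Z : GMfd.{v, u} G}

/-- The vector at `k` that generates the action of `t ↦ exp (i t) ∈ S¹`. -/
def vert (K : GBun Z) (k : K.tot) : K.tot.E :=
  (mfderiv 𝓘(ℝ, ℝ) (𝓡 K.tot.dim) (fun t : ℝ => K.circ (Circle.exp t) k) 0 : ℝ →L[ℝ] K.tot.E) 1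

/-- `A ∈ Ω¹(K)` is a `G`-invariant connection (with `ℝ` as the Lie algebra of `S¹`). -/
structure IsConn (K : GBun Z) (A : K.tot → (K.tot.E →L[ℝ] ℝ)) : Prop where
  smooth : SmoothOneForm A
  vertical : ∀ k, A k (K.vert k) = 1
  invariant_circ : ∀ c k a, A (K.circ c k) (D (K.circ c) k a) = A k a
  invariant : ∀ g k a, A (K.tot.act g k) (D (K.tot.act g) k a) = A k a

/-- The equivariant extension `A_G ∈ Ω_G¹(K)` of an invariant connection: at `k` it is the linear
form `(η, a) ↦ A(a) - A(η_K)` on `𝔤 × T_kK`. -/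
def equivExt (K : GBun Z) (A : K.tot → (K.tot.E →L[ℝ] ℝ)) (k : K.tot) :
    (G.E × K.tot.E) →L[ℝ] ℝ :=
  (A k).comp (ContinuousLinearMap.snd ℝ G.E K.tot.E)
    - ((A k).comp (K.tot.fund k)).comp (ContinuousLinearMap.fst ℝ G.E K.tot.E)

/-- `F = curv_G(A) ∈ Ω_G²(Z)`, the form with pullback `d_G A_G` to the total space. The part of
`d_G A_G` in `S¹𝔤*` is `u ↦ A_G(u, 0)`; the part in `Λ²(𝔤 × TK)*` is the exterior derivative, in
the preferred chart at `k`, with the Chevalley--Eilenberg term. -/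
def IsCurv (K : GBun Z) (A : K.tot → (K.tot.E →L[ℝ] ℝ)) (F : WeilForm Z 0) : Prop :=
  (∀ k u, (F.pull K.proj).lin k u ![] = K.equivExt A k (u, 0)) ∧
  ∀ k (a b : G.E × K.tot.E),
    let φ := extChartAt (𝓡 K.tot.dim) k
    let T := chartT K.tot.toMfd k
    let α : K.tot.E → ((G.E × K.tot.E) →L[ℝ] ℝ) := fun y =>
      (K.equivExt A (φ.symm y)).comp
        ((ContinuousLinearMap.id ℝ G.E).prodMap (chartD K.tot.toMfd k y))
    (F.pull K.proj).top k ![a, b] =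
      fderiv ℝ α (φ k) (T a.2) (b.1, T b.2) - fderiv ℝ α (φ k) (T b.2) (a.1, T a.2)
        - K.equivExt A k (G.bracket a.1 b.1, 0)

end GBun

/-! ## Bundle gerbes

Isomorphisms between tensor products of circle bundles are given by their values on elements: an
isomorphism `A ⊗ B → C` by a map `(a, b) ↦ c` with `(z a, b) ↦ z c`, `(a, z b) ↦ z c`, and an
isomorphism `A ⊗ B → C ⊗ E` by the map `(a, b, c) ↦ e` for which the image of `a ⊗ b` is `c ⊗ e`.
A map on a fibre product of manifolds is smooth iff it takes smooth families, parametrized by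
manifolds `T`, to smooth families. Equality of forms on a fibre product is tested by such families
as well. -/

/-- A `G`-equivariant bundle gerbe on `M`. -/
structure Gerbe (M : GMfd.{v, u} G) where
  Y : GMfd.{v, u} G
  π : Y → M
  cover : IsGCover π
  /-- the fibre product of `Y` with itself -/
  Y₂ : GMfd.{v, u} G
  fst : Y₂ → Y
  snd : Y₂ → Y
  square : IsFibreSquare π fst snd
  L : GBun Y₂
  /-- the multiplication -/
  μ : ∀ a b : L.tot, snd (L.proj a) = fst (L.proj b) → L.tot
  μ_fst : ∀ a b h, fst (L.proj (μ a b h)) = fst (L.proj a)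
  μ_snd : ∀ a b h, snd (L.proj (μ a b h)) = snd (L.proj b)
  μ_circ_left : ∀ c a b h h₁, μ (L.circ c a) b h₁ = L.circ c (μ a b h)
  μ_circ_right : ∀ c a b h h₁, μ a (L.circ c b) h₁ = L.circ c (μ a b h)
  μ_act : ∀ g a b h h₁, μ (L.tot.act g a) (L.tot.act g b) h₁ = L.tot.act g (μ a b h)
  μ_smooth : ∀ (T : Mfd.{u}) (a b : T → L.tot) (h : ∀ t, snd (L.proj (a t)) = fst (L.proj (b t))),
    Smooth a → Smooth b → Smooth (fun t => μ (a t) (b t) (h t))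
  μ_assoc : ∀ a b c hab hbc h₁ h₂, μ (μ a b hab) c h₁ = μ a (μ b c hbc) h₂

/-- A `G`-equivariant connection on a bundle gerbe: a connection on the circle bundle `L` and a
curving `B ∈ Ω_G²(Y)`. -/
structure Gerbe.Conn {M : GMfd.{v, u} G} (𝓛 : Gerbe M) where
  A : 𝓛.L.tot → (𝓛.L.tot.E →L[ℝ] ℝ)
  isConn : 𝓛.L.IsConn A
  B : WeilForm 𝓛.Y 0
  isEquivForm : B.IsEquivForm
  curv : 𝓛.L.IsCurv A (B.pull 𝓛.snd - B.pull 𝓛.fst)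
  μ_conn : ∀ (T : Mfd.{u}) (a b : T → 𝓛.L.tot)
    (h : ∀ t, 𝓛.snd (𝓛.L.proj (a t)) = 𝓛.fst (𝓛.L.proj (b t))), Smooth a → Smooth b →
    ∀ t (e : T.E), A (𝓛.μ (a t) (b t) (h t)) (D (fun t => 𝓛.μ (a t) (b t) (h t)) t e) =
      A (a t) (D a t e) + A (b t) (D b t e)

/-- A 1-morphism `𝓛₁ → 𝓛₂` of equivariant bundle gerbes. The map `(ζ₁, ζ₂)` is an equivariant
surjective submersion of `Z` onto the manifold `Y₁ ×_M Y₂`, whose tangent spaces are the fibre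
products of those of `Y₁` and `Y₂`. With `k, k₁ ∈ K` over `z, z₁ ∈ Z` and `l ∈ L₁` over
`(ζ₁ z, ζ₁ z₁)`, the isomorphism `α` takes `l ⊗ k₁` to `k ⊗ α l k₁ k`. -/
structure Hom {M : GMfd.{v, u} G} (𝓛₁ 𝓛₂ : Gerbe M) where
  Z : GMfd.{v, u} G
  ζ₁ : Z → 𝓛₁.Y
  ζ₂ : Z → 𝓛₂.Y
  ζ₁_map : IsGMap ζ₁
  ζ₂_map : IsGMap ζ₂
  comm : ∀ z, 𝓛₁.π (ζ₁ z) = 𝓛₂.π (ζ₂ z)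
  surjective : ∀ y₁ y₂, 𝓛₁.π y₁ = 𝓛₂.π y₂ → ∃ z, ζ₁ z = y₁ ∧ ζ₂ z = y₂
  submersion : ∀ z (a₁ : 𝓛₁.Y.E) (a₂ : 𝓛₂.Y.E), D 𝓛₁.π (ζ₁ z) a₁ = D 𝓛₂.π (ζ₂ z) a₂ →
    ∃ e : Z.E, D ζ₁ z e = a₁ ∧ D ζ₂ z e = a₂
  K : GBun Z
  α : ∀ (l : 𝓛₁.L.tot) (k₁ k : K.tot), 𝓛₁.fst (𝓛₁.L.proj l) = ζ₁ (K.proj k) →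
    𝓛₁.snd (𝓛₁.L.proj l) = ζ₁ (K.proj k₁) → 𝓛₂.L.tot
  α_fst : ∀ l k₁ k h h₁, 𝓛₂.fst (𝓛₂.L.proj (α l k₁ k h h₁)) = ζ₂ (K.proj k)
  α_snd : ∀ l k₁ k h h₁, 𝓛₂.snd (𝓛₂.L.proj (α l k₁ k h h₁)) = ζ₂ (K.proj k₁)
  α_circ_l : ∀ c l k₁ k h h₁ h₂ h₃,
    α (𝓛₁.L.circ c l) k₁ k h₂ h₃ = 𝓛₂.L.circ c (α l k₁ k h h₁)
  α_circ_k₁ : ∀ c l k₁ k h h₁ h₂ h₃, α l (K.circ c k₁) k h₂ h₃ = 𝓛₂.L.circ c (α l k₁ k h h₁)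
  α_circ_k : ∀ c l k₁ k h h₁ h₂ h₃, α l k₁ (K.circ c k) h₂ h₃ = 𝓛₂.L.circ c⁻¹ (α l k₁ k h h₁)
  α_act : ∀ g l k₁ k h h₁ h₂ h₃,
    α (𝓛₁.L.tot.act g l) (K.tot.act g k₁) (K.tot.act g k) h₂ h₃ =
      𝓛₂.L.tot.act g (α l k₁ k h h₁)
  α_smooth : ∀ (T : Mfd.{u}) (l : T → 𝓛₁.L.tot) (k₁ k : T → K.tot)
    (h : ∀ t, 𝓛₁.fst (𝓛₁.L.proj (l t)) = ζ₁ (K.proj (k t)))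
    (h₁ : ∀ t, 𝓛₁.snd (𝓛₁.L.proj (l t)) = ζ₁ (K.proj (k₁ t))),
    Smooth l → Smooth k₁ → Smooth k → Smooth (fun t => α (l t) (k₁ t) (k t) (h t) (h₁ t))
  /-- compatibility with the multiplications -/
  α_μ : ∀ (l l₁ : 𝓛₁.L.tot) (k₂ k₁ k : K.tot) hl h h₂ h₃ h₄ h₅ h₆ hμ,
    α (𝓛₁.μ l l₁ hl) k₂ k h h₂ = 𝓛₂.μ (α l k₁ k h₃ h₄) (α l₁ k₂ k₁ h₅ h₆) hμ

/-- A connection on a 1-morphism between bundle gerbes with connection. -/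
structure Hom.Conn {M : GMfd.{v, u} G} {𝓛₁ 𝓛₂ : Gerbe M} (c₁ : 𝓛₁.Conn) (c₂ : 𝓛₂.Conn)
    (𝓚 : Hom 𝓛₁ 𝓛₂) where
  A : 𝓚.K.tot → (𝓚.K.tot.E →L[ℝ] ℝ)
  isConn : 𝓚.K.IsConn A
  curv : 𝓚.K.IsCurv A (c₂.B.pull 𝓚.ζ₂ - c₁.B.pull 𝓚.ζ₁)
  α_conn : ∀ (T : Mfd.{u}) (l : T → 𝓛₁.L.tot) (k₁ k : T → 𝓚.K.tot)
    (h : ∀ t, 𝓛₁.fst (𝓛₁.L.proj (l t)) = 𝓚.ζ₁ (𝓚.K.proj (k t)))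
    (h₁ : ∀ t, 𝓛₁.snd (𝓛₁.L.proj (l t)) = 𝓚.ζ₁ (𝓚.K.proj (k₁ t))),
    Smooth l → Smooth k₁ → Smooth k → ∀ t (e : T.E),
    c₁.A (l t) (D l t e) + A (k₁ t) (D k₁ t e) =
      A (k t) (D k t e) + c₂.A (𝓚.α (l t) (k₁ t) (k t) (h t) (h₁ t))
        (D (fun t => 𝓚.α (l t) (k₁ t) (k t) (h t) (h₁ t)) t e)

end Basics

/-! ## 2-morphisms

A pseudofunctor acts on 2-morphisms `𝓚 ⇒ 𝓚₁`, and it has constraints for composition and for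
identities. To express these, the 2-morphisms `𝓚₁₂ ∘ 𝓚₀₁ ⇒ 𝓚₀₂` out of a composite and `id ⇒ 𝓚` out
of an identity are made explicit too, by unfolding of the definition of a 2-morphism: the composite
`𝓚₁₂ ∘ 𝓚₀₁` has the cover `Z₀₁ ×_{Y₁} Z₁₂`, the bundle `K₀₁ ⊗ K₁₂`, and the isomorphism
`(id ⊗ α₁₂) ∘ (α₀₁ ⊗ id)`; the identity of `𝓛` has the cover `Y ×_M Y`, the bundle `L`, and the
isomorphism that takes `l ⊗ k₁` to `k ⊗ m` iff `μ(l, k₁) = μ(k, m)`. -/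

section Cells

variable {G : LieGrp.{v}} {M : GMfd.{v, u} G}

/-- Representatives of 2-morphisms `𝓚 ⇒ 𝓚₁`: an equivariant surjective submersion `(w₁, w₂)` of
`W` onto the fibre product of `Z` and `Z₁` over `Y₁ ×_M Y₂`, and an isomorphism `β : K → K₁` of
equivariant bundles over `W` compatible with `α` and `α₁`. -/
structure TwoRep {𝓛₁ 𝓛₂ : Gerbe M} (𝓚 𝓚₁ : Hom 𝓛₁ 𝓛₂) where
  W : GMfd.{v, u} G
  w₁ : W → 𝓚.Z
  w₂ : W → 𝓚₁.Z
  w₁_map : IsGMap w₁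
  w₂_map : IsGMap w₂
  comm₁ : ∀ w, 𝓚.ζ₁ (w₁ w) = 𝓚₁.ζ₁ (w₂ w)
  comm₂ : ∀ w, 𝓚.ζ₂ (w₁ w) = 𝓚₁.ζ₂ (w₂ w)
  surjective : ∀ z z₁, 𝓚.ζ₁ z = 𝓚₁.ζ₁ z₁ → 𝓚.ζ₂ z = 𝓚₁.ζ₂ z₁ → ∃ w, w₁ w = z ∧ w₂ w = z₁
  submersion : ∀ w (a : 𝓚.Z.E) (a₁ : 𝓚₁.Z.E),
    D 𝓚.ζ₁ (w₁ w) a = D 𝓚₁.ζ₁ (w₂ w) a₁ → D 𝓚.ζ₂ (w₁ w) a = D 𝓚₁.ζ₂ (w₂ w) a₁ →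
    ∃ e : W.E, D w₁ w e = a ∧ D w₂ w e = a₁
  β : ∀ (w : W) (k : 𝓚.K.tot), 𝓚.K.proj k = w₁ w → 𝓚₁.K.tot
  β_proj : ∀ w k h, 𝓚₁.K.proj (β w k h) = w₂ w
  β_circ : ∀ c w k h h₁, β w (𝓚.K.circ c k) h₁ = 𝓚₁.K.circ c (β w k h)
  β_act : ∀ g w k h h₁, β (W.act g w) (𝓚.K.tot.act g k) h₁ = 𝓚₁.K.tot.act g (β w k h)
  β_smooth : ∀ (T : Mfd.{u}) (w : T → W) (k : T → 𝓚.K.tot) (h : ∀ t, 𝓚.K.proj (k t) = w₁ (w t)),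
    Smooth w → Smooth k → Smooth (fun t => β (w t) (k t) (h t))
  β_α : ∀ (w w' : W) (l : 𝓛₁.L.tot) (k' k : 𝓚.K.tot) hk' hk h₁ h₂ h₃ h₄,
    𝓚₁.α l (β w' k' hk') (β w k hk) h₁ h₂ = 𝓚.α l k' k h₃ h₄

/-- Representatives of 2-morphisms `𝓚₁₂ ∘ 𝓚₀₁ ⇒ 𝓚₀₂`: the manifold `W` covers the fibre product of
`Z₀₁ ×_{Y₁} Z₁₂` and `Z₀₂` over `Y₀ ×_M Y₂`, and `β` is an isomorphism `K₀₁ ⊗ K₁₂ → K₀₂` over it. -/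
structure TriRep {𝓛₀ 𝓛₁ 𝓛₂ : Gerbe M} (𝓚₀₁ : Hom 𝓛₀ 𝓛₁) (𝓚₁₂ : Hom 𝓛₁ 𝓛₂)
    (𝓚₀₂ : Hom 𝓛₀ 𝓛₂) where
  W : GMfd.{v, u} G
  w₀₁ : W → 𝓚₀₁.Z
  w₁₂ : W → 𝓚₁₂.Z
  w₀₂ : W → 𝓚₀₂.Z
  w₀₁_map : IsGMap w₀₁
  w₁₂_map : IsGMap w₁₂
  w₀₂_map : IsGMap w₀₂
  comm₀ : ∀ w, 𝓚₀₁.ζ₁ (w₀₁ w) = 𝓚₀₂.ζ₁ (w₀₂ w)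
  comm₁ : ∀ w, 𝓚₀₁.ζ₂ (w₀₁ w) = 𝓚₁₂.ζ₁ (w₁₂ w)
  comm₂ : ∀ w, 𝓚₁₂.ζ₂ (w₁₂ w) = 𝓚₀₂.ζ₂ (w₀₂ w)
  surjective : ∀ z₀₁ z₁₂ z₀₂, 𝓚₀₁.ζ₁ z₀₁ = 𝓚₀₂.ζ₁ z₀₂ → 𝓚₀₁.ζ₂ z₀₁ = 𝓚₁₂.ζ₁ z₁₂ →
    𝓚₁₂.ζ₂ z₁₂ = 𝓚₀₂.ζ₂ z₀₂ → ∃ w, w₀₁ w = z₀₁ ∧ w₁₂ w = z₁₂ ∧ w₀₂ w = z₀₂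
  submersion : ∀ w (a₀₁ : 𝓚₀₁.Z.E) (a₁₂ : 𝓚₁₂.Z.E) (a₀₂ : 𝓚₀₂.Z.E),
    D 𝓚₀₁.ζ₁ (w₀₁ w) a₀₁ = D 𝓚₀₂.ζ₁ (w₀₂ w) a₀₂ →
    D 𝓚₀₁.ζ₂ (w₀₁ w) a₀₁ = D 𝓚₁₂.ζ₁ (w₁₂ w) a₁₂ →
    D 𝓚₁₂.ζ₂ (w₁₂ w) a₁₂ = D 𝓚₀₂.ζ₂ (w₀₂ w) a₀₂ →
    ∃ e : W.E, D w₀₁ w e = a₀₁ ∧ D w₁₂ w e = a₁₂ ∧ D w₀₂ w e = a₀₂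
  β : ∀ (w : W) (a : 𝓚₀₁.K.tot) (b : 𝓚₁₂.K.tot), 𝓚₀₁.K.proj a = w₀₁ w → 𝓚₁₂.K.proj b = w₁₂ w →
    𝓚₀₂.K.tot
  β_proj : ∀ w a b ha hb, 𝓚₀₂.K.proj (β w a b ha hb) = w₀₂ w
  β_circ_left : ∀ c w a b ha hb h, β w (𝓚₀₁.K.circ c a) b h hb = 𝓚₀₂.K.circ c (β w a b ha hb)
  β_circ_right : ∀ c w a b ha hb h, β w a (𝓚₁₂.K.circ c b) ha h = 𝓚₀₂.K.circ c (β w a b ha hb)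
  β_act : ∀ g w a b ha hb h h₁, β (W.act g w) (𝓚₀₁.K.tot.act g a) (𝓚₁₂.K.tot.act g b) h h₁ =
    𝓚₀₂.K.tot.act g (β w a b ha hb)
  β_smooth : ∀ (T : Mfd.{u}) (w : T → W) (a : T → 𝓚₀₁.K.tot) (b : T → 𝓚₁₂.K.tot)
    (ha : ∀ t, 𝓚₀₁.K.proj (a t) = w₀₁ (w t)) (hb : ∀ t, 𝓚₁₂.K.proj (b t) = w₁₂ (w t)),
    Smooth w → Smooth a → Smooth b → Smooth (fun t => β (w t) (a t) (b t) (ha t) (hb t))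
  β_α : ∀ (w w' : W) (l : 𝓛₀.L.tot) (a' a : 𝓚₀₁.K.tot) (b' b : 𝓚₁₂.K.tot)
    ha' hb' ha hb h₁ h₂ h₃ h₄ h₅ h₆,
    𝓚₀₂.α l (β w' a' b' ha' hb') (β w a b ha hb) h₁ h₂ =
      𝓚₁₂.α (𝓚₀₁.α l a' a h₃ h₄) b' b h₅ h₆

/-- Representatives of 2-morphisms `id ⇒ 𝓔` for a 1-morphism `𝓔 : 𝓛 → 𝓛`. -/
structure UnitRep {𝓛 : Gerbe M} (𝓔 : Hom 𝓛 𝓛) where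
  W : GMfd.{v, u} G
  w₁ : W → 𝓛.Y₂
  w₂ : W → 𝓔.Z
  w₁_map : IsGMap w₁
  w₂_map : IsGMap w₂
  comm₁ : ∀ w, 𝓛.fst (w₁ w) = 𝓔.ζ₁ (w₂ w)
  comm₂ : ∀ w, 𝓛.snd (w₁ w) = 𝓔.ζ₂ (w₂ w)
  surjective : ∀ y z, 𝓛.fst y = 𝓔.ζ₁ z → 𝓛.snd y = 𝓔.ζ₂ z → ∃ w, w₁ w = y ∧ w₂ w = z
  submersion : ∀ w (a : 𝓛.Y₂.E) (a₁ : 𝓔.Z.E),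
    D 𝓛.fst (w₁ w) a = D 𝓔.ζ₁ (w₂ w) a₁ → D 𝓛.snd (w₁ w) a = D 𝓔.ζ₂ (w₂ w) a₁ →
    ∃ e : W.E, D w₁ w e = a ∧ D w₂ w e = a₁
  β : ∀ (w : W) (k : 𝓛.L.tot), 𝓛.L.proj k = w₁ w → 𝓔.K.tot
  β_proj : ∀ w k h, 𝓔.K.proj (β w k h) = w₂ w
  β_circ : ∀ c w k h h₁, β w (𝓛.L.circ c k) h₁ = 𝓔.K.circ c (β w k h)
  β_act : ∀ g w k h h₁, β (W.act g w) (𝓛.L.tot.act g k) h₁ = 𝓔.K.tot.act g (β w k h)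
  β_smooth : ∀ (T : Mfd.{u}) (w : T → W) (k : T → 𝓛.L.tot) (h : ∀ t, 𝓛.L.proj (k t) = w₁ (w t)),
    Smooth w → Smooth k → Smooth (fun t => β (w t) (k t) (h t))
  β_α : ∀ (w w' : W) (l : 𝓛.L.tot) (k' k m : 𝓛.L.tot) hk' hk h₁ h₂ h₃ h₄,
    𝓛.μ l k' h₃ = 𝓛.μ k m h₄ → 𝓔.α l (β w' k' hk') (β w k hk) h₁ h₂ = m

/-- Two representatives are identified if they agree on a common refinement. -/
def TwoRep.Rel {𝓛₁ 𝓛₂ : Gerbe M} {𝓚 𝓚₁ : Hom 𝓛₁ 𝓛₂} (r s : TwoRep 𝓚 𝓚₁) : Prop :=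
  ∃ (V : GMfd.{v, u} G) (p : V → r.W) (p₁ : V → s.W), IsGCover p ∧ IsGCover p₁ ∧
    (∀ x, r.w₁ (p x) = s.w₁ (p₁ x)) ∧ (∀ x, r.w₂ (p x) = s.w₂ (p₁ x)) ∧
    ∀ x k h h₁, r.β (p x) k h = s.β (p₁ x) k h₁

/-- Two representatives are identified if they agree on a common refinement. -/
def TriRep.Rel {𝓛₀ 𝓛₁ 𝓛₂ : Gerbe M} {𝓚₀₁ : Hom 𝓛₀ 𝓛₁} {𝓚₁₂ : Hom 𝓛₁ 𝓛₂}
    {𝓚₀₂ : Hom 𝓛₀ 𝓛₂} (r s : TriRep 𝓚₀₁ 𝓚₁₂ 𝓚₀₂) : Prop :=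
  ∃ (V : GMfd.{v, u} G) (p : V → r.W) (p₁ : V → s.W), IsGCover p ∧ IsGCover p₁ ∧
    (∀ x, r.w₀₁ (p x) = s.w₀₁ (p₁ x)) ∧ (∀ x, r.w₁₂ (p x) = s.w₁₂ (p₁ x)) ∧
    (∀ x, r.w₀₂ (p x) = s.w₀₂ (p₁ x)) ∧
    ∀ x a b ha hb ha₁ hb₁, r.β (p x) a b ha hb = s.β (p₁ x) a b ha₁ hb₁

/-- Two representatives are identified if they agree on a common refinement. -/
def UnitRep.Rel {𝓛 : Gerbe M} {𝓔 : Hom 𝓛 𝓛} (r s : UnitRep 𝓔) : Prop :=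
  ∃ (V : GMfd.{v, u} G) (p : V → r.W) (p₁ : V → s.W), IsGCover p ∧ IsGCover p₁ ∧
    (∀ x, r.w₁ (p x) = s.w₁ (p₁ x)) ∧ (∀ x, r.w₂ (p x) = s.w₂ (p₁ x)) ∧
    ∀ x k h h₁, r.β (p x) k h = s.β (p₁ x) k h₁

/-- 2-morphisms `𝓚 ⇒ 𝓚₁`. -/
def Two {𝓛₁ 𝓛₂ : Gerbe M} (𝓚 𝓚₁ : Hom 𝓛₁ 𝓛₂) := Quot (TwoRep.Rel (𝓚 := 𝓚) (𝓚₁ := 𝓚₁))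

/-- 2-morphisms `𝓚₁₂ ∘ 𝓚₀₁ ⇒ 𝓚₀₂`. -/
def Tri {𝓛₀ 𝓛₁ 𝓛₂ : Gerbe M} (𝓚₀₁ : Hom 𝓛₀ 𝓛₁) (𝓚₁₂ : Hom 𝓛₁ 𝓛₂) (𝓚₀₂ : Hom 𝓛₀ 𝓛₂) :=
  Quot (TriRep.Rel (𝓚₀₁ := 𝓚₀₁) (𝓚₁₂ := 𝓚₁₂) (𝓚₀₂ := 𝓚₀₂))

/-- 2-morphisms `id ⇒ 𝓔`. -/
def UnitCell {𝓛 : Gerbe M} (𝓔 : Hom 𝓛 𝓛) := Quot (UnitRep.Rel (𝓔 := 𝓔))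

/-! ### Compositions of 2-morphisms -/

/-- `J` is the identity of `𝓚`. -/
def IsIdTwo {𝓛₁ 𝓛₂ : Gerbe M} {𝓚 : Hom 𝓛₁ 𝓛₂} (J : Two 𝓚 𝓚) : Prop :=
  ∃ r : TwoRep 𝓚 𝓚, Quot.mk _ r = J ∧ ∀ w k h, r.w₁ w = r.w₂ w → r.β w k h = k

/-- `J₁₃` is the vertical composite `J₂₃ • J₁₂`. -/
def IsVComp {𝓛 𝓛' : Gerbe M} {𝓚₁ 𝓚₂ 𝓚₃ : Hom 𝓛 𝓛'} (J₁₂ : Two 𝓚₁ 𝓚₂) (J₂₃ : Two 𝓚₂ 𝓚₃)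
    (J₁₃ : Two 𝓚₁ 𝓚₃) : Prop :=
  ∃ (r₁₂ : TwoRep 𝓚₁ 𝓚₂) (r₂₃ : TwoRep 𝓚₂ 𝓚₃) (r₁₃ : TwoRep 𝓚₁ 𝓚₃),
    Quot.mk _ r₁₂ = J₁₂ ∧ Quot.mk _ r₂₃ = J₂₃ ∧ Quot.mk _ r₁₃ = J₁₃ ∧
    ∀ w₁₂ w₂₃ w₁₃, r₁₂.w₁ w₁₂ = r₁₃.w₁ w₁₃ → r₁₂.w₂ w₁₂ = r₂₃.w₁ w₂₃ → r₂₃.w₂ w₂₃ = r₁₃.w₂ w₁₃ →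
      ∀ k h h₁ h₂, r₂₃.β w₂₃ (r₁₂.β w₁₂ k h) h₁ = r₁₃.β w₁₃ k h₂

/-- `T' • (J₁₂ ∘ J₀₁) = J₀₂ • T`, where `J₁₂ ∘ J₀₁` is the horizontal composite. -/
def IsNatural {𝓛₀ 𝓛₁ 𝓛₂ : Gerbe M} {𝓚₀₁ 𝓚₀₁' : Hom 𝓛₀ 𝓛₁} {𝓚₁₂ 𝓚₁₂' : Hom 𝓛₁ 𝓛₂}
    {𝓚₀₂ 𝓚₀₂' : Hom 𝓛₀ 𝓛₂} (J₀₁ : Two 𝓚₀₁ 𝓚₀₁') (J₁₂ : Two 𝓚₁₂ 𝓚₁₂') (J₀₂ : Two 𝓚₀₂ 𝓚₀₂')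
    (T : Tri 𝓚₀₁ 𝓚₁₂ 𝓚₀₂) (T' : Tri 𝓚₀₁' 𝓚₁₂' 𝓚₀₂') : Prop :=
  ∃ (r₀₁ : TwoRep 𝓚₀₁ 𝓚₀₁') (r₁₂ : TwoRep 𝓚₁₂ 𝓚₁₂') (r₀₂ : TwoRep 𝓚₀₂ 𝓚₀₂')
    (t : TriRep 𝓚₀₁ 𝓚₁₂ 𝓚₀₂) (t' : TriRep 𝓚₀₁' 𝓚₁₂' 𝓚₀₂'),
    Quot.mk _ r₀₁ = J₀₁ ∧ Quot.mk _ r₁₂ = J₁₂ ∧ Quot.mk _ r₀₂ = J₀₂ ∧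
    Quot.mk _ t = T ∧ Quot.mk _ t' = T' ∧
    ∀ w₀₁ w₁₂ w₀₂ w w',
      r₀₁.w₁ w₀₁ = t.w₀₁ w → r₁₂.w₁ w₁₂ = t.w₁₂ w → r₀₂.w₁ w₀₂ = t.w₀₂ w →
      r₀₁.w₂ w₀₁ = t'.w₀₁ w' → r₁₂.w₂ w₁₂ = t'.w₁₂ w' → r₀₂.w₂ w₀₂ = t'.w₀₂ w' →
      ∀ a b ha hb ha' hb' h₁ h₂ h₃,
        t'.β w' (r₀₁.β w₀₁ a ha) (r₁₂.β w₁₂ b hb) h₁ h₂ = r₀₂.β w₀₂ (t.β w a b ha' hb') h₃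

/-- `T₀₂₃ • (id ∘ T₀₁₂) = T₀₁₃ • (T₁₂₃ ∘ id)`, up to the associator. -/
def IsTet {𝓛₀ 𝓛₁ 𝓛₂ 𝓛₃ : Gerbe M} {𝓚₀₁ : Hom 𝓛₀ 𝓛₁} {𝓚₁₂ : Hom 𝓛₁ 𝓛₂} {𝓚₂₃ : Hom 𝓛₂ 𝓛₃}
    {𝓚₀₂ : Hom 𝓛₀ 𝓛₂} {𝓚₁₃ : Hom 𝓛₁ 𝓛₃} {𝓚₀₃ : Hom 𝓛₀ 𝓛₃}
    (T₀₁₂ : Tri 𝓚₀₁ 𝓚₁₂ 𝓚₀₂) (T₀₂₃ : Tri 𝓚₀₂ 𝓚₂₃ 𝓚₀₃)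
    (T₁₂₃ : Tri 𝓚₁₂ 𝓚₂₃ 𝓚₁₃) (T₀₁₃ : Tri 𝓚₀₁ 𝓚₁₃ 𝓚₀₃) : Prop :=
  ∃ (t₀₁₂ : TriRep 𝓚₀₁ 𝓚₁₂ 𝓚₀₂) (t₀₂₃ : TriRep 𝓚₀₂ 𝓚₂₃ 𝓚₀₃)
    (t₁₂₃ : TriRep 𝓚₁₂ 𝓚₂₃ 𝓚₁₃) (t₀₁₃ : TriRep 𝓚₀₁ 𝓚₁₃ 𝓚₀₃),
    Quot.mk _ t₀₁₂ = T₀₁₂ ∧ Quot.mk _ t₀₂₃ = T₀₂₃ ∧ Quot.mk _ t₁₂₃ = T₁₂₃ ∧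
    Quot.mk _ t₀₁₃ = T₀₁₃ ∧
    ∀ w₀₁₂ w₀₂₃ w₁₂₃ w₀₁₃,
      t₀₁₂.w₀₁ w₀₁₂ = t₀₁₃.w₀₁ w₀₁₃ → t₀₁₂.w₁₂ w₀₁₂ = t₁₂₃.w₀₁ w₁₂₃ →
      t₀₂₃.w₁₂ w₀₂₃ = t₁₂₃.w₁₂ w₁₂₃ → t₀₁₂.w₀₂ w₀₁₂ = t₀₂₃.w₀₁ w₀₂₃ →
      t₁₂₃.w₀₂ w₁₂₃ = t₀₁₃.w₁₂ w₀₁₃ → t₀₂₃.w₀₂ w₀₂₃ = t₀₁₃.w₀₂ w₀₁₃ →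
      ∀ a b c h₁ h₂ h₃ h₄ h₅ h₆ h₇ h₈,
        t₀₂₃.β w₀₂₃ (t₀₁₂.β w₀₁₂ a b h₁ h₂) c h₃ h₄ =
          t₀₁₃.β w₀₁₃ a (t₁₂₃.β w₁₂₃ b c h₅ h₆) h₇ h₈

/-- `u₁ = J • u`. -/
def IsUnitComp {𝓛 : Gerbe M} {𝓔 𝓔₁ : Hom 𝓛 𝓛} (u : UnitCell 𝓔) (J : Two 𝓔 𝓔₁)
    (u₁ : UnitCell 𝓔₁) : Prop :=
  ∃ (s : UnitRep 𝓔) (r : TwoRep 𝓔 𝓔₁) (s₁ : UnitRep 𝓔₁),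
    Quot.mk _ s = u ∧ Quot.mk _ r = J ∧ Quot.mk _ s₁ = u₁ ∧
    ∀ w w' w₁, s.w₁ w = s₁.w₁ w₁ → s.w₂ w = r.w₁ w' → r.w₂ w' = s₁.w₂ w₁ →
      ∀ k h h₁ h₂, r.β w' (s.β w k h) h₁ = s₁.β w₁ k h₂

/-- `T • (id ∘ u) = J • λ` as 2-morphisms `𝓚 ∘ id ⇒ 𝓚₁`. Here the unit constraint
`λ : 𝓚 ∘ id ⇒ 𝓚` takes `l ⊗ k` to `k'` iff `α` takes `l ⊗ k` to `k' ⊗ m`, with `m` in the fibre of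
`L` over a point of the diagonal the unit element, `μ(m, m) = m`. -/
def IsRightUnit {𝓛 𝓛' : Gerbe M} {𝓔 : Hom 𝓛 𝓛} {𝓚 𝓚₁ : Hom 𝓛 𝓛'} (u : UnitCell 𝓔)
    (T : Tri 𝓔 𝓚 𝓚₁) (J : Two 𝓚 𝓚₁) : Prop :=
  ∃ (s : UnitRep 𝓔) (t : TriRep 𝓔 𝓚 𝓚₁) (r : TwoRep 𝓚 𝓚₁),
    Quot.mk _ s = u ∧ Quot.mk _ t = T ∧ Quot.mk _ r = J ∧
    ∀ w w' w₁, s.w₂ w = t.w₀₁ w' → t.w₀₂ w' = r.w₂ w₁ →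
      ∀ (l : 𝓛.L.tot) (k k' : 𝓚.K.tot) h h₁ h₂ h₃ h₄ h₅ hm,
        𝓛'.μ (𝓚.α l k k' h h₁) (𝓚.α l k k' h h₁) hm = 𝓚.α l k k' h h₁ →
        t.β w' (s.β w l h₂) k h₃ h₄ = r.β w₁ k' h₅

/-- `T • (u ∘ id) = J • ρ` as 2-morphisms `id ∘ 𝓚 ⇒ 𝓚₁`. Here the unit constraint
`ρ : id ∘ 𝓚 ⇒ 𝓚` takes `k ⊗ l` to `k'` iff `α` takes `m ⊗ k'` to `k ⊗ l`, with `m` in the fibre of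
`L` over a point of the diagonal the unit element, `μ(m, m) = m`. -/
def IsLeftUnit {𝓛 𝓛' : Gerbe M} {𝓔 : Hom 𝓛' 𝓛'} {𝓚 𝓚₁ : Hom 𝓛 𝓛'} (u : UnitCell 𝓔)
    (T : Tri 𝓚 𝓔 𝓚₁) (J : Two 𝓚 𝓚₁) : Prop :=
  ∃ (s : UnitRep 𝓔) (t : TriRep 𝓚 𝓔 𝓚₁) (r : TwoRep 𝓚 𝓚₁),
    Quot.mk _ s = u ∧ Quot.mk _ t = T ∧ Quot.mk _ r = J ∧
    ∀ w w' w₁, s.w₂ w = t.w₁₂ w' → t.w₀₂ w' = r.w₂ w₁ →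
      ∀ (m : 𝓛.L.tot) (k k' : 𝓚.K.tot) (l : 𝓛'.L.tot) h h₁ h₂ h₃ h₄ h₅ hm,
        𝓛.μ m m hm = m → 𝓚.α m k' k h h₁ = l →
        t.β w' k (s.β w l h₂) h₃ h₄ = r.β w₁ k' h₅

/-! ### Compatibility of 2-morphisms with connections -/

/-- `β` preserves connections. -/
def TwoRep.Pres {𝓛₁ 𝓛₂ : Gerbe M} {c₁ : 𝓛₁.Conn} {c₂ : 𝓛₂.Conn} {𝓚 𝓚₁ : Hom 𝓛₁ 𝓛₂}
    (r : TwoRep 𝓚 𝓚₁) (d : Hom.Conn c₁ c₂ 𝓚) (d₁ : Hom.Conn c₁ c₂ 𝓚₁) : Prop :=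
  ∀ (T : Mfd.{u}) (w : T → r.W) (k : T → 𝓚.K.tot) (h : ∀ t, 𝓚.K.proj (k t) = r.w₁ (w t)),
    Smooth w → Smooth k → ∀ t (e : T.E),
    d₁.A (r.β (w t) (k t) (h t)) (D (fun t => r.β (w t) (k t) (h t)) t e) = d.A (k t) (D k t e)

/-- `β` preserves connections. -/
def TriRep.Pres {𝓛₀ 𝓛₁ 𝓛₂ : Gerbe M} {c₀ : 𝓛₀.Conn} {c₁ : 𝓛₁.Conn} {c₂ : 𝓛₂.Conn}
    {𝓚₀₁ : Hom 𝓛₀ 𝓛₁} {𝓚₁₂ : Hom 𝓛₁ 𝓛₂} {𝓚₀₂ : Hom 𝓛₀ 𝓛₂} (r : TriRep 𝓚₀₁ 𝓚₁₂ 𝓚₀₂)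
    (d₀₁ : Hom.Conn c₀ c₁ 𝓚₀₁) (d₁₂ : Hom.Conn c₁ c₂ 𝓚₁₂) (d₀₂ : Hom.Conn c₀ c₂ 𝓚₀₂) : Prop :=
  ∀ (T : Mfd.{u}) (w : T → r.W) (a : T → 𝓚₀₁.K.tot) (b : T → 𝓚₁₂.K.tot)
    (ha : ∀ t, 𝓚₀₁.K.proj (a t) = r.w₀₁ (w t)) (hb : ∀ t, 𝓚₁₂.K.proj (b t) = r.w₁₂ (w t)),
    Smooth w → Smooth a → Smooth b → ∀ t (e : T.E),
    d₀₂.A (r.β (w t) (a t) (b t) (ha t) (hb t))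
      (D (fun t => r.β (w t) (a t) (b t) (ha t) (hb t)) t e) =
      d₀₁.A (a t) (D a t e) + d₁₂.A (b t) (D b t e)

/-- `β` preserves connections. -/
def UnitRep.Pres {𝓛 : Gerbe M} {c : 𝓛.Conn} {𝓔 : Hom 𝓛 𝓛} (r : UnitRep 𝓔)
    (d : Hom.Conn c c 𝓔) : Prop :=
  ∀ (T : Mfd.{u}) (w : T → r.W) (k : T → 𝓛.L.tot) (h : ∀ t, 𝓛.L.proj (k t) = r.w₁ (w t)),
    Smooth w → Smooth k → ∀ t (e : T.E),
    d.A (r.β (w t) (k t) (h t)) (D (fun t => r.β (w t) (k t) (h t)) t e) = c.A (k t) (D k t e)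

end Cells

/-! ## The 2-groupoids and functors between them -/

/-- The data of a 2-groupoid as seen by pseudofunctors: objects, 1-morphisms, 2-morphisms `f ⇒ g`,
2-morphisms `g ∘ f ⇒ h`, 2-morphisms `id ⇒ e`, and the equations between composites of these. -/
structure TwoGpd : Type (w + 1) where
  Obj : Type w
  Hom : Obj → Obj → Type w
  Two : ∀ {x y}, Hom x y → Hom x y → Type w
  Tri : ∀ {x y z}, Hom x y → Hom y z → Hom x z → Type w
  UnitCell : ∀ {x}, Hom x x → Type w
  IsId : ∀ {x y} {f : Hom x y}, Two f f → Prop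
  IsVComp : ∀ {x y} {f g h : Hom x y}, Two f g → Two g h → Two f h → Prop
  IsNatural : ∀ {x y z} {f f' : Hom x y} {g g' : Hom y z} {h h' : Hom x z},
    Two f f' → Two g g' → Two h h' → Tri f g h → Tri f' g' h' → Prop
  IsTet : ∀ {x₀ x₁ x₂ x₃} {f₀₁ : Hom x₀ x₁} {f₁₂ : Hom x₁ x₂} {f₂₃ : Hom x₂ x₃}
    {f₀₂ : Hom x₀ x₂} {f₁₃ : Hom x₁ x₃} {f₀₃ : Hom x₀ x₃},
    Tri f₀₁ f₁₂ f₀₂ → Tri f₀₂ f₂₃ f₀₃ → Tri f₁₂ f₂₃ f₁₃ → Tri f₀₁ f₁₃ f₀₃ → Prop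
  IsUnitComp : ∀ {x} {e e₁ : Hom x x}, UnitCell e → Two e e₁ → UnitCell e₁ → Prop
  IsRightUnit : ∀ {x y} {e : Hom x x} {f f₁ : Hom x y},
    UnitCell e → Tri e f f₁ → Two f f₁ → Prop
  IsLeftUnit : ∀ {x y} {e : Hom y y} {f f₁ : Hom x y},
    UnitCell e → Tri f e f₁ → Two f f₁ → Prop

/-- Functors of 2-groupoids (pseudofunctors). The image under `tri` of the identity 2-morphism
`g ∘ f ⇒ g ∘ f` is the composition constraint `F g ∘ F f ⇒ F (g ∘ f)`, and the image under `unit`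
of `id ⇒ id` is the identity constraint `id ⇒ F id`. The axioms say that `F` is a functor on the
groupoids of morphisms, and that the constraints are natural, associative and unital. All
2-morphisms being invertible, there is no further condition on the constraints. -/
structure TwoFunctor (𝓐 𝓑 : TwoGpd) where
  obj : 𝓐.Obj → 𝓑.Obj
  map : ∀ {x y}, 𝓐.Hom x y → 𝓑.Hom (obj x) (obj y)
  two : ∀ {x y} {f g : 𝓐.Hom x y}, 𝓐.Two f g → 𝓑.Two (map f) (map g)
  tri : ∀ {x y z} {f : 𝓐.Hom x y} {g : 𝓐.Hom y z} {h : 𝓐.Hom x z},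
    𝓐.Tri f g h → 𝓑.Tri (map f) (map g) (map h)
  unit : ∀ {x} {e : 𝓐.Hom x x}, 𝓐.UnitCell e → 𝓑.UnitCell (map e)
  isId : ∀ {x y} {f : 𝓐.Hom x y} (J : 𝓐.Two f f), 𝓐.IsId J → 𝓑.IsId (two J)
  isVComp : ∀ {x y} {f g h : 𝓐.Hom x y} (J₁ : 𝓐.Two f g) (J₂ : 𝓐.Two g h) (J₃ : 𝓐.Two f h),
    𝓐.IsVComp J₁ J₂ J₃ → 𝓑.IsVComp (two J₁) (two J₂) (two J₃)
  isNatural : ∀ {x y z} {f f' : 𝓐.Hom x y} {g g' : 𝓐.Hom y z} {h h' : 𝓐.Hom x z}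
    (J₁ : 𝓐.Two f f') (J₂ : 𝓐.Two g g') (J₃ : 𝓐.Two h h') (T : 𝓐.Tri f g h)
    (T' : 𝓐.Tri f' g' h'), 𝓐.IsNatural J₁ J₂ J₃ T T' →
    𝓑.IsNatural (two J₁) (two J₂) (two J₃) (tri T) (tri T')
  isTet : ∀ {x₀ x₁ x₂ x₃} {f₀₁ : 𝓐.Hom x₀ x₁} {f₁₂ : 𝓐.Hom x₁ x₂} {f₂₃ : 𝓐.Hom x₂ x₃}
    {f₀₂ : 𝓐.Hom x₀ x₂} {f₁₃ : 𝓐.Hom x₁ x₃} {f₀₃ : 𝓐.Hom x₀ x₃}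
    (T₀₁₂ : 𝓐.Tri f₀₁ f₁₂ f₀₂) (T₀₂₃ : 𝓐.Tri f₀₂ f₂₃ f₀₃)
    (T₁₂₃ : 𝓐.Tri f₁₂ f₂₃ f₁₃) (T₀₁₃ : 𝓐.Tri f₀₁ f₁₃ f₀₃),
    𝓐.IsTet T₀₁₂ T₀₂₃ T₁₂₃ T₀₁₃ → 𝓑.IsTet (tri T₀₁₂) (tri T₀₂₃) (tri T₁₂₃) (tri T₀₁₃)
  isUnitComp : ∀ {x} {e e₁ : 𝓐.Hom x x} (u : 𝓐.UnitCell e) (J : 𝓐.Two e e₁)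
    (u₁ : 𝓐.UnitCell e₁), 𝓐.IsUnitComp u J u₁ → 𝓑.IsUnitComp (unit u) (two J) (unit u₁)
  isRightUnit : ∀ {x y} {e : 𝓐.Hom x x} {f f₁ : 𝓐.Hom x y} (u : 𝓐.UnitCell e)
    (T : 𝓐.Tri e f f₁) (J : 𝓐.Two f f₁),
    𝓐.IsRightUnit u T J → 𝓑.IsRightUnit (unit u) (tri T) (two J)
  isLeftUnit : ∀ {x y} {e : 𝓐.Hom y y} {f f₁ : 𝓐.Hom x y} (u : 𝓐.UnitCell e)
    (T : 𝓐.Tri f e f₁) (J : 𝓐.Two f f₁),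
    𝓐.IsLeftUnit u T J → 𝓑.IsLeftUnit (unit u) (tri T) (two J)

/-- The composite of two functors: first `F`, then `F₁`. -/
def TwoFunctor.comp {𝓐 𝓑 𝓒 : TwoGpd} (F : TwoFunctor 𝓐 𝓑) (F₁ : TwoFunctor 𝓑 𝓒) :
    TwoFunctor 𝓐 𝓒 where
  obj := fun x => F₁.obj (F.obj x)
  map := fun f => F₁.map (F.map f)
  two := fun J => F₁.two (F.two J)
  tri := fun T => F₁.tri (F.tri T)
  unit := fun u => F₁.unit (F.unit u)
  isId := fun J h => F₁.isId _ (F.isId J h)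
  isVComp := fun _ _ _ h => F₁.isVComp _ _ _ (F.isVComp _ _ _ h)
  isNatural := fun _ _ _ _ _ h => F₁.isNatural _ _ _ _ _ (F.isNatural _ _ _ _ _ h)
  isTet := fun _ _ _ _ h => F₁.isTet _ _ _ _ (F.isTet _ _ _ _ h)
  isUnitComp := fun _ _ _ h => F₁.isUnitComp _ _ _ (F.isUnitComp _ _ _ h)
  isRightUnit := fun _ _ _ h => F₁.isRightUnit _ _ _ (F.isRightUnit _ _ _ h)
  isLeftUnit := fun _ _ _ h => F₁.isLeftUnit _ _ _ (F.isLeftUnit _ _ _ h)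

section Groupoids

variable {G : LieGrp.{v}}

/-- The 2-groupoid of `G`-equivariant bundle gerbes on `M`; for the trivial group `G`, the
2-groupoid of bundle gerbes on `M`. -/
abbrev GGrb (M : GMfd.{v, u} G) : TwoGpd where
  Obj := Gerbe M
  Hom := Hom
  Two := Two
  Tri := Tri
  UnitCell := UnitCell
  IsId := IsIdTwo
  IsVComp := IsVComp
  IsNatural := IsNatural
  IsTet := IsTet
  IsUnitComp := IsUnitComp
  IsRightUnit := IsRightUnit
  IsLeftUnit := IsLeftUnit

/-- A bundle gerbe with connection. -/
structure GerbeC (M : GMfd.{v, u} G) where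
  gerbe : Gerbe M
  conn : gerbe.Conn

/-- A 1-morphism with connection. -/
structure HomC {M : GMfd.{v, u} G} (𝓛₁ 𝓛₂ : GerbeC M) where
  hom : Hom 𝓛₁.gerbe 𝓛₂.gerbe
  conn : Hom.Conn 𝓛₁.conn 𝓛₂.conn hom

/-- The 2-groupoid of `G`-equivariant bundle gerbes with connection on `M`; for the trivial group
`G`, the 2-groupoid of bundle gerbes with connection. The 2-morphisms are the ones between the
underlying 1-morphisms that preserve the connections. -/
abbrev GGrbC (M : GMfd.{v, u} G) : TwoGpd where
  Obj := GerbeC M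
  Hom := HomC
  Two := fun f g => {J : Two f.hom g.hom // ∃ r, Quot.mk _ r = J ∧ r.Pres f.conn g.conn}
  Tri := fun f g h =>
    {T : Tri f.hom g.hom h.hom // ∃ r, Quot.mk _ r = T ∧ r.Pres f.conn g.conn h.conn}
  UnitCell := fun e => {u : UnitCell e.hom // ∃ r, Quot.mk _ r = u ∧ r.Pres e.conn}
  IsId := fun J => IsIdTwo J.1
  IsVComp := fun J₁ J₂ J₃ => IsVComp J₁.1 J₂.1 J₃.1
  IsNatural := fun J₁ J₂ J₃ T T' => IsNatural J₁.1 J₂.1 J₃.1 T.1 T'.1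
  IsTet := fun T₀₁₂ T₀₂₃ T₁₂₃ T₀₁₃ => IsTet T₀₁₂.1 T₀₂₃.1 T₁₂₃.1 T₀₁₃.1
  IsUnitComp := fun u J u₁ => IsUnitComp u.1 J.1 u₁.1
  IsRightUnit := fun u T J => IsRightUnit u.1 T.1 J.1
  IsLeftUnit := fun u T J => IsLeftUnit u.1 T.1 J.1

/-- The functor that forgets connections. -/
def forget (M : GMfd.{v, u} G) : TwoFunctor (GGrbC M) (GGrb M) where
  obj := fun 𝓛 => 𝓛.gerbe
  map := fun f => f.hom
  two := fun J => J.1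
  tri := fun T => T.1
  unit := fun u => u.1
  isId := fun _ h => h
  isVComp := fun _ _ _ h => h
  isNatural := fun _ _ _ _ _ h => h
  isTet := fun _ _ _ _ h => h
  isUnitComp := fun _ _ _ h => h
  isRightUnit := fun _ _ _ h => h
  isLeftUnit := fun _ _ _ h => h

/-- `η = curv_G(𝓛)`: the equivariant form `η ∈ Ω_G³(M)` with `π^*η = d_G B`. -/
def IsGerbeCurv {M : GMfd.{v, u} G} (𝓛 : GerbeC M) (η : WeilForm M 1) : Prop :=
  η.IsEquivForm ∧ (η.pull 𝓛.gerbe.π).IsDG 𝓛.conn.B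

end Groupoids

/-! ## Quotients -/

section Quotients

variable {G : LieGrp.{v}}

/-- `q : N → N₁` is the quotient `N → N/G` by a free action: a principal `G`-bundle. -/
def IsQuotientMap (N : GMfd.{v, u} G) (N₁ : GMfd.{0, u} trivialGrp) (q : N → N₁) : Prop :=
  IsPrincipal G (P := N.toMfd) (X := N₁.toMfd) N.act q

variable {P : GMfd.{v, u} G} {X : Mfd.{u}}

/-- Quotient maps that exhibit `𝓛₁ = (Y₁, L₁, μ₁)` as `𝓛/G = (Y/G, L/G, μ/G)`. -/
structure ObjQuotient (q : P → X) (𝓛 : Gerbe P) (𝓛₁ : Gerbe X.triv) where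
  qY : 𝓛.Y → 𝓛₁.Y
  qY_quot : IsQuotientMap 𝓛.Y 𝓛₁.Y qY
  qY₂ : 𝓛.Y₂ → 𝓛₁.Y₂
  qY₂_quot : IsQuotientMap 𝓛.Y₂ 𝓛₁.Y₂ qY₂
  qL : 𝓛.L.tot → 𝓛₁.L.tot
  qL_quot : IsQuotientMap 𝓛.L.tot 𝓛₁.L.tot qL
  π_eq : ∀ y, 𝓛₁.π (qY y) = q (𝓛.π y)
  fst_eq : ∀ y, 𝓛₁.fst (qY₂ y) = qY (𝓛.fst y)
  snd_eq : ∀ y, 𝓛₁.snd (qY₂ y) = qY (𝓛.snd y)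
  proj_eq : ∀ l, 𝓛₁.L.proj (qL l) = qY₂ (𝓛.L.proj l)
  circ_eq : ∀ c l, 𝓛₁.L.circ c (qL l) = qL (𝓛.L.circ c l)
  μ_eq : ∀ a b h h₁, 𝓛₁.μ (qL a) (qL b) h₁ = qL (𝓛.μ a b h)

variable {q : P → X}

/-- Quotient maps that exhibit the 1-morphism `𝓚₁` as `𝓚/G = (Z/G, K/G, α/G)`. -/
structure HomQuotient {𝓛 𝓛' : Gerbe P} {𝓛₁ 𝓛₁' : Gerbe X.triv} (o : ObjQuotient q 𝓛 𝓛₁)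
    (o' : ObjQuotient q 𝓛' 𝓛₁') (𝓚 : Hom 𝓛 𝓛') (𝓚₁ : Hom 𝓛₁ 𝓛₁') where
  qZ : 𝓚.Z → 𝓚₁.Z
  qZ_quot : IsQuotientMap 𝓚.Z 𝓚₁.Z qZ
  qK : 𝓚.K.tot → 𝓚₁.K.tot
  qK_quot : IsQuotientMap 𝓚.K.tot 𝓚₁.K.tot qK
  ζ₁_eq : ∀ z, 𝓚₁.ζ₁ (qZ z) = o.qY (𝓚.ζ₁ z)
  ζ₂_eq : ∀ z, 𝓚₁.ζ₂ (qZ z) = o'.qY (𝓚.ζ₂ z)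
  proj_eq : ∀ k, 𝓚₁.K.proj (qK k) = qZ (𝓚.K.proj k)
  circ_eq : ∀ c k, 𝓚₁.K.circ c (qK k) = qK (𝓚.K.circ c k)
  α_eq : ∀ l k' k h h' h₁ h₁', 𝓚₁.α (o.qL l) (qK k') (qK k) h₁ h₁' = o'.qL (𝓚.α l k' k h h')

/-- `J₁ = J/G`: for every representative `(W, β)` of `J`, the 2-morphism `J₁` is the class of
`(W/G, β/G)`. -/
def IsTwoQuotient {𝓛 𝓛' : Gerbe P} {𝓛₁ 𝓛₁' : Gerbe X.triv} {o : ObjQuotient q 𝓛 𝓛₁}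
    {o' : ObjQuotient q 𝓛' 𝓛₁'} {f g : Hom 𝓛 𝓛'} {f₁ g₁ : Hom 𝓛₁ 𝓛₁'}
    (m : HomQuotient o o' f f₁) (n : HomQuotient o o' g g₁) (J : Two f g) (J₁ : Two f₁ g₁) : Prop :=
  ∀ r : TwoRep f g, Quot.mk _ r = J → ∃ r₁ : TwoRep f₁ g₁, Quot.mk _ r₁ = J₁ ∧
    ∃ qW : r.W → r₁.W, IsQuotientMap r.W r₁.W qW ∧
      (∀ w, r₁.w₁ (qW w) = m.qZ (r.w₁ w)) ∧ (∀ w, r₁.w₂ (qW w) = n.qZ (r.w₂ w)) ∧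
      ∀ w k h h₁, r₁.β (qW w) (m.qK k) h₁ = n.qK (r.β w k h)

/-- `T₁ = T/G`. -/
def IsTriQuotient {𝓛 𝓛' 𝓛'' : Gerbe P} {𝓛₁ 𝓛₁' 𝓛₁'' : Gerbe X.triv} {o : ObjQuotient q 𝓛 𝓛₁}
    {o' : ObjQuotient q 𝓛' 𝓛₁'} {o'' : ObjQuotient q 𝓛'' 𝓛₁''}
    {f : Hom 𝓛 𝓛'} {g : Hom 𝓛' 𝓛''} {h : Hom 𝓛 𝓛''}
    {f₁ : Hom 𝓛₁ 𝓛₁'} {g₁ : Hom 𝓛₁' 𝓛₁''} {h₁ : Hom 𝓛₁ 𝓛₁''}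
    (m : HomQuotient o o' f f₁) (n : HomQuotient o' o'' g g₁) (p : HomQuotient o o'' h h₁)
    (T : Tri f g h) (T₁ : Tri f₁ g₁ h₁) : Prop :=
  ∀ r : TriRep f g h, Quot.mk _ r = T → ∃ r₁ : TriRep f₁ g₁ h₁, Quot.mk _ r₁ = T₁ ∧
    ∃ qW : r.W → r₁.W, IsQuotientMap r.W r₁.W qW ∧
      (∀ w, r₁.w₀₁ (qW w) = m.qZ (r.w₀₁ w)) ∧ (∀ w, r₁.w₁₂ (qW w) = n.qZ (r.w₁₂ w)) ∧
      (∀ w, r₁.w₀₂ (qW w) = p.qZ (r.w₀₂ w)) ∧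
      ∀ w a b ha hb ha₁ hb₁, r₁.β (qW w) (m.qK a) (n.qK b) ha₁ hb₁ = p.qK (r.β w a b ha hb)

/-- `u₁ = u/G`. -/
def IsUnitQuotient {𝓛 : Gerbe P} {𝓛₁ : Gerbe X.triv} {o : ObjQuotient q 𝓛 𝓛₁}
    {e : Hom 𝓛 𝓛} {e₁ : Hom 𝓛₁ 𝓛₁} (m : HomQuotient o o e e₁) (u : UnitCell e)
    (u₁ : UnitCell e₁) : Prop :=
  ∀ r : UnitRep e, Quot.mk _ r = u → ∃ r₁ : UnitRep e₁, Quot.mk _ r₁ = u₁ ∧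
    ∃ qW : r.W → r₁.W, IsQuotientMap r.W r₁.W qW ∧
      (∀ w, r₁.w₁ (qW w) = o.qY₂ (r.w₁ w)) ∧ (∀ w, r₁.w₂ (qW w) = m.qZ (r.w₂ w)) ∧
      ∀ w k h h₁, r₁.β (qW w) (o.qL k) h₁ = m.qK (r.β w k h)

/-- Quotient maps that exhibit `F` as the functor `𝓛 ↦ 𝓛/G`. -/
structure QuotientData (q : P → X) (F : TwoFunctor (GGrb P) (GGrb X.triv)) where
  obj : ∀ 𝓛 : Gerbe P, ObjQuotient q 𝓛 (F.obj 𝓛)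
  hom : ∀ {𝓛 𝓛' : Gerbe P} (f : Hom 𝓛 𝓛'), HomQuotient (obj 𝓛) (obj 𝓛') f (F.map f)
  two : ∀ {𝓛 𝓛' : Gerbe P} {f g : Hom 𝓛 𝓛'} (J : Two f g),
    IsTwoQuotient (hom f) (hom g) J (F.two J)
  tri : ∀ {𝓛 𝓛' 𝓛'' : Gerbe P} {f : Hom 𝓛 𝓛'} {g : Hom 𝓛' 𝓛''} {h : Hom 𝓛 𝓛''} (T : Tri f g h),
    IsTriQuotient (hom f) (hom g) (hom h) T (F.tri T)
  unit : ∀ {𝓛 : Gerbe P} {e : Hom 𝓛 𝓛} (u : UnitCell e),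
    IsUnitQuotient (hom e) u (F.unit u)

/-- The connection `A₁` on `K₁ = K/G` is `Θ^*A`: its pullback to `K` is `(1 - ι_Θ) A`. Here
`f : K → P` is equivariant, so that `K → K/G` carries the connection `f^*Θ`. -/
def IsDescendedConn {K : GMfd.{v, u} G} {K₁ : GMfd.{0, u} trivialGrp}
    (Θ : P → (P.E →L[ℝ] G.E)) (f : K → P) (qK : K → K₁)
    (A₁ : K₁ → (K₁.E →L[ℝ] ℝ)) (A : K → (K.E →L[ℝ] ℝ)) : Prop :=
  ∀ k (a : K.E), A₁ (qK k) (D qK k a) = A k a - A k (K.fund k (Θ (f k) (D f k a)))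

/-- Quotient maps that exhibit `F` as the functor `Θ^*`, which takes `(Y, L, A, B, μ)` to
`(Y/G, L/G, Θ^*A, Θ^*B, μ/G)`, the 1-morphism `(Z, K, A, α)` to `(Z/G, K/G, Θ^*A, α/G)`, and is
the quotient by `G` on 2-morphisms. -/
structure QuotientDataC (q : P → X) (Θ : P → (P.E →L[ℝ] G.E))
    (F : TwoFunctor (GGrbC P) (GGrbC X.triv)) where
  obj : ∀ 𝓛 : GerbeC P, ObjQuotient q 𝓛.gerbe (F.obj 𝓛).gerbe
  obj_conn : ∀ 𝓛 : GerbeC P,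
    IsDescendedConn Θ (fun l => 𝓛.gerbe.π (𝓛.gerbe.fst (𝓛.gerbe.L.proj l))) (obj 𝓛).qL
      (F.obj 𝓛).conn.A 𝓛.conn.A
  obj_curving : ∀ 𝓛 : GerbeC P,
    IsWeilImageTwo Θ 𝓛.gerbe.π (obj 𝓛).qY (F.obj 𝓛).conn.B 𝓛.conn.B
  hom : ∀ {𝓛 𝓛' : GerbeC P} (f : HomC 𝓛 𝓛'), HomQuotient (obj 𝓛) (obj 𝓛') f.hom (F.map f).hom
  hom_conn : ∀ {𝓛 𝓛' : GerbeC P} (f : HomC 𝓛 𝓛'),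
    IsDescendedConn Θ (fun k => 𝓛.gerbe.π (f.hom.ζ₁ (f.hom.K.proj k))) (hom f).qK
      (F.map f).conn.A f.conn.A
  two : ∀ {𝓛 𝓛' : GerbeC P} {f g : HomC 𝓛 𝓛'} (J : (GGrbC P).Two f g),
    IsTwoQuotient (hom f) (hom g) J.1 (F.two J).1
  tri : ∀ {𝓛 𝓛' 𝓛'' : GerbeC P} {f : HomC 𝓛 𝓛'} {g : HomC 𝓛' 𝓛''} {h : HomC 𝓛 𝓛''}
    (T : (GGrbC P).Tri f g h), IsTriQuotient (hom f) (hom g) (hom h) T.1 (F.tri T).1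
  unit : ∀ {𝓛 : GerbeC P} {e : HomC 𝓛 𝓛} (u : (GGrbC P).UnitCell e),
    IsUnitQuotient (hom e) u.1 (F.unit u).1

end Quotients

end GerbeQuot

end

open GerbeQuot

/-!
# Descent of equivariant bundle gerbes along a principal bundle

Let `P → X` be a principal `G`-bundle. A `G`-manifold `N` with an equivariant map `N → P` carries a
free action, and a local trivialization of `P` pulls back to an equivariant map from an invariant
open set of `N` to `G`, whose fibre over `1` is a slice. The slices are submanifolds that meet every
nearby orbit exactly once, so they are charts of a quotient manifold `N / G`
(`exists_orbitChart`, `exists_quotient`).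

A point of `N / G` over `x : X` has exactly one representative over each given point of the fibre
`P_x` (`IsQuo.exists_lift`), and locally the same holds for smooth families of points
(`IsQuo.exists_lift_family`). Hence finitely many points of quotients over the same point of `X` have
simultaneous representatives over one point of `P`, and fibre products of quotients are quotients of
fibre products. The multiplication `μ` of a gerbe and the isomorphisms `α`, `β` of 1- and 2-morphisms
descend: they are computed on representatives (`quoμ_eq`, `quoα_eq`, `quoβ_eq`), and are smooth since
they are so on lifts of families. The relations between them, the refinements that define equality
of 2-morphisms, and the axioms of a 2-functor are identities between elements that hold upstairs, so
they hold in the quotient (`quoFunctor`).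

A connection `Θ` on `P` enters in three ways.

* If `A` is the connection form of an equivariant circle bundle, then `(1 - ι_Θ) A` vanishes on
  orbits and is invariant, so it descends (`GBun.horPart`). Its differential is the Weil image of the
  equivariant curvature (`d_horPart`). The Weil image of a curving is likewise basic and descends
  (`weilTwo`, `exists_curving`), and the curvature conditions descend as the projections are
  submersions.
* Preservation of connections by `μ`, `α`, `β` is an equality of descended 1-forms on tangent
  vectors of a family. The family lifts to one whose image in `P` is `Θ`-horizontal at the given
  parameter (`IsConnection.exists_horizontal_lift_family`); there `(1 - ι_Θ) A` takes the same value
  as `A` (`descended_eq_of_horizontal`), and the equality is the one that holds upstairs.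
* The equivariant curvature of a gerbe exists and is unique, since `d_G B` agrees on the two
  pullbacks to `Y ×_M Y`; its components, the 3-form `d B` and the 1-forms `dMoment`, descend along
  the submersion `Y → M` (`existsUnique_isGerbeCurv`). The formula for `curv (Θ^* 𝓛)` is the statement
  that the Weil homomorphism intertwines `d_G` and `d` in degree 2 (`d_weilTwo`). This is a pointwise
  computation with the structure equation of `Θ`, the Bianchi identity (`d_curvForm`) and a formula
  for the exterior derivative of a form with 1-forms substituted into its arguments
  (`extDeriv_substitution`).
-/

universe w'

noncomputable section

namespace GerbeQuot

open Set Filter Topology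

/-! ### Differentials, charts and local inverses -/

section Calculus

variable {M : Mfd.{u}} {N : Mfd.{v}} {Q : Mfd.{w}}

theorem Smooth.contMDiffAt {f : M → N} (hf : Smooth f) (x : M) :
    ContMDiffAt (𝓡 M.dim) (𝓡 N.dim) ∞ f x :=
  ContMDiff.contMDiffAt hf

theorem Smooth.mdiff {f : M → N} (hf : Smooth f) (x : M) :
    MDifferentiableAt (𝓡 M.dim) (𝓡 N.dim) f x :=
  (hf.contMDiffAt x).mdifferentiableAt (by simp)

theorem Smooth.continuous {f : M → N} (hf : Smooth f) : Continuous f :=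
  ContMDiff.continuous hf

theorem Smooth.comp {g : N → Q} {f : M → N} (hg : Smooth g) (hf : Smooth f) :
    Smooth (fun x => g (f x)) :=
  ContMDiff.comp hg hf

theorem smooth_id : Smooth (fun x : M => x) := contMDiff_id

theorem smooth_const (y : N) : Smooth (fun _ : M => y) := contMDiff_const

theorem D_comp {g : N → Q} {f : M → N} (hg : Smooth g) (hf : Smooth f) (x : M) (v : M.E) :
    D (fun x => g (f x)) x v = D g (f x) (D f x v) := by
  have := mfderiv_comp (I := 𝓡 M.dim) (I' := 𝓡 N.dim) (I'' := 𝓡 Q.dim) x (hg.mdiff (f x))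
    (hf.mdiff x)
  exact DFunLike.congr_fun this v

theorem D_comp_at {g : N → Q} {f : M → N} {x : M}
    (hg : ContMDiffAt (𝓡 N.dim) (𝓡 Q.dim) ∞ g (f x))
    (hf : ContMDiffAt (𝓡 M.dim) (𝓡 N.dim) ∞ f x) (v : M.E) :
    D (fun x => g (f x)) x v = D g (f x) (D f x v) := by
  have := mfderiv_comp (I := 𝓡 M.dim) (I' := 𝓡 N.dim) (I'' := 𝓡 Q.dim) x
    (hg.mdifferentiableAt (by simp)) (hf.mdifferentiableAt (by simp))
  exact DFunLike.congr_fun this v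

theorem D_congr {f g : M → N} {x : M} (h : f =ᶠ[𝓝 x] g) : D f x = D g x := by
  have h1 := h.mfderiv_eq (I := 𝓡 M.dim) (I' := 𝓡 N.dim)
  exact h1

theorem D_id (x : M) (v : M.E) : D (fun x : M => x) x v = v :=
  DFunLike.congr_fun (mfderiv_id (I := 𝓡 M.dim) (x := x)) v

theorem D_const (y : N) (x : M) : D (fun _ : M => y) x = 0 :=
  mfderiv_const

/-- The inverse function theorem with a smooth inverse on a whole neighbourhood. -/
theorem exists_local_inverse {V W : Type*} [NormedAddCommGroup V] [NormedSpace ℝ V]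
    [FiniteDimensional ℝ V] [NormedAddCommGroup W] [NormedSpace ℝ W]
    [FiniteDimensional ℝ W] {h : V → W} {O : Set V} {x : V} (hO : IsOpen O) (hx : x ∈ O)
    (hh : ContDiffOn ℝ ∞ h O) (hd : Function.Bijective (fderiv ℝ h x)) :
    ∃ e : OpenPartialHomeomorph V W, x ∈ e.source ∧ e.source ⊆ O ∧ (∀ y, e y = h y) ∧
      ContDiffOn ℝ ∞ e.symm e.target := by
  have := FiniteDimensional.complete ℝ V
  have := FiniteDimensional.complete ℝ W
  let d : V ≃L[ℝ] W := ContinuousLinearEquiv.ofBijective (fderiv ℝ h x)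
    (LinearMap.ker_eq_bot.2 hd.1) (LinearMap.range_eq_top.2 hd.2)
  have hdc : (d : V →L[ℝ] W) = fderiv ℝ h x := by ext; rfl
  have hat : ∀ y ∈ O, ContDiffAt ℝ ∞ h y := fun y hy => hh.contDiffAt (hO.mem_nhds hy)
  have hder : HasFDerivAt h (d : V →L[ℝ] W) x := by
    rw [hdc]; exact ((hat x hx).differentiableAt (by simp)).hasFDerivAt
  let e₀ := (hat x hx).toOpenPartialHomeomorph h hder (by simp)
  have hcont : ContinuousOn (fderiv ℝ h) O :=
    (hh.fderiv_of_isOpen hO (m := 0) (by simp)).continuousOn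
  have hopen : IsOpen (O ∩ fderiv ℝ h ⁻¹' range ((↑) : (V ≃L[ℝ] W) → V →L[ℝ] W)) :=
    hcont.isOpen_inter_preimage hO ContinuousLinearEquiv.isOpen
  refine ⟨e₀.restrOpen _ hopen, ?_, ?_, ?_, ?_⟩
  · refine ⟨(hat x hx).mem_toOpenPartialHomeomorph_source hder (by simp), hx, ⟨d, hdc⟩⟩
  · intro y hy; exact hy.2.1
  · intro y; rfl
  · intro z hz
    set e := e₀.restrOpen _ hopen
    have hy : e.symm z ∈ e.source := e.map_target hz
    obtain ⟨d', hd'⟩ := hy.2.2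
    have h2 : HasFDerivAt e (d' : V →L[ℝ] W) (e.symm z) := by
      rw [hd']; exact ((hat _ hy.2.1).differentiableAt (by simp)).hasFDerivAt
    exact (e.contDiffAt_symm hz h2 (hat _ hy.2.1)).contDiffWithinAt

/-- Tangent spaces are identified with the model space by the preferred chart. -/
theorem chartT_eq_id (M : Mfd.{u}) (x : M) : chartT M x = ContinuousLinearMap.id ℝ M.E := by
  have h := (contMDiffAt_extChartAt (I := 𝓡 M.dim) (n := ∞) (x := x)).mdifferentiableAt (by simp)
  unfold chartT
  rw [h.mfderiv]
  have : writtenInExtChartAt (𝓡 M.dim) 𝓘(ℝ, M.E) x (extChartAt (𝓡 M.dim) x)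
      =ᶠ[𝓝 (extChartAt (𝓡 M.dim) x x)] id := by
    filter_upwards [extChartAt_target_mem_nhds (I := 𝓡 M.dim) x] with y hy
    simp only [writtenInExtChartAt, Function.comp_apply, extChartAt_model_space_eq_id, id,
      PartialEquiv.refl_coe]
    exact (extChartAt (𝓡 M.dim) x).right_inv hy
  simp only [modelWithCornersSelf_coe, range_id, fderivWithin_univ]
  rw [this.fderiv_eq]
  exact fderiv_id

theorem chartD_eq_id (M : Mfd.{u}) (x : M) :
    chartD M x (extChartAt (𝓡 M.dim) x x) = ContinuousLinearMap.id ℝ M.E := by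
  have h := (contMDiffOn_extChartAt_symm (I := 𝓡 M.dim) (n := ∞) x).contMDiffAt
    (extChartAt_target_mem_nhds (I := 𝓡 M.dim) x) |>.mdifferentiableAt (by simp)
  have h2 := (contMDiffAt_extChartAt (I := 𝓡 M.dim) (n := ∞) (x := x)).mdifferentiableAt (by simp)
  have hx := extChartAt_to_inv (I := 𝓡 M.dim) x
  have hc := mfderiv_comp (I := 𝓘(ℝ, M.E)) (I' := 𝓡 M.dim) (I'' := 𝓘(ℝ, M.E))
    (extChartAt (𝓡 M.dim) x x) (g := extChartAt (𝓡 M.dim) x) (by rw [hx]; exact h2) h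
  have he : (extChartAt (𝓡 M.dim) x ∘ (extChartAt (𝓡 M.dim) x).symm)
      =ᶠ[𝓝 (extChartAt (𝓡 M.dim) x x)] id := by
    filter_upwards [extChartAt_target_mem_nhds (I := 𝓡 M.dim) x] with y hy
    exact (extChartAt (𝓡 M.dim) x).right_inv hy
  rw [he.mfderiv_eq, mfderiv_id] at hc
  have h3 := chartT_eq_id M x
  ext1 v
  have h4 := DFunLike.congr_fun hc v
  have h5 : ∀ z (hz : z = x), mfderiv (𝓡 M.dim) 𝓘(ℝ, M.E) (extChartAt (𝓡 M.dim) x) z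
      = (ContinuousLinearMap.id ℝ M.E) := by
    rintro z rfl; exact h3
  have h6 := h5 _ hx
  exact ((h4.trans (DFunLike.congr_fun h6 _)).symm :)

/-- The differential is the derivative of the expression in the preferred charts. -/
theorem hasFDerivAt_chart {f : M → N} {x : M} (hf : ContMDiffAt (𝓡 M.dim) (𝓡 N.dim) ∞ f x) :
    HasFDerivAt (fun y => extChartAt (𝓡 N.dim) (f x) (f ((extChartAt (𝓡 M.dim) x).symm y)))
      (D f x) (extChartAt (𝓡 M.dim) x x) := by
  have hm := hf.mdifferentiableAt (by simp)
  have e1 : D f x = fderiv ℝ (writtenInExtChartAt (𝓡 M.dim) (𝓡 N.dim) x f)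
      (extChartAt (𝓡 M.dim) x x) := by
    unfold D
    rw [hm.mfderiv]
    simp
  have h3 := hm.differentiableWithinAt_writtenInExtChartAt
  simp only [modelWithCornersSelf_coe, range_id] at h3
  rw [e1]
  exact (h3.differentiableAt univ_mem).hasFDerivAt

/-- A submersion has a smooth local section through every point, with any derivative that is right
inverse to the one of the submersion. -/
theorem exists_local_section_of_rightInverse {N : Mfd.{v}} {Q : Mfd.{w}} {p : N → Q}
    (hp : Smooth p) (n : N) {R : Q.E →L[ℝ] N.E} (hR : ∀ v, D p n (R v) = v) :
    ∃ (U : Set Q) (s : Q → N), IsOpen U ∧ p n ∈ U ∧ ContMDiffOn (𝓡 Q.dim) (𝓡 N.dim) ∞ s U ∧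
      (∀ x ∈ U, p (s x) = x) ∧ s (p n) = n ∧ ∀ v, D s (p n) v = R v := by
  set φ := extChartAt (𝓡 N.dim) n
  set ψ := extChartAt (𝓡 Q.dim) (p n)
  let a : Q.E → N.E := fun v => φ n + R v
  have ha : ContDiff ℝ ∞ a := contDiff_const.add R.contDiff
  -- the locus where the chart expression of `p` along `a` makes sense
  let O : Set Q.E := a ⁻¹' (φ.target ∩ φ.symm ⁻¹' (p ⁻¹' ψ.source))
  have hO₁ : IsOpen (φ.target ∩ φ.symm ⁻¹' (p ⁻¹' ψ.source)) :=
    (continuousOn_extChartAt_symm n).isOpen_inter_preimage (isOpen_extChartAt_target n)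
      ((isOpen_extChartAt_source (p n)).preimage hp.continuous)
  have hO : IsOpen O := hO₁.preimage ha.continuous
  have h0 : (0 : Q.E) ∈ O := by
    have h : a 0 = φ n := by simp [a]
    refine ⟨?_, ?_⟩
    · rw [h]; exact mem_extChartAt_target n
    · change p (φ.symm (a 0)) ∈ ψ.source
      rw [h, extChartAt_to_inv]; exact mem_extChartAt_source (p n)
  let h : Q.E → Q.E := fun v => ψ (p (φ.symm (a v)))
  have hsm : ContDiffOn ℝ ∞ h O := by
    rw [← contMDiffOn_iff_contDiffOn]
    intro v hv
    have h1 : ContMDiffAt 𝓘(ℝ, N.E) (𝓡 N.dim) ∞ φ.symm (a v) :=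
      (contMDiffOn_extChartAt_symm n).contMDiffAt ((isOpen_extChartAt_target n).mem_nhds hv.1)
    have h2 : ContMDiffAt (𝓡 Q.dim) 𝓘(ℝ, Q.E) ∞ ψ (p (φ.symm (a v))) :=
      contMDiffAt_extChartAt' (by rw [← extChartAt_source (𝓡 Q.dim)]; exact hv.2)
    have h3 : ContMDiffAt 𝓘(ℝ, Q.E) 𝓘(ℝ, N.E) ∞ a v := ha.contMDiff.contMDiffAt
    exact (h2.comp v ((hp.contMDiffAt _).comp v (h1.comp v h3))).contMDiffWithinAt
  have hd : fderiv ℝ h 0 = ContinuousLinearMap.id ℝ Q.E := by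
    have e2 : HasFDerivAt (fun y => ψ (p (φ.symm y))) (D p n) (a 0) := by
      have h : a 0 = φ n := by simp [a]
      rw [h]
      exact hasFDerivAt_chart (hp.contMDiffAt n)
    have e3 : HasFDerivAt a R 0 := R.hasFDerivAt.const_add _
    have e4 := e2.comp (0 : Q.E) e3
    have e5 : (D p n).comp R = ContinuousLinearMap.id ℝ Q.E := by ext1 v; exact hR v
    rw [e5] at e4
    exact e4.fderiv
  obtain ⟨e, he0, heO, heh, hesm⟩ := exists_local_inverse hO h0 hsm
    (by rw [hd]; exact Function.bijective_id)
  have hat : ψ (p n) = e 0 := by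
    rw [heh]; change _ = ψ (p (φ.symm (a 0)))
    have h : a 0 = φ n := by simp [a]
    rw [h, extChartAt_to_inv]
  have hpU : p n ∈ ψ.source ∩ ψ ⁻¹' e.target :=
    ⟨mem_extChartAt_source _, by change ψ (p n) ∈ e.target; rw [hat]; exact e.map_source he0⟩
  have hsn : φ.symm (a (e.symm (ψ (p n)))) = n := by
    rw [hat, e.left_inv he0]
    have h : a 0 = φ n := by simp [a]
    rw [h]; exact extChartAt_to_inv n
  have hU : IsOpen (ψ.source ∩ ψ ⁻¹' e.target) :=
    (continuousOn_extChartAt (p n)).isOpen_inter_preimage (isOpen_extChartAt_source _) e.open_target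
  have hss : ContMDiffOn (𝓡 Q.dim) (𝓡 N.dim) ∞ (fun x => φ.symm (a (e.symm (ψ x))))
      (ψ.source ∩ ψ ⁻¹' e.target) := by
    intro x hx
    have hO' : e.symm (ψ x) ∈ O := heO (e.map_target hx.2)
    have h1 : ContMDiffAt 𝓘(ℝ, N.E) (𝓡 N.dim) ∞ φ.symm (a (e.symm (ψ x))) :=
      (contMDiffOn_extChartAt_symm n).contMDiffAt ((isOpen_extChartAt_target n).mem_nhds hO'.1)
    have h2 : ContMDiffAt (𝓡 Q.dim) 𝓘(ℝ, Q.E) ∞ ψ x :=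
      contMDiffAt_extChartAt' (by rw [← extChartAt_source (𝓡 Q.dim)]; exact hx.1)
    have h3 : ContMDiffAt 𝓘(ℝ, Q.E) 𝓘(ℝ, N.E) ∞ a (e.symm (ψ x)) := ha.contMDiff.contMDiffAt
    have h4 : ContMDiffAt 𝓘(ℝ, Q.E) 𝓘(ℝ, Q.E) ∞ e.symm (ψ x) :=
      (hesm.contDiffAt (e.open_target.mem_nhds hx.2)).contMDiffAt
    exact (h1.comp x (h3.comp x (h4.comp x h2))).contMDiffWithinAt
  refine ⟨ψ.source ∩ ψ ⁻¹' e.target, fun x => φ.symm (a (e.symm (ψ x))), hU, hpU, hss, ?_, hsn,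
    fun v => ?_⟩
  · intro x hx
    have hO' : e.symm (ψ x) ∈ O := heO (e.map_target hx.2)
    have h1 : h (e.symm (ψ x)) = ψ x := by rw [← heh]; exact e.right_inv hx.2
    exact ψ.injOn hO'.2 hx.1 h1
  · have h1 := hasFDerivAt_chart (f := fun x => φ.symm (a (e.symm (ψ x))))
      (hss.contMDiffAt (hU.mem_nhds hpU))
    rw [hsn] at h1
    have het : ψ (p n) ∈ e.target := hpU.2
    have he' : HasFDerivAt e ((ContinuousLinearEquiv.refl ℝ Q.E : Q.E ≃L[ℝ] Q.E) : Q.E →L[ℝ] Q.E)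
        (e.symm (ψ (p n))) := by
      rw [hat, e.left_inv he0, show (e : Q.E → Q.E) = h from funext heh]
      have h2 := ((hsm.contDiffAt (hO.mem_nhds h0)).differentiableAt (by simp)).hasFDerivAt
      rw [hd] at h2
      exact h2
    have h3 : HasFDerivAt (fun y => a (e.symm y)) (R.comp (ContinuousLinearMap.id ℝ Q.E))
        (ψ (p n)) :=
      (R.hasFDerivAt.const_add (φ n)).comp (ψ (p n)) (e.hasFDerivAt_symm het he')
    have h4 : (fun y => φ (φ.symm (a (e.symm (ψ (ψ.symm y)))))) =ᶠ[𝓝 (ψ (p n))]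
        fun y => a (e.symm y) := by
      filter_upwards [e.open_target.mem_nhds het, extChartAt_target_mem_nhds (p n)] with y hy hy'
      rw [ψ.right_inv hy']
      exact φ.right_inv (heO (e.map_target hy)).1
    exact DFunLike.congr_fun (h1.unique (h3.congr_of_eventuallyEq h4)) v

theorem exists_rightInverse {V W : Type*} [NormedAddCommGroup V] [NormedSpace ℝ V]
    [NormedAddCommGroup W] [NormedSpace ℝ W] [FiniteDimensional ℝ W] {l : V →L[ℝ] W}
    (hl : Function.Surjective l) : ∃ R : W →L[ℝ] V, ∀ w, l (R w) = w := by
  obtain ⟨R₀, hR₀⟩ := LinearMap.exists_rightInverse_of_surjective (l : V →ₗ[ℝ] W)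
    (LinearMap.range_eq_top.2 hl)
  exact ⟨LinearMap.toContinuousLinearMap R₀, fun w => LinearMap.congr_fun hR₀ w⟩

/-- A submersion has smooth local sections through every point. -/
theorem exists_local_section {N : Mfd.{v}} {Q : Mfd.{w}} {p : N → Q} (hp : Smooth p) (n : N)
    (hs : Function.Surjective (D p n)) :
    ∃ (U : Set Q) (s : Q → N), IsOpen U ∧ p n ∈ U ∧ ContMDiffOn (𝓡 Q.dim) (𝓡 N.dim) ∞ s U ∧
      (∀ x ∈ U, p (s x) = x) ∧ s (p n) = n := by
  obtain ⟨R, hR⟩ := exists_rightInverse hs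
  obtain ⟨U, s, h₁, h₂, h₃, h₄, h₅, -⟩ := exists_local_section_of_rightInverse hp n hR
  exact ⟨U, s, h₁, h₂, h₃, h₄, h₅⟩

end Calculus

/-! ### Submersions and open submanifolds -/

section Submersions

variable {M : Mfd.{u}} {N : Mfd.{v}} {Q : Mfd.{w}}

theorem contMDiffAt_of_comp_submersion {p : N → Q} (hp : Smooth p) {n : N}
    (hs : Function.Surjective (D p n)) {g : Q → M}
    (hg : ContMDiffAt (𝓡 N.dim) (𝓡 M.dim) ∞ (fun y => g (p y)) n) :
    ContMDiffAt (𝓡 Q.dim) (𝓡 M.dim) ∞ g (p n) := by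
  obtain ⟨U, s, hU, hn, hsm, hps, hsn⟩ := exists_local_section hp n hs
  have h1 := hsm.contMDiffAt (hU.mem_nhds hn)
  have hg' : ContMDiffAt (𝓡 N.dim) (𝓡 M.dim) ∞ (fun y => g (p y)) (s (p n)) := by rwa [hsn]
  refine (hg'.comp (p n) h1).congr_of_eventuallyEq ?_
  filter_upwards [hU.mem_nhds hn] with x hx
  simp [hps x hx]

theorem Smooth.of_comp {p : N → Q} (hp : Smooth p) (hsurj : Function.Surjective p)
    (hs : ∀ n, Function.Surjective (D p n)) {g : Q → M} (hg : Smooth (fun y => g (p y))) :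
    Smooth g := by
  intro x
  obtain ⟨n, rfl⟩ := hsurj x
  exact contMDiffAt_of_comp_submersion hp (hs n) (hg.contMDiffAt n)

/-- An open subset of a manifold, as a manifold. -/
def Mfd.restr (T : Mfd.{u}) (U : TopologicalSpace.Opens T) : Mfd.{u} where
  carrier := U
  dim := T.dim

/-- The inclusion of an open subset. -/
def Mfd.incl (T : Mfd.{u}) (U : TopologicalSpace.Opens T) : T.restr U → T := Subtype.val

/-- A point of an open subset. -/
def Mfd.restrMk (T : Mfd.{u}) (U : TopologicalSpace.Opens T) (t : T) (h : t ∈ U) : T.restr U :=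
  (⟨t, h⟩ : U)

theorem incl_restrMk (T : Mfd.{u}) (U : TopologicalSpace.Opens T) (t : T) (h : t ∈ U) :
    T.incl U (T.restrMk U t h) = t := rfl

theorem smooth_incl (T : Mfd.{u}) (U : TopologicalSpace.Opens T) : Smooth (T.incl U) :=
  (contMDiff_subtype_val : ContMDiff (𝓡 T.dim) (𝓡 T.dim) ∞ (Subtype.val : U → T))

theorem contMDiffAt_incl_iff {T : Mfd.{u}} {U : TopologicalSpace.Opens T} {f : T → N}
    {x : T.restr U} : ContMDiffAt (𝓡 T.dim) (𝓡 N.dim) ∞ f (T.incl U x) ↔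
      ContMDiffAt (𝓡 (T.restr U).dim) (𝓡 N.dim) ∞ (fun y => f (T.incl U y)) x :=
  (contMDiffAt_subtype_iff (I := 𝓡 T.dim) (I' := 𝓡 N.dim) (U := U) (f := f) (x := x)).symm

theorem surjective_D_incl (T : Mfd.{u}) (U : TopologicalSpace.Opens T) (x : T.restr U) :
    Function.Surjective (D (T.incl U) x) := by
  classical
  -- a local inverse of the inclusion
  let g : T → T.restr U := fun t => if h : t ∈ U then T.restrMk U t h else x
  have hgi : ∀ y, g (T.incl U y) = y := fun y => dif_pos y.2
  have hg : ContMDiffAt (𝓡 T.dim) (𝓡 (T.restr U).dim) ∞ g (T.incl U x) := by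
    rw [contMDiffAt_incl_iff]
    simp only [hgi]
    exact contMDiffAt_id
  have hc : (fun t => T.incl U (g t)) =ᶠ[𝓝 (T.incl U x)] fun t => t := by
    filter_upwards [U.2.mem_nhds x.2] with t ht
    exact congr_arg (T.incl U) (hgi (T.restrMk U t ht))
  intro v
  have h := D_comp_at ((smooth_incl T U).contMDiffAt _) hg v
  rw [D_congr hc, D_id, hgi] at h
  exact ⟨_, h.symm⟩

/-- A smooth family in the base of a submersion lifts to the total space locally in the
parameters, with prescribed value and derivative at one parameter. -/
theorem exists_lift_family_of_rightInverse {p : N → Q} (hp : Smooth p) {T : Mfd.{u}} {b : T → Q}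
    (hb : Smooth b) {t₀ : T} {n : N} (hn : p n = b t₀) {R : Q.E →L[ℝ] N.E}
    (hR : ∀ v, D p n (R v) = v) :
    ∃ (U : TopologicalSpace.Opens T) (t' : T.restr U) (c : T.restr U → N), T.incl U t' = t₀ ∧
      Smooth c ∧ (∀ t, p (c t) = b (T.incl U t)) ∧ c t' = n ∧ ∀ e, ∃ v, D c t' e = R v := by
  obtain ⟨U, s, hU, hnU, hsm, hps, hsn, hsR⟩ := exists_local_section_of_rightInverse hp n hR
  let O : TopologicalSpace.Opens T := ⟨b ⁻¹' U, hU.preimage hb.continuous⟩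
  have hat : ∀ t : T.restr O, ContMDiffAt (𝓡 Q.dim) (𝓡 N.dim) ∞ s (b (T.incl O t)) := fun t =>
    hsm.contMDiffAt (hU.mem_nhds t.2)
  have hbs : ∀ t : T.restr O, ContMDiffAt (𝓡 (T.restr O).dim) (𝓡 Q.dim) ∞
      (fun t => b (T.incl O t)) t := fun t => (hb.comp (smooth_incl T O)).contMDiffAt t
  have ht₀ : t₀ ∈ O := by change b t₀ ∈ U; rwa [← hn]
  refine ⟨O, T.restrMk O t₀ ht₀, fun t => s (b (T.incl O t)), rfl,
    fun t => (hat t).comp t (hbs t), fun t => hps _ t.2, ?_, fun e =>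
    ⟨D (fun t => b (T.incl O t)) (T.restrMk O t₀ ht₀) e, ?_⟩⟩
  · change s (b t₀) = n
    rw [← hn, hsn]
  · refine (D_comp_at (f := fun t => b (T.incl O t)) (hat _) (hbs _) e).trans ?_
    change D s (b t₀) _ = _
    rw [← hn]
    exact hsR _

/-- A smooth family in the base of a submersion lifts to the total space locally in the
parameters. -/
theorem exists_lift_family {p : N → Q} (hp : Smooth p) (hsurj : Function.Surjective p)
    (hs : ∀ n, Function.Surjective (D p n)) {T : Mfd.{u}} {b : T → Q} (hb : Smooth b) (t₀ : T) :
    ∃ (U : TopologicalSpace.Opens T) (t' : T.restr U) (c : T.restr U → N), T.incl U t' = t₀ ∧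
      Smooth c ∧ ∀ t, p (c t) = b (T.incl U t) := by
  obtain ⟨n, hn⟩ := hsurj (b t₀)
  obtain ⟨R, hR⟩ := exists_rightInverse (hs n)
  obtain ⟨U, t', c, h₁, h₂, h₃, -⟩ := exists_lift_family_of_rightInverse hp hb hn hR
  exact ⟨U, t', c, h₁, h₂, h₃⟩

end Submersions

/-! ### Smooth actions -/

section Actions

variable {H : LieGrp.{v}} {P : Mfd.{u}} {a : H → P → P}

theorem smooth_inv (H : LieGrp.{v}) : Smooth (M := H.toMfd) (N := H.toMfd) (fun h : H => h⁻¹) :=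
  contMDiff_inv (𝓡 H.dim) ∞

theorem Smooth.mul {T : Mfd.{w}} {g h : T → H} (hg : Smooth (N := H.toMfd) g)
    (hh : Smooth (N := H.toMfd) h) : Smooth (N := H.toMfd) (fun t => g t * h t) :=
  ContMDiff.mul hg hh

theorem isSmoothAction_mul (H : LieGrp.{v}) :
    IsSmoothAction H H.toMfd (fun g h : H => g * h) :=
  ⟨one_mul, mul_assoc, contMDiff_mul (𝓡 H.dim) ∞⟩

namespace IsSmoothAction

theorem inv_act (ha : IsSmoothAction H P a) (g : H) (p : P) : a g⁻¹ (a g p) = p := by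
  rw [← ha.mul_act, inv_mul_cancel, ha.one_act]

theorem act_inv (ha : IsSmoothAction H P a) (g : H) (p : P) : a g (a g⁻¹ p) = p := by
  rw [← ha.mul_act, mul_inv_cancel, ha.one_act]

theorem smooth (ha : IsSmoothAction H P a) {T : Mfd.{w}} {g : T → H} {x : T → P}
    (hg : Smooth (N := H.toMfd) g) (hx : Smooth x) : Smooth (fun t => a (g t) (x t)) :=
  ContMDiff.comp ha.smooth_act (ContMDiff.prodMk hg hx)

theorem contMDiffAt (ha : IsSmoothAction H P a) {E' H' : Type*} [NormedAddCommGroup E']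
    [NormedSpace ℝ E'] [TopologicalSpace H'] {J : ModelWithCorners ℝ E' H'} {T : Type*}
    [TopologicalSpace T] [ChartedSpace H' T] {g : T → H} {x : T → P} {t : T}
    (hg : ContMDiffAt J (𝓡 H.dim) ∞ g t) (hx : ContMDiffAt J (𝓡 P.dim) ∞ x t) :
    ContMDiffAt J (𝓡 P.dim) ∞ (fun t => a (g t) (x t)) t :=
  ContMDiffAt.comp (x := t) ha.smooth_act.contMDiffAt (ContMDiffAt.prodMk hg hx)

theorem smooth_left (ha : IsSmoothAction H P a) (g : H) : Smooth (a g) :=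
  ha.smooth (smooth_const g) smooth_id

theorem smooth_orbit (ha : IsSmoothAction H P a) (x : P) :
    Smooth (M := H.toMfd) (fun h : H => a h x) :=
  ha.smooth smooth_id (smooth_const x)

/-- The derivative of a family of points moved by a family of group elements. -/
theorem mfderiv_act (ha : IsSmoothAction H P a) {E' H' : Type*} [NormedAddCommGroup E']
    [NormedSpace ℝ E'] [TopologicalSpace H'] {J : ModelWithCorners ℝ E' H'} {T : Type*}
    [TopologicalSpace T] [ChartedSpace H' T] {g : T → H} {x : T → P} {t : T}
    (hg : MDifferentiableAt J (𝓡 H.dim) g t) (hx : MDifferentiableAt J (𝓡 P.dim) x t) (v : E') :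
    (mfderiv J (𝓡 P.dim) (fun t => a (g t) (x t)) t : E' →L[ℝ] P.E) v =
      D (a (g t)) (x t) ((mfderiv J (𝓡 P.dim) x t : E' →L[ℝ] P.E) v) +
      D (M := H.toMfd) (fun h : H => a h (x t)) (g t)
        ((mfderiv J (𝓡 H.dim) g t : E' →L[ℝ] H.E) v) := by
  have hm : MDifferentiableAt ((𝓡 H.dim).prod (𝓡 P.dim)) (𝓡 P.dim)
      (fun p : H.carrier × P.carrier => a p.1 p.2) (g t, x t) :=
    ha.smooth_act.contMDiffAt.mdifferentiableAt (by simp)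
  have h1 := mfderiv_comp (I := J) (I' := (𝓡 H.dim).prod (𝓡 P.dim)) (I'' := 𝓡 P.dim) t
    (f := fun t => (g t, x t)) hm (hg.prodMk hx)
  have h2 := mfderiv_prod_eq_add_apply hm (v := mfderiv J ((𝓡 H.dim).prod (𝓡 P.dim))
    (fun t => (g t, x t)) t v)
  have h3 := mfderiv_prodMk hg hx
  refine (DFunLike.congr_fun h1 v).trans ?_
  refine h2.trans ?_
  rw [h3]
  exact add_comm _ _

theorem D_act_at (ha : IsSmoothAction H P a) {T : Mfd.{w}} {g : T → H} {x : T → P} {t : T}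
    (hg : ContMDiffAt (𝓡 T.dim) (𝓡 H.dim) ∞ g t) (hx : ContMDiffAt (𝓡 T.dim) (𝓡 P.dim) ∞ x t)
    (v : T.E) :
    D (fun t => a (g t) (x t)) t v = D (a (g t)) (x t) (D x t v) +
      D (M := H.toMfd) (fun h : H => a h (x t)) (g t) (D (N := H.toMfd) g t v) :=
  ha.mfderiv_act (hg.mdifferentiableAt (by simp)) (hx.mdifferentiableAt (by simp)) v

theorem D_act (ha : IsSmoothAction H P a) {T : Mfd.{w}} {g : T → H} {x : T → P}
    (hg : Smooth (N := H.toMfd) g) (hx : Smooth x) (t : T) (v : T.E) :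
    D (fun t => a (g t) (x t)) t v = D (a (g t)) (x t) (D x t v) +
      D (M := H.toMfd) (fun h : H => a h (x t)) (g t) (D (N := H.toMfd) g t v) :=
  ha.mfderiv_act (hg.mdiff t) (hx.mdiff t) v

end IsSmoothAction

theorem D_inv_one (H : LieGrp.{v}) (ξ : H.E) :
    D (M := H.toMfd) (N := H.toMfd) (fun h : H => h⁻¹) 1 ξ = -ξ := by
  have h := (isSmoothAction_mul H).D_act (T := H.toMfd) smooth_id (smooth_inv H) 1 ξ
  simp only [mul_inv_cancel] at h
  rw [D_const, D_id] at h
  simp only [inv_one, one_mul, mul_one] at h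
  rw [D_id, D_id] at h
  exact eq_neg_of_add_eq_zero_left h.symm

theorem bijective_D_mul_right (H : LieGrp.{v}) (g h : H) :
    Function.Bijective (D (M := H.toMfd) (N := H.toMfd) (fun k : H => k * g) h) := by
  have hs : ∀ g : H, Smooth (M := H.toMfd) (N := H.toMfd) (fun k : H => k * g) :=
    fun g => smooth_id.mul (smooth_const g)
  have key : ∀ (g h : H) (v : H.E), D (M := H.toMfd) (N := H.toMfd) (fun k : H => k * g⁻¹) (h * g)
      (D (M := H.toMfd) (N := H.toMfd) (fun k : H => k * g) h v) = v := by
    intro g h v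
    rw [← D_comp (hs g⁻¹) (hs g)]
    simp only [mul_inv_cancel_right]
    exact D_id _ _
  refine ⟨Function.LeftInverse.injective (key g h), fun v => ?_⟩
  have := key g⁻¹ (h * g) v
  rw [inv_inv, mul_inv_cancel_right] at this
  exact ⟨_, this⟩

/-- Orbit maps have constant rank: the image of the differential at `g` is the image of the
differential at `1` for the point `g · x`. -/
theorem IsSmoothAction.D_orbit (ha : IsSmoothAction H P a) (x : P) (g : H) (v : H.E) :
    D (M := H.toMfd) (fun h : H => a h (a g x)) 1
      (D (M := H.toMfd) (N := H.toMfd) (fun k : H => k * g⁻¹) g v) =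
      D (M := H.toMfd) (fun h : H => a h x) g v := by
  have hs : Smooth (M := H.toMfd) (N := H.toMfd) (fun k : H => k * g⁻¹) :=
    smooth_id.mul (smooth_const g⁻¹)
  have h := D_comp (ha.smooth_orbit (a g x)) hs g v
  simp only [← ha.mul_act, inv_mul_cancel_right, mul_inv_cancel] at h
  simp only [← ha.mul_act]
  exact h.symm

end Actions

section Fund

variable {G : LieGrp.{v}} {M : GMfd.{v, u} G} {N : GMfd.{v, u} G}

theorem GMfd.fund_eq_neg (M : GMfd.{v, u} G) (x : M) (ξ : G.E) :
    M.fund x ξ = -D (M := G.toMfd) (N := M.toMfd) (fun g : G => M.act g x) 1 ξ := by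
  have h := D_comp (M := G.toMfd) (N := G.toMfd) (Q := M.toMfd) (M.isAction.smooth_orbit x)
    (smooth_inv G) 1 ξ
  rw [D_inv_one, inv_one, map_neg] at h
  exact h

theorem IsGMap.D_fund {f : M → N} (hf : IsGMap f) (x : M) (ξ : G.E) :
    D f x (M.fund x ξ) = N.fund (f x) ξ := by
  rw [M.fund_eq_neg, N.fund_eq_neg, map_neg]
  have h := D_comp (M := G.toMfd) (N := M.toMfd) (Q := N.toMfd) hf.smooth
    (M.isAction.smooth_orbit x) 1 ξ
  simp only [hf.equivariant, M.isAction.one_act] at h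
  rw [h]

theorem GMfd.D_act_fund (M : GMfd.{v, u} G) (g : G) (x : M) (ξ : G.E) :
    D (M.act g) x (M.fund x ξ) = M.fund (M.act g x) (G.Ad g ξ) := by
  rw [M.fund_eq_neg, M.fund_eq_neg, map_neg, LieGrp.Ad]
  have h := D_comp (M := G.toMfd) (N := M.toMfd) (Q := M.toMfd) (M.isAction.smooth_left g)
    (M.isAction.smooth_orbit x) 1 ξ
  have hs : Smooth (M := G.toMfd) (N := G.toMfd) (fun h : G => g * h * g⁻¹) :=
    ((smooth_const g).mul smooth_id).mul (smooth_const g⁻¹)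
  have h' := D_comp (M := G.toMfd) (N := G.toMfd) (Q := M.toMfd)
    (M.isAction.smooth_orbit (M.act g x)) hs 1 ξ
  simp only [mul_one, mul_inv_cancel] at h'
  simp only [M.isAction.one_act] at h
  rw [← h', ← h]
  congr 3
  funext t
  rw [← M.isAction.mul_act, ← M.isAction.mul_act, inv_mul_cancel_right]

theorem IsGMap.comp {Q : GMfd.{v, u} G} {g : N → Q} {f : M → N} (hg : IsGMap g) (hf : IsGMap f) :
    IsGMap (fun x => g (f x)) :=
  ⟨hg.smooth.comp hf.smooth, fun k x => by rw [hf.equivariant, hg.equivariant]⟩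

end Fund

/-! ### Principal bundles -/

namespace IsPrincipal

variable {H : LieGrp.{v}} {P : Mfd.{u}} {X : Mfd.{w}} {a : H → P → P} {q : P → X}

theorem surjective (hq : IsPrincipal H a q) : Function.Surjective q := fun x =>
  let ⟨_, _, hx, s, _, _, _, h, _⟩ := hq.locally_trivial x
  ⟨s x, h x hx⟩

theorem act_injective (hq : IsPrincipal H a q) {g h : H} {p : P} (e : a g p = a h p) : g = h := by
  obtain ⟨U, -, hx, s, χ, -, -, -, hχ, hχ'⟩ := hq.locally_trivial (q p)
  have h1 := hχ p hx
  rw [← h1, ← hq.isAction.mul_act, ← hq.isAction.mul_act] at e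
  have h2 := congr_arg χ e
  rw [hχ' _ hx, hχ' _ hx] at h2
  exact mul_right_cancel h2

theorem exists_act (hq : IsPrincipal H a q) {p p' : P} (e : q p = q p') : ∃ h, a h p = p' := by
  obtain ⟨U, -, hx, s, χ, -, -, -, hχ, -⟩ := hq.locally_trivial (q p)
  refine ⟨χ p' * (χ p)⁻¹, ?_⟩
  have h2 := hχ p' (by rwa [← e])
  have h3 : a (χ p)⁻¹ p = s (q p) := by
    conv_lhs => arg 2; rw [← hχ p hx]
    exact hq.isAction.inv_act _ _
  rw [hq.isAction.mul_act, h3, e, h2]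

/-- The element that takes `p` to `p'`, for `p` and `p'` in the same fibre, depends smoothly on
`p` and `p'`. -/
theorem exists_translation (hq : IsPrincipal H a q) {T : Mfd.{w'}} {m n : T → P} (hm : Smooth m)
    (hn : Smooth n) (e : ∀ t, q (m t) = q (n t)) :
    ∃ h : T → H, Smooth (N := H.toMfd) h ∧ ∀ t, a (h t) (m t) = n t := by
  choose h hh using fun t => hq.exists_act (e t)
  refine ⟨h, fun t => ?_, hh⟩
  obtain ⟨U, hU, hx, s, χ, -, hχs, -, hχ, hχ'⟩ := hq.locally_trivial (q (m t))
  have hO : IsOpen (q ⁻¹' U) := hU.preimage hq.smooth_proj.continuous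
  have hOm : IsOpen ((fun t => q (m t)) ⁻¹' U) :=
    hU.preimage (hq.smooth_proj.comp hm).continuous
  have h1 : ContMDiffAt (𝓡 T.dim) (𝓡 H.dim) ∞ (fun t => χ (m t)) t :=
    (hχs.contMDiffAt (hO.mem_nhds hx)).comp t (hm.contMDiffAt t)
  have h2 : ContMDiffAt (𝓡 T.dim) (𝓡 H.dim) ∞ (fun t => χ (n t)) t :=
    (hχs.contMDiffAt (hO.mem_nhds (by change q (n t) ∈ U; rwa [← e]))).comp t (hn.contMDiffAt t)
  refine (h2.mul h1.inv).congr_of_eventuallyEq ?_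
  filter_upwards [hOm.mem_nhds hx] with t' ht'
  apply hq.act_injective (p := m t')
  have e2 := hχ (n t') (by rw [← e]; exact ht')
  have e3 : a (χ (m t'))⁻¹ (m t') = s (q (m t')) := by
    conv_lhs => arg 2; rw [← hχ (m t') ht']
    exact hq.isAction.inv_act _ _
  change a (h t') (m t') = a (χ (n t') * (χ (m t'))⁻¹) (m t')
  rw [hh, hq.isAction.mul_act, e3, e, e2]

theorem submersion (hq : IsPrincipal H a q) (p : P) : Function.Surjective (D q p) := by
  obtain ⟨U, hU, hx, s, χ, hs, -, hqs, hχ, -⟩ := hq.locally_trivial (q p)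
  -- the section through `p`
  let σ : X → P := fun x => a (χ p) (s x)
  have hσp : σ (q p) = p := hχ p hx
  have hσ : ContMDiffAt (𝓡 X.dim) (𝓡 P.dim) ∞ σ (q p) :=
    (hq.isAction.smooth_left (χ p)).contMDiffAt _ |>.comp (q p) (hs.contMDiffAt (hU.mem_nhds hx))
  have he : (fun x => q (σ x)) =ᶠ[𝓝 (q p)] id := by
    filter_upwards [hU.mem_nhds hx] with x hx'
    simp [σ, hq.proj_act, hqs x hx']
  intro v
  have h := D_comp_at (hq.smooth_proj.contMDiffAt _) hσ v
  rw [D_congr he, hσp] at h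
  exact ⟨_, h.symm.trans (D_id _ _)⟩

theorem smooth_of_comp (hq : IsPrincipal H a q) {M : Mfd.{w'}} {g : X → M}
    (hg : Smooth (fun y => g (q y))) : Smooth g :=
  Smooth.of_comp hq.smooth_proj hq.surjective hq.submersion hg

theorem D_orbit_eq_zero (hq : IsPrincipal H a q) (p : P) (ξ : H.E) :
    D q p (D (M := H.toMfd) (fun h : H => a h p) 1 ξ) = 0 := by
  have h := D_comp hq.smooth_proj (hq.isAction.smooth_orbit p) 1 ξ
  simp only [hq.proj_act, hq.isAction.one_act] at h
  rw [← h, D_const]; rfl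

theorem exists_D_orbit (hq : IsPrincipal H a q) (p : P) {v : P.E} (hv : D q p v = 0) :
    ∃ ξ : H.E, D (M := H.toMfd) (fun h : H => a h p) 1 ξ = v := by
  obtain ⟨U, hU, hx, s, χ, hs, hχs, hqs, hχ, -⟩ := hq.locally_trivial (q p)
  have hO : IsOpen (q ⁻¹' U) := hU.preimage hq.smooth_proj.continuous
  have hsd : ContMDiffAt (𝓡 X.dim) (𝓡 P.dim) ∞ s (q p) := hs.contMDiffAt (hU.mem_nhds hx)
  have hχd : ContMDiffAt (𝓡 P.dim) (𝓡 H.dim) ∞ χ p := hχs.contMDiffAt (hO.mem_nhds hx)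
  have hsq : ContMDiffAt (𝓡 P.dim) (𝓡 P.dim) ∞ (fun y => s (q y)) p :=
    hsd.comp p (hq.smooth_proj.contMDiffAt p)
  have h1 := hq.isAction.D_act_at hχd hsq v
  have he : (fun y => a (χ y) (s (q y))) =ᶠ[𝓝 p] fun y => y := by
    filter_upwards [hO.mem_nhds hx] with y hy
    exact hχ y hy
  rw [D_congr he, D_id, D_comp_at hsd (hq.smooth_proj.contMDiffAt _), hv, map_zero, map_zero,
    zero_add, ← hq.isAction.D_orbit, hχ p hx] at h1
  exact ⟨_, h1.symm⟩

theorem D_orbit_injective (hq : IsPrincipal H a q) (p : P) :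
    Function.Injective (D (M := H.toMfd) (fun h : H => a h p) 1) := by
  obtain ⟨U, hU, hx, s, χ, hs, hχs, hqs, hχ, hχ'⟩ := hq.locally_trivial (q p)
  have hO : IsOpen (q ⁻¹' U) := hU.preimage hq.smooth_proj.continuous
  have hχd : ContMDiffAt (𝓡 P.dim) (𝓡 H.dim) ∞ χ (a 1 p) :=
    hχs.contMDiffAt (hO.mem_nhds (by change q (a 1 p) ∈ U; rwa [hq.proj_act]))
  intro v w hvw
  apply (bijective_D_mul_right H (χ p) 1).1
  have h2 : (fun h : H => χ (a h p)) = fun h => h * χ p := by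
    funext h
    conv_lhs => rw [← hχ p hx]
    rw [← hq.isAction.mul_act, hχ' _ hx]
  have h1 := fun v => D_comp_at (M := H.toMfd) (N := P) (Q := H.toMfd) hχd
    ((hq.isAction.smooth_orbit p).contMDiffAt 1) v
  rw [h2] at h1
  rw [h1, h1, hvw]

end IsPrincipal

section PrincipalFund

variable {G : LieGrp.{v}} {P : GMfd.{v, u} G} {X : Mfd.{w}} {q : P → X}

theorem IsPrincipal.D_fund_eq_zero (hq : IsPrincipal G (P := P.toMfd) P.act q) (p : P) (ξ : G.E) :
    D q p (P.fund p ξ) = 0 := by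
  rw [P.fund_eq_neg, map_neg, hq.D_orbit_eq_zero, neg_zero]

theorem IsPrincipal.exists_fund (hq : IsPrincipal G (P := P.toMfd) P.act q) (p : P) {v : P.E}
    (hv : D q p v = 0) : ∃ ξ : G.E, P.fund p ξ = v := by
  obtain ⟨ξ, hξ⟩ := hq.exists_D_orbit p hv
  exact ⟨-ξ, by rw [P.fund_eq_neg, map_neg, neg_neg, hξ]⟩

theorem IsPrincipal.fund_injective (hq : IsPrincipal G (P := P.toMfd) P.act q) (p : P) :
    Function.Injective (P.fund p) := by
  intro ξ η h
  rw [P.fund_eq_neg, P.fund_eq_neg, neg_inj] at h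
  exact hq.D_orbit_injective p h

end PrincipalFund

/-! ### Quotient manifolds -/

section QuotientManifold

variable {G : LieGrp.{v}}

/-- A chart of the orbit space `N/G` near the orbit of `n₀`, of dimension `k`: an invariant open
set `W`, an invariant smooth function `c` on it with values in the open set `T ⊆ ℝᵏ`, and a smooth
map `σ : T → W` that meets every orbit in `W`, with `c (σ v) = v`. -/
structure OrbitChart (N : GMfd.{v, u} G) (k : ℕ) (n₀ : N) where
  W : Set N
  c : N → EuclideanSpace ℝ (Fin k)
  T : Set (EuclideanSpace ℝ (Fin k))
  σ : EuclideanSpace ℝ (Fin k) → N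
  isOpen_W : IsOpen W
  mem_W : n₀ ∈ W
  isOpen_T : IsOpen T
  act_mem : ∀ g, ∀ n ∈ W, N.act g n ∈ W
  c_act : ∀ g, ∀ n ∈ W, c (N.act g n) = c n
  c_mem : ∀ n ∈ W, c n ∈ T
  σ_mem : ∀ v ∈ T, σ v ∈ W
  c_σ : ∀ v ∈ T, c (σ v) = v
  exists_act : ∀ n ∈ W, ∃ g, N.act g (σ (c n)) = n
  smooth_c : ContMDiffOn (𝓡 N.dim) 𝓘(ℝ, EuclideanSpace ℝ (Fin k)) ∞ c W
  smooth_σ : ContMDiffOn 𝓘(ℝ, EuclideanSpace ℝ (Fin k)) (𝓡 N.dim) ∞ σ T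

/-- A smooth equivariant map `ρ` from an invariant open set to `G` provides orbit charts: the
level set of `ρ` through `n₀` is a slice for the action. -/
theorem exists_orbitChart (N : GMfd.{v, u} G) (n₀ : N) (O : Set N) (ρ : N → G) (hO : IsOpen O)
    (h₀ : n₀ ∈ O) (hOact : ∀ g, ∀ n ∈ O, N.act g n ∈ O)
    (hρ : ContMDiffOn (𝓡 N.dim) (𝓡 G.dim) ∞ ρ O)
    (hρact : ∀ g, ∀ n ∈ O, ρ (N.act g n) = g * ρ n) (hρ₀ : ρ n₀ = 1) :
    Nonempty (OrbitChart N (N.dim - G.dim) n₀) := by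
  set k := N.dim - G.dim with hk
  have hA := N.isAction
  -- the retraction onto the slice
  let r : N → N := fun n => N.act (ρ n)⁻¹ n
  have hρat : ∀ n ∈ O, ContMDiffAt (𝓡 N.dim) (𝓡 G.dim) ∞ ρ n := fun n hn =>
    hρ.contMDiffAt (hO.mem_nhds hn)
  have hrat : ∀ n ∈ O, ContMDiffAt (𝓡 N.dim) (𝓡 N.dim) ∞ r n := fun n hn =>
    hA.contMDiffAt (hρat n hn).inv contMDiffAt_id
  have hrO : ∀ n ∈ O, r n ∈ O := fun n hn => hOact _ n hn
  have hρr : ∀ n ∈ O, ρ (r n) = 1 := fun n hn => by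
    rw [hρact _ n hn, inv_mul_cancel]
  have hr1 : ∀ n, ρ n = 1 → r n = n := fun n hn => by
    change N.act (ρ n)⁻¹ n = n
    rw [hn, inv_one, hA.one_act]
  have hract : ∀ g, ∀ n ∈ O, r (N.act g n) = r n := fun g n hn => by
    change N.act (ρ (N.act g n))⁻¹ (N.act g n) = _
    rw [hρact g n hn, mul_inv_rev, hA.mul_act, hA.inv_act]
  have hr₀ : r n₀ = n₀ := hr1 _ hρ₀
  let dρ : N.E →L[ℝ] G.E := D (N := G.toMfd) ρ n₀
  let F : G.E →L[ℝ] N.E := N.fund n₀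
  have hdr : ∀ a, D r n₀ a = a + F (dρ a) := by
    intro a
    have h := hA.D_act_at (T := N.toMfd) (g := fun n => (ρ n)⁻¹) (x := fun n => n)
      (hρat n₀ h₀).inv contMDiffAt_id a
    have h2 := D_comp_at (M := N.toMfd) (N := G.toMfd) (Q := G.toMfd)
      ((smooth_inv G).contMDiffAt _) (hρat n₀ h₀) a
    have h4 : N.act 1 = fun x => x := funext hA.one_act
    rw [h2, D_id, hρ₀, D_inv_one, inv_one, h4, D_id, map_neg, ← N.fund_eq_neg] at h
    exact h
  have hdF : ∀ ξ, dρ (F ξ) = -ξ := by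
    intro ξ
    have h := D_comp_at (M := G.toMfd) (N := N.toMfd) (Q := G.toMfd) (x := (1 : G))
      (f := fun h : G => N.act h n₀) (g := ρ)
      (by rw [hA.one_act]; exact hρat n₀ h₀) ((hA.smooth_orbit n₀).contMDiffAt 1) ξ
    have h2 : (fun h : G => ρ (N.act h n₀)) = fun h => h := by
      funext h; rw [hρact h n₀ h₀, hρ₀, mul_one]
    rw [h2, D_id, hA.one_act] at h
    change D (N := G.toMfd) ρ n₀ (N.fund n₀ ξ) = _
    rw [N.fund_eq_neg, map_neg, ← h]
  -- the projection onto the tangent space of the slice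
  let Pr : N.E →L[ℝ] N.E := ContinuousLinearMap.id ℝ N.E + F.comp dρ
  have hPr : ∀ a, Pr a = a + F (dρ a) := fun a => rfl
  have hdPr : ∀ a, dρ (Pr a) = 0 := fun a => by rw [hPr, map_add, hdF, add_neg_cancel]
  have hPrPr : ∀ a, Pr (Pr a) = Pr a := fun a => by rw [hPr (Pr a), hdPr, map_zero, add_zero]
  have hdsurj : Function.Surjective dρ := fun ξ => ⟨F (-ξ), by rw [hdF, neg_neg]⟩
  have hrank := LinearMap.finrank_range_add_finrank_ker (dρ : N.E →ₗ[ℝ] G.E)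
  rw [LinearMap.range_eq_top.2 hdsurj, finrank_top, finrank_euclideanSpace_fin,
    finrank_euclideanSpace_fin] at hrank
  let K := LinearMap.ker (dρ : N.E →ₗ[ℝ] G.E)
  have hKk : Module.finrank ℝ K = Module.finrank ℝ (EuclideanSpace ℝ (Fin k)) := by
    rw [finrank_euclideanSpace_fin]
    change Module.finrank ℝ (LinearMap.ker (dρ : N.E →ₗ[ℝ] G.E)) = k
    omega
  let e : K ≃ₗ[ℝ] EuclideanSpace ℝ (Fin k) := LinearEquiv.ofFinrankEq _ _ hKk
  let L₀ : N.E →ₗ[ℝ] EuclideanSpace ℝ (Fin k) :=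
    e.toLinearMap.comp (LinearMap.codRestrict K (Pr : N.E →ₗ[ℝ] N.E) hdPr)
  let L : N.E →L[ℝ] EuclideanSpace ℝ (Fin k) := LinearMap.toContinuousLinearMap L₀
  have hL : ∀ a, L a = e ⟨Pr a, hdPr a⟩ := fun a => rfl
  let d : N.E →L[ℝ] G.E × EuclideanSpace ℝ (Fin k) := dρ.prod (L.comp (D r n₀))
  have hdinj : Function.Injective d := by
    rw [injective_iff_map_eq_zero]
    intro a ha
    have h1 : dρ a = 0 := congr_arg Prod.fst ha
    have h2 : L (D r n₀ a) = 0 := congr_arg Prod.snd ha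
    rw [hdr, h1, map_zero, add_zero, hL, LinearEquiv.map_eq_zero_iff] at h2
    have h3 : Pr a = 0 := congr_arg Subtype.val h2
    rwa [hPr, h1, map_zero, add_zero] at h3
  have hdbij : Function.Bijective d := by
    have hr : Module.finrank ℝ N.E = Module.finrank ℝ (G.E × EuclideanSpace ℝ (Fin k)) := by
      rw [Module.finrank_prod, finrank_euclideanSpace_fin, finrank_euclideanSpace_fin,
        finrank_euclideanSpace_fin]
      omega
    exact ⟨hdinj, (LinearMap.injective_iff_surjective_of_finrank_eq_finrank
      (f := d.toLinearMap) hr).1 hdinj⟩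
  -- the local diffeomorphism with components `ρ` and `L ∘ r`
  set φ := extChartAt (𝓡 N.dim) n₀
  set ψ := extChartAt (𝓡 G.dim) (ρ n₀)
  set φ' := extChartAt (𝓡 N.dim) (r n₀)
  let Φ : N.E → G.E × EuclideanSpace ℝ (Fin k) := fun y =>
    (ψ (ρ (φ.symm y)), L (φ' (r (φ.symm y))))
  let S₀ : Set N := (O ∩ ρ ⁻¹' ψ.source) ∩ (O ∩ r ⁻¹' φ'.source)
  have hS₀ : IsOpen S₀ :=
    (hρ.continuousOn.isOpen_inter_preimage hO (isOpen_extChartAt_source _)).inter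
      (ContinuousOn.isOpen_inter_preimage
        (fun n hn => (hrat n hn).continuousAt.continuousWithinAt) hO (isOpen_extChartAt_source _))
  have hΩ : IsOpen (φ.target ∩ φ.symm ⁻¹' S₀) :=
    (continuousOn_extChartAt_symm n₀).isOpen_inter_preimage (isOpen_extChartAt_target n₀) hS₀
  have hφ₀ : φ.symm (φ n₀) = n₀ := extChartAt_to_inv n₀
  have hmem : φ n₀ ∈ φ.target ∩ φ.symm ⁻¹' S₀ := by
    refine ⟨mem_extChartAt_target n₀, ?_⟩
    change φ.symm (φ n₀) ∈ S₀
    rw [hφ₀]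
    exact ⟨⟨h₀, mem_extChartAt_source (ρ n₀)⟩, ⟨h₀, mem_extChartAt_source (r n₀)⟩⟩
  have hφs : ∀ y ∈ φ.target, ContMDiffAt 𝓘(ℝ, N.E) (𝓡 N.dim) ∞ φ.symm y := fun y hy =>
    (contMDiffOn_extChartAt_symm n₀).contMDiffAt ((isOpen_extChartAt_target n₀).mem_nhds hy)
  have hΦ : ContDiffOn ℝ ∞ Φ (φ.target ∩ φ.symm ⁻¹' S₀) := by
    rw [← contMDiffOn_iff_contDiffOn]
    intro y hy
    have h1 : ContMDiffAt (𝓡 G.dim) 𝓘(ℝ, G.E) ∞ ψ (ρ (φ.symm y)) :=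
      contMDiffAt_extChartAt' (by rw [← extChartAt_source (𝓡 G.dim)]; exact hy.2.1.2)
    have h2 : ContMDiffAt (𝓡 N.dim) 𝓘(ℝ, N.E) ∞ φ' (r (φ.symm y)) :=
      contMDiffAt_extChartAt' (by rw [← extChartAt_source (𝓡 N.dim)]; exact hy.2.2.2)
    have h3 : ContMDiffAt 𝓘(ℝ, N.E) 𝓘(ℝ, EuclideanSpace ℝ (Fin k)) ∞ L (φ' (r (φ.symm y))) :=
      L.contMDiff.contMDiffAt
    have h4 := h1.comp y ((hρat _ hy.2.1.1).comp y (hφs y hy.1))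
    have h5 := h3.comp y (h2.comp y ((hrat _ hy.2.1.1).comp y (hφs y hy.1)))
    exact (h4.prodMk_space h5).contMDiffWithinAt
  have hdΦ : fderiv ℝ Φ (φ n₀) = d := by
    have h1 := hasFDerivAt_chart (M := N.toMfd) (N := G.toMfd) (hρat n₀ h₀)
    have h2 := hasFDerivAt_chart (M := N.toMfd) (N := N.toMfd) (hrat n₀ h₀)
    exact (h1.prodMk (L.hasFDerivAt.comp _ h2)).fderiv
  obtain ⟨E, hE₀, hES, hEΦ, hEs⟩ := exists_local_inverse hΩ hmem hΦ (by rw [hdΦ]; exact hdbij)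
  let S : Set N := φ.source ∩ φ ⁻¹' E.source
  have hS : IsOpen S := (continuousOn_extChartAt n₀).isOpen_inter_preimage
    (isOpen_extChartAt_source n₀) E.open_source
  have hSS₀ : ∀ n ∈ S, n ∈ S₀ := fun n hn => by
    have := (hES hn.2).2
    rwa [mem_preimage, φ.left_inv hn.1] at this
  let c : N → EuclideanSpace ℝ (Fin k) := fun n => L (φ' (r n))
  have hEφ : ∀ m ∈ S, ρ m = 1 → E (φ m) = (ψ (ρ n₀), c m) := fun m hm h1 => by
    rw [hEΦ]
    change (ψ (ρ (φ.symm (φ m))), L (φ' (r (φ.symm (φ m))))) = _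
    rw [φ.left_inv hm.1, h1, hρ₀]
  let σ : EuclideanSpace ℝ (Fin k) → N := fun v => φ.symm (E.symm (ψ (ρ n₀), v))
  have hcr : ∀ n ∈ O, c (r n) = c n := fun n hn => by
    change L (φ' (r (r n))) = L (φ' (r n)); rw [hr1 _ (hρr n hn)]
  have hσ : ∀ v, (ψ (ρ n₀), v) ∈ E.target → σ v ∈ S ∧ ρ (σ v) = 1 ∧ c (σ v) = v := by
    intro v hv
    have h1 := E.map_target hv
    have h2 := hES h1
    have h3 : φ (σ v) = E.symm (ψ (ρ n₀), v) := φ.right_inv h2.1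
    have h4 : σ v ∈ S := ⟨φ.map_target h2.1, by rw [mem_preimage, h3]; exact h1⟩
    have h5 := E.right_inv hv
    rw [← h3, hEΦ] at h5
    change (ψ (ρ (φ.symm (φ (σ v)))), L (φ' (r (φ.symm (φ (σ v)))))) = _ at h5
    rw [φ.left_inv h4.1] at h5
    have h6 : ρ (σ v) = ρ n₀ :=
      ψ.injOn (hSS₀ _ h4).1.2 (mem_extChartAt_source _) (congr_arg Prod.fst h5)
    exact ⟨h4, h6.trans hρ₀, congr_arg Prod.snd h5⟩
  refine ⟨⟨O ∩ r ⁻¹' S, c, {v | (ψ (ρ n₀), v) ∈ E.target}, σ, ?_, ?_, ?_, ?_, ?_, ?_, ?_, ?_, ?_,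
    ?_, ?_⟩⟩
  · exact ContinuousOn.isOpen_inter_preimage
      (fun n hn => (hrat n hn).continuousAt.continuousWithinAt) hO hS
  · refine ⟨h₀, ?_⟩
    rw [mem_preimage, hr₀]
    exact ⟨mem_extChartAt_source n₀, hE₀⟩
  · exact E.open_target.preimage (by fun_prop)
  · intro g n hn
    refine ⟨hOact g n hn.1, ?_⟩
    rw [mem_preimage, hract g n hn.1]; exact hn.2
  · intro g n hn
    change L (φ' (r (N.act g n))) = L (φ' (r n))
    rw [hract g n hn.1]
  · intro n hn
    change (ψ (ρ n₀), c n) ∈ E.target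
    rw [← hcr n hn.1, ← hEφ _ hn.2 (hρr n hn.1)]
    exact E.map_source hn.2.2
  · intro v hv
    obtain ⟨h1, h2, -⟩ := hσ v hv
    exact ⟨(hSS₀ _ h1).1.1, by rw [mem_preimage, hr1 _ h2]; exact h1⟩
  · exact fun v hv => (hσ v hv).2.2
  · intro n hn
    refine ⟨ρ n, ?_⟩
    have h1 : σ (c n) = r n := by
      change φ.symm (E.symm (ψ (ρ n₀), c n)) = r n
      rw [← hcr n hn.1, ← hEφ _ hn.2 (hρr n hn.1), E.left_inv hn.2.2, φ.left_inv hn.2.1]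
    rw [h1]; exact hA.act_inv _ _
  · intro n hn
    have h2 : ContMDiffAt (𝓡 N.dim) 𝓘(ℝ, N.E) ∞ φ' (r n) := by
      have := (hSS₀ _ hn.2).2.2
      rw [mem_preimage, hr1 _ (hρr n hn.1)] at this
      exact contMDiffAt_extChartAt' (by rw [← extChartAt_source (𝓡 N.dim)]; exact this)
    have h3 : ContMDiffAt 𝓘(ℝ, N.E) 𝓘(ℝ, EuclideanSpace ℝ (Fin k)) ∞ L (φ' (r n)) :=
      L.contMDiff.contMDiffAt
    exact (h3.comp n (h2.comp n (hrat n hn.1))).contMDiffWithinAt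
  · intro v hv
    have h1 : ContMDiffAt 𝓘(ℝ, EuclideanSpace ℝ (Fin k))
        𝓘(ℝ, G.E × EuclideanSpace ℝ (Fin k)) ∞ (fun v => (ψ (ρ n₀), v)) v :=
      (contDiff_const.prodMk contDiff_id).contMDiff.contMDiffAt
    have h2 := (hEs.contDiffAt (E.open_target.mem_nhds hv)).contMDiffAt
    exact ((hφs _ (hES (E.map_target hv)).1).comp v (h2.comp v h1)).contMDiffWithinAt

/-- The orbit equivalence relation. -/
def orbitSetoid (N : GMfd.{v, u} G) : Setoid N where
  r n n' := ∃ g, N.act g n = n'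
  iseqv := ⟨fun n => ⟨1, N.isAction.one_act n⟩,
    fun {n n'} ⟨g, h⟩ => ⟨g⁻¹, by rw [← h, N.isAction.inv_act]⟩,
    fun {n n' n''} ⟨g, h⟩ ⟨g', h'⟩ => ⟨g' * g, by rw [N.isAction.mul_act, h, h']⟩⟩

/-- The orbit space. -/
def OrbitSpace (N : GMfd.{v, u} G) : Type u := Quotient (orbitSetoid N)

instance (N : GMfd.{v, u} G) : TopologicalSpace (OrbitSpace N) :=
  inferInstanceAs (TopologicalSpace (Quotient (orbitSetoid N)))

/-- The projection to the orbit space. -/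
def orbitMk (N : GMfd.{v, u} G) (n : N) : OrbitSpace N := Quotient.mk (orbitSetoid N) n

theorem orbitMk_eq_iff {N : GMfd.{v, u} G} {n n' : N} :
    orbitMk N n = orbitMk N n' ↔ ∃ g, N.act g n = n' :=
  Quotient.eq (r := orbitSetoid N)

theorem orbitMk_surjective (N : GMfd.{v, u} G) : Function.Surjective (orbitMk N) :=
  Quotient.mk_surjective

theorem orbitMk_act {N : GMfd.{v, u} G} (g : G) (n : N) : orbitMk N (N.act g n) = orbitMk N n :=
  (orbitMk_eq_iff.2 ⟨g, rfl⟩).symm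

theorem continuous_orbitMk (N : GMfd.{v, u} G) : Continuous (orbitMk N) := continuous_quotient_mk'

theorem isOpenMap_orbitMk (N : GMfd.{v, u} G) : IsOpenMap (orbitMk N) := by
  intro A hA
  change IsOpen (orbitMk N ⁻¹' (orbitMk N '' A))
  have : orbitMk N ⁻¹' (orbitMk N '' A) = ⋃ g, N.act g ⁻¹' A := by
    ext n
    simp only [mem_preimage, mem_image, mem_iUnion]
    constructor
    · rintro ⟨m, hm, h⟩
      obtain ⟨g, rfl⟩ := orbitMk_eq_iff.1 h
      exact ⟨g⁻¹, by rwa [N.isAction.inv_act]⟩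
    · rintro ⟨g, hg⟩
      exact ⟨_, hg, orbitMk_act g n⟩
  rw [this]
  exact isOpen_iUnion fun g => hA.preimage (N.isAction.smooth_left g).continuous

theorem isOpenQuotientMap_orbitMk (N : GMfd.{v, u} G) : IsOpenQuotientMap (orbitMk N) :=
  ⟨orbitMk_surjective N, continuous_orbitMk N, isOpenMap_orbitMk N⟩

/-- A chart of the orbit space. -/
def OrbitChart.chart {N : GMfd.{v, u} G} {k : ℕ} {n₀ : N} (C : OrbitChart N k n₀) :
    OpenPartialHomeomorph (OrbitSpace N) (EuclideanSpace ℝ (Fin k)) where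
  toFun x := C.c (Quotient.out (s := orbitSetoid N) x)
  invFun v := orbitMk N (C.σ v)
  source := orbitMk N '' C.W
  target := C.T
  map_source' := by
    rintro _ ⟨n, hn, rfl⟩
    obtain ⟨g, hg⟩ := orbitMk_eq_iff.1 (Quotient.out_eq (s := orbitSetoid N) (orbitMk N n)).symm
    rw [← hg, C.c_act g n hn]
    exact C.c_mem n hn
  map_target' := fun v hv => ⟨_, C.σ_mem v hv, rfl⟩
  left_inv' := by
    rintro _ ⟨n, hn, rfl⟩
    obtain ⟨g, hg⟩ := orbitMk_eq_iff.1 (Quotient.out_eq (s := orbitSetoid N) (orbitMk N n)).symm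
    rw [← hg, C.c_act g n hn]
    exact orbitMk_eq_iff.2 (C.exists_act n hn)
  right_inv' := by
    intro v hv
    obtain ⟨g, hg⟩ := orbitMk_eq_iff.1
      (Quotient.out_eq (s := orbitSetoid N) (orbitMk N (C.σ v))).symm
    rw [← hg, C.c_act g _ (C.σ_mem v hv), C.c_σ v hv]
  open_source := isOpenMap_orbitMk N _ C.isOpen_W
  open_target := C.isOpen_T
  continuousOn_toFun := by
    rintro _ ⟨n, hn, rfl⟩
    refine ContinuousAt.continuousWithinAt ?_
    rw [← (isOpenQuotientMap_orbitMk N).continuousAt_comp_iff]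
    refine ((C.smooth_c.contMDiffAt (C.isOpen_W.mem_nhds hn)).continuousAt).congr ?_
    filter_upwards [C.isOpen_W.mem_nhds hn] with m hm
    obtain ⟨g, hg⟩ := orbitMk_eq_iff.1 (Quotient.out_eq (s := orbitSetoid N) (orbitMk N m)).symm
    rw [Function.comp_apply, ← hg, C.c_act g m hm]
  continuousOn_invFun := (continuous_orbitMk N).comp_continuousOn C.smooth_σ.continuousOn

theorem OrbitChart.chart_mk {N : GMfd.{v, u} G} {k : ℕ} {n₀ : N} (C : OrbitChart N k n₀) {n : N}
    (hn : n ∈ C.W) : C.chart (orbitMk N n) = C.c n := by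
  obtain ⟨g, hg⟩ := orbitMk_eq_iff.1 (Quotient.out_eq (s := orbitSetoid N) (orbitMk N n)).symm
  change C.c _ = _
  rw [← hg, C.c_act g n hn]

theorem OrbitChart.mk_mem_source {N : GMfd.{v, u} G} {k : ℕ} {n₀ : N} (C : OrbitChart N k n₀)
    {n : N} : orbitMk N n ∈ C.chart.source ↔ n ∈ C.W := by
  constructor
  · rintro ⟨m, hm, h⟩
    obtain ⟨g, rfl⟩ := orbitMk_eq_iff.1 h
    exact C.act_mem g m hm
  · exact fun h => ⟨n, h, rfl⟩

variable {P : GMfd.{v, u} G} {X : Mfd.{u}} {q : P → X}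

/-- If `N` maps equivariantly to a principal bundle, then `N/G` exists as a manifold, and
`N → N/G` is a principal bundle. -/
theorem exists_quotient (hq : IsPrincipal G (P := P.toMfd) P.act q) {N : GMfd.{v, u} G} {f : N → P}
    (hf : IsGMap f) :
    ∃ (Q : Mfd.{u}) (p : N → Q), IsPrincipal G (P := N.toMfd) (X := Q) N.act p := by
  have hA := N.isAction
  let k := N.dim - G.dim
  let b : OrbitSpace N → X := Quotient.lift (s := orbitSetoid N) (fun n => q (f n)) (by
    rintro n n' ⟨g, rfl⟩
    rw [hf.equivariant, hq.proj_act])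
  have hb : ∀ n, b (orbitMk N n) = q (f n) := fun n => rfl
  have hbc : Continuous b := Continuous.quotient_lift (hq.smooth_proj.comp hf.smooth).continuous _
  -- trivializations of `N` over the orbit space, pulled back from `P`
  have hslice : ∀ n₀ : N, ∃ (U : Set X) (ρ : N → G), IsOpen U ∧ q (f n₀) ∈ U ∧
      ContMDiffOn (𝓡 N.dim) (𝓡 G.dim) ∞ ρ ((fun n => q (f n)) ⁻¹' U) ∧
      (∀ g n, q (f n) ∈ U → ρ (N.act g n) = g * ρ n) ∧ ρ n₀ = 1 := by
    intro n₀
    obtain ⟨U, hU, hx, s, χ, -, hχs, -, hχ, hχ'⟩ := hq.locally_trivial (q (f n₀))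
    have hχg : ∀ g p, q p ∈ U → χ (P.act g p) = g * χ p := fun g p hp => by
      conv_lhs => rw [← hχ p hp]
      rw [← P.isAction.mul_act, hχ' _ hp]
    refine ⟨U, fun n => χ (f n) * (χ (f n₀))⁻¹, hU, hx, ?_, ?_, mul_inv_cancel _⟩
    · have h1 : ContMDiffOn (𝓡 N.dim) (𝓡 G.dim) ∞ (fun n => χ (f n))
          ((fun n => q (f n)) ⁻¹' U) :=
        hχs.comp hf.smooth.contMDiffOn fun n hn => hn
      exact h1.mul contMDiffOn_const
    · intro g n hn
      change χ (f (N.act g n)) * _ = g * (χ (f n) * _)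
      rw [hf.equivariant, hχg g _ hn, mul_assoc]
  have hC : ∀ n₀ : N, Nonempty (OrbitChart N k n₀) := by
    intro n₀
    obtain ⟨U, ρ, hU, hx, hρ, hρg, hρ₀⟩ := hslice n₀
    exact exists_orbitChart N n₀ ((fun n => q (f n)) ⁻¹' U) ρ
      (hU.preimage (hq.smooth_proj.comp hf.smooth).continuous) hx
      (fun g n hn => by rw [mem_preimage, hf.equivariant, hq.proj_act]; exact hn) hρ
      (fun g n hn => hρg g n hn) hρ₀
  let C := fun n₀ => (hC n₀).some
  let _ : ChartedSpace (EuclideanSpace ℝ (Fin k)) (OrbitSpace N) :=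
    { atlas := range fun n => (C n).chart
      chartAt := fun x => (C (Quotient.out (s := orbitSetoid N) x)).chart
      mem_chart_source := fun x =>
        ⟨_, (C _).mem_W, Quotient.out_eq (s := orbitSetoid N) x⟩
      chart_mem_atlas := fun x => mem_range_self _ }
  have : IsManifold (𝓡 k) ∞ (OrbitSpace N) := by
    apply isManifold_of_contDiffOn
    rintro _ _ ⟨n, rfl⟩ ⟨n', rfl⟩
    intro y hy
    simp only [modelWithCornersSelf_coe, modelWithCornersSelf_coe_symm, range_id, inter_univ,
      preimage_id] at hy ⊢
    rw [OpenPartialHomeomorph.trans_source] at hy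
    have hy1 : y ∈ (C n).T := hy.1
    have hy2 : (C n).σ y ∈ (C n').W := (C n').mk_mem_source.1 hy.2
    have hσy := (C n).smooth_σ.contMDiffAt ((C n).isOpen_T.mem_nhds hy1)
    have h1 := ((C n').smooth_c.contMDiffAt ((C n').isOpen_W.mem_nhds hy2)).comp y hσy
    rw [contMDiffAt_iff_contDiffAt] at h1
    refine (h1.congr_of_eventuallyEq ?_).contDiffWithinAt
    filter_upwards [hσy.continuousAt.preimage_mem_nhds ((C n').isOpen_W.mem_nhds hy2)] with z hz
    exact (C n').chart_mk hz
  have : SecondCountableTopology (OrbitSpace N) :=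
    (isOpenQuotientMap_orbitMk N).isQuotientMap.secondCountableTopology (isOpenMap_orbitMk N)
  have : T2Space (OrbitSpace N) := by
    refine ⟨fun x y hxy => ?_⟩
    obtain ⟨n, rfl⟩ := orbitMk_surjective N x
    obtain ⟨m, rfl⟩ := orbitMk_surjective N y
    by_cases hb' : b (orbitMk N n) = b (orbitMk N m)
    · obtain ⟨U, ρ, hU, hx, hρ, hρg, hρ₀⟩ := hslice n
      let r : N → N := fun n => N.act (ρ n)⁻¹ n
      have hO : IsOpen ((fun n => q (f n)) ⁻¹' U) :=
        hU.preimage (hq.smooth_proj.comp hf.smooth).continuous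
      have hrc : ContinuousOn r ((fun n => q (f n)) ⁻¹' U) := fun n hn =>
        (hA.contMDiffAt (hρ.contMDiffAt (hO.mem_nhds hn)).inv
          contMDiffAt_id).continuousAt.continuousWithinAt
      have hne : r n ≠ r m := by
        intro h
        apply hxy
        have h1 := congr_arg (orbitMk N) h
        rwa [orbitMk_act, orbitMk_act] at h1
      obtain ⟨A, B, hA', hB', hnA, hmB, hAB⟩ := t2_separation hne
      refine ⟨orbitMk N '' _, orbitMk N '' _, isOpenMap_orbitMk N _
        (hrc.isOpen_inter_preimage hO hA'), isOpenMap_orbitMk N _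
        (hrc.isOpen_inter_preimage hO hB'), ⟨n, ⟨hx, hnA⟩, rfl⟩,
        ⟨m, ⟨by change q (f m) ∈ U; rw [← hb m, ← hb']; exact hx, hmB⟩, rfl⟩, ?_⟩
      rw [Set.disjoint_left]
      rintro _ ⟨n₁, hn₁, rfl⟩ ⟨n₂, hn₂, h⟩
      obtain ⟨g, rfl⟩ := orbitMk_eq_iff.1 h
      refine Set.disjoint_left.1 hAB hn₁.2 ?_
      have h1 : r (N.act g n₂) = r n₂ := by
        change N.act (ρ (N.act g n₂))⁻¹ (N.act g n₂) = _
        rw [hρg g n₂ hn₂.1, mul_inv_rev, hA.mul_act, hA.inv_act]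
      rw [h1]
      exact hn₂.2
    · obtain ⟨A, B, hA', hB', hnA, hmB, hAB⟩ := t2_separation hb'
      exact ⟨b ⁻¹' A, b ⁻¹' B, hA'.preimage hbc, hB'.preimage hbc, hnA, hmB,
        hAB.preimage b⟩
  let Q : Mfd.{u} := { carrier := OrbitSpace N, dim := k }
  let p : N → Q := orbitMk N
  have hps : Smooth (N := Q) p := by
    intro n
    refine contMDiffAt_iff_target.2 ⟨(continuous_orbitMk N).continuousAt, ?_⟩
    let C' := C (Quotient.out (s := orbitSetoid N) (orbitMk N n))
    have hn : n ∈ C'.W := C'.mk_mem_source.1 (mem_chart_source (EuclideanSpace ℝ (Fin k))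
      (show OrbitSpace N from orbitMk N n))
    refine (C'.smooth_c.contMDiffAt (C'.isOpen_W.mem_nhds hn)).congr_of_eventuallyEq ?_
    filter_upwards [C'.isOpen_W.mem_nhds hn] with m hm
    exact C'.chart_mk hm
  -- smoothness on the quotient can be tested upstairs
  have hdesc : ∀ (M : Mfd.{u}) (g : Q → M) (x : Q),
      (∀ n, p n = x → ContMDiffAt (𝓡 N.dim) (𝓡 M.dim) ∞ (fun y => g (p y)) n) →
      ContMDiffAt (𝓡 Q.dim) (𝓡 M.dim) ∞ g x := by
    intro M g x hg
    let C' := C (Quotient.out (s := orbitSetoid N) x)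
    have hx : x ∈ C'.chart.source := mem_chart_source (EuclideanSpace ℝ (Fin k))
      (show OrbitSpace N from x)
    have hxT := C'.chart.map_source hx
    have h1 : ContMDiffAt (𝓡 Q.dim) (𝓡 k) ∞ C'.chart x := by
      exact contMDiffAt_extChartAt (I := 𝓡 k) (M := OrbitSpace N) (x := x)
    have h2 := C'.smooth_σ.contMDiffAt (C'.isOpen_T.mem_nhds hxT)
    have h3 : p (C'.σ (C'.chart x)) = x := C'.chart.left_inv hx
    refine ((hg _ h3).comp x (h2.comp x h1)).congr_of_eventuallyEq ?_
    filter_upwards [C'.chart.open_source.mem_nhds hx] with y hy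
    exact congr_arg g (C'.chart.left_inv hy).symm
  refine ⟨Q, p, hA, hps, fun g n => orbitMk_act g n, fun x => ?_⟩
  obtain ⟨n₀, rfl⟩ := orbitMk_surjective N x
  obtain ⟨U, ρ, hU, hx, hρ, hρg, hρ₀⟩ := hslice n₀
  have hO : IsOpen ((fun n => q (f n)) ⁻¹' U) :=
    hU.preimage (hq.smooth_proj.comp hf.smooth).continuous
  have hr : ∀ g n, q (f n) ∈ U → N.act (ρ (N.act g n))⁻¹ (N.act g n) = N.act (ρ n)⁻¹ n := by
    intro g n hn
    rw [hρg g n hn, mul_inv_rev, hA.mul_act, hA.inv_act]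
  let s : Q → N := fun x =>
    N.act (ρ (Quotient.out (s := orbitSetoid N) x))⁻¹ (Quotient.out (s := orbitSetoid N) x)
  have hsp : ∀ n, q (f n) ∈ U → s (p n) = N.act (ρ n)⁻¹ n := by
    intro n hn
    obtain ⟨g, hg⟩ := orbitMk_eq_iff.1 (Quotient.out_eq (s := orbitSetoid N) (orbitMk N n)).symm
    change N.act (ρ (Quotient.out (s := orbitSetoid N) (orbitMk N n)))⁻¹ _ = _
    rw [← hg, hr g n hn]
  refine ⟨b ⁻¹' U, hU.preimage hbc, hx, s, ρ, ?_, hρ, ?_, ?_, ?_⟩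
  · intro x hx'
    refine (hdesc N.toMfd s x ?_).contMDiffWithinAt
    rintro n rfl
    refine (hA.contMDiffAt (hρ.contMDiffAt (hO.mem_nhds hx')).inv
      contMDiffAt_id).congr_of_eventuallyEq ?_
    filter_upwards [hO.mem_nhds hx'] with m hm
    exact hsp m hm
  · intro x hx'
    change orbitMk N (N.act _ _) = x
    rw [orbitMk_act]
    exact Quotient.out_eq (s := orbitSetoid N) x
  · intro n hn
    rw [hsp n hn, hA.act_inv]
  · intro x hx' g
    obtain ⟨n, rfl⟩ := orbitMk_surjective N x
    have h1 : q (f n) ∈ U := hx'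
    change ρ (N.act g (s (p n))) = g
    rw [hsp n h1, ← hA.mul_act, hρg _ _ h1, inv_mul_cancel_right]

end QuotientManifold

/-! ### Quotients over a principal bundle -/

section Quo

variable {G : LieGrp.{v}} {P : GMfd.{v, u} G} {X : Mfd.{u}} {q : P → X}

/-- `mk : N → N₁` is a quotient by `G`, and the equivariant map `f : N → P` induces `b : N₁ → X` on
quotients. -/
structure IsQuo (q : P → X) {N : GMfd.{v, u} G} {N₁ : Mfd.{u}} (f : N → P) (mk : N → N₁)
    (b : N₁ → X) : Prop where
  map : IsGMap f
  principal : IsPrincipal G (P := N.toMfd) (X := N₁) N.act mk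
  comm : ∀ n, b (mk n) = q (f n)

namespace IsQuo

variable {N : GMfd.{v, u} G} {N₁ : Mfd.{u}} {f : N → P} {mk : N → N₁} {b : N₁ → X}

theorem mk_act (h : IsQuo q f mk b) (g : G) (n : N) : mk (N.act g n) = mk n :=
  h.principal.proj_act g n

theorem smooth_mk (h : IsQuo q f mk b) : Smooth (M := N.toMfd) mk := h.principal.smooth_proj

theorem smooth_base (h : IsQuo q f mk b) (hq : IsPrincipal G (P := P.toMfd) P.act q) :
    Smooth b := by
  apply h.principal.smooth_of_comp
  simp only [h.comm]
  exact hq.smooth_proj.comp h.map.smooth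

theorem D_base (h : IsQuo q f mk b) (hq : IsPrincipal G (P := P.toMfd) P.act q) (n : N) (v : N.E) :
    D b (mk n) (D (M := N.toMfd) mk n v) = D (M := P.toMfd) q (f n) (D f n v) := by
  rw [← D_comp (h.smooth_base hq) h.smooth_mk, ← D_comp hq.smooth_proj h.map.smooth]
  simp only [h.comm]

/-- A point of `N/G` lifts to `N` over a given point of `P`. -/
theorem exists_lift (h : IsQuo q f mk b) (hq : IsPrincipal G (P := P.toMfd) P.act q) {p : P}
    {x : N₁} (e : q p = b x) : ∃ n, f n = p ∧ mk n = x := by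
  obtain ⟨n, rfl⟩ := h.principal.surjective x
  rw [h.comm] at e
  obtain ⟨g, hg⟩ := hq.exists_act e.symm
  exact ⟨N.act g n, by rw [h.map.equivariant, hg], h.mk_act g n⟩

theorem eq_of_eq (h : IsQuo q f mk b) (hq : IsPrincipal G (P := P.toMfd) P.act q) {n n' : N}
    (e : f n = f n') (e' : mk n = mk n') : n = n' := by
  obtain ⟨g, rfl⟩ := h.principal.exists_act e'
  rw [h.map.equivariant] at e
  have : g = 1 := hq.act_injective (p := f n) (by rw [← e, P.isAction.one_act])
  rw [this, N.isAction.one_act]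

/-- A tangent vector of `N/G` lifts to `N` over a given tangent vector of `P`. -/
theorem exists_lift_tangent (h : IsQuo q f mk b) (hq : IsPrincipal G (P := P.toMfd) P.act q)
    (n : N) {v : P.E} {w : N₁.E} (e : D (M := P.toMfd) q (f n) v = D b (mk n) w) :
    ∃ a : N.E, D f n a = v ∧ D (M := N.toMfd) mk n a = w := by
  obtain ⟨a, rfl⟩ := h.principal.submersion n w
  rw [h.D_base hq, ← sub_eq_zero, ← map_sub] at e
  obtain ⟨ξ, hξ⟩ := hq.exists_fund _ e
  refine ⟨a + N.fund n ξ, ?_, ?_⟩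
  · rw [map_add, h.map.D_fund, hξ, add_sub_cancel]
  · rw [map_add, h.principal.D_fund_eq_zero, add_zero]

theorem tangent_eq_zero (h : IsQuo q f mk b) (hq : IsPrincipal G (P := P.toMfd) P.act q)
    {n : N} {a : N.E} (e : D f n a = 0) (e' : D (M := N.toMfd) mk n a = 0) : a = 0 := by
  obtain ⟨ξ, rfl⟩ := h.principal.exists_fund n e'
  rw [h.map.D_fund] at e
  have : ξ = 0 := hq.fund_injective (f n) (by rw [e, map_zero])
  rw [this, map_zero]

theorem tangent_eq (h : IsQuo q f mk b) (hq : IsPrincipal G (P := P.toMfd) P.act q)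
    {n : N} {a a' : N.E} (e : D f n a = D f n a')
    (e' : D (M := N.toMfd) mk n a = D (M := N.toMfd) mk n a') : a = a' :=
  sub_eq_zero.1 (h.tangent_eq_zero hq (n := n) (by rw [map_sub, e, sub_self])
    (by rw [map_sub, e', sub_self]))

/-- A smooth family in `N/G` lifts to a smooth family in `N` over a given smooth family in `P`. -/
theorem exists_lift_family (h : IsQuo q f mk b) (hq : IsPrincipal G (P := P.toMfd) P.act q)
    {T : Mfd.{w}} {p : T → P} {x : T → N₁} (hp : Smooth (N := P.toMfd) p) (hx : Smooth x)
    (e : ∀ t, q (p t) = b (x t)) :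
    ∃ n : T → N, Smooth (N := N.toMfd) n ∧ (∀ t, f (n t) = p t) ∧ ∀ t, mk (n t) = x t := by
  choose n hn hn' using fun t => h.exists_lift hq (e t)
  refine ⟨n, fun t₀ => ?_, hn, hn'⟩
  obtain ⟨U, t', c, ht', hc, hcx⟩ := GerbeQuot.exists_lift_family h.smooth_mk
    h.principal.surjective h.principal.submersion hx t₀
  have e1 : ∀ t, q (f (c t)) = q (p (T.incl U t)) := fun t => by
    rw [← h.comm, hcx, e]
  obtain ⟨g, hg, hgp⟩ := hq.exists_translation (h.map.smooth.comp hc)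
    (hp.comp (smooth_incl T U)) e1
  have e2 : (fun t => n (T.incl U t)) = fun t => N.act (g t) (c t) := by
    funext t
    apply h.eq_of_eq hq
    · rw [hn, h.map.equivariant, hgp]
    · rw [hn', h.mk_act, hcx]
  rw [← ht', contMDiffAt_incl_iff, e2]
  exact (N.isAction.smooth hg hc).contMDiffAt t'

end IsQuo

/-- Smoothness of a family is local in the parameters. -/
theorem smooth_of_restr {T : Mfd.{u}} {N : Mfd.{w}} {F : T → N}
    (h : ∀ t₀, ∃ (U : TopologicalSpace.Opens T) (t' : T.restr U), T.incl U t' = t₀ ∧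
      Smooth (fun t => F (T.incl U t))) : Smooth F := by
  intro t₀
  obtain ⟨U, t', rfl, hF⟩ := h t₀
  exact contMDiffAt_incl_iff.2 (hF.contMDiffAt t')

/-- The action on `N` has a manifold as its quotient. -/
def HasQuo (N : GMfd.{v, u} G) : Prop :=
  ∃ (Q : Mfd.{u}) (p : N → Q), IsPrincipal G (P := N.toMfd) (X := Q) N.act p

/-- The quotient manifold `N/G`. -/
def quo {N : GMfd.{v, u} G} (h : HasQuo N) : GMfd.{0, u} trivialGrp := h.choose.triv

/-- The projection `N → N/G`. -/
def quoMk {N : GMfd.{v, u} G} (h : HasQuo N) : N → quo h := h.choose_spec.choose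

theorem quo_principal {N : GMfd.{v, u} G} (h : HasQuo N) :
    IsPrincipal G (P := N.toMfd) (X := (quo h).toMfd) N.act (quoMk h) := h.choose_spec.choose_spec

/-- The map on the quotient `N/G` induced by an invariant map. -/
def quoLift {N : GMfd.{v, u} G} (h : HasQuo N) {A : Type*} (F : N → A) : quo h → A :=
  fun x => F (Function.surjInv (quo_principal h).surjective x)

theorem quoLift_mk {N : GMfd.{v, u} G} (h : HasQuo N) {A : Type*} {F : N → A}
    (hF : ∀ g n, F (N.act g n) = F n) (n : N) : quoLift h F (quoMk h n) = F n := by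
  have e := Function.surjInv_eq (quo_principal h).surjective (quoMk h n)
  obtain ⟨g, hg⟩ := (quo_principal h).exists_act e
  conv_rhs => rw [← hg, hF]
  rfl

/-- The map `N/G → N'/G` induced by an equivariant map. -/
def quoMap {N N' : GMfd.{v, u} G} (h : HasQuo N) (h' : HasQuo N') (F : N → N') : quo h → quo h' :=
  quoLift h fun n => quoMk h' (F n)

theorem quoMap_mk {N N' : GMfd.{v, u} G} (h : HasQuo N) (h' : HasQuo N') {F : N → N'}
    (hF : ∀ g n, F (N.act g n) = N'.act g (F n)) (n : N) :
    quoMap h h' F (quoMk h n) = quoMk h' (F n) :=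
  quoLift_mk h (fun g n => by rw [hF, (quo_principal h').proj_act]) n

theorem smooth_quoMap {N N' : GMfd.{v, u} G} (h : HasQuo N) (h' : HasQuo N') {F : N → N'}
    (hF : IsGMap F) : Smooth (quoMap h h' F) := by
  apply (quo_principal h).smooth_of_comp
  simp only [quoMap_mk h h' hF.equivariant]
  exact (quo_principal h').smooth_proj.comp hF.smooth

theorem IsPrincipal.hasQuo (hq : IsPrincipal G (P := P.toMfd) P.act q) {N : GMfd.{v, u} G}
    {f : N → P} (hf : IsGMap f) : HasQuo N := exists_quotient hq hf

theorem IsPrincipal.isQuo_quoMk (hq : IsPrincipal G (P := P.toMfd) P.act q) {N : GMfd.{v, u} G}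
    {f : N → P} (hf : IsGMap f) (h : HasQuo N) :
    IsQuo q f (quoMk h) (quoLift h fun n => q (f n)) :=
  ⟨hf, quo_principal h, fun n =>
    quoLift_mk h (F := fun n => q (f n)) (fun g n => by rw [hf.equivariant, hq.proj_act]) n⟩

/-- A quotient of `N`, over the map to the base that is induced by an equivariant map to another
quotient. -/
theorem IsQuo.of_map {N N' : GMfd.{v, u} G} {N₁ N₁' : Mfd.{u}} {f : N → P} {mk : N → N₁}
    {b : N₁ → X} (h : IsQuo q f mk b) {F : N' → N} (hF : IsGMap F) {mk' : N' → N₁'}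
    (hmk' : IsPrincipal G (P := N'.toMfd) (X := N₁') N'.act mk') {F₁ : N₁' → N₁}
    (e : ∀ n, F₁ (mk' n) = mk (F n)) : IsQuo q (fun n => f (F n)) mk' (fun x => b (F₁ x)) :=
  ⟨h.map.comp hF, hmk', fun n => by rw [e, h.comm]⟩

theorem GMfd.trivialGrp_act (M : GMfd.{0, u} trivialGrp) (g : trivialGrp) (x : M) :
    M.act g x = x := M.isAction.one_act x

theorem isGMap_triv {M N : GMfd.{0, u} trivialGrp} {f : M → N} (hf : Smooth f) : IsGMap f :=
  ⟨hf, fun g x => by rw [M.trivialGrp_act, N.trivialGrp_act]⟩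

theorem isGMap_circ {Z : GMfd.{v, u} G} (K : GBun Z) (c : circleGrp) : IsGMap (K.circ c) :=
  ⟨K.principal.isAction.smooth_left c, fun g k => K.circ_act c g k⟩

/-- The quotient by `G` of an equivariant circle bundle is a circle bundle. -/
theorem isPrincipal_circ (hq : IsPrincipal G (P := P.toMfd) P.act q) {Z : GMfd.{v, u} G}
    (K : GBun Z) {Z₁ K₁ : Mfd.{u}} {f : Z → P} {b : Z₁ → X} {mkZ : Z → Z₁} {mkK : K.tot → K₁}
    (hZ : IsQuo q f mkZ b) (hK : IsPrincipal G (P := K.tot.toMfd) (X := K₁) K.tot.act mkK)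
    {proj₁ : K₁ → Z₁} {circ₁ : circleGrp → K₁ → K₁} (hproj : ∀ k, proj₁ (mkK k) = mkZ (K.proj k))
    (hcirc : ∀ c k, circ₁ c (mkK k) = mkK (K.circ c k)) :
    IsPrincipal circleGrp (P := K₁) (X := Z₁) circ₁ proj₁ := by
  have hKq := hZ.of_map K.proj_map hK hproj
  have hps : Smooth proj₁ := hK.smooth_of_comp (by
    simp only [hproj]; exact hZ.smooth_mk.comp K.proj_map.smooth)
  refine ⟨⟨fun k => ?_, fun c d k => ?_, ?_⟩, hps, fun c k => ?_, fun z₁ => ?_⟩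
  · obtain ⟨k, rfl⟩ := hK.surjective k
    rw [hcirc, K.principal.isAction.one_act]
  · obtain ⟨k, rfl⟩ := hK.surjective k
    rw [hcirc, hcirc, hcirc, K.principal.isAction.mul_act]
  · rintro ⟨c, x⟩
    obtain ⟨k, rfl⟩ := hK.surjective x
    obtain ⟨U, s, hU, hx, hs, hsp, -⟩ := exists_local_section hK.smooth_proj k (hK.submersion k)
    have h1 : ContMDiffAt ((𝓡 circleGrp.dim).prod (𝓡 K₁.dim)) (𝓡 K.tot.dim) ∞
        (fun p : circleGrp.carrier × K₁.carrier => s p.2) (c, mkK k) :=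
      ContMDiffAt.comp (x := ((c, mkK k) : circleGrp.carrier × K₁.carrier))
        (hs.contMDiffAt (hU.mem_nhds hx)) contMDiffAt_snd
    have h2 : ContMDiffAt ((𝓡 circleGrp.dim).prod (𝓡 K₁.dim)) (𝓡 K₁.dim) ∞
        (fun p : circleGrp.carrier × K₁.carrier => mkK (K.circ p.1 (s p.2))) (c, mkK k) :=
      ContMDiffAt.comp (x := ((c, mkK k) : circleGrp.carrier × K₁.carrier))
        (hK.smooth_proj.contMDiffAt _)
        (K.principal.isAction.contMDiffAt contMDiffAt_fst h1)
    refine h2.congr_of_eventuallyEq ?_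
    have hO : IsOpen ((fun p : circleGrp.carrier × K₁.carrier => p.2) ⁻¹' U) :=
      hU.preimage continuous_snd
    filter_upwards [hO.mem_nhds hx] with p hp
    rw [← hcirc, hsp _ hp]
  · obtain ⟨k, rfl⟩ := hK.surjective k
    rw [hcirc, hproj, hproj, K.principal.proj_act]
  · obtain ⟨z, rfl⟩ := hZ.principal.surjective z₁
    obtain ⟨U₁, σ, hU₁, hz₁, hσ, hσp, hσz⟩ :=
      exists_local_section hZ.smooth_mk z (hZ.principal.submersion z)
    obtain ⟨V, hV, hzV, s, χ, hs, hχs, hps', hχ, hχ'⟩ := K.principal.locally_trivial z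
    let U : Set Z₁ := U₁ ∩ σ ⁻¹' V
    have hU : IsOpen U := hσ.continuousOn.isOpen_inter_preimage hU₁ hV
    have hσat : ∀ y ∈ U, ContMDiffAt (𝓡 Z₁.dim) (𝓡 Z.dim) ∞ σ y := fun y hy =>
      hσ.contMDiffAt (hU₁.mem_nhds hy.1)
    -- every point of the quotient over `U` has a unique representative over the section `σ`
    let O : TopologicalSpace.Opens K₁ := ⟨proj₁ ⁻¹' U, hU.preimage hps.continuous⟩
    have hOU : ∀ t : K₁.restr O, proj₁ (K₁.incl O t) ∈ U := fun t => t.2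
    have hp : Smooth (N := Z.toMfd) (fun t : K₁.restr O => σ (proj₁ (K₁.incl O t))) := fun t =>
      (hσat _ t.2).comp t ((hps.comp (smooth_incl K₁ O)).contMDiffAt t)
    obtain ⟨k, hk, hkf, hkm⟩ := hKq.exists_lift_family hq (hZ.map.smooth.comp hp)
      (smooth_incl K₁ O) (fun t => by rw [← hZ.comm, hσp _ (hOU t).1])
    have hkσ : ∀ t, K.proj (k t) = σ (proj₁ (K₁.incl O t)) := fun t => by
      apply hZ.eq_of_eq hq (hkf t)
      rw [← hproj, hkm, hσp _ (hOU t).1]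
    classical
    let χ₁ : K₁ → circleGrp := fun x => if h : x ∈ O then χ (k (K₁.restrMk O x h)) else 1
    have hχ₁ : ∀ t : K₁.restr O, χ₁ (K₁.incl O t) = χ (k t) := fun t => dif_pos t.2
    refine ⟨U, hU, ⟨hz₁, by rw [mem_preimage, hσz]; exact hzV⟩, fun y => mkK (s (σ y)), χ₁, ?_, ?_,
      ?_, ?_, ?_⟩
    · intro y hy
      exact ((hK.smooth_proj.contMDiffAt _).comp y ((hs.contMDiffAt (hV.mem_nhds hy.2)).comp y
        (hσat y hy))).contMDiffWithinAt
    · intro x hx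
      have h1 : ContMDiffAt (𝓡 K₁.dim) (𝓡 circleGrp.dim) ∞ χ₁ (K₁.incl O (K₁.restrMk O x hx)) := by
        have h2 : ContMDiffAt (𝓡 (K₁.restr O).dim) (𝓡 circleGrp.toMfd.dim) ∞
            (fun t => χ₁ (K₁.incl O t)) (K₁.restrMk O x hx) := by
          simp only [hχ₁]
          have h3 : K.proj (k (K₁.restrMk O x hx)) ∈ V := by
            rw [hkσ]; exact hx.2
          exact (hχs.contMDiffAt
            ((hV.preimage K.proj_map.smooth.continuous).mem_nhds h3)).comp _ (hk.contMDiffAt _)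
        exact (contMDiffAt_incl_iff (N := circleGrp.toMfd)).2 h2
      exact h1.contMDiffWithinAt
    · intro y hy
      rw [hproj, hps' _ hy.2, hσp _ hy.1]
    · intro x hx
      have h1 := hχ₁ (K₁.restrMk O x hx)
      change χ₁ x = _ at h1
      have h2 := hkσ (K₁.restrMk O x hx)
      change _ = σ (proj₁ x) at h2
      rw [h1, hcirc, ← h2, hχ _ (by rw [h2]; exact hx.2)]
      exact hkm (K₁.restrMk O x hx)
    · intro y hy c
      have hx : circ₁ c (mkK (s (σ y))) ∈ O := by
        change proj₁ _ ∈ U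
        rw [hcirc, hproj, K.principal.proj_act, hps' _ hy.2, hσp _ hy.1]
        exact hy
      have h1 := hχ₁ (K₁.restrMk O _ hx)
      change χ₁ (circ₁ c (mkK (s (σ y)))) = _ at h1
      have h2 : k (K₁.restrMk O _ hx) = K.circ c (s (σ y)) := by
        apply hKq.eq_of_eq hq
        · rw [hkσ, K.principal.proj_act, hps' _ hy.2, incl_restrMk, hcirc, hproj,
            K.principal.proj_act, hps' _ hy.2, hσp _ hy.1]
        · rw [hkm]; exact hcirc _ _
      rw [h1, h2]
      exact hχ' _ hy.2 c

theorem GBun.hasQuo_tot (hq : IsPrincipal G (P := P.toMfd) P.act q) {Z : GMfd.{v, u} G}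
    (K : GBun Z) {f : Z → P} (hf : IsGMap f) : HasQuo K.tot :=
  hq.hasQuo (hf.comp K.proj_map)

/-- The quotient `K/G` of an equivariant circle bundle `K → Z`. -/
def GBun.quo (hq : IsPrincipal G (P := P.toMfd) P.act q) {Z : GMfd.{v, u} G} (K : GBun Z)
    {f : Z → P} (hf : IsGMap f) : GBun (GerbeQuot.quo (hq.hasQuo hf)) where
  tot := GerbeQuot.quo (K.hasQuo_tot hq hf)
  proj := quoMap (K.hasQuo_tot hq hf) (hq.hasQuo hf) K.proj
  proj_map := isGMap_triv (smooth_quoMap _ _ K.proj_map)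
  circ := fun c => quoMap (K.hasQuo_tot hq hf) (K.hasQuo_tot hq hf) (K.circ c)
  principal := isPrincipal_circ (mkK := quoMk (K.hasQuo_tot hq hf)) hq K (hq.isQuo_quoMk hf (hq.hasQuo hf)) (quo_principal _)
    (fun k => quoMap_mk _ _ K.proj_map.equivariant k)
    (fun c k => quoMap_mk _ _ (isGMap_circ K c).equivariant k)
  circ_act := fun c g k => by rw [GMfd.trivialGrp_act, GMfd.trivialGrp_act]

end Quo

/-! ### Quotients of gerbes -/

section QuoGerbe

variable {G : LieGrp.{v}} {P : GMfd.{v, u} G} {X : Mfd.{u}} {q : P → X.triv}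

namespace GBun

variable {Z : GMfd.{v, u} G} {f : Z → P}

/-- The projection `K → K/G`. -/
def qmk (K : GBun Z) (hq : IsPrincipal G (P := P.toMfd) (X := X.triv.toMfd) P.act q) (hf : IsGMap f) :
    K.tot → (K.quo hq hf).tot :=
  quoMk (K.hasQuo_tot hq hf)

variable (K : GBun Z) (hq : IsPrincipal G (P := P.toMfd) (X := X.triv.toMfd) P.act q) (hf : IsGMap f)

theorem proj_qmk (k : K.tot) :
    (K.quo hq hf).proj (K.qmk hq hf k) = quoMk (hq.hasQuo hf) (K.proj k) :=
  quoMap_mk _ _ K.proj_map.equivariant k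

theorem circ_qmk (c : circleGrp) (k : K.tot) :
    (K.quo hq hf).circ c (K.qmk hq hf k) = K.qmk hq hf (K.circ c k) :=
  quoMap_mk _ _ (isGMap_circ K c).equivariant k

theorem isQuo_qmk {b : GerbeQuot.quo (hq.hasQuo hf) → X.triv}
    (h : IsQuo q f (quoMk (hq.hasQuo hf)) b) :
    IsQuo (N₁ := (K.quo hq hf).tot.toMfd) q (fun k => f (K.proj k)) (K.qmk hq hf)
      (fun x => b ((K.quo hq hf).proj x)) :=
  h.of_map K.proj_map (quo_principal _) (K.proj_qmk hq hf)

end GBun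

/-- Fibre squares descend to quotients. -/
theorem IsFibreSquare.descend (hq : IsPrincipal G (P := P.toMfd) (X := X.triv.toMfd) P.act q)
    {Y Y₂ : GMfd.{v, u} G} {π : Y → P} {fst snd : Y₂ → Y} (h : IsFibreSquare π fst snd)
    {Y' Y₂' : GMfd.{0, u} trivialGrp} {mk : Y → Y'} {mk₂ : Y₂ → Y₂'} {π' : Y' → X.triv}
    (hY : IsQuo (X := X.triv.toMfd) (N₁ := Y'.toMfd) q π mk π')
    (h₂ : IsPrincipal G (P := Y₂.toMfd) (X := Y₂'.toMfd) Y₂.act mk₂) {fst' snd' : Y₂' → Y'}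
    (hfst : ∀ y, fst' (mk₂ y) = mk (fst y)) (hsnd : ∀ y, snd' (mk₂ y) = mk (snd y)) :
    IsFibreSquare π' fst' snd' := by
  have hs₁ : Smooth fst' := h₂.smooth_of_comp (by
    simp only [hfst]; exact hY.smooth_mk.comp h.fst_map.smooth)
  have hs₂ : Smooth snd' := h₂.smooth_of_comp (by
    simp only [hsnd]; exact hY.smooth_mk.comp h.snd_map.smooth)
  have hd₁ : ∀ y a, D fst' (mk₂ y) (D (M := Y₂.toMfd) mk₂ y a) =
      D (M := Y.toMfd) mk (fst y) (D fst y a) := fun y a => by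
    rw [← D_comp hs₁ h₂.smooth_proj, ← D_comp hY.smooth_mk h.fst_map.smooth]
    simp only [hfst]
  have hd₂ : ∀ y a, D snd' (mk₂ y) (D (M := Y₂.toMfd) mk₂ y a) =
      D (M := Y.toMfd) mk (snd y) (D snd y a) := fun y a => by
    rw [← D_comp hs₂ h₂.smooth_proj, ← D_comp hY.smooth_mk h.snd_map.smooth]
    simp only [hsnd]
  refine ⟨isGMap_triv hs₁, isGMap_triv hs₂, fun p => ?_, fun a b e => ?_, fun p a b e => ?_⟩
  · obtain ⟨y, rfl⟩ := h₂.surjective p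
    rw [hfst, hsnd, hY.comm, hY.comm, h.comm]
  · obtain ⟨p, hp⟩ := hq.surjective (π' a)
    obtain ⟨a, ha, rfl⟩ := hY.exists_lift hq hp
    obtain ⟨b, hb, rfl⟩ := hY.exists_lift hq (hp.trans e)
    obtain ⟨c, ⟨hc₁, hc₂⟩, hc⟩ := h.points a b (ha.trans hb.symm)
    refine ⟨mk₂ c, ⟨by rw [hfst, hc₁], by rw [hsnd, hc₂]⟩, ?_⟩
    rintro c' ⟨h₁, h₂'⟩
    obtain ⟨c', rfl⟩ := h₂.surjective c'
    rw [hfst] at h₁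
    rw [hsnd] at h₂'
    obtain ⟨g, hg⟩ := hY.principal.exists_act h₁
    have h3 : Y.act g (snd c') = b := by
      apply hY.eq_of_eq hq
      · rw [hY.map.equivariant, ← h.comm, ← hY.map.equivariant, hg, ha, hb]
      · rw [hY.mk_act, h₂']
    rw [← hc (Y₂.act g c') ⟨by rw [h.fst_map.equivariant, hg], by rw [h.snd_map.equivariant, h3]⟩,
      h₂.proj_act]
  · obtain ⟨y, rfl⟩ := h₂.surjective p
    have e' : D (N := X.triv.toMfd) π' (mk (fst y)) a = D (N := X.triv.toMfd) π' (mk (snd y)) b := by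
      rw [← hfst, ← hsnd]; exact e
    obtain ⟨v, hv⟩ := hq.submersion (π (fst y)) (D (N := X.triv.toMfd) π' (mk (fst y)) a)
    obtain ⟨a, ha, rfl⟩ := hY.exists_lift_tangent hq (fst y) hv
    obtain ⟨b, hb, rfl⟩ := hY.exists_lift_tangent hq (snd y) (v := v)
      (by rw [← h.comm, hv]; exact e')
    obtain ⟨c, ⟨hc₁, hc₂⟩, hc⟩ := h.tangent y a b (ha.trans hb.symm)
    refine ⟨D (M := Y₂.toMfd) mk₂ y c, ⟨?_, ?_⟩, ?_⟩
    · exact (hd₁ y c).trans (by rw [hc₁])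
    · exact (hd₂ y c).trans (by rw [hc₂])
    · rintro c' ⟨h₁, h₂'⟩
      obtain ⟨c', rfl⟩ := h₂.submersion y c'
      replace h₁ := (hd₁ y c').symm.trans h₁
      replace h₂' := (hd₂ y c').symm.trans h₂'
      -- `c' - c` has vertical projections to `Y`, hence is vertical
      have k₁ : D (M := Y.toMfd) mk (fst y) (D fst y c' - a) = 0 := by
        rw [map_sub, h₁, sub_self]
      have k₂ : D (M := Y.toMfd) mk (snd y) (D snd y c' - b) = 0 := by
        rw [map_sub, h₂', sub_self]
      obtain ⟨ξ, hξ⟩ := hY.principal.exists_fund _ k₁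
      have h3 : D snd y (c' - Y₂.fund y ξ) = b := by
        apply hY.tangent_eq hq
        · have h4 : ∀ w, D π (snd y) (D snd y w) = D π (fst y) (D fst y w) := fun w => by
            rw [← D_comp hY.map.smooth h.snd_map.smooth, ← D_comp hY.map.smooth h.fst_map.smooth]
            simp only [h.comm]
          rw [h4, map_sub, h.fst_map.D_fund, hξ, sub_sub_cancel, ha, hb]
        · rw [map_sub, h.snd_map.D_fund, map_sub, h₂', hY.principal.D_fund_eq_zero, sub_zero]
      have h5 := hc (c' - Y₂.fund y ξ)
        ⟨by rw [map_sub, h.fst_map.D_fund, hξ, sub_sub_cancel], h3⟩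
      rw [← h5, map_sub, h₂.D_fund_eq_zero, sub_zero]

namespace Gerbe

variable (hq : IsPrincipal G (P := P.toMfd) (X := X.triv.toMfd) P.act q) (𝓛 : Gerbe P)

theorem isGMap_base₂ : IsGMap (fun y => 𝓛.π (𝓛.fst y)) :=
  𝓛.cover.toIsGMap.comp 𝓛.square.fst_map

/-- The projection `Y → Y/G`. -/
def qY : 𝓛.Y → quo (hq.hasQuo 𝓛.cover.toIsGMap) := quoMk _

/-- The projection `Y₂ → Y₂/G`. -/
def qY₂ : 𝓛.Y₂ → quo (hq.hasQuo 𝓛.isGMap_base₂) := quoMk _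

/-- The submersion `Y/G → X`. -/
def quoπ : quo (hq.hasQuo 𝓛.cover.toIsGMap) → X.triv := quoLift _ fun y => q (𝓛.π y)

/-- The first projection `Y₂/G → Y/G`. -/
def quoFst : quo (hq.hasQuo 𝓛.isGMap_base₂) → quo (hq.hasQuo 𝓛.cover.toIsGMap) :=
  quoMap _ _ 𝓛.fst

/-- The second projection `Y₂/G → Y/G`. -/
def quoSnd : quo (hq.hasQuo 𝓛.isGMap_base₂) → quo (hq.hasQuo 𝓛.cover.toIsGMap) :=
  quoMap _ _ 𝓛.snd

/-- The bundle `L/G`. -/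
def quoL : GBun (quo (hq.hasQuo 𝓛.isGMap_base₂)) := 𝓛.L.quo hq 𝓛.isGMap_base₂

/-- The projection `L → L/G`. -/
def qL : 𝓛.L.tot → (𝓛.quoL hq).tot := 𝓛.L.qmk hq 𝓛.isGMap_base₂

theorem isQuo_qY : IsQuo q 𝓛.π (𝓛.qY hq) (𝓛.quoπ hq) := hq.isQuo_quoMk 𝓛.cover.toIsGMap _

theorem quoFst_mk (y : 𝓛.Y₂) : 𝓛.quoFst hq (𝓛.qY₂ hq y) = 𝓛.qY hq (𝓛.fst y) :=
  quoMap_mk _ _ 𝓛.square.fst_map.equivariant y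

theorem quoSnd_mk (y : 𝓛.Y₂) : 𝓛.quoSnd hq (𝓛.qY₂ hq y) = 𝓛.qY hq (𝓛.snd y) :=
  quoMap_mk _ _ 𝓛.square.snd_map.equivariant y

theorem isQuo_qY₂ : IsQuo q (fun y => 𝓛.π (𝓛.fst y)) (𝓛.qY₂ hq)
    (fun x => 𝓛.quoπ hq (𝓛.quoFst hq x)) :=
  (𝓛.isQuo_qY hq).of_map 𝓛.square.fst_map (quo_principal _) (𝓛.quoFst_mk hq)

theorem proj_qL (l : 𝓛.L.tot) : (𝓛.quoL hq).proj (𝓛.qL hq l) = 𝓛.qY₂ hq (𝓛.L.proj l) :=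
  𝓛.L.proj_qmk hq _ l

theorem circ_qL (c : circleGrp) (l : 𝓛.L.tot) :
    (𝓛.quoL hq).circ c (𝓛.qL hq l) = 𝓛.qL hq (𝓛.L.circ c l) := 𝓛.L.circ_qmk hq _ c l

theorem isQuo_qL : IsQuo (N₁ := (𝓛.quoL hq).tot.toMfd) q
    (fun l => 𝓛.π (𝓛.fst (𝓛.L.proj l))) (𝓛.qL hq)
    (fun x => 𝓛.quoπ hq (𝓛.quoFst hq ((𝓛.quoL hq).proj x))) :=
  𝓛.L.isQuo_qmk hq _ (𝓛.isQuo_qY₂ hq)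

theorem quoFst_proj (l : 𝓛.L.tot) :
    𝓛.quoFst hq ((𝓛.quoL hq).proj (𝓛.qL hq l)) = 𝓛.qY hq (𝓛.fst (𝓛.L.proj l)) := by
  rw [proj_qL, quoFst_mk]

theorem quoSnd_proj (l : 𝓛.L.tot) :
    𝓛.quoSnd hq ((𝓛.quoL hq).proj (𝓛.qL hq l)) = 𝓛.qY hq (𝓛.snd (𝓛.L.proj l)) := by
  rw [proj_qL, quoSnd_mk]

theorem quoπ_quoSnd (x) : 𝓛.quoπ hq (𝓛.quoSnd hq x) = 𝓛.quoπ hq (𝓛.quoFst hq x) := by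
  obtain ⟨y, rfl⟩ := (𝓛.isQuo_qY₂ hq).principal.surjective x
  rw [quoSnd_mk, quoFst_mk, (𝓛.isQuo_qY hq).comm, (𝓛.isQuo_qY hq).comm, 𝓛.square.comm]

variable {𝓛}

/-- Composable elements of `L`, in terms of their classes in `L/G` and their images in `P`. -/
theorem composable_iff {a b : 𝓛.L.tot}
    (e : 𝓛.π (𝓛.fst (𝓛.L.proj a)) = 𝓛.π (𝓛.fst (𝓛.L.proj b))) :
    𝓛.quoSnd hq ((𝓛.quoL hq).proj (𝓛.qL hq a)) = 𝓛.quoFst hq ((𝓛.quoL hq).proj (𝓛.qL hq b)) ↔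
      𝓛.snd (𝓛.L.proj a) = 𝓛.fst (𝓛.L.proj b) := by
  rw [quoSnd_proj, quoFst_proj]
  refine ⟨fun h => (𝓛.isQuo_qY hq).eq_of_eq hq ?_ h, fun h => by rw [h]⟩
  rw [← 𝓛.square.comm, e]

theorem exists_lift_composable {a₁ b₁ : (𝓛.quoL hq).tot}
    (h : 𝓛.quoSnd hq ((𝓛.quoL hq).proj a₁) = 𝓛.quoFst hq ((𝓛.quoL hq).proj b₁)) :
    ∃ a b, 𝓛.qL hq a = a₁ ∧ 𝓛.qL hq b = b₁ ∧ 𝓛.snd (𝓛.L.proj a) = 𝓛.fst (𝓛.L.proj b) := by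
  obtain ⟨p, hp⟩ := hq.surjective (𝓛.quoπ hq (𝓛.quoFst hq ((𝓛.quoL hq).proj a₁)))
  obtain ⟨a, ha, rfl⟩ := (𝓛.isQuo_qL hq).exists_lift hq hp
  obtain ⟨b, hb, rfl⟩ := (𝓛.isQuo_qL hq).exists_lift hq (p := p) (x := b₁)
    (by rw [hp, ← quoπ_quoSnd, h])
  exact ⟨a, b, rfl, rfl, (composable_iff hq (ha.trans hb.symm)).1 h⟩

/-- The multiplication of `L/G`. -/
def quoμ (a₁ b₁ : (𝓛.quoL hq).tot)
    (h : 𝓛.quoSnd hq ((𝓛.quoL hq).proj a₁) = 𝓛.quoFst hq ((𝓛.quoL hq).proj b₁)) :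
    (𝓛.quoL hq).tot :=
  𝓛.qL hq (𝓛.μ (exists_lift_composable hq h).choose
    (exists_lift_composable hq h).choose_spec.choose
    (exists_lift_composable hq h).choose_spec.choose_spec.2.2)

theorem quoμ_eq {a b : 𝓛.L.tot} (h : 𝓛.snd (𝓛.L.proj a) = 𝓛.fst (𝓛.L.proj b))
    {a₁ b₁ : (𝓛.quoL hq).tot} (ha : 𝓛.qL hq a = a₁) (hb : 𝓛.qL hq b = b₁) (h₁) :
    quoμ hq a₁ b₁ h₁ = 𝓛.qL hq (𝓛.μ a b h) := by
  unfold quoμ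
  set a' := (exists_lift_composable hq h₁).choose
  set b' := (exists_lift_composable hq h₁).choose_spec.choose
  obtain ⟨ha', hb', h'⟩ := (exists_lift_composable hq h₁).choose_spec.choose_spec
  obtain ⟨g, hg⟩ := (𝓛.isQuo_qL hq).principal.exists_act (ha.trans ha'.symm)
  have hg' : 𝓛.L.tot.act g b = b' := by
    apply (𝓛.isQuo_qL hq).eq_of_eq hq
    · rw [(𝓛.isQuo_qL hq).map.equivariant, ← h, ← 𝓛.square.comm,
        ← (𝓛.isQuo_qL hq).map.equivariant, hg]
      exact (𝓛.square.comm _).trans (congr_arg 𝓛.π h')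
    · rw [(𝓛.isQuo_qL hq).mk_act, hb]; exact hb'.symm
  have key : ∀ x y (hx : 𝓛.L.tot.act g a = x) (hy : 𝓛.L.tot.act g b = y) (hxy),
      𝓛.qL hq (𝓛.μ x y hxy) = 𝓛.qL hq (𝓛.μ a b h) := by
    rintro _ _ rfl rfl hxy
    rw [𝓛.μ_act g a b h, (𝓛.isQuo_qL hq).mk_act]
  exact key a' b' hg hg' h'

theorem exists_lift_family_composable {T : Mfd.{u}} {a₁ b₁ : T → (𝓛.quoL hq).tot}
    (h : ∀ t, 𝓛.quoSnd hq ((𝓛.quoL hq).proj (a₁ t)) = 𝓛.quoFst hq ((𝓛.quoL hq).proj (b₁ t)))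
    (ha : Smooth a₁) (hb : Smooth b₁) {c : T → P} (hc : Smooth c)
    (hcb : ∀ t, q (c t) = 𝓛.quoπ hq (𝓛.quoFst hq ((𝓛.quoL hq).proj (a₁ t)))) :
    ∃ a b : T → 𝓛.L.tot, Smooth a ∧ Smooth b ∧ (∀ t, 𝓛.qL hq (a t) = a₁ t) ∧
      (∀ t, 𝓛.qL hq (b t) = b₁ t) ∧ (∀ t, 𝓛.π (𝓛.fst (𝓛.L.proj (a t))) = c t) ∧
      (∀ t, 𝓛.π (𝓛.fst (𝓛.L.proj (b t))) = c t) ∧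
      ∀ t, 𝓛.snd (𝓛.L.proj (a t)) = 𝓛.fst (𝓛.L.proj (b t)) := by
  obtain ⟨a, has, haf, ham⟩ := (𝓛.isQuo_qL hq).exists_lift_family hq hc ha hcb
  obtain ⟨b, hbs, hbf, hbm⟩ := (𝓛.isQuo_qL hq).exists_lift_family hq hc hb
    (fun t => by rw [hcb, ← h, quoπ_quoSnd])
  exact ⟨a, b, has, hbs, ham, hbm, haf, hbf, fun t =>
    (composable_iff hq ((haf t).trans (hbf t).symm)).1 (by rw [ham, hbm, h])⟩

variable (𝓛)

/-- The quotient `𝓛/G = (Y/G, L/G, μ/G)`. -/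
def quo : Gerbe X.triv where
  Y := GerbeQuot.quo (hq.hasQuo 𝓛.cover.toIsGMap)
  π := 𝓛.quoπ hq
  cover :=
    { smooth := (𝓛.isQuo_qY hq).smooth_base hq
      equivariant := fun g x => by rw [GMfd.trivialGrp_act, GMfd.trivialGrp_act]
      surjective := fun x => by
        obtain ⟨p, rfl⟩ := hq.surjective x
        obtain ⟨y, rfl⟩ := 𝓛.cover.surjective p
        exact ⟨𝓛.qY hq y, (𝓛.isQuo_qY hq).comm y⟩
      submersion := fun y w => by
        obtain ⟨y, rfl⟩ := (𝓛.isQuo_qY hq).principal.surjective y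
        obtain ⟨v, hv⟩ := hq.submersion (𝓛.π y) w
        obtain ⟨a, rfl⟩ := 𝓛.cover.submersion y v
        exact ⟨_, ((𝓛.isQuo_qY hq).D_base hq y a).trans hv⟩ }
  Y₂ := GerbeQuot.quo (hq.hasQuo 𝓛.isGMap_base₂)
  fst := 𝓛.quoFst hq
  snd := 𝓛.quoSnd hq
  square := 𝓛.square.descend hq (𝓛.isQuo_qY hq) (𝓛.isQuo_qY₂ hq).principal (𝓛.quoFst_mk hq)
    (𝓛.quoSnd_mk hq)
  L := 𝓛.quoL hq
  μ := quoμ hq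
  μ_fst := fun a b h => by
    obtain ⟨a, b, rfl, rfl, h'⟩ := exists_lift_composable hq h
    rw [quoμ_eq hq h' rfl rfl, quoFst_proj, quoFst_proj, 𝓛.μ_fst]
  μ_snd := fun a b h => by
    obtain ⟨a, b, rfl, rfl, h'⟩ := exists_lift_composable hq h
    rw [quoμ_eq hq h' rfl rfl, quoSnd_proj, quoSnd_proj, 𝓛.μ_snd]
  μ_circ_left := fun c a b h h₁ => by
    obtain ⟨a, b, rfl, rfl, h'⟩ := exists_lift_composable hq h
    rw [quoμ_eq hq (by rw [𝓛.L.principal.proj_act, h']) (circ_qL hq 𝓛 c a).symm rfl h₁,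
      𝓛.μ_circ_left c a b h', quoμ_eq hq h' rfl rfl, circ_qL]
  μ_circ_right := fun c a b h h₁ => by
    obtain ⟨a, b, rfl, rfl, h'⟩ := exists_lift_composable hq h
    rw [quoμ_eq hq (by rw [𝓛.L.principal.proj_act, h']) rfl (circ_qL hq 𝓛 c b).symm h₁,
      𝓛.μ_circ_right c a b h', quoμ_eq hq h' rfl rfl, circ_qL]
  μ_act := fun g a b h h₁ => by
    simp only [GMfd.trivialGrp_act]
  μ_smooth := fun T a₁ b₁ h ha hb => by
    apply smooth_of_restr
    intro t₀
    obtain ⟨U, t', c, ht', hc, hcb⟩ := exists_lift_family hq.smooth_proj hq.surjective hq.submersion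
      (((𝓛.isQuo_qL hq).smooth_base hq).comp ha) t₀
    obtain ⟨a, b, has, hbs, ham, hbm, -, -, hab⟩ := exists_lift_family_composable hq
      (fun t => h (T.incl U t)) (ha.comp (smooth_incl T U)) (hb.comp (smooth_incl T U)) hc hcb
    refine ⟨U, t', ht', ?_⟩
    have e : (fun t => quoμ hq (a₁ (T.incl U t)) (b₁ (T.incl U t)) (h (T.incl U t))) =
        fun t => 𝓛.qL hq (𝓛.μ (a t) (b t) (hab t)) := by
      funext t; exact quoμ_eq hq (hab t) (ham t) (hbm t) _
    rw [e]
    exact (𝓛.isQuo_qL hq).smooth_mk.comp (𝓛.μ_smooth _ a b hab has hbs)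
  μ_assoc := fun a b c hab hbc h₁ h₂ => by
    obtain ⟨a, b, rfl, rfl, h'⟩ := exists_lift_composable hq hab
    obtain ⟨c, hc, rfl⟩ := (𝓛.isQuo_qL hq).exists_lift hq (x := c)
      (p := 𝓛.π (𝓛.fst (𝓛.L.proj b)))
      (by rw [← hbc, quoπ_quoSnd]; exact ((𝓛.isQuo_qL hq).comm b).symm)
    have hbc' := (composable_iff hq hc.symm).1 hbc
    rw [quoμ_eq hq (by rw [𝓛.μ_snd, hbc']) (quoμ_eq hq h' rfl rfl hab).symm rfl,
      quoμ_eq hq (by rw [𝓛.μ_fst, h']) rfl (quoμ_eq hq hbc' rfl rfl hbc).symm,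
      𝓛.μ_assoc a b c h' hbc']

/-- The projections that exhibit `𝓛.quo` as the quotient of `𝓛`. -/
def objQuotient : ObjQuotient (X := X) q 𝓛 (𝓛.quo hq) where
  qY := 𝓛.qY hq
  qY_quot := (𝓛.isQuo_qY hq).principal
  qY₂ := 𝓛.qY₂ hq
  qY₂_quot := (𝓛.isQuo_qY₂ hq).principal
  qL := 𝓛.qL hq
  qL_quot := (𝓛.isQuo_qL hq).principal
  π_eq := (𝓛.isQuo_qY hq).comm
  fst_eq := 𝓛.quoFst_mk hq
  snd_eq := 𝓛.quoSnd_mk hq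
  proj_eq := 𝓛.proj_qL hq
  circ_eq := 𝓛.circ_qL hq
  μ_eq := fun _ _ h h₁ => quoμ_eq hq h rfl rfl h₁

end Gerbe

end QuoGerbe

/-! ### Quotients of 1-morphisms -/

section QuoHom

variable {G : LieGrp.{v}} {P : GMfd.{v, u} G} {X : Mfd.{u}}

namespace IsQuo

variable {q : P → X} {N N' : GMfd.{v, u} G} {N₁ N₁' : Mfd.{u}} {f : N → P} {mk : N → N₁}
  {b : N₁ → X} {f' : N' → P} {mk' : N' → N₁'} {b' : N₁' → X}

theorem eq_iff (h : IsQuo q f mk b) (hq : IsPrincipal G (P := P.toMfd) P.act q) {n n' : N}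
    (e : f n = f n') : mk n = mk n' ↔ n = n' :=
  ⟨h.eq_of_eq hq e, fun e => by rw [e]⟩

/-- Two lifts over points of `P` that are related by `g` are related by `g`. -/
theorem act_eq (h : IsQuo q f mk b) (hq : IsPrincipal G (P := P.toMfd) P.act q) {n n' : N}
    {g : G} (e : f n' = P.act g (f n)) (e' : mk n = mk n') : N.act g n = n' :=
  h.eq_of_eq hq (by rw [h.map.equivariant, e]) (by rw [h.mk_act, e'])

end IsQuo

variable {q : P → X.triv} (hq : IsPrincipal G (P := P.toMfd) (X := X.triv.toMfd) P.act q)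
  {𝓛 𝓛' : Gerbe P} (𝓚 : Hom 𝓛 𝓛')

namespace Hom

theorem isGMap_base : IsGMap (fun z => 𝓛.π (𝓚.ζ₁ z)) := 𝓛.cover.toIsGMap.comp 𝓚.ζ₁_map

/-- The projection `Z → Z/G`. -/
def qZ : 𝓚.Z → GerbeQuot.quo (hq.hasQuo 𝓚.isGMap_base) := quoMk _

/-- The map `Z/G → Y/G` induced by `ζ₁`. -/
def quoζ₁ : GerbeQuot.quo (hq.hasQuo 𝓚.isGMap_base) →
    GerbeQuot.quo (hq.hasQuo 𝓛.cover.toIsGMap) := quoMap _ _ 𝓚.ζ₁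

/-- The map `Z/G → Y'/G` induced by `ζ₂`. -/
def quoζ₂ : GerbeQuot.quo (hq.hasQuo 𝓚.isGMap_base) →
    GerbeQuot.quo (hq.hasQuo 𝓛'.cover.toIsGMap) := quoMap _ _ 𝓚.ζ₂

/-- The bundle `K/G`. -/
def quoK : GBun (GerbeQuot.quo (hq.hasQuo 𝓚.isGMap_base)) := 𝓚.K.quo hq 𝓚.isGMap_base

/-- The projection `K → K/G`. -/
def qK : 𝓚.K.tot → (𝓚.quoK hq).tot := 𝓚.K.qmk hq 𝓚.isGMap_base

theorem quoζ₁_mk (z : 𝓚.Z) : 𝓚.quoζ₁ hq (𝓚.qZ hq z) = 𝓛.qY hq (𝓚.ζ₁ z) :=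
  quoMap_mk _ _ 𝓚.ζ₁_map.equivariant z

theorem quoζ₂_mk (z : 𝓚.Z) : 𝓚.quoζ₂ hq (𝓚.qZ hq z) = 𝓛'.qY hq (𝓚.ζ₂ z) :=
  quoMap_mk _ _ 𝓚.ζ₂_map.equivariant z

theorem isQuo_qZ : IsQuo q (fun z => 𝓛.π (𝓚.ζ₁ z)) (𝓚.qZ hq)
    (fun x => 𝓛.quoπ hq (𝓚.quoζ₁ hq x)) :=
  (𝓛.isQuo_qY hq).of_map 𝓚.ζ₁_map (quo_principal _) (𝓚.quoζ₁_mk hq)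

theorem proj_qK (k : 𝓚.K.tot) : (𝓚.quoK hq).proj (𝓚.qK hq k) = 𝓚.qZ hq (𝓚.K.proj k) :=
  𝓚.K.proj_qmk hq _ k

theorem circ_qK (c : circleGrp) (k : 𝓚.K.tot) :
    (𝓚.quoK hq).circ c (𝓚.qK hq k) = 𝓚.qK hq (𝓚.K.circ c k) := 𝓚.K.circ_qmk hq _ c k

theorem isQuo_qK : IsQuo (N₁ := (𝓚.quoK hq).tot.toMfd) q
    (fun k => 𝓛.π (𝓚.ζ₁ (𝓚.K.proj k))) (𝓚.qK hq)
    (fun x => 𝓛.quoπ hq (𝓚.quoζ₁ hq ((𝓚.quoK hq).proj x))) :=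
  𝓚.K.isQuo_qmk hq _ (𝓚.isQuo_qZ hq)

theorem quoζ₁_proj (k : 𝓚.K.tot) :
    𝓚.quoζ₁ hq ((𝓚.quoK hq).proj (𝓚.qK hq k)) = 𝓛.qY hq (𝓚.ζ₁ (𝓚.K.proj k)) := by
  rw [proj_qK, quoζ₁_mk]

theorem quoζ₂_proj (k : 𝓚.K.tot) :
    𝓚.quoζ₂ hq ((𝓚.quoK hq).proj (𝓚.qK hq k)) = 𝓛'.qY hq (𝓚.ζ₂ (𝓚.K.proj k)) := by
  rw [proj_qK, quoζ₂_mk]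

theorem quo_comm (x) : 𝓛.quoπ hq (𝓚.quoζ₁ hq x) = 𝓛'.quoπ hq (𝓚.quoζ₂ hq x) := by
  obtain ⟨z, rfl⟩ := (𝓚.isQuo_qZ hq).principal.surjective x
  rw [quoζ₁_mk, quoζ₂_mk, (𝓛.isQuo_qY hq).comm, (𝓛'.isQuo_qY hq).comm, 𝓚.comm]

variable {𝓚}

theorem fst_eq_iff {l : 𝓛.L.tot} {k : 𝓚.K.tot}
    (e : 𝓛.π (𝓛.fst (𝓛.L.proj l)) = 𝓛.π (𝓚.ζ₁ (𝓚.K.proj k))) :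
    𝓛.quoFst hq ((𝓛.quoL hq).proj (𝓛.qL hq l)) = 𝓚.quoζ₁ hq ((𝓚.quoK hq).proj (𝓚.qK hq k)) ↔
      𝓛.fst (𝓛.L.proj l) = 𝓚.ζ₁ (𝓚.K.proj k) := by
  rw [Gerbe.quoFst_proj, quoζ₁_proj]
  exact (𝓛.isQuo_qY hq).eq_iff hq e

theorem snd_eq_iff {l : 𝓛.L.tot} {k : 𝓚.K.tot}
    (e : 𝓛.π (𝓛.fst (𝓛.L.proj l)) = 𝓛.π (𝓚.ζ₁ (𝓚.K.proj k))) :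
    𝓛.quoSnd hq ((𝓛.quoL hq).proj (𝓛.qL hq l)) = 𝓚.quoζ₁ hq ((𝓚.quoK hq).proj (𝓚.qK hq k)) ↔
      𝓛.snd (𝓛.L.proj l) = 𝓚.ζ₁ (𝓚.K.proj k) := by
  rw [Gerbe.quoSnd_proj, quoζ₁_proj]
  exact (𝓛.isQuo_qY hq).eq_iff hq (by rw [← 𝓛.square.comm, e])

theorem exists_lift_α {l₁ : (𝓛.quoL hq).tot} {k₁' k₁ : (𝓚.quoK hq).tot}
    (h : 𝓛.quoFst hq ((𝓛.quoL hq).proj l₁) = 𝓚.quoζ₁ hq ((𝓚.quoK hq).proj k₁))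
    (h' : 𝓛.quoSnd hq ((𝓛.quoL hq).proj l₁) = 𝓚.quoζ₁ hq ((𝓚.quoK hq).proj k₁')) :
    ∃ l k' k, 𝓛.qL hq l = l₁ ∧ 𝓚.qK hq k' = k₁' ∧ 𝓚.qK hq k = k₁ ∧
      𝓛.fst (𝓛.L.proj l) = 𝓚.ζ₁ (𝓚.K.proj k) ∧ 𝓛.snd (𝓛.L.proj l) = 𝓚.ζ₁ (𝓚.K.proj k') := by
  obtain ⟨l, rfl⟩ := (𝓛.isQuo_qL hq).principal.surjective l₁
  have e := (𝓛.isQuo_qL hq).comm l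
  obtain ⟨k, hk, rfl⟩ := (𝓚.isQuo_qK hq).exists_lift hq (x := k₁) (by rw [← h, e])
  obtain ⟨k', hk', rfl⟩ := (𝓚.isQuo_qK hq).exists_lift hq (x := k₁')
    (by rw [← h', Gerbe.quoπ_quoSnd, e])
  exact ⟨l, k', k, rfl, rfl, rfl, (fst_eq_iff hq hk.symm).1 h, (snd_eq_iff hq hk'.symm).1 h'⟩

theorem exists_quoα (l₁ : (𝓛.quoL hq).tot) (k₁' k₁ : (𝓚.quoK hq).tot)
    (h : 𝓛.quoFst hq ((𝓛.quoL hq).proj l₁) = 𝓚.quoζ₁ hq ((𝓚.quoK hq).proj k₁))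
    (h' : 𝓛.quoSnd hq ((𝓛.quoL hq).proj l₁) = 𝓚.quoζ₁ hq ((𝓚.quoK hq).proj k₁')) :
    ∃ m, ∀ l k' k, 𝓛.qL hq l = l₁ → 𝓚.qK hq k' = k₁' → 𝓚.qK hq k = k₁ → ∀ h h',
      m = 𝓛'.qL hq (𝓚.α l k' k h h') := by
  obtain ⟨l, k', k, rfl, rfl, rfl, e, e'⟩ := exists_lift_α hq h h'
  refine ⟨𝓛'.qL hq (𝓚.α l k' k e e'), fun l₀ k₀' k₀ hl hk' hk e₀ e₀' => ?_⟩
  obtain ⟨g, rfl⟩ := (𝓛.isQuo_qL hq).principal.exists_act hl.symm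
  have h1 := (𝓛.isQuo_qL hq).map.equivariant g l
  obtain rfl := (𝓚.isQuo_qK hq).act_eq hq (g := g) (by rw [← e₀, h1, e]) hk.symm
  obtain rfl := (𝓚.isQuo_qK hq).act_eq hq (g := g)
    (by rw [← e₀', ← 𝓛.square.comm, h1, 𝓛.square.comm, e']) hk'.symm
  rw [𝓚.α_act g l k' k e e', (𝓛'.isQuo_qL hq).mk_act]

/-- The isomorphism `α/G`. -/
def quoα (l₁ : (𝓛.quoL hq).tot) (k₁' k₁ : (𝓚.quoK hq).tot)
    (h : 𝓛.quoFst hq ((𝓛.quoL hq).proj l₁) = 𝓚.quoζ₁ hq ((𝓚.quoK hq).proj k₁))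
    (h' : 𝓛.quoSnd hq ((𝓛.quoL hq).proj l₁) = 𝓚.quoζ₁ hq ((𝓚.quoK hq).proj k₁')) :
    (𝓛'.quoL hq).tot :=
  (exists_quoα hq l₁ k₁' k₁ h h').choose

theorem quoα_eq {l : 𝓛.L.tot} {k' k : 𝓚.K.tot} (h h') {l₁ : (𝓛.quoL hq).tot}
    {k₁' k₁ : (𝓚.quoK hq).tot} (hl : 𝓛.qL hq l = l₁) (hk' : 𝓚.qK hq k' = k₁')
    (hk : 𝓚.qK hq k = k₁) (h₁ h₁') :
    quoα hq l₁ k₁' k₁ h₁ h₁' = 𝓛'.qL hq (𝓚.α l k' k h h') :=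
  (exists_quoα hq l₁ k₁' k₁ h₁ h₁').choose_spec l k' k hl hk' hk h h'

theorem exists_lift_family_α {T : Mfd.{u}} {l₁ : T → (𝓛.quoL hq).tot}
    {k₁' k₁ : T → (𝓚.quoK hq).tot}
    (h : ∀ t, 𝓛.quoFst hq ((𝓛.quoL hq).proj (l₁ t)) = 𝓚.quoζ₁ hq ((𝓚.quoK hq).proj (k₁ t)))
    (h' : ∀ t, 𝓛.quoSnd hq ((𝓛.quoL hq).proj (l₁ t)) = 𝓚.quoζ₁ hq ((𝓚.quoK hq).proj (k₁' t)))
    (hl : Smooth l₁) (hk' : Smooth k₁') (hk : Smooth k₁) {c : T → P} (hc : Smooth c)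
    (hcb : ∀ t, q (c t) = 𝓛.quoπ hq (𝓛.quoFst hq ((𝓛.quoL hq).proj (l₁ t)))) :
    ∃ (l : T → 𝓛.L.tot) (k' k : T → 𝓚.K.tot), Smooth l ∧ Smooth k' ∧ Smooth k ∧
      (∀ t, 𝓛.qL hq (l t) = l₁ t) ∧ (∀ t, 𝓚.qK hq (k' t) = k₁' t) ∧ (∀ t, 𝓚.qK hq (k t) = k₁ t) ∧
      (∀ t, 𝓛.π (𝓛.fst (𝓛.L.proj (l t))) = c t) ∧ (∀ t, 𝓛.π (𝓚.ζ₁ (𝓚.K.proj (k' t))) = c t) ∧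
      (∀ t, 𝓛.π (𝓚.ζ₁ (𝓚.K.proj (k t))) = c t) ∧
      (∀ t, 𝓛.fst (𝓛.L.proj (l t)) = 𝓚.ζ₁ (𝓚.K.proj (k t))) ∧
      ∀ t, 𝓛.snd (𝓛.L.proj (l t)) = 𝓚.ζ₁ (𝓚.K.proj (k' t)) := by
  obtain ⟨l, hls, hlf, hlm⟩ := (𝓛.isQuo_qL hq).exists_lift_family hq hc hl hcb
  obtain ⟨k', hks', hkf', hkm'⟩ := (𝓚.isQuo_qK hq).exists_lift_family hq hc hk'
    (fun t => by rw [hcb, ← h', Gerbe.quoπ_quoSnd])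
  obtain ⟨k, hks, hkf, hkm⟩ := (𝓚.isQuo_qK hq).exists_lift_family hq hc hk
    (fun t => by rw [hcb, ← h])
  exact ⟨l, k', k, hls, hks', hks, hlm, hkm', hkm, hlf, hkf', hkf, fun t =>
    (fst_eq_iff hq ((hlf t).trans (hkf t).symm)).1 (by rw [hlm, hkm, h]), fun t =>
    (snd_eq_iff hq ((hlf t).trans (hkf' t).symm)).1 (by rw [hlm, hkm', h'])⟩

variable (𝓚)

theorem smooth_quoζ₁ : Smooth (𝓚.quoζ₁ hq) := smooth_quoMap _ _ 𝓚.ζ₁_map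

theorem smooth_quoζ₂ : Smooth (𝓚.quoζ₂ hq) := smooth_quoMap _ _ 𝓚.ζ₂_map

theorem D_quoζ₁ (z : 𝓚.Z) (e : 𝓚.Z.E) : D (𝓚.quoζ₁ hq) (𝓚.qZ hq z) (D (𝓚.qZ hq) z e) =
    D (𝓛.qY hq) (𝓚.ζ₁ z) (D 𝓚.ζ₁ z e) := by
  rw [← D_comp (𝓚.smooth_quoζ₁ hq) (𝓚.isQuo_qZ hq).smooth_mk,
    ← D_comp (𝓛.isQuo_qY hq).smooth_mk 𝓚.ζ₁_map.smooth]
  simp only [quoζ₁_mk]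

theorem D_quoζ₂ (z : 𝓚.Z) (e : 𝓚.Z.E) : D (𝓚.quoζ₂ hq) (𝓚.qZ hq z) (D (𝓚.qZ hq) z e) =
    D (𝓛'.qY hq) (𝓚.ζ₂ z) (D 𝓚.ζ₂ z e) := by
  rw [← D_comp (𝓚.smooth_quoζ₂ hq) (𝓚.isQuo_qZ hq).smooth_mk,
    ← D_comp (𝓛'.isQuo_qY hq).smooth_mk 𝓚.ζ₂_map.smooth]
  simp only [quoζ₂_mk]

/-- The quotient `𝓚/G = (Z/G, K/G, α/G)`. -/
def quo : Hom (𝓛.quo hq) (𝓛'.quo hq) where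
  Z := GerbeQuot.quo (hq.hasQuo 𝓚.isGMap_base)
  ζ₁ := 𝓚.quoζ₁ hq
  ζ₂ := 𝓚.quoζ₂ hq
  ζ₁_map := isGMap_triv (𝓚.smooth_quoζ₁ hq)
  ζ₂_map := isGMap_triv (𝓚.smooth_quoζ₂ hq)
  comm := 𝓚.quo_comm hq
  surjective := fun y₁ y₂ e => by
    obtain ⟨y, rfl⟩ := (𝓛.isQuo_qY hq).principal.surjective y₁
    obtain ⟨y', hy, rfl⟩ := (𝓛'.isQuo_qY hq).exists_lift hq
      (((𝓛.isQuo_qY hq).comm y).symm.trans e)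
    obtain ⟨z, rfl, rfl⟩ := 𝓚.surjective y y' hy.symm
    exact ⟨𝓚.qZ hq z, 𝓚.quoζ₁_mk hq z, 𝓚.quoζ₂_mk hq z⟩
  submersion := fun z a₁ a₂ e => by
    obtain ⟨z, rfl⟩ := (𝓚.isQuo_qZ hq).principal.surjective z
    have e' : D (𝓛.quoπ hq) (𝓛.qY hq (𝓚.ζ₁ z)) a₁ = D (𝓛'.quoπ hq) (𝓛'.qY hq (𝓚.ζ₂ z)) a₂ := by
      rw [← quoζ₁_mk, ← quoζ₂_mk]; exact e
    obtain ⟨a, rfl⟩ := (𝓛.isQuo_qY hq).principal.submersion (𝓚.ζ₁ z) a₁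
    rw [(𝓛.isQuo_qY hq).D_base hq, 𝓚.comm] at e'
    obtain ⟨a', ha', rfl⟩ := (𝓛'.isQuo_qY hq).exists_lift_tangent hq _ e'
    obtain ⟨c, rfl, rfl⟩ := 𝓚.submersion z a a' ha'.symm
    exact ⟨D (𝓚.qZ hq) z c, 𝓚.D_quoζ₁ hq z c, 𝓚.D_quoζ₂ hq z c⟩
  K := 𝓚.quoK hq
  α := quoα hq
  α_fst := fun l k' k h h' => by
    obtain ⟨l, k', k, rfl, rfl, rfl, e, e'⟩ := exists_lift_α hq h h'
    rw [quoα_eq hq e e' rfl rfl rfl h h']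
    exact (𝓛'.quoFst_proj hq _).trans ((congr_arg _ (𝓚.α_fst _ _ _ _ _)).trans
      (𝓚.quoζ₂_proj hq k).symm)
  α_snd := fun l k' k h h' => by
    obtain ⟨l, k', k, rfl, rfl, rfl, e, e'⟩ := exists_lift_α hq h h'
    rw [quoα_eq hq e e' rfl rfl rfl h h']
    exact (𝓛'.quoSnd_proj hq _).trans ((congr_arg _ (𝓚.α_snd _ _ _ _ _)).trans
      (𝓚.quoζ₂_proj hq k').symm)
  α_circ_l := fun c l k' k h h' h₂ h₃ => by
    obtain ⟨l, k', k, rfl, rfl, rfl, e, e'⟩ := exists_lift_α hq h h'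
    rw [quoα_eq hq e e' rfl rfl rfl h h']
    refine (quoα_eq hq (by rw [𝓛.L.principal.proj_act, e])
      (by rw [𝓛.L.principal.proj_act, e']) (𝓛.circ_qL hq c l).symm rfl rfl h₂ h₃).trans ?_
    rw [𝓚.α_circ_l c l k' k e e']
    exact (𝓛'.circ_qL hq _ _).symm
  α_circ_k₁ := fun c l k' k h h' h₂ h₃ => by
    obtain ⟨l, k', k, rfl, rfl, rfl, e, e'⟩ := exists_lift_α hq h h'
    rw [quoα_eq hq e e' rfl rfl rfl h h', quoα_eq hq e
      (by rw [𝓚.K.principal.proj_act, e']) rfl (𝓚.circ_qK hq c k').symm rfl h₂ h₃,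
      𝓚.α_circ_k₁ c l k' k e e']
    exact (𝓛'.circ_qL hq _ _).symm
  α_circ_k := fun c l k' k h h' h₂ h₃ => by
    obtain ⟨l, k', k, rfl, rfl, rfl, e, e'⟩ := exists_lift_α hq h h'
    rw [quoα_eq hq e e' rfl rfl rfl h h', quoα_eq hq
      (by rw [𝓚.K.principal.proj_act, e]) e' rfl rfl (𝓚.circ_qK hq c k).symm h₂ h₃,
      𝓚.α_circ_k c l k' k e e']
    exact (𝓛'.circ_qL hq _ _).symm
  α_act := fun g l k' k h h' h₂ h₃ => by
    simp only [GMfd.trivialGrp_act]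
    exact (GMfd.trivialGrp_act _ g _).symm
  α_smooth := fun T l₁ k₁' k₁ h h' hl hk' hk => by
    apply smooth_of_restr
    intro t₀
    obtain ⟨U, t', c, ht', hc, hcb⟩ := exists_lift_family hq.smooth_proj hq.surjective hq.submersion
      (((𝓛.isQuo_qL hq).smooth_base hq).comp hl) t₀
    obtain ⟨l, k', k, hls, hks', hks, hlm, hkm', hkm, -, -, -, e, e'⟩ :=
      exists_lift_family_α hq (fun t => h (T.incl U t)) (fun t => h' (T.incl U t))
        (hl.comp (smooth_incl T U)) (hk'.comp (smooth_incl T U)) (hk.comp (smooth_incl T U)) hc hcb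
    refine ⟨U, t', ht', ?_⟩
    have e₁ : (fun t => quoα hq (l₁ (T.incl U t)) (k₁' (T.incl U t)) (k₁ (T.incl U t))
        (h (T.incl U t)) (h' (T.incl U t))) =
        fun t => 𝓛'.qL hq (𝓚.α (l t) (k' t) (k t) (e t) (e' t)) := by
      funext t; exact quoα_eq hq (e t) (e' t) (hlm t) (hkm' t) (hkm t) _ _
    rw [e₁]
    exact (𝓛'.isQuo_qL hq).smooth_mk.comp (𝓚.α_smooth _ l k' k e e' hls hks' hks)
  α_μ := fun l l' k₂ k₁ k hl h h₂ h₃ h₄ h₅ h₆ hμ => by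
    obtain ⟨l, rfl⟩ := (𝓛.isQuo_qL hq).principal.surjective l
    have hb := (𝓛.isQuo_qL hq).comm l
    obtain ⟨l', hl', rfl⟩ := (𝓛.isQuo_qL hq).exists_lift hq (x := l')
      (p := 𝓛.π (𝓛.fst (𝓛.L.proj l))) (by
        rw [← hb, ← Gerbe.quoπ_quoSnd]; exact congr_arg _ hl)
    have el := (Gerbe.composable_iff hq hl'.symm).1 hl
    obtain ⟨k, hk, rfl⟩ := (𝓚.isQuo_qK hq).exists_lift hq (x := k)
      (p := 𝓛.π (𝓛.fst (𝓛.L.proj l))) (by rw [← hb]; exact congr_arg _ h₃)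
    have e₃ := (fst_eq_iff hq hk.symm).1 h₃
    obtain ⟨k₁, hk₁, rfl⟩ := (𝓚.isQuo_qK hq).exists_lift hq (x := k₁)
      (p := 𝓛.π (𝓛.fst (𝓛.L.proj l))) (by
        rw [← hb, ← Gerbe.quoπ_quoSnd]; exact congr_arg _ h₄)
    have e₄ := (snd_eq_iff hq hk₁.symm).1 h₄
    obtain ⟨k₂, hk₂, rfl⟩ := (𝓚.isQuo_qK hq).exists_lift hq (x := k₂)
      (p := 𝓛.π (𝓛.fst (𝓛.L.proj l))) (by
        rw [← hl', ← (𝓛.isQuo_qL hq).comm, ← Gerbe.quoπ_quoSnd]; exact congr_arg _ h₆)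
    have e₆ := (snd_eq_iff hq (hl'.trans hk₂.symm)).1 h₆
    have e₅ := (fst_eq_iff hq (hl'.trans hk₁.symm)).1 h₅
    refine (quoα_eq hq (by rw [𝓛.μ_fst, e₃]) (by rw [𝓛.μ_snd, e₆])
      (Gerbe.quoμ_eq hq el rfl rfl hl).symm rfl rfl h h₂).trans ?_
    refine Eq.trans ?_ (Gerbe.quoμ_eq hq (by rw [𝓚.α_snd, 𝓚.α_fst])
      (quoα_eq hq e₃ e₄ rfl rfl rfl h₃ h₄).symm (quoα_eq hq e₅ e₆ rfl rfl rfl h₅ h₆).symm hμ).symm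
    rw [𝓚.α_μ l l' k₂ k₁ k el _ _ e₃ e₄ e₅ e₆]

/-- The projections that exhibit `𝓚.quo` as the quotient of `𝓚`. -/
def homQuotient : HomQuotient (X := X) (𝓛.objQuotient hq) (𝓛'.objQuotient hq) 𝓚 (𝓚.quo hq) where
  qZ := 𝓚.qZ hq
  qZ_quot := (𝓚.isQuo_qZ hq).principal
  qK := 𝓚.qK hq
  qK_quot := (𝓚.isQuo_qK hq).principal
  ζ₁_eq := 𝓚.quoζ₁_mk hq
  ζ₂_eq := 𝓚.quoζ₂_mk hq
  proj_eq := 𝓚.proj_qK hq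
  circ_eq := 𝓚.circ_qK hq
  α_eq := fun _ _ _ h h' h₁ h₁' => quoα_eq hq h h' rfl rfl rfl h₁ h₁'

end Hom

end QuoHom

/-! ### Quotients of 2-morphisms -/

section QuoTwo

variable {G : LieGrp.{v}} {P : GMfd.{v, u} G} {X : Mfd.{u}}

theorem D_quoMap {N N' : GMfd.{v, u} G} (h : HasQuo N) (h' : HasQuo N') {F : N → N'}
    (hF : IsGMap F) (n : N) (a : N.E) :
    D (quoMap h h' F) (quoMk h n) (D (quoMk h) n a) = D (quoMk h') (F n) (D F n a) := by
  rw [← D_comp (smooth_quoMap h h' hF) (quo_principal h).smooth_proj,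
    ← D_comp (quo_principal h').smooth_proj hF.smooth]
  simp only [quoMap_mk h h' hF.equivariant]

/-- Tangent vectors at two points with the same image in `N` have the same image if they do so in
`P` and in `N/G`. -/
theorem IsQuo.D_eq_D {q : P → X} (hq : IsPrincipal G (P := P.toMfd) P.act q) {N : GMfd.{v, u} G}
    {N₁ : Mfd.{u}} {f : N → P} {mk : N → N₁} {b : N₁ → X} (h : IsQuo q f mk b)
    {M M' : GMfd.{v, u} G} {F : M → N} {F' : M' → N} (hF : IsGMap F) (hF' : IsGMap F') {x : M}
    {x' : M'} {a : M.E} {a' : M'.E} (hx : F x = F' x')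
    (e : D (fun x => f (F x)) x a = D (fun x => f (F' x)) x' a')
    (e' : D (M := N.toMfd) mk (F x) (D F x a) = D (M := N.toMfd) mk (F' x') (D F' x' a')) :
    D F x a = D F' x' a' := by
  rw [D_comp h.map.smooth hF.smooth, D_comp h.map.smooth hF'.smooth] at e
  rw [← hx] at e e'
  exact h.tangent_eq hq e e'

theorem D_descend {N M : GMfd.{v, u} G} {N₁ M₁ : Mfd.{u}} {mk : N → N₁}
    (hN : IsPrincipal G (P := N.toMfd) (X := N₁) N.act mk) {mkM : M → M₁}
    (hM : IsPrincipal G (P := M.toMfd) (X := M₁) M.act mkM) {F : M → N} (hF : IsGMap F)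
    {F₁ : M₁ → N₁} (eF : ∀ x, F₁ (mkM x) = mk (F x)) (x : M) (a : M.E) :
    D F₁ (mkM x) (D (M := M.toMfd) mkM x a) = D (M := N.toMfd) mk (F x) (D F x a) := by
  have hF₁ : Smooth F₁ := hM.smooth_of_comp (by
    simp only [eF]; exact hN.smooth_proj.comp hF.smooth)
  rw [← D_comp hF₁ hM.smooth_proj, ← D_comp hN.smooth_proj hF.smooth]
  simp only [eF]

/-- Given manifolds `M` and `M'` over `N`, a tangent vector of `M'/G` lifts to `M'` over the image
in `N` of a tangent vector of `M`, if the images in `N/G` agree. -/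
theorem exists_lift_tangent_over {N M M' : GMfd.{v, u} G} {N₁ M₁ M₁' : Mfd.{u}} {mk : N → N₁}
    (hN : IsPrincipal G (P := N.toMfd) (X := N₁) N.act mk) {mkM : M → M₁}
    (hM : IsPrincipal G (P := M.toMfd) (X := M₁) M.act mkM) {mkM' : M' → M₁'}
    (hM' : IsPrincipal G (P := M'.toMfd) (X := M₁') M'.act mkM')
    {F : M → N} {F' : M' → N} (hF : IsGMap F) (hF' : IsGMap F') {F₁ : M₁ → N₁} {F₁' : M₁' → N₁}
    (eF : ∀ x, F₁ (mkM x) = mk (F x)) (eF' : ∀ x, F₁' (mkM' x) = mk (F' x)) {x : M} {x' : M'}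
    (hx : F x = F' x') (a : M.E) (a₁ : M₁'.E)
    (e : D F₁ (mkM x) (D (M := M.toMfd) mkM x a) = D F₁' (mkM' x') a₁) :
    ∃ a' : M'.E, D F x a = D F' x' a' ∧ D (M := M'.toMfd) mkM' x' a' = a₁ := by
  obtain ⟨a', rfl⟩ := hM'.submersion x' a₁
  rw [D_descend hN hM hF eF, D_descend hN hM' hF' eF', hx, ← sub_eq_zero, ← map_sub] at e
  obtain ⟨ξ, hξ⟩ := hN.exists_fund _ e
  refine ⟨a' + M'.fund x' ξ, ?_, ?_⟩
  · rw [map_add, hF'.D_fund, hξ, add_sub_cancel]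
  · rw [map_add, hM'.D_fund_eq_zero, add_zero]

variable {q : P → X.triv} (hq : IsPrincipal G (P := P.toMfd) (X := X.triv.toMfd) P.act q)
  {𝓛 𝓛' 𝓛'' : Gerbe P}

theorem Hom.base_eq (𝓚 : Hom 𝓛 𝓛') :
    (fun z => 𝓛.π (𝓚.ζ₁ z)) = fun z => 𝓛'.π (𝓚.ζ₂ z) := funext 𝓚.comm

namespace TwoRep

variable {f g : Hom 𝓛 𝓛'} (r : TwoRep f g)

theorem isGMap_base : IsGMap (fun w => 𝓛.π (f.ζ₁ (r.w₁ w))) := f.isGMap_base.comp r.w₁_map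

theorem base₂ (w : r.W) : 𝓛.π (g.ζ₁ (r.w₂ w)) = 𝓛.π (f.ζ₁ (r.w₁ w)) := by rw [r.comm₁]

/-- The projection `W → W/G`. -/
def qW : r.W → GerbeQuot.quo (hq.hasQuo r.isGMap_base) := quoMk _

/-- The map induced by `w₁` on quotients. -/
def quow₁ : GerbeQuot.quo (hq.hasQuo r.isGMap_base) → GerbeQuot.quo (hq.hasQuo f.isGMap_base) :=
  quoMap _ _ r.w₁

/-- The map induced by `w₂` on quotients. -/
def quow₂ : GerbeQuot.quo (hq.hasQuo r.isGMap_base) → GerbeQuot.quo (hq.hasQuo g.isGMap_base) :=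
  quoMap _ _ r.w₂

theorem quow₁_mk (w : r.W) : r.quow₁ hq (r.qW hq w) = f.qZ hq (r.w₁ w) :=
  quoMap_mk _ _ r.w₁_map.equivariant w

theorem quow₂_mk (w : r.W) : r.quow₂ hq (r.qW hq w) = g.qZ hq (r.w₂ w) :=
  quoMap_mk _ _ r.w₂_map.equivariant w

theorem isQuo_qW : IsQuo q (fun w => 𝓛.π (f.ζ₁ (r.w₁ w))) (r.qW hq)
    (fun x => 𝓛.quoπ hq (f.quoζ₁ hq (r.quow₁ hq x))) :=
  (f.isQuo_qZ hq).of_map r.w₁_map (quo_principal _) (r.quow₁_mk hq)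

variable {r}

theorem proj_eq_iff {w : r.W} {k : f.K.tot}
    (e : 𝓛.π (f.ζ₁ (f.K.proj k)) = 𝓛.π (f.ζ₁ (r.w₁ w))) :
    (f.quoK hq).proj (f.qK hq k) = r.quow₁ hq (r.qW hq w) ↔ f.K.proj k = r.w₁ w := by
  rw [Hom.proj_qK, quow₁_mk]
  exact (f.isQuo_qZ hq).eq_iff hq e

theorem exists_lift_β {w₁ : GerbeQuot.quo (hq.hasQuo r.isGMap_base)} {k₁ : (f.quoK hq).tot}
    (h : (f.quoK hq).proj k₁ = r.quow₁ hq w₁) :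
    ∃ w k, r.qW hq w = w₁ ∧ f.qK hq k = k₁ ∧ f.K.proj k = r.w₁ w := by
  obtain ⟨w, rfl⟩ := (r.isQuo_qW hq).principal.surjective w₁
  obtain ⟨k, hk, rfl⟩ := (f.isQuo_qK hq).exists_lift hq (x := k₁)
    (by rw [h, (r.isQuo_qW hq).comm w])
  exact ⟨w, k, rfl, rfl, (proj_eq_iff hq hk).1 h⟩

theorem exists_quoβ (w₁ : GerbeQuot.quo (hq.hasQuo r.isGMap_base)) (k₁ : (f.quoK hq).tot)
    (h : (f.quoK hq).proj k₁ = r.quow₁ hq w₁) :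
    ∃ m, ∀ w k, r.qW hq w = w₁ → f.qK hq k = k₁ → ∀ h, m = g.qK hq (r.β w k h) := by
  obtain ⟨w, k, rfl, rfl, e⟩ := exists_lift_β hq h
  refine ⟨g.qK hq (r.β w k e), fun w' k' hw hk e' => ?_⟩
  obtain ⟨γ, rfl⟩ := (r.isQuo_qW hq).principal.exists_act hw.symm
  obtain rfl := (f.isQuo_qK hq).act_eq hq (g := γ)
    (by rw [e', (r.isQuo_qW hq).map.equivariant γ w, e]) hk.symm
  rw [r.β_act γ w k e, (g.isQuo_qK hq).mk_act]

variable (r) in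
/-- The isomorphism `β/G`. -/
def quoβ (w₁ : GerbeQuot.quo (hq.hasQuo r.isGMap_base)) (k₁ : (f.quoK hq).tot)
    (h : (f.quoK hq).proj k₁ = r.quow₁ hq w₁) : (g.quoK hq).tot :=
  (exists_quoβ hq w₁ k₁ h).choose

theorem quoβ_eq {w : r.W} {k : f.K.tot} (h) {w₁ : GerbeQuot.quo (hq.hasQuo r.isGMap_base)}
    {k₁ : (f.quoK hq).tot} (hw : r.qW hq w = w₁) (hk : f.qK hq k = k₁) (h₁) :
    r.quoβ hq w₁ k₁ h₁ = g.qK hq (r.β w k h) :=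
  (exists_quoβ hq w₁ k₁ h₁).choose_spec w k hw hk h

theorem exists_lift_family_β {T : Mfd.{u}} {w₁ : T → GerbeQuot.quo (hq.hasQuo r.isGMap_base)}
    {k₁ : T → (f.quoK hq).tot} (h : ∀ t, (f.quoK hq).proj (k₁ t) = r.quow₁ hq (w₁ t))
    (hw : Smooth w₁) (hk : Smooth k₁) {c : T → P} (hc : Smooth c)
    (hcb : ∀ t, q (c t) = 𝓛.quoπ hq (f.quoζ₁ hq (r.quow₁ hq (w₁ t)))) :
    ∃ (w : T → r.W) (k : T → f.K.tot), Smooth w ∧ Smooth k ∧ (∀ t, r.qW hq (w t) = w₁ t) ∧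
      (∀ t, f.qK hq (k t) = k₁ t) ∧ (∀ t, 𝓛.π (f.ζ₁ (f.K.proj (k t))) = c t) ∧
      ∀ t, f.K.proj (k t) = r.w₁ (w t) := by
  obtain ⟨w, hws, hwf, hwm⟩ := (r.isQuo_qW hq).exists_lift_family hq hc hw hcb
  obtain ⟨k, hks, hkf, hkm⟩ := (f.isQuo_qK hq).exists_lift_family hq hc hk
    (fun t => by rw [hcb, ← h])
  exact ⟨w, k, hws, hks, hwm, hkm, hkf, fun t =>
    (proj_eq_iff hq ((hkf t).trans (hwf t).symm)).1 (by rw [hkm, hwm, h])⟩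

variable (r)

/-- The quotient `(W/G, β/G)`. -/
def quo : TwoRep (f.quo hq) (g.quo hq) where
  W := GerbeQuot.quo (hq.hasQuo r.isGMap_base)
  w₁ := r.quow₁ hq
  w₂ := r.quow₂ hq
  w₁_map := isGMap_triv (smooth_quoMap _ _ r.w₁_map)
  w₂_map := isGMap_triv (smooth_quoMap _ _ r.w₂_map)
  comm₁ := fun w => by
    obtain ⟨w, rfl⟩ := (r.isQuo_qW hq).principal.surjective w
    rw [quow₁_mk, quow₂_mk]
    exact (f.quoζ₁_mk hq _).trans ((congr_arg _ (r.comm₁ w)).trans (g.quoζ₁_mk hq _).symm)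
  comm₂ := fun w => by
    obtain ⟨w, rfl⟩ := (r.isQuo_qW hq).principal.surjective w
    rw [quow₁_mk, quow₂_mk]
    exact (f.quoζ₂_mk hq _).trans ((congr_arg _ (r.comm₂ w)).trans (g.quoζ₂_mk hq _).symm)
  surjective := fun z z₁ e e' => by
    obtain ⟨z, rfl⟩ := (f.isQuo_qZ hq).principal.surjective z
    obtain ⟨z₁, hz, rfl⟩ := (g.isQuo_qZ hq).exists_lift hq (x := z₁)
      (((f.isQuo_qZ hq).comm z).symm.trans (congr_arg (𝓛.quoπ hq) e))
    have e₁ := ((f.quoζ₁_mk hq z).symm.trans e).trans (g.quoζ₁_mk hq z₁)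
    have e₂ := ((f.quoζ₂_mk hq z).symm.trans e').trans (g.quoζ₂_mk hq z₁)
    obtain ⟨w, rfl, rfl⟩ := r.surjective z z₁ ((𝓛.isQuo_qY hq).eq_of_eq hq hz.symm e₁)
      ((𝓛'.isQuo_qY hq).eq_of_eq hq (by rw [← f.comm, ← g.comm, hz]) e₂)
    exact ⟨r.qW hq w, r.quow₁_mk hq w, r.quow₂_mk hq w⟩
  submersion := fun w a a₁ e e' => by
    obtain ⟨w, rfl⟩ := (r.isQuo_qW hq).principal.surjective w
    change D (f.quoζ₁ hq) (r.quow₁ hq (r.qW hq w)) a =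
      D (g.quoζ₁ hq) (r.quow₂ hq (r.qW hq w)) a₁ at e
    change D (f.quoζ₂ hq) (r.quow₁ hq (r.qW hq w)) a =
      D (g.quoζ₂ hq) (r.quow₂ hq (r.qW hq w)) a₁ at e'
    rw [quow₁_mk, quow₂_mk] at e e'
    obtain ⟨a, rfl⟩ := (f.isQuo_qZ hq).principal.submersion (r.w₁ w) a
    obtain ⟨a₁, ha, rfl⟩ := exists_lift_tangent_over (𝓛.isQuo_qY hq).principal
      (f.isQuo_qZ hq).principal (g.isQuo_qZ hq).principal f.ζ₁_map g.ζ₁_map (f.quoζ₁_mk hq)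
      (g.quoζ₁_mk hq) (r.comm₁ w) a a₁ e
    rw [Hom.D_quoζ₂, Hom.D_quoζ₂] at e'
    obtain ⟨c, rfl, rfl⟩ := r.submersion w a a₁ ha
      ((𝓛'.isQuo_qY hq).D_eq_D hq f.ζ₂_map g.ζ₂_map (r.comm₂ w) (by
        rw [← f.base_eq, ← g.base_eq, D_comp 𝓛.cover.smooth f.ζ₁_map.smooth,
          D_comp 𝓛.cover.smooth g.ζ₁_map.smooth, ha, r.comm₁]) e')
    exact ⟨D (r.qW hq) w c, D_quoMap _ _ r.w₁_map w c, D_quoMap _ _ r.w₂_map w c⟩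
  β := r.quoβ hq
  β_proj := fun w k h => by
    obtain ⟨w, k, rfl, rfl, e⟩ := exists_lift_β hq h
    rw [quoβ_eq hq e rfl rfl h]
    exact (g.proj_qK hq _).trans ((congr_arg _ (r.β_proj w k e)).trans (r.quow₂_mk hq w).symm)
  β_circ := fun c w k h h₁ => by
    obtain ⟨w, k, rfl, rfl, e⟩ := exists_lift_β hq h
    rw [quoβ_eq hq e rfl rfl h]
    refine (quoβ_eq hq (by rw [f.K.principal.proj_act, e]) rfl (f.circ_qK hq c k).symm h₁).trans ?_
    rw [r.β_circ c w k e]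
    exact (g.circ_qK hq _ _).symm
  β_act := fun γ w k h h₁ => by
    simp only [GMfd.trivialGrp_act]
    exact (GMfd.trivialGrp_act _ γ _).symm
  β_smooth := fun T w₁ k₁ h hw hk => by
    apply smooth_of_restr
    intro t₀
    obtain ⟨U, t', c, ht', hc, hcb⟩ := exists_lift_family hq.smooth_proj hq.surjective hq.submersion
      (((r.isQuo_qW hq).smooth_base hq).comp hw) t₀
    obtain ⟨w, k, hws, hks, hwm, hkm, -, e⟩ := exists_lift_family_β hq (fun t => h (T.incl U t))
      (hw.comp (smooth_incl T U)) (hk.comp (smooth_incl T U)) hc hcb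
    refine ⟨U, t', ht', ?_⟩
    have e₁ : (fun t => r.quoβ hq (w₁ (T.incl U t)) (k₁ (T.incl U t)) (h (T.incl U t))) =
        fun t => g.qK hq (r.β (w t) (k t) (e t)) := by
      funext t; exact quoβ_eq hq (e t) (hwm t) (hkm t) _
    rw [e₁]
    exact (g.isQuo_qK hq).smooth_mk.comp (r.β_smooth _ w k e hws hks)
  β_α := fun w w' l k' k hk' hk h₁ h₂ h₃ h₄ => by
    obtain ⟨l, rfl⟩ := (𝓛.isQuo_qL hq).principal.surjective l
    have hb := (𝓛.isQuo_qL hq).comm l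
    obtain ⟨k, ek, rfl⟩ := (f.isQuo_qK hq).exists_lift hq (x := k)
      (p := 𝓛.π (𝓛.fst (𝓛.L.proj l))) (by rw [← hb]; exact congr_arg _ h₃)
    have e₃ := (Hom.fst_eq_iff hq ek.symm).1 h₃
    obtain ⟨k', ek', rfl⟩ := (f.isQuo_qK hq).exists_lift hq (x := k')
      (p := 𝓛.π (𝓛.fst (𝓛.L.proj l))) (by
        rw [← hb, ← Gerbe.quoπ_quoSnd]; exact congr_arg _ h₄)
    have e₄ := (Hom.snd_eq_iff hq ek'.symm).1 h₄
    obtain ⟨w, ew, rfl⟩ := (r.isQuo_qW hq).exists_lift hq (x := w)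
      (p := 𝓛.π (𝓛.fst (𝓛.L.proj l))) (by
        rw [← ek, ← (f.isQuo_qK hq).comm]; exact congr_arg (fun x => 𝓛.quoπ hq (f.quoζ₁ hq x)) hk)
    have e := (proj_eq_iff hq (ek.trans ew.symm)).1 hk
    obtain ⟨w', ew', rfl⟩ := (r.isQuo_qW hq).exists_lift hq (x := w')
      (p := 𝓛.π (𝓛.fst (𝓛.L.proj l))) (by
        rw [← ek', ← (f.isQuo_qK hq).comm]
        exact congr_arg (fun x => 𝓛.quoπ hq (f.quoζ₁ hq x)) hk')
    have e' := (proj_eq_iff hq (ek'.trans ew'.symm)).1 hk'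
    refine (Hom.quoα_eq hq (by rw [r.β_proj, e₃, ← r.comm₁, e])
      (by rw [r.β_proj, e₄, ← r.comm₁, e']) rfl (quoβ_eq hq e' rfl rfl hk').symm
      (quoβ_eq hq e rfl rfl hk).symm h₁ h₂).trans
      (Eq.trans ?_ (Hom.quoα_eq hq e₃ e₄ rfl rfl rfl h₃ h₄).symm)
    rw [r.β_α w w' l k' k e' e _ _ e₃ e₄]

end TwoRep

end QuoTwo

/-! ### Quotients of 2-morphisms involving composites and identities -/

section QuoTri

variable {G : LieGrp.{v}} {P : GMfd.{v, u} G} {X : Mfd.{u}}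
variable {q : P → X.triv} (hq : IsPrincipal G (P := P.toMfd) (X := X.triv.toMfd) P.act q)
  {𝓛 𝓛' 𝓛'' : Gerbe P}

namespace TriRep

variable {f : Hom 𝓛 𝓛'} {g : Hom 𝓛' 𝓛''} {h : Hom 𝓛 𝓛''} (r : TriRep f g h)

theorem isGMap_base : IsGMap (fun w => 𝓛.π (f.ζ₁ (r.w₀₁ w))) := f.isGMap_base.comp r.w₀₁_map

theorem base₁₂ (w : r.W) : 𝓛'.π (g.ζ₁ (r.w₁₂ w)) = 𝓛.π (f.ζ₁ (r.w₀₁ w)) := by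
  rw [← r.comm₁, f.comm]

theorem base₀₂ (w : r.W) : 𝓛.π (h.ζ₁ (r.w₀₂ w)) = 𝓛.π (f.ζ₁ (r.w₀₁ w)) := by
  rw [r.comm₀]

/-- The projection `W → W/G`. -/
def qW : r.W → GerbeQuot.quo (hq.hasQuo r.isGMap_base) := quoMk _

/-- The map induced by `w₀₁` on quotients. -/
def quow₀₁ : GerbeQuot.quo (hq.hasQuo r.isGMap_base) → GerbeQuot.quo (hq.hasQuo f.isGMap_base) :=
  quoMap _ _ r.w₀₁

/-- The map induced by `w₁₂` on quotients. -/
def quow₁₂ : GerbeQuot.quo (hq.hasQuo r.isGMap_base) → GerbeQuot.quo (hq.hasQuo g.isGMap_base) :=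
  quoMap _ _ r.w₁₂

/-- The map induced by `w₀₂` on quotients. -/
def quow₀₂ : GerbeQuot.quo (hq.hasQuo r.isGMap_base) → GerbeQuot.quo (hq.hasQuo h.isGMap_base) :=
  quoMap _ _ r.w₀₂

theorem quow₀₁_mk (w : r.W) : r.quow₀₁ hq (r.qW hq w) = f.qZ hq (r.w₀₁ w) :=
  quoMap_mk _ _ r.w₀₁_map.equivariant w

theorem quow₁₂_mk (w : r.W) : r.quow₁₂ hq (r.qW hq w) = g.qZ hq (r.w₁₂ w) :=
  quoMap_mk _ _ r.w₁₂_map.equivariant w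

theorem quow₀₂_mk (w : r.W) : r.quow₀₂ hq (r.qW hq w) = h.qZ hq (r.w₀₂ w) :=
  quoMap_mk _ _ r.w₀₂_map.equivariant w

theorem isQuo_qW : IsQuo q (fun w => 𝓛.π (f.ζ₁ (r.w₀₁ w))) (r.qW hq)
    (fun x => 𝓛.quoπ hq (f.quoζ₁ hq (r.quow₀₁ hq x))) :=
  (f.isQuo_qZ hq).of_map r.w₀₁_map (quo_principal _) (r.quow₀₁_mk hq)

theorem quo_base₁₂ (x) : 𝓛'.quoπ hq (g.quoζ₁ hq (r.quow₁₂ hq x)) =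
    𝓛.quoπ hq (f.quoζ₁ hq (r.quow₀₁ hq x)) := by
  obtain ⟨w, rfl⟩ := (r.isQuo_qW hq).principal.surjective x
  rw [(r.isQuo_qW hq).comm, quow₁₂_mk, (g.isQuo_qZ hq).comm, r.base₁₂]

variable {r}

theorem proj_eq_iff {w : r.W} {a : f.K.tot}
    (e : 𝓛.π (f.ζ₁ (f.K.proj a)) = 𝓛.π (f.ζ₁ (r.w₀₁ w))) :
    (f.quoK hq).proj (f.qK hq a) = r.quow₀₁ hq (r.qW hq w) ↔ f.K.proj a = r.w₀₁ w := by
  rw [Hom.proj_qK, quow₀₁_mk]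
  exact (f.isQuo_qZ hq).eq_iff hq e

theorem proj_eq_iff₁₂ {w : r.W} {b : g.K.tot}
    (e : 𝓛'.π (g.ζ₁ (g.K.proj b)) = 𝓛.π (f.ζ₁ (r.w₀₁ w))) :
    (g.quoK hq).proj (g.qK hq b) = r.quow₁₂ hq (r.qW hq w) ↔ g.K.proj b = r.w₁₂ w := by
  rw [Hom.proj_qK, quow₁₂_mk]
  exact (g.isQuo_qZ hq).eq_iff hq (by rw [e, r.base₁₂])

theorem exists_lift_β {w₁ : GerbeQuot.quo (hq.hasQuo r.isGMap_base)} {a₁ : (f.quoK hq).tot}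
    {b₁ : (g.quoK hq).tot} (ha : (f.quoK hq).proj a₁ = r.quow₀₁ hq w₁)
    (hb : (g.quoK hq).proj b₁ = r.quow₁₂ hq w₁) :
    ∃ w a b, r.qW hq w = w₁ ∧ f.qK hq a = a₁ ∧ g.qK hq b = b₁ ∧ f.K.proj a = r.w₀₁ w ∧
      g.K.proj b = r.w₁₂ w := by
  obtain ⟨w, rfl⟩ := (r.isQuo_qW hq).principal.surjective w₁
  obtain ⟨a, ea, rfl⟩ := (f.isQuo_qK hq).exists_lift hq (x := a₁)
    (by rw [ha, (r.isQuo_qW hq).comm w])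
  obtain ⟨b, eb, rfl⟩ := (g.isQuo_qK hq).exists_lift hq (x := b₁)
    (by rw [hb, quo_base₁₂, (r.isQuo_qW hq).comm w])
  exact ⟨w, a, b, rfl, rfl, rfl, (proj_eq_iff hq ea).1 ha, (proj_eq_iff₁₂ hq eb).1 hb⟩

theorem exists_quoβ (w₁ : GerbeQuot.quo (hq.hasQuo r.isGMap_base)) (a₁ : (f.quoK hq).tot)
    (b₁ : (g.quoK hq).tot) (ha : (f.quoK hq).proj a₁ = r.quow₀₁ hq w₁)
    (hb : (g.quoK hq).proj b₁ = r.quow₁₂ hq w₁) :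
    ∃ m, ∀ w a b, r.qW hq w = w₁ → f.qK hq a = a₁ → g.qK hq b = b₁ → ∀ ha hb,
      m = h.qK hq (r.β w a b ha hb) := by
  obtain ⟨w, a, b, rfl, rfl, rfl, ea, eb⟩ := exists_lift_β hq ha hb
  refine ⟨h.qK hq (r.β w a b ea eb), fun w' a' b' hw ha hb ea' eb' => ?_⟩
  obtain ⟨γ, rfl⟩ := (r.isQuo_qW hq).principal.exists_act hw.symm
  obtain rfl := (f.isQuo_qK hq).act_eq hq (g := γ)
    (by rw [ea', (r.isQuo_qW hq).map.equivariant γ w, ea]) ha.symm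
  obtain rfl := (g.isQuo_qK hq).act_eq hq (g := γ)
    (by rw [eb', r.base₁₂, (r.isQuo_qW hq).map.equivariant γ w, eb, r.base₁₂]) hb.symm
  rw [r.β_act γ w a b ea eb, (h.isQuo_qK hq).mk_act]

variable (r) in
/-- The isomorphism `β/G`. -/
def quoβ (w₁ : GerbeQuot.quo (hq.hasQuo r.isGMap_base)) (a₁ : (f.quoK hq).tot)
    (b₁ : (g.quoK hq).tot) (ha : (f.quoK hq).proj a₁ = r.quow₀₁ hq w₁)
    (hb : (g.quoK hq).proj b₁ = r.quow₁₂ hq w₁) : (h.quoK hq).tot :=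
  (exists_quoβ hq w₁ a₁ b₁ ha hb).choose

theorem quoβ_eq {w : r.W} {a : f.K.tot} {b : g.K.tot} (ha hb)
    {w₁ : GerbeQuot.quo (hq.hasQuo r.isGMap_base)} {a₁ : (f.quoK hq).tot} {b₁ : (g.quoK hq).tot}
    (hw : r.qW hq w = w₁) (ea : f.qK hq a = a₁) (eb : g.qK hq b = b₁) (ha₁ hb₁) :
    r.quoβ hq w₁ a₁ b₁ ha₁ hb₁ = h.qK hq (r.β w a b ha hb) :=
  (exists_quoβ hq w₁ a₁ b₁ ha₁ hb₁).choose_spec w a b hw ea eb ha hb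

theorem exists_lift_family_β {T : Mfd.{u}} {w₁ : T → GerbeQuot.quo (hq.hasQuo r.isGMap_base)}
    {a₁ : T → (f.quoK hq).tot} {b₁ : T → (g.quoK hq).tot}
    (ha : ∀ t, (f.quoK hq).proj (a₁ t) = r.quow₀₁ hq (w₁ t))
    (hb : ∀ t, (g.quoK hq).proj (b₁ t) = r.quow₁₂ hq (w₁ t))
    (sw : Smooth w₁) (sa : Smooth a₁) (sb : Smooth b₁) {c : T → P} (hc : Smooth c)
    (hcb : ∀ t, q (c t) = 𝓛.quoπ hq (f.quoζ₁ hq (r.quow₀₁ hq (w₁ t)))) :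
    ∃ (w : T → r.W) (a : T → f.K.tot) (b : T → g.K.tot), Smooth w ∧ Smooth a ∧ Smooth b ∧
      (∀ t, r.qW hq (w t) = w₁ t) ∧ (∀ t, f.qK hq (a t) = a₁ t) ∧ (∀ t, g.qK hq (b t) = b₁ t) ∧
      (∀ t, 𝓛.π (f.ζ₁ (f.K.proj (a t))) = c t) ∧ (∀ t, 𝓛'.π (g.ζ₁ (g.K.proj (b t))) = c t) ∧
      (∀ t, f.K.proj (a t) = r.w₀₁ (w t)) ∧ ∀ t, g.K.proj (b t) = r.w₁₂ (w t) := by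
  obtain ⟨w, hws, hwf, hwm⟩ := (r.isQuo_qW hq).exists_lift_family hq hc sw hcb
  obtain ⟨a, has, haf, ham⟩ := (f.isQuo_qK hq).exists_lift_family hq hc sa
    (fun t => by rw [hcb, ← ha])
  obtain ⟨b, hbs, hbf, hbm⟩ := (g.isQuo_qK hq).exists_lift_family hq hc sb
    (fun t => by rw [hcb, hb, quo_base₁₂])
  exact ⟨w, a, b, hws, has, hbs, hwm, ham, hbm, haf, hbf, fun t =>
    (proj_eq_iff hq ((haf t).trans (hwf t).symm)).1 (by rw [ham, hwm, ha]), fun t =>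
    (proj_eq_iff₁₂ hq ((hbf t).trans (hwf t).symm)).1 (by rw [hbm, hwm, hb])⟩

variable (r)

/-- The quotient `(W/G, β/G)`. -/
def quo : TriRep (f.quo hq) (g.quo hq) (h.quo hq) where
  W := GerbeQuot.quo (hq.hasQuo r.isGMap_base)
  w₀₁ := r.quow₀₁ hq
  w₁₂ := r.quow₁₂ hq
  w₀₂ := r.quow₀₂ hq
  w₀₁_map := isGMap_triv (smooth_quoMap _ _ r.w₀₁_map)
  w₁₂_map := isGMap_triv (smooth_quoMap _ _ r.w₁₂_map)
  w₀₂_map := isGMap_triv (smooth_quoMap _ _ r.w₀₂_map)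
  comm₀ := fun w => by
    obtain ⟨w, rfl⟩ := (r.isQuo_qW hq).principal.surjective w
    rw [quow₀₁_mk, quow₀₂_mk]
    exact (f.quoζ₁_mk hq _).trans ((congr_arg _ (r.comm₀ w)).trans (h.quoζ₁_mk hq _).symm)
  comm₁ := fun w => by
    obtain ⟨w, rfl⟩ := (r.isQuo_qW hq).principal.surjective w
    rw [quow₀₁_mk, quow₁₂_mk]
    exact (f.quoζ₂_mk hq _).trans ((congr_arg _ (r.comm₁ w)).trans (g.quoζ₁_mk hq _).symm)
  comm₂ := fun w => by
    obtain ⟨w, rfl⟩ := (r.isQuo_qW hq).principal.surjective w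
    rw [quow₁₂_mk, quow₀₂_mk]
    exact (g.quoζ₂_mk hq _).trans ((congr_arg _ (r.comm₂ w)).trans (h.quoζ₂_mk hq _).symm)
  surjective := fun z₀₁ z₁₂ z₀₂ e₀ e₁ e₂ => by
    obtain ⟨z₀₁, rfl⟩ := (f.isQuo_qZ hq).principal.surjective z₀₁
    have hb := (f.isQuo_qZ hq).comm z₀₁
    obtain ⟨z₀₂, hz₀₂, rfl⟩ := (h.isQuo_qZ hq).exists_lift hq (x := z₀₂)
      (hb.symm.trans (congr_arg (𝓛.quoπ hq) e₀))
    obtain ⟨z₁₂, hz₁₂, rfl⟩ := (g.isQuo_qZ hq).exists_lift hq (x := z₁₂)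
      (hb.symm.trans ((f.quo_comm hq _).trans (congr_arg (𝓛'.quoπ hq) e₁)))
    replace e₀ := ((f.quoζ₁_mk hq z₀₁).symm.trans e₀).trans (h.quoζ₁_mk hq z₀₂)
    replace e₁ := ((f.quoζ₂_mk hq z₀₁).symm.trans e₁).trans (g.quoζ₁_mk hq z₁₂)
    replace e₂ := ((g.quoζ₂_mk hq z₁₂).symm.trans e₂).trans (h.quoζ₂_mk hq z₀₂)
    obtain ⟨w, rfl, rfl, rfl⟩ := r.surjective z₀₁ z₁₂ z₀₂
      ((𝓛.isQuo_qY hq).eq_of_eq hq hz₀₂.symm e₀)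
      ((𝓛'.isQuo_qY hq).eq_of_eq hq (by rw [← f.comm, hz₁₂]) e₁)
      ((𝓛''.isQuo_qY hq).eq_of_eq hq (by rw [← g.comm, ← h.comm, hz₁₂, hz₀₂]) e₂)
    exact ⟨r.qW hq w, r.quow₀₁_mk hq w, r.quow₁₂_mk hq w, r.quow₀₂_mk hq w⟩
  submersion := fun w a₀₁ a₁₂ a₀₂ e₀ e₁ e₂ => by
    obtain ⟨w, rfl⟩ := (r.isQuo_qW hq).principal.surjective w
    change D (f.quoζ₁ hq) (r.quow₀₁ hq (r.qW hq w)) a₀₁ =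
      D (h.quoζ₁ hq) (r.quow₀₂ hq (r.qW hq w)) a₀₂ at e₀
    change D (f.quoζ₂ hq) (r.quow₀₁ hq (r.qW hq w)) a₀₁ =
      D (g.quoζ₁ hq) (r.quow₁₂ hq (r.qW hq w)) a₁₂ at e₁
    change D (g.quoζ₂ hq) (r.quow₁₂ hq (r.qW hq w)) a₁₂ =
      D (h.quoζ₂ hq) (r.quow₀₂ hq (r.qW hq w)) a₀₂ at e₂
    rw [quow₀₁_mk, quow₀₂_mk] at e₀
    rw [quow₀₁_mk, quow₁₂_mk] at e₁
    rw [quow₁₂_mk, quow₀₂_mk] at e₂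
    obtain ⟨a, rfl⟩ := (f.isQuo_qZ hq).principal.submersion (r.w₀₁ w) a₀₁
    obtain ⟨a', ha', rfl⟩ := exists_lift_tangent_over (𝓛.isQuo_qY hq).principal
      (f.isQuo_qZ hq).principal (h.isQuo_qZ hq).principal f.ζ₁_map h.ζ₁_map (f.quoζ₁_mk hq)
      (h.quoζ₁_mk hq) (r.comm₀ w) a a₀₂ e₀
    obtain ⟨b, hb, rfl⟩ := exists_lift_tangent_over (𝓛'.isQuo_qY hq).principal
      (f.isQuo_qZ hq).principal (g.isQuo_qZ hq).principal f.ζ₂_map g.ζ₁_map (f.quoζ₂_mk hq)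
      (g.quoζ₁_mk hq) (r.comm₁ w) a a₁₂ e₁
    rw [Hom.D_quoζ₂, Hom.D_quoζ₂] at e₂
    obtain ⟨c, rfl, rfl, rfl⟩ := r.submersion w a b a' ha' hb
      ((𝓛''.isQuo_qY hq).D_eq_D hq g.ζ₂_map h.ζ₂_map (r.comm₂ w) (by
        rw [← g.base_eq, ← h.base_eq, D_comp 𝓛.cover.smooth h.ζ₁_map.smooth, ← ha', ← r.comm₀,
          ← D_comp 𝓛.cover.smooth f.ζ₁_map.smooth, f.base_eq,
          D_comp 𝓛'.cover.smooth f.ζ₂_map.smooth, hb, r.comm₁,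
          ← D_comp 𝓛'.cover.smooth g.ζ₁_map.smooth]) e₂)
    exact ⟨D (r.qW hq) w c, D_quoMap _ _ r.w₀₁_map w c, D_quoMap _ _ r.w₁₂_map w c,
      D_quoMap _ _ r.w₀₂_map w c⟩
  β := r.quoβ hq
  β_proj := fun w a b ha hb => by
    obtain ⟨w, a, b, rfl, rfl, rfl, ea, eb⟩ := exists_lift_β hq ha hb
    rw [quoβ_eq hq ea eb rfl rfl rfl ha hb]
    exact (h.proj_qK hq _).trans
      ((congr_arg _ (r.β_proj w a b ea eb)).trans (r.quow₀₂_mk hq w).symm)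
  β_circ_left := fun c w a b ha hb h₁ => by
    obtain ⟨w, a, b, rfl, rfl, rfl, ea, eb⟩ := exists_lift_β hq ha hb
    rw [quoβ_eq hq ea eb rfl rfl rfl ha hb]
    refine (quoβ_eq hq (by rw [f.K.principal.proj_act, ea]) eb rfl (f.circ_qK hq c a).symm rfl
      h₁ hb).trans ?_
    rw [r.β_circ_left c w a b ea eb]
    exact (h.circ_qK hq _ _).symm
  β_circ_right := fun c w a b ha hb h₁ => by
    obtain ⟨w, a, b, rfl, rfl, rfl, ea, eb⟩ := exists_lift_β hq ha hb
    rw [quoβ_eq hq ea eb rfl rfl rfl ha hb]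
    refine (quoβ_eq hq ea (by rw [g.K.principal.proj_act, eb]) rfl rfl (g.circ_qK hq c b).symm
      ha h₁).trans ?_
    rw [r.β_circ_right c w a b ea eb]
    exact (h.circ_qK hq _ _).symm
  β_act := fun γ w a b ha hb h₁ h₂ => by
    simp only [GMfd.trivialGrp_act]
    exact (GMfd.trivialGrp_act _ γ _).symm
  β_smooth := fun T w₁ a₁ b₁ ha hb sw sa sb => by
    apply smooth_of_restr
    intro t₀
    obtain ⟨U, t', c, ht', hc, hcb⟩ := exists_lift_family hq.smooth_proj hq.surjective hq.submersion
      (((r.isQuo_qW hq).smooth_base hq).comp sw) t₀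
    obtain ⟨w, a, b, hws, has, hbs, hwm, ham, hbm, -, -, ea, eb⟩ :=
      exists_lift_family_β hq (fun t => ha (T.incl U t)) (fun t => hb (T.incl U t))
        (sw.comp (smooth_incl T U)) (sa.comp (smooth_incl T U)) (sb.comp (smooth_incl T U)) hc hcb
    refine ⟨U, t', ht', ?_⟩
    have e₁ : (fun t => r.quoβ hq (w₁ (T.incl U t)) (a₁ (T.incl U t)) (b₁ (T.incl U t))
        (ha (T.incl U t)) (hb (T.incl U t))) =
        fun t => h.qK hq (r.β (w t) (a t) (b t) (ea t) (eb t)) := by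
      funext t; exact quoβ_eq hq (ea t) (eb t) (hwm t) (ham t) (hbm t) _ _
    rw [e₁]
    exact (h.isQuo_qK hq).smooth_mk.comp (r.β_smooth _ w a b ea eb hws has hbs)
  β_α := fun w w' l a' a b' b ha' hb' ha hb h₁ h₂ h₃ h₄ h₅ h₆ => by
    obtain ⟨l, rfl⟩ := (𝓛.isQuo_qL hq).principal.surjective l
    have hl := (𝓛.isQuo_qL hq).comm l
    obtain ⟨a, pa, rfl⟩ := (f.isQuo_qK hq).exists_lift hq (x := a)
      (p := 𝓛.π (𝓛.fst (𝓛.L.proj l))) (by rw [← hl]; exact congr_arg _ h₃)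
    have e₃ := (Hom.fst_eq_iff hq pa.symm).1 h₃
    obtain ⟨a', pa', rfl⟩ := (f.isQuo_qK hq).exists_lift hq (x := a')
      (p := 𝓛.π (𝓛.fst (𝓛.L.proj l))) (by
        rw [← hl, ← Gerbe.quoπ_quoSnd]; exact congr_arg _ h₄)
    have e₄ := (Hom.snd_eq_iff hq pa'.symm).1 h₄
    obtain ⟨w, pw, rfl⟩ := (r.isQuo_qW hq).exists_lift hq (x := w)
      (p := 𝓛.π (𝓛.fst (𝓛.L.proj l))) (by
        rw [← pa, ← (f.isQuo_qK hq).comm]; exact congr_arg (fun x => 𝓛.quoπ hq (f.quoζ₁ hq x)) ha)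
    have ea := (proj_eq_iff hq (pa.trans pw.symm)).1 ha
    obtain ⟨w', pw', rfl⟩ := (r.isQuo_qW hq).exists_lift hq (x := w')
      (p := 𝓛.π (𝓛.fst (𝓛.L.proj l))) (by
        rw [← pa', ← (f.isQuo_qK hq).comm]
        exact congr_arg (fun x => 𝓛.quoπ hq (f.quoζ₁ hq x)) ha')
    have ea' := (proj_eq_iff hq (pa'.trans pw'.symm)).1 ha'
    obtain ⟨b, pb, rfl⟩ := (g.isQuo_qK hq).exists_lift hq (x := b)
      (p := 𝓛.π (𝓛.fst (𝓛.L.proj l))) (by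
        rw [← pw, ← (r.isQuo_qW hq).comm, ← quo_base₁₂]
        exact congr_arg (fun x => 𝓛'.quoπ hq (g.quoζ₁ hq x)) hb.symm)
    have eb := (proj_eq_iff₁₂ hq (pb.trans pw.symm)).1 hb
    obtain ⟨b', pb', rfl⟩ := (g.isQuo_qK hq).exists_lift hq (x := b')
      (p := 𝓛.π (𝓛.fst (𝓛.L.proj l))) (by
        rw [← pw', ← (r.isQuo_qW hq).comm, ← quo_base₁₂]
        exact congr_arg (fun x => 𝓛'.quoπ hq (g.quoζ₁ hq x)) hb'.symm)
    have eb' := (proj_eq_iff₁₂ hq (pb'.trans pw'.symm)).1 hb'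
    refine (Hom.quoα_eq hq (by rw [r.β_proj, e₃, ← r.comm₀, ea])
      (by rw [r.β_proj, e₄, ← r.comm₀, ea']) rfl (quoβ_eq hq ea' eb' rfl rfl rfl ha' hb').symm
      (quoβ_eq hq ea eb rfl rfl rfl ha hb).symm h₁ h₂).trans
      (Eq.trans ?_ (Hom.quoα_eq hq (by rw [f.α_fst, ea, r.comm₁, eb])
        (by rw [f.α_snd, ea', r.comm₁, eb'])
        (Hom.quoα_eq hq e₃ e₄ rfl rfl rfl h₃ h₄).symm rfl rfl h₅ h₆).symm)
    rw [r.β_α w w' l a' a b' b ea' eb' ea eb _ _ e₃ e₄]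

end TriRep

namespace UnitRep

variable {g : Hom 𝓛 𝓛} (r : UnitRep g)

theorem isGMap_base : IsGMap (fun w => 𝓛.π (𝓛.fst (r.w₁ w))) := 𝓛.isGMap_base₂.comp r.w₁_map

theorem base₂ (w : r.W) : 𝓛.π (g.ζ₁ (r.w₂ w)) = 𝓛.π (𝓛.fst (r.w₁ w)) := by rw [r.comm₁]

/-- The projection `W → W/G`. -/
def qW : r.W → GerbeQuot.quo (hq.hasQuo r.isGMap_base) := quoMk _

/-- The map induced by `w₁` on quotients. -/
def quow₁ : GerbeQuot.quo (hq.hasQuo r.isGMap_base) → GerbeQuot.quo (hq.hasQuo 𝓛.isGMap_base₂) :=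
  quoMap _ _ r.w₁

/-- The map induced by `w₂` on quotients. -/
def quow₂ : GerbeQuot.quo (hq.hasQuo r.isGMap_base) → GerbeQuot.quo (hq.hasQuo g.isGMap_base) :=
  quoMap _ _ r.w₂

theorem quow₁_mk (w : r.W) : r.quow₁ hq (r.qW hq w) = 𝓛.qY₂ hq (r.w₁ w) :=
  quoMap_mk _ _ r.w₁_map.equivariant w

theorem quow₂_mk (w : r.W) : r.quow₂ hq (r.qW hq w) = g.qZ hq (r.w₂ w) :=
  quoMap_mk _ _ r.w₂_map.equivariant w

theorem isQuo_qW : IsQuo q (fun w => 𝓛.π (𝓛.fst (r.w₁ w))) (r.qW hq)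
    (fun x => 𝓛.quoπ hq (𝓛.quoFst hq (r.quow₁ hq x))) :=
  (𝓛.isQuo_qY₂ hq).of_map r.w₁_map (quo_principal _) (r.quow₁_mk hq)

variable {r}

theorem proj_eq_iff {w : r.W} {k : 𝓛.L.tot}
    (e : 𝓛.π (𝓛.fst (𝓛.L.proj k)) = 𝓛.π (𝓛.fst (r.w₁ w))) :
    (𝓛.quoL hq).proj (𝓛.qL hq k) = r.quow₁ hq (r.qW hq w) ↔ 𝓛.L.proj k = r.w₁ w := by
  rw [Gerbe.proj_qL, quow₁_mk]
  exact (𝓛.isQuo_qY₂ hq).eq_iff hq e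

theorem exists_lift_β {w₁ : GerbeQuot.quo (hq.hasQuo r.isGMap_base)} {k₁ : (𝓛.quoL hq).tot}
    (h : (𝓛.quoL hq).proj k₁ = r.quow₁ hq w₁) :
    ∃ w k, r.qW hq w = w₁ ∧ 𝓛.qL hq k = k₁ ∧ 𝓛.L.proj k = r.w₁ w := by
  obtain ⟨w, rfl⟩ := (r.isQuo_qW hq).principal.surjective w₁
  obtain ⟨k, hk, rfl⟩ := (𝓛.isQuo_qL hq).exists_lift hq (x := k₁)
    (by rw [h, (r.isQuo_qW hq).comm w])
  exact ⟨w, k, rfl, rfl, (proj_eq_iff hq hk).1 h⟩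

theorem exists_quoβ (w₁ : GerbeQuot.quo (hq.hasQuo r.isGMap_base)) (k₁ : (𝓛.quoL hq).tot)
    (h : (𝓛.quoL hq).proj k₁ = r.quow₁ hq w₁) :
    ∃ m, ∀ w k, r.qW hq w = w₁ → 𝓛.qL hq k = k₁ → ∀ h, m = g.qK hq (r.β w k h) := by
  obtain ⟨w, k, rfl, rfl, e⟩ := exists_lift_β hq h
  refine ⟨g.qK hq (r.β w k e), fun w' k' hw hk e' => ?_⟩
  obtain ⟨γ, rfl⟩ := (r.isQuo_qW hq).principal.exists_act hw.symm
  obtain rfl := (𝓛.isQuo_qL hq).act_eq hq (g := γ)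
    (by rw [e', (r.isQuo_qW hq).map.equivariant γ w, e]) hk.symm
  rw [r.β_act γ w k e, (g.isQuo_qK hq).mk_act]

variable (r) in
/-- The isomorphism `β/G`. -/
def quoβ (w₁ : GerbeQuot.quo (hq.hasQuo r.isGMap_base)) (k₁ : (𝓛.quoL hq).tot)
    (h : (𝓛.quoL hq).proj k₁ = r.quow₁ hq w₁) : (g.quoK hq).tot :=
  (exists_quoβ hq w₁ k₁ h).choose

theorem quoβ_eq {w : r.W} {k : 𝓛.L.tot} (h) {w₁ : GerbeQuot.quo (hq.hasQuo r.isGMap_base)}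
    {k₁ : (𝓛.quoL hq).tot} (hw : r.qW hq w = w₁) (hk : 𝓛.qL hq k = k₁) (h₁) :
    r.quoβ hq w₁ k₁ h₁ = g.qK hq (r.β w k h) :=
  (exists_quoβ hq w₁ k₁ h₁).choose_spec w k hw hk h

theorem exists_lift_family_β {T : Mfd.{u}} {w₁ : T → GerbeQuot.quo (hq.hasQuo r.isGMap_base)}
    {k₁ : T → (𝓛.quoL hq).tot} (h : ∀ t, (𝓛.quoL hq).proj (k₁ t) = r.quow₁ hq (w₁ t))
    (hw : Smooth w₁) (hk : Smooth k₁) {c : T → P} (hc : Smooth c)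
    (hcb : ∀ t, q (c t) = 𝓛.quoπ hq (𝓛.quoFst hq (r.quow₁ hq (w₁ t)))) :
    ∃ (w : T → r.W) (k : T → 𝓛.L.tot), Smooth w ∧ Smooth k ∧ (∀ t, r.qW hq (w t) = w₁ t) ∧
      (∀ t, 𝓛.qL hq (k t) = k₁ t) ∧ (∀ t, 𝓛.π (𝓛.fst (𝓛.L.proj (k t))) = c t) ∧
      ∀ t, 𝓛.L.proj (k t) = r.w₁ (w t) := by
  obtain ⟨w, hws, hwf, hwm⟩ := (r.isQuo_qW hq).exists_lift_family hq hc hw hcb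
  obtain ⟨k, hks, hkf, hkm⟩ := (𝓛.isQuo_qL hq).exists_lift_family hq hc hk
    (fun t => by rw [hcb, ← h])
  exact ⟨w, k, hws, hks, hwm, hkm, hkf, fun t =>
    (proj_eq_iff hq ((hkf t).trans (hwf t).symm)).1 (by rw [hkm, hwm, h])⟩

variable (r)

/-- The quotient `(W/G, β/G)`. -/
def quo : UnitRep (g.quo hq) where
  W := GerbeQuot.quo (hq.hasQuo r.isGMap_base)
  w₁ := r.quow₁ hq
  w₂ := r.quow₂ hq
  w₁_map := isGMap_triv (smooth_quoMap _ _ r.w₁_map)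
  w₂_map := isGMap_triv (smooth_quoMap _ _ r.w₂_map)
  comm₁ := fun w => by
    obtain ⟨w, rfl⟩ := (r.isQuo_qW hq).principal.surjective w
    rw [quow₁_mk, quow₂_mk]
    exact (𝓛.quoFst_mk hq _).trans ((congr_arg _ (r.comm₁ w)).trans (g.quoζ₁_mk hq _).symm)
  comm₂ := fun w => by
    obtain ⟨w, rfl⟩ := (r.isQuo_qW hq).principal.surjective w
    rw [quow₁_mk, quow₂_mk]
    exact (𝓛.quoSnd_mk hq _).trans ((congr_arg _ (r.comm₂ w)).trans (g.quoζ₂_mk hq _).symm)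
  surjective := fun z z₁ e e' => by
    obtain ⟨z, rfl⟩ := (𝓛.isQuo_qY₂ hq).principal.surjective z
    obtain ⟨z₁, hz, rfl⟩ := (g.isQuo_qZ hq).exists_lift hq (x := z₁)
      (((𝓛.isQuo_qY₂ hq).comm z).symm.trans (congr_arg (𝓛.quoπ hq) e))
    have e₁ := ((𝓛.quoFst_mk hq z).symm.trans e).trans (g.quoζ₁_mk hq z₁)
    have e₂ := ((𝓛.quoSnd_mk hq z).symm.trans e').trans (g.quoζ₂_mk hq z₁)
    obtain ⟨w, rfl, rfl⟩ := r.surjective z z₁ ((𝓛.isQuo_qY hq).eq_of_eq hq hz.symm e₁)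
      ((𝓛.isQuo_qY hq).eq_of_eq hq (by rw [← 𝓛.square.comm, ← g.comm, hz]) e₂)
    exact ⟨r.qW hq w, r.quow₁_mk hq w, r.quow₂_mk hq w⟩
  submersion := fun w a a₁ e e' => by
    obtain ⟨w, rfl⟩ := (r.isQuo_qW hq).principal.surjective w
    change D (𝓛.quoFst hq) (r.quow₁ hq (r.qW hq w)) a =
      D (g.quoζ₁ hq) (r.quow₂ hq (r.qW hq w)) a₁ at e
    change D (𝓛.quoSnd hq) (r.quow₁ hq (r.qW hq w)) a =
      D (g.quoζ₂ hq) (r.quow₂ hq (r.qW hq w)) a₁ at e'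
    rw [quow₁_mk, quow₂_mk] at e e'
    obtain ⟨a, rfl⟩ := (𝓛.isQuo_qY₂ hq).principal.submersion (r.w₁ w) a
    obtain ⟨a₁, ha, rfl⟩ := exists_lift_tangent_over (𝓛.isQuo_qY hq).principal
      (𝓛.isQuo_qY₂ hq).principal (g.isQuo_qZ hq).principal 𝓛.square.fst_map g.ζ₁_map
      (𝓛.quoFst_mk hq) (g.quoζ₁_mk hq) (r.comm₁ w) a a₁ e
    rw [D_descend (𝓛.isQuo_qY hq).principal (𝓛.isQuo_qY₂ hq).principal 𝓛.square.snd_map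
      (𝓛.quoSnd_mk hq), Hom.D_quoζ₂] at e'
    have hb : (fun y => 𝓛.π (𝓛.snd y)) = fun y => 𝓛.π (𝓛.fst y) :=
      funext fun y => (𝓛.square.comm y).symm
    obtain ⟨c, rfl, rfl⟩ := r.submersion w a a₁ ha
      ((𝓛.isQuo_qY hq).D_eq_D hq 𝓛.square.snd_map g.ζ₂_map (r.comm₂ w) (by
        rw [hb, ← g.base_eq, D_comp 𝓛.cover.smooth 𝓛.square.fst_map.smooth,
          D_comp 𝓛.cover.smooth g.ζ₁_map.smooth, ha, r.comm₁]) e')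
    exact ⟨D (r.qW hq) w c, D_quoMap _ _ r.w₁_map w c, D_quoMap _ _ r.w₂_map w c⟩
  β := r.quoβ hq
  β_proj := fun w k h => by
    obtain ⟨w, k, rfl, rfl, e⟩ := exists_lift_β hq h
    rw [quoβ_eq hq e rfl rfl h]
    exact (g.proj_qK hq _).trans ((congr_arg _ (r.β_proj w k e)).trans (r.quow₂_mk hq w).symm)
  β_circ := fun c w k h h₁ => by
    obtain ⟨w, k, rfl, rfl, e⟩ := exists_lift_β hq h
    rw [quoβ_eq hq e rfl rfl h]
    refine (quoβ_eq hq (by rw [𝓛.L.principal.proj_act, e]) rfl (𝓛.circ_qL hq c k).symm h₁).trans ?_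
    rw [r.β_circ c w k e]
    exact (g.circ_qK hq _ _).symm
  β_act := fun γ w k h h₁ => by
    simp only [GMfd.trivialGrp_act]
    exact (GMfd.trivialGrp_act _ γ _).symm
  β_smooth := fun T w₁ k₁ h hw hk => by
    apply smooth_of_restr
    intro t₀
    obtain ⟨U, t', c, ht', hc, hcb⟩ := exists_lift_family hq.smooth_proj hq.surjective hq.submersion
      (((r.isQuo_qW hq).smooth_base hq).comp hw) t₀
    obtain ⟨w, k, hws, hks, hwm, hkm, -, e⟩ := exists_lift_family_β hq (fun t => h (T.incl U t))
      (hw.comp (smooth_incl T U)) (hk.comp (smooth_incl T U)) hc hcb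
    refine ⟨U, t', ht', ?_⟩
    have e₁ : (fun t => r.quoβ hq (w₁ (T.incl U t)) (k₁ (T.incl U t)) (h (T.incl U t))) =
        fun t => g.qK hq (r.β (w t) (k t) (e t)) := by
      funext t; exact quoβ_eq hq (e t) (hwm t) (hkm t) _
    rw [e₁]
    exact (g.isQuo_qK hq).smooth_mk.comp (r.β_smooth _ w k e hws hks)
  β_α := fun w w' l k' k m hk' hk h₁ h₂ h₃ h₄ hμ => by
    obtain ⟨l, rfl⟩ := (𝓛.isQuo_qL hq).principal.surjective l
    have hb := (𝓛.isQuo_qL hq).comm l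
    obtain ⟨k', ek', rfl⟩ := (𝓛.isQuo_qL hq).exists_lift hq (x := k')
      (p := 𝓛.π (𝓛.fst (𝓛.L.proj l))) (by
        rw [← hb, ← Gerbe.quoπ_quoSnd]; exact congr_arg _ h₃)
    have e₃ := (Gerbe.composable_iff hq ek'.symm).1 h₃
    obtain ⟨k, ek, rfl⟩ := (𝓛.isQuo_qL hq).exists_lift hq (x := k)
      (p := 𝓛.π (𝓛.fst (𝓛.L.proj l))) (by
        rw [← hb]
        have h₅ := congr_arg (fun x => 𝓛.quoπ hq (𝓛.quoFst hq ((𝓛.quoL hq).proj x))) hμ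
        exact (congr_arg (𝓛.quoπ hq) ((𝓛.quo hq).μ_fst _ _ h₃)).symm.trans
          (h₅.trans (congr_arg (𝓛.quoπ hq) ((𝓛.quo hq).μ_fst _ _ h₄))))
    obtain ⟨m, em, rfl⟩ := (𝓛.isQuo_qL hq).exists_lift hq (x := m)
      (p := 𝓛.π (𝓛.fst (𝓛.L.proj l))) (by
        rw [← ek, ← (𝓛.isQuo_qL hq).comm, ← Gerbe.quoπ_quoSnd]; exact congr_arg _ h₄)
    have e₄ := (Gerbe.composable_iff hq (ek.trans em.symm)).1 h₄
    obtain ⟨w, ew, rfl⟩ := (r.isQuo_qW hq).exists_lift hq (x := w)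
      (p := 𝓛.π (𝓛.fst (𝓛.L.proj l))) (by
        rw [← ek, ← (𝓛.isQuo_qL hq).comm]
        exact congr_arg (fun x => 𝓛.quoπ hq (𝓛.quoFst hq x)) hk)
    have e := (proj_eq_iff hq (ek.trans ew.symm)).1 hk
    obtain ⟨w', ew', rfl⟩ := (r.isQuo_qW hq).exists_lift hq (x := w')
      (p := 𝓛.π (𝓛.fst (𝓛.L.proj l))) (by
        rw [← ek', ← (𝓛.isQuo_qL hq).comm]
        exact congr_arg (fun x => 𝓛.quoπ hq (𝓛.quoFst hq x)) hk')
    have e' := (proj_eq_iff hq (ek'.trans ew'.symm)).1 hk'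
    have eμ : 𝓛.μ l k' e₃ = 𝓛.μ k m e₄ := by
      apply (𝓛.isQuo_qL hq).eq_of_eq hq
      · rw [𝓛.μ_fst, 𝓛.μ_fst, ek]
      · exact (Gerbe.quoμ_eq hq e₃ rfl rfl h₃).symm.trans
          (Eq.trans hμ (Gerbe.quoμ_eq hq e₄ rfl rfl h₄))
    have ef : 𝓛.fst (𝓛.L.proj l) = 𝓛.fst (𝓛.L.proj k) := by
      rw [← 𝓛.μ_fst l k' e₃, eμ, 𝓛.μ_fst]
    refine (Hom.quoα_eq hq (by rw [r.β_proj, ← r.comm₁, ← e, ef])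
      (by rw [r.β_proj, e₃, ← r.comm₁, e']) rfl (quoβ_eq hq e' rfl rfl hk').symm
      (quoβ_eq hq e rfl rfl hk).symm h₁ h₂).trans ?_
    rw [r.β_α w w' l k' k m e' e _ _ e₃ e₄ eμ]

end UnitRep

end QuoTri

/-! ### The quotient functor -/

section QuoFunctor

variable {G : LieGrp.{v}} {P : GMfd.{v, u} G} {X : Mfd.{u}}

theorem IsGCover.quoMap {N N' : GMfd.{v, u} G} {F : N → N'} (hF : IsGCover F) (h : HasQuo N)
    (h' : HasQuo N') : IsGCover (quoMap h h' F) where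
  toIsGMap := isGMap_triv (smooth_quoMap h h' hF.toIsGMap)
  surjective := fun x => by
    obtain ⟨y, rfl⟩ := (quo_principal h').surjective x
    obtain ⟨n, rfl⟩ := hF.surjective y
    exact ⟨quoMk h n, quoMap_mk h h' hF.equivariant n⟩
  submersion := fun y c => by
    obtain ⟨n, rfl⟩ := (quo_principal h).surjective y
    obtain ⟨b, rfl⟩ := (quo_principal h').submersion (F n) c
    obtain ⟨a, rfl⟩ := hF.submersion n b
    exact ⟨_, D_quoMap h h' hF.toIsGMap n a⟩

variable {q : P → X.triv} (hq : IsPrincipal G (P := P.toMfd) (X := X.triv.toMfd) P.act q)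
  {𝓛 𝓛' 𝓛'' : Gerbe P}

namespace TwoRep

variable {f g : Hom 𝓛 𝓛'}

theorem quo_base₂ (r : TwoRep f g) (x) : 𝓛.quoπ hq (g.quoζ₁ hq (r.quow₂ hq x)) =
    𝓛.quoπ hq (f.quoζ₁ hq (r.quow₁ hq x)) := by
  obtain ⟨w, rfl⟩ := (r.isQuo_qW hq).principal.surjective x
  rw [(r.isQuo_qW hq).comm, quow₂_mk, (g.isQuo_qZ hq).comm, r.base₂]

theorem Rel.quo {r s : TwoRep f g} (h : r.Rel s) : (r.quo hq).Rel (s.quo hq) := by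
  obtain ⟨V, p, p₁, hp, hp₁, h₁, h₂, hβ⟩ := h
  have hV : HasQuo V := hq.hasQuo (r.isGMap_base.comp hp.toIsGMap)
  have e : ∀ x, quoMap hV (hq.hasQuo r.isGMap_base) p (quoMk hV x) = r.qW hq (p x) :=
    quoMap_mk _ _ hp.equivariant
  have e₁ : ∀ x, quoMap hV (hq.hasQuo s.isGMap_base) p₁ (quoMk hV x) = s.qW hq (p₁ x) :=
    quoMap_mk _ _ hp₁.equivariant
  have hV' := (r.isQuo_qW hq).of_map hp.toIsGMap (quo_principal hV) e
  refine ⟨GerbeQuot.quo hV, quoMap hV (hq.hasQuo r.isGMap_base) p,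
    quoMap hV (hq.hasQuo s.isGMap_base) p₁, hp.quoMap _ _, hp₁.quoMap _ _, fun x => ?_, fun x => ?_,
    fun x k hk hk' => ?_⟩
  · obtain ⟨x, rfl⟩ := (quo_principal hV).surjective x
    rw [e, e₁]
    exact (r.quow₁_mk hq _).trans ((congr_arg _ (h₁ x)).trans (s.quow₁_mk hq _).symm)
  · obtain ⟨x, rfl⟩ := (quo_principal hV).surjective x
    rw [e, e₁]
    exact (r.quow₂_mk hq _).trans ((congr_arg _ (h₂ x)).trans (s.quow₂_mk hq _).symm)
  · obtain ⟨x, rfl⟩ := (quo_principal hV).surjective x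
    have hx := (f.proj_qK hq)
    obtain ⟨k, pk, rfl⟩ := (f.isQuo_qK hq).exists_lift hq (x := k) (p := 𝓛.π (f.ζ₁ (r.w₁ (p x))))
      (((hV').comm x).symm.trans (congr_arg (fun x => 𝓛.quoπ hq (f.quoζ₁ hq x)) hk.symm))
    have ek := (proj_eq_iff hq pk).1 (hk.trans (congr_arg (r.quow₁ hq) (e x)))
    refine (quoβ_eq hq ek (e x).symm rfl hk).trans (Eq.trans ?_
      (quoβ_eq hq (by rw [ek, h₁]) (e₁ x).symm rfl hk').symm)
    rw [hβ x k ek]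

end TwoRep

namespace TriRep

variable {f : Hom 𝓛 𝓛'} {g : Hom 𝓛' 𝓛''} {h : Hom 𝓛 𝓛''}

theorem quo_base₀₂ (r : TriRep f g h) (x) : 𝓛.quoπ hq (h.quoζ₁ hq (r.quow₀₂ hq x)) =
    𝓛.quoπ hq (f.quoζ₁ hq (r.quow₀₁ hq x)) := by
  obtain ⟨w, rfl⟩ := (r.isQuo_qW hq).principal.surjective x
  rw [(r.isQuo_qW hq).comm, quow₀₂_mk, (h.isQuo_qZ hq).comm, r.base₀₂]

theorem Rel.quo {r s : TriRep f g h} (H : r.Rel s) : (r.quo hq).Rel (s.quo hq) := by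
  obtain ⟨V, p, p₁, hp, hp₁, h₀, h₁, h₂, hβ⟩ := H
  have hV : HasQuo V := hq.hasQuo (r.isGMap_base.comp hp.toIsGMap)
  have e : ∀ x, quoMap hV (hq.hasQuo r.isGMap_base) p (quoMk hV x) = r.qW hq (p x) :=
    quoMap_mk _ _ hp.equivariant
  have e₁ : ∀ x, quoMap hV (hq.hasQuo s.isGMap_base) p₁ (quoMk hV x) = s.qW hq (p₁ x) :=
    quoMap_mk _ _ hp₁.equivariant
  have hV' := (r.isQuo_qW hq).of_map hp.toIsGMap (quo_principal hV) e
  refine ⟨GerbeQuot.quo hV, quoMap hV (hq.hasQuo r.isGMap_base) p,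
    quoMap hV (hq.hasQuo s.isGMap_base) p₁, hp.quoMap _ _, hp₁.quoMap _ _, fun x => ?_, fun x => ?_,
    fun x => ?_, fun x a b ha hb ha' hb' => ?_⟩
  · obtain ⟨x, rfl⟩ := (quo_principal hV).surjective x
    rw [e, e₁]
    exact (r.quow₀₁_mk hq _).trans ((congr_arg _ (h₀ x)).trans (s.quow₀₁_mk hq _).symm)
  · obtain ⟨x, rfl⟩ := (quo_principal hV).surjective x
    rw [e, e₁]
    exact (r.quow₁₂_mk hq _).trans ((congr_arg _ (h₁ x)).trans (s.quow₁₂_mk hq _).symm)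
  · obtain ⟨x, rfl⟩ := (quo_principal hV).surjective x
    rw [e, e₁]
    exact (r.quow₀₂_mk hq _).trans ((congr_arg _ (h₂ x)).trans (s.quow₀₂_mk hq _).symm)
  · obtain ⟨x, rfl⟩ := (quo_principal hV).surjective x
    obtain ⟨a, pa, rfl⟩ := (f.isQuo_qK hq).exists_lift hq (x := a) (p := 𝓛.π (f.ζ₁ (r.w₀₁ (p x))))
      ((hV'.comm x).symm.trans (congr_arg (fun x => 𝓛.quoπ hq (f.quoζ₁ hq x)) ha.symm))
    have ea := (proj_eq_iff hq pa).1 (ha.trans (congr_arg (r.quow₀₁ hq) (e x)))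
    obtain ⟨b, pb, rfl⟩ := (g.isQuo_qK hq).exists_lift hq (x := b) (p := 𝓛.π (f.ζ₁ (r.w₀₁ (p x))))
      ((hV'.comm x).symm.trans ((r.quo_base₁₂ hq _).symm.trans
        (congr_arg (fun x => 𝓛'.quoπ hq (g.quoζ₁ hq x)) hb.symm)))
    have eb := (proj_eq_iff₁₂ hq pb).1 (hb.trans (congr_arg (r.quow₁₂ hq) (e x)))
    refine (quoβ_eq hq ea eb (e x).symm rfl rfl ha hb).trans (Eq.trans ?_
      (quoβ_eq hq (by rw [ea, h₀]) (by rw [eb, h₁]) (e₁ x).symm rfl rfl ha' hb').symm)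
    rw [hβ x a b ea eb]

end TriRep

namespace UnitRep

variable {g : Hom 𝓛 𝓛}

theorem quo_base₂ (r : UnitRep g) (x) : 𝓛.quoπ hq (g.quoζ₁ hq (r.quow₂ hq x)) =
    𝓛.quoπ hq (𝓛.quoFst hq (r.quow₁ hq x)) := by
  obtain ⟨w, rfl⟩ := (r.isQuo_qW hq).principal.surjective x
  rw [(r.isQuo_qW hq).comm, quow₂_mk, (g.isQuo_qZ hq).comm, r.base₂]

theorem Rel.quo {r s : UnitRep g} (h : r.Rel s) : (r.quo hq).Rel (s.quo hq) := by
  obtain ⟨V, p, p₁, hp, hp₁, h₁, h₂, hβ⟩ := h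
  have hV : HasQuo V := hq.hasQuo (r.isGMap_base.comp hp.toIsGMap)
  have e : ∀ x, quoMap hV (hq.hasQuo r.isGMap_base) p (quoMk hV x) = r.qW hq (p x) :=
    quoMap_mk _ _ hp.equivariant
  have e₁ : ∀ x, quoMap hV (hq.hasQuo s.isGMap_base) p₁ (quoMk hV x) = s.qW hq (p₁ x) :=
    quoMap_mk _ _ hp₁.equivariant
  have hV' := (r.isQuo_qW hq).of_map hp.toIsGMap (quo_principal hV) e
  refine ⟨GerbeQuot.quo hV, quoMap hV (hq.hasQuo r.isGMap_base) p,
    quoMap hV (hq.hasQuo s.isGMap_base) p₁, hp.quoMap _ _, hp₁.quoMap _ _, fun x => ?_, fun x => ?_,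
    fun x k hk hk' => ?_⟩
  · obtain ⟨x, rfl⟩ := (quo_principal hV).surjective x
    rw [e, e₁]
    exact (r.quow₁_mk hq _).trans ((congr_arg _ (h₁ x)).trans (s.quow₁_mk hq _).symm)
  · obtain ⟨x, rfl⟩ := (quo_principal hV).surjective x
    rw [e, e₁]
    exact (r.quow₂_mk hq _).trans ((congr_arg _ (h₂ x)).trans (s.quow₂_mk hq _).symm)
  · obtain ⟨x, rfl⟩ := (quo_principal hV).surjective x
    obtain ⟨k, pk, rfl⟩ := (𝓛.isQuo_qL hq).exists_lift hq (x := k)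
      (p := 𝓛.π (𝓛.fst (r.w₁ (p x))))
      ((hV'.comm x).symm.trans (congr_arg (fun x => 𝓛.quoπ hq (𝓛.quoFst hq x)) hk.symm))
    have ek := (proj_eq_iff hq pk).1 (hk.trans (congr_arg (r.quow₁ hq) (e x)))
    refine (quoβ_eq hq ek (e x).symm rfl hk).trans (Eq.trans ?_
      (quoβ_eq hq (by rw [ek, h₁]) (e₁ x).symm rfl hk').symm)
    rw [hβ x k ek]

end UnitRep

/-- The quotient of a 2-morphism. -/
def Two.quo {f g : Hom 𝓛 𝓛'} (J : Two f g) : Two (f.quo hq) (g.quo hq) :=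
  Quot.map (TwoRep.quo hq) (fun _ _ => TwoRep.Rel.quo hq) J

/-- The quotient of a 2-morphism out of a composite. -/
def Tri.quo {f : Hom 𝓛 𝓛'} {g : Hom 𝓛' 𝓛''} {h : Hom 𝓛 𝓛''} (T : Tri f g h) :
    Tri (f.quo hq) (g.quo hq) (h.quo hq) :=
  Quot.map (TriRep.quo hq) (fun _ _ => TriRep.Rel.quo hq) T

/-- The quotient of a 2-morphism out of an identity. -/
def UnitCell.quo {g : Hom 𝓛 𝓛} (U : UnitCell g) : UnitCell (g.quo hq) :=
  Quot.map (UnitRep.quo hq) (fun _ _ => UnitRep.Rel.quo hq) U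

theorem IsIdTwo.quo {f : Hom 𝓛 𝓛'} {J : Two f f} (h : IsIdTwo J) : IsIdTwo (J.quo hq) := by
  obtain ⟨r, rfl, H⟩ := h
  refine ⟨r.quo hq, rfl, fun w k h e => ?_⟩
  obtain ⟨w, k, rfl, rfl, ek⟩ := TwoRep.exists_lift_β hq h
  have e' : r.w₁ w = r.w₂ w := (f.isQuo_qZ hq).eq_of_eq hq (r.base₂ w).symm
    ((r.quow₁_mk hq w).symm.trans (Eq.trans e (r.quow₂_mk hq w)))
  exact (TwoRep.quoβ_eq hq ek rfl rfl h).trans (by rw [H w k ek e'])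

theorem IsVComp.quo {f₁ f₂ f₃ : Hom 𝓛 𝓛'} {J₁₂ : Two f₁ f₂} {J₂₃ : Two f₂ f₃} {J₁₃ : Two f₁ f₃}
    (h : IsVComp J₁₂ J₂₃ J₁₃) : IsVComp (J₁₂.quo hq) (J₂₃.quo hq) (J₁₃.quo hq) := by
  obtain ⟨r, s, t, rfl, rfl, rfl, H⟩ := h
  refine ⟨r.quo hq, s.quo hq, t.quo hq, rfl, rfl, rfl, fun w₁ w₂ w₃ e₁ e₂ e₃ k h h₁ h₂ => ?_⟩
  obtain ⟨w₁, k, rfl, rfl, ek⟩ := TwoRep.exists_lift_β hq h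
  have hb := (r.isQuo_qW hq).comm w₁
  obtain ⟨w₂, p₂, rfl⟩ := (s.isQuo_qW hq).exists_lift hq (x := w₂)
    (hb.symm.trans ((r.quo_base₂ hq _).symm.trans
      (congr_arg (fun x => 𝓛.quoπ hq (f₂.quoζ₁ hq x)) e₂)))
  obtain ⟨w₃, p₃, rfl⟩ := (t.isQuo_qW hq).exists_lift hq (x := w₃)
    (hb.symm.trans (congr_arg (fun x => 𝓛.quoπ hq (f₁.quoζ₁ hq x)) e₁))
  have c₁ : r.w₁ w₁ = t.w₁ w₃ := (f₁.isQuo_qZ hq).eq_of_eq hq p₃.symm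
    ((r.quow₁_mk hq _).symm.trans (Eq.trans e₁ (t.quow₁_mk hq _)))
  have c₂ : r.w₂ w₁ = s.w₁ w₂ := (f₂.isQuo_qZ hq).eq_of_eq hq (by rw [r.base₂, p₂])
    ((r.quow₂_mk hq _).symm.trans (Eq.trans e₂ (s.quow₁_mk hq _)))
  have c₃ : s.w₂ w₂ = t.w₂ w₃ := (f₃.isQuo_qZ hq).eq_of_eq hq (by rw [s.base₂, t.base₂, p₂, p₃])
    ((s.quow₂_mk hq _).symm.trans (Eq.trans e₃ (t.quow₂_mk hq _)))
  refine (TwoRep.quoβ_eq hq (by rw [r.β_proj, c₂]) rfl (TwoRep.quoβ_eq hq ek rfl rfl h).symm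
    h₁).trans (Eq.trans ?_ (TwoRep.quoβ_eq hq (by rw [ek, c₁]) rfl rfl h₂).symm)
  rw [H w₁ w₂ w₃ c₁ c₂ c₃ k ek]

theorem IsNatural.quo {f f' : Hom 𝓛 𝓛'} {g g' : Hom 𝓛' 𝓛''} {h h' : Hom 𝓛 𝓛''}
    {J₁ : Two f f'} {J₂ : Two g g'} {J₃ : Two h h'} {T : Tri f g h} {T' : Tri f' g' h'}
    (H : IsNatural J₁ J₂ J₃ T T') :
    IsNatural (J₁.quo hq) (J₂.quo hq) (J₃.quo hq) (T.quo hq) (T'.quo hq) := by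
  obtain ⟨r₁, r₂, r₃, t, t', rfl, rfl, rfl, rfl, rfl, H⟩ := H
  refine ⟨r₁.quo hq, r₂.quo hq, r₃.quo hq, t.quo hq, t'.quo hq, rfl, rfl, rfl, rfl, rfl,
    fun w₁ w₂ w₃ w w' e₁ e₂ e₃ e₁' e₂' e₃' a b ha hb ha' hb' h₁ h₂ h₃ => ?_⟩
  obtain ⟨w, a, b, rfl, rfl, rfl, ea, eb⟩ := TriRep.exists_lift_β hq ha' hb'
  have hp := ((t.isQuo_qW hq).comm w).symm
  obtain ⟨w₁, p₁, rfl⟩ := (r₁.isQuo_qW hq).exists_lift hq (x := w₁)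
    (hp.trans (congr_arg (fun x => 𝓛.quoπ hq (f.quoζ₁ hq x)) (Eq.symm e₁)))
  obtain ⟨w₂, p₂, rfl⟩ := (r₂.isQuo_qW hq).exists_lift hq (x := w₂)
    (hp.trans ((t.quo_base₁₂ hq _).symm.trans
      (congr_arg (fun x => 𝓛'.quoπ hq (g.quoζ₁ hq x)) (Eq.symm e₂))))
  obtain ⟨w₃, p₃, rfl⟩ := (r₃.isQuo_qW hq).exists_lift hq (x := w₃)
    (hp.trans ((t.quo_base₀₂ hq _).symm.trans
      (congr_arg (fun x => 𝓛.quoπ hq (h.quoζ₁ hq x)) (Eq.symm e₃))))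
  obtain ⟨w', p', rfl⟩ := (t'.isQuo_qW hq).exists_lift hq (x := w')
    (p₁.symm ▸ ((r₁.isQuo_qW hq).comm w₁).symm.trans ((r₁.quo_base₂ hq _).symm.trans
      (congr_arg (fun x => 𝓛.quoπ hq (f'.quoζ₁ hq x)) e₁')))
  have c₁ : r₁.w₁ w₁ = t.w₀₁ w := (f.isQuo_qZ hq).eq_of_eq hq p₁
    ((r₁.quow₁_mk hq _).symm.trans (Eq.trans e₁ (t.quow₀₁_mk hq _)))
  have c₂ : r₂.w₁ w₂ = t.w₁₂ w := (g.isQuo_qZ hq).eq_of_eq hq (by rw [p₂, t.base₁₂])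
    ((r₂.quow₁_mk hq _).symm.trans (Eq.trans e₂ (t.quow₁₂_mk hq _)))
  have c₃ : r₃.w₁ w₃ = t.w₀₂ w := (h.isQuo_qZ hq).eq_of_eq hq (by rw [p₃, t.base₀₂])
    ((r₃.quow₁_mk hq _).symm.trans (Eq.trans e₃ (t.quow₀₂_mk hq _)))
  have c₁' : r₁.w₂ w₁ = t'.w₀₁ w' := (f'.isQuo_qZ hq).eq_of_eq hq (by rw [r₁.base₂, p₁, p'])
    ((r₁.quow₂_mk hq _).symm.trans (Eq.trans e₁' (t'.quow₀₁_mk hq _)))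
  have c₂' : r₂.w₂ w₂ = t'.w₁₂ w' := (g'.isQuo_qZ hq).eq_of_eq hq
    (by rw [r₂.base₂, p₂, t'.base₁₂, p'])
    ((r₂.quow₂_mk hq _).symm.trans (Eq.trans e₂' (t'.quow₁₂_mk hq _)))
  have c₃' : r₃.w₂ w₃ = t'.w₀₂ w' := (h'.isQuo_qZ hq).eq_of_eq hq
    (by rw [r₃.base₂, p₃, t'.base₀₂, p'])
    ((r₃.quow₂_mk hq _).symm.trans (Eq.trans e₃' (t'.quow₀₂_mk hq _)))
  refine (TriRep.quoβ_eq hq (by rw [r₁.β_proj, c₁']) (by rw [r₂.β_proj, c₂']) rfl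
    (TwoRep.quoβ_eq hq (by rw [ea, c₁]) rfl rfl ha).symm
    (TwoRep.quoβ_eq hq (by rw [eb, c₂]) rfl rfl hb).symm h₁ h₂).trans (Eq.trans ?_
    (TwoRep.quoβ_eq hq (by rw [t.β_proj, c₃]) rfl
      (TriRep.quoβ_eq hq ea eb rfl rfl rfl ha' hb').symm h₃).symm)
  rw [H w₁ w₂ w₃ w w' c₁ c₂ c₃ c₁' c₂' c₃' a b _ _ ea eb]

theorem IsTet.quo {𝓛₀ 𝓛₁ 𝓛₂ 𝓛₃ : Gerbe P} {f₀₁ : Hom 𝓛₀ 𝓛₁} {f₁₂ : Hom 𝓛₁ 𝓛₂}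
    {f₂₃ : Hom 𝓛₂ 𝓛₃} {f₀₂ : Hom 𝓛₀ 𝓛₂} {f₁₃ : Hom 𝓛₁ 𝓛₃} {f₀₃ : Hom 𝓛₀ 𝓛₃}
    {T₀₁₂ : Tri f₀₁ f₁₂ f₀₂} {T₀₂₃ : Tri f₀₂ f₂₃ f₀₃} {T₁₂₃ : Tri f₁₂ f₂₃ f₁₃}
    {T₀₁₃ : Tri f₀₁ f₁₃ f₀₃} (H : IsTet T₀₁₂ T₀₂₃ T₁₂₃ T₀₁₃) :
    IsTet (T₀₁₂.quo hq) (T₀₂₃.quo hq) (T₁₂₃.quo hq) (T₀₁₃.quo hq) := by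
  obtain ⟨r, s, t, o, rfl, rfl, rfl, rfl, H⟩ := H
  refine ⟨r.quo hq, s.quo hq, t.quo hq, o.quo hq, rfl, rfl, rfl, rfl,
    fun wr ws wt wo e₁ e₂ e₃ e₄ e₅ e₆ a b c h₁ h₂ h₃ h₄ h₅ h₆ h₇ h₈ => ?_⟩
  obtain ⟨wr, a, b, rfl, rfl, rfl, ea, eb⟩ := TriRep.exists_lift_β hq h₁ h₂
  have hp := ((r.isQuo_qW hq).comm wr).symm
  obtain ⟨wo, po, rfl⟩ := (o.isQuo_qW hq).exists_lift hq (x := wo)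
    (hp.trans (congr_arg (fun x => 𝓛₀.quoπ hq (f₀₁.quoζ₁ hq x)) e₁))
  obtain ⟨wt, pt, rfl⟩ := (t.isQuo_qW hq).exists_lift hq (x := wt)
    (hp.trans ((r.quo_base₁₂ hq _).symm.trans
      (congr_arg (fun x => 𝓛₁.quoπ hq (f₁₂.quoζ₁ hq x)) e₂)))
  obtain ⟨ws, ps, rfl⟩ := (s.isQuo_qW hq).exists_lift hq (x := ws)
    (hp.trans ((r.quo_base₀₂ hq _).symm.trans
      (congr_arg (fun x => 𝓛₀.quoπ hq (f₀₂.quoζ₁ hq x)) e₄)))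
  obtain ⟨c, pc, rfl⟩ := (f₂₃.isQuo_qK hq).exists_lift hq (x := c)
    (ps.symm ▸ ((s.isQuo_qW hq).comm ws).symm.trans ((s.quo_base₁₂ hq _).symm.trans
      (congr_arg (fun x => 𝓛₂.quoπ hq (f₂₃.quoζ₁ hq x)) (Eq.symm h₄))))
  have ec := (TriRep.proj_eq_iff₁₂ hq (pc.trans ps.symm)).1 h₄
  have c₁ : r.w₀₁ wr = o.w₀₁ wo := (f₀₁.isQuo_qZ hq).eq_of_eq hq po.symm
    ((r.quow₀₁_mk hq _).symm.trans (Eq.trans e₁ (o.quow₀₁_mk hq _)))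
  have c₂ : r.w₁₂ wr = t.w₀₁ wt := (f₁₂.isQuo_qZ hq).eq_of_eq hq (by rw [r.base₁₂, pt])
    ((r.quow₁₂_mk hq _).symm.trans (Eq.trans e₂ (t.quow₀₁_mk hq _)))
  have c₃ : s.w₁₂ ws = t.w₁₂ wt := (f₂₃.isQuo_qZ hq).eq_of_eq hq
    (by rw [s.base₁₂, t.base₁₂, ps, pt])
    ((s.quow₁₂_mk hq _).symm.trans (Eq.trans e₃ (t.quow₁₂_mk hq _)))
  have c₄ : r.w₀₂ wr = s.w₀₁ ws := (f₀₂.isQuo_qZ hq).eq_of_eq hq (by rw [r.base₀₂, ps])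
    ((r.quow₀₂_mk hq _).symm.trans (Eq.trans e₄ (s.quow₀₁_mk hq _)))
  have c₅ : t.w₀₂ wt = o.w₁₂ wo := (f₁₃.isQuo_qZ hq).eq_of_eq hq
    (by rw [t.base₀₂, o.base₁₂, pt, po])
    ((t.quow₀₂_mk hq _).symm.trans (Eq.trans e₅ (o.quow₁₂_mk hq _)))
  have c₆ : s.w₀₂ ws = o.w₀₂ wo := (f₀₃.isQuo_qZ hq).eq_of_eq hq
    (by rw [s.base₀₂, o.base₀₂, ps, po])
    ((s.quow₀₂_mk hq _).symm.trans (Eq.trans e₆ (o.quow₀₂_mk hq _)))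
  refine (TriRep.quoβ_eq hq (by rw [r.β_proj, c₄]) ec rfl
    (TriRep.quoβ_eq hq ea eb rfl rfl rfl h₁ h₂).symm rfl h₃ h₄).trans (Eq.trans ?_
    (TriRep.quoβ_eq hq (by rw [ea, c₁]) (by rw [t.β_proj, c₅]) rfl rfl
      (TriRep.quoβ_eq hq (by rw [eb, c₂]) (by rw [ec, c₃]) rfl rfl rfl h₅ h₆).symm h₇ h₈).symm)
  rw [H wr ws wt wo c₁ c₂ c₃ c₄ c₅ c₆ a b c ea eb]

theorem IsUnitComp.quo {e e₁ : Hom 𝓛 𝓛} {U : UnitCell e} {J : Two e e₁} {U₁ : UnitCell e₁}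
    (H : IsUnitComp U J U₁) : IsUnitComp (U.quo hq) (J.quo hq) (U₁.quo hq) := by
  obtain ⟨s, r, t, rfl, rfl, rfl, H⟩ := H
  refine ⟨s.quo hq, r.quo hq, t.quo hq, rfl, rfl, rfl, fun w₁ w₂ w₃ e₁ e₂ e₃ k h h₁ h₂ => ?_⟩
  obtain ⟨w₁, k, rfl, rfl, ek⟩ := UnitRep.exists_lift_β hq h
  have hp := ((s.isQuo_qW hq).comm w₁).symm
  obtain ⟨w₂, p₂, rfl⟩ := (r.isQuo_qW hq).exists_lift hq (x := w₂)
    (hp.trans ((s.quo_base₂ hq _).symm.trans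
      (congr_arg (fun x => 𝓛.quoπ hq (e.quoζ₁ hq x)) e₂)))
  obtain ⟨w₃, p₃, rfl⟩ := (t.isQuo_qW hq).exists_lift hq (x := w₃)
    (hp.trans (congr_arg (fun x => 𝓛.quoπ hq (𝓛.quoFst hq x)) e₁))
  have c₁ : s.w₁ w₁ = t.w₁ w₃ := (𝓛.isQuo_qY₂ hq).eq_of_eq hq p₃.symm
    ((s.quow₁_mk hq _).symm.trans (Eq.trans e₁ (t.quow₁_mk hq _)))
  have c₂ : s.w₂ w₁ = r.w₁ w₂ := (e.isQuo_qZ hq).eq_of_eq hq (by rw [s.base₂, p₂])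
    ((s.quow₂_mk hq _).symm.trans (Eq.trans e₂ (r.quow₁_mk hq _)))
  have c₃ : r.w₂ w₂ = t.w₂ w₃ := (Hom.isQuo_qZ hq _).eq_of_eq hq
    (by rw [r.base₂, t.base₂, p₂, p₃])
    ((r.quow₂_mk hq _).symm.trans (Eq.trans e₃ (t.quow₂_mk hq _)))
  refine (TwoRep.quoβ_eq hq (by rw [s.β_proj, c₂]) rfl (UnitRep.quoβ_eq hq ek rfl rfl h).symm
    h₁).trans (Eq.trans ?_ (UnitRep.quoβ_eq hq (by rw [ek, c₁]) rfl rfl h₂).symm)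
  rw [H w₁ w₂ w₃ c₁ c₂ c₃ k ek]

theorem IsRightUnit.quo {e : Hom 𝓛 𝓛} {f f₁ : Hom 𝓛 𝓛'} {U : UnitCell e} {T : Tri e f f₁}
    {J : Two f f₁} (H : IsRightUnit U T J) : IsRightUnit (U.quo hq) (T.quo hq) (J.quo hq) := by
  obtain ⟨s, t, r, rfl, rfl, rfl, H⟩ := H
  refine ⟨s.quo hq, t.quo hq, r.quo hq, rfl, rfl, rfl,
    fun w w' w₁ e₁ e₂ l k k' h h₁ h₂ h₃ h₄ h₅ hm hμ => ?_⟩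
  obtain ⟨w, l, rfl, rfl, el⟩ := UnitRep.exists_lift_β hq h₂
  have hp := ((s.isQuo_qW hq).comm w).symm
  have hl := ((𝓛.isQuo_qL hq).comm l).symm
  have pl : 𝓛.π (𝓛.fst (𝓛.L.proj l)) = 𝓛.π (𝓛.fst (s.w₁ w)) := by rw [el]
  obtain ⟨k, pk, rfl⟩ := (f.isQuo_qK hq).exists_lift hq (x := k)
    (hl.trans ((𝓛.quoπ_quoSnd hq _).symm.trans (congr_arg (𝓛.quoπ hq) h₁)))
  obtain ⟨k', pk', rfl⟩ := (f.isQuo_qK hq).exists_lift hq (x := k')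
    (hl.trans (congr_arg (𝓛.quoπ hq) h))
  have d := (Hom.fst_eq_iff hq pk'.symm).1 h
  have d₁ := (Hom.snd_eq_iff hq pk.symm).1 h₁
  obtain ⟨w', pw', rfl⟩ := (t.isQuo_qW hq).exists_lift hq (x := w')
    (hp.trans ((s.quo_base₂ hq _).symm.trans
      (congr_arg (fun x => 𝓛.quoπ hq (e.quoζ₁ hq x)) e₁)))
  have d₄ := (TriRep.proj_eq_iff₁₂ hq ((pk.trans pl).trans pw'.symm)).1 h₄
  obtain ⟨w₁, pw₁, rfl⟩ := (r.isQuo_qW hq).exists_lift hq (x := w₁)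
    (p := 𝓛.π (f.ζ₁ (f.K.proj k'))) (((f.isQuo_qK hq).comm k').symm.trans
      (congr_arg (fun x => 𝓛.quoπ hq (f.quoζ₁ hq x)) h₅))
  have d₅ := (TwoRep.proj_eq_iff hq pw₁.symm).1 h₅
  have c₁ : s.w₂ w = t.w₀₁ w' := (e.isQuo_qZ hq).eq_of_eq hq (by rw [s.base₂, pw'])
    ((s.quow₂_mk hq _).symm.trans (Eq.trans e₁ (t.quow₀₁_mk hq _)))
  have c₂ : t.w₀₂ w' = r.w₂ w₁ := (f₁.isQuo_qZ hq).eq_of_eq hq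
    (by rw [t.base₀₂, r.base₂, pw', pw₁, pk', pl])
    ((t.quow₀₂_mk hq _).symm.trans (Eq.trans e₂ (r.quow₂_mk hq _)))
  have eα := Hom.quoα_eq hq d d₁ rfl rfl rfl h h₁
  have dm : 𝓛'.snd (𝓛'.L.proj (f.α l k k' d d₁)) = 𝓛'.fst (𝓛'.L.proj (f.α l k k' d d₁)) := by
    refine (Gerbe.composable_iff hq rfl).1 ?_
    rw [← eα]
    exact hm
  have dμ : 𝓛'.μ _ _ dm = f.α l k k' d d₁ := by
    apply (𝓛'.isQuo_qL hq).eq_of_eq hq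
    · rw [𝓛'.μ_fst]
    · exact (Gerbe.quoμ_eq hq dm eα.symm eα.symm hm).symm.trans (Eq.trans hμ eα)
  refine (TriRep.quoβ_eq hq (by rw [s.β_proj, c₁]) d₄ rfl
    (UnitRep.quoβ_eq hq el rfl rfl h₂).symm rfl h₃ h₄).trans
    (Eq.trans ?_ (TwoRep.quoβ_eq hq d₅ rfl rfl h₅).symm)
  rw [H w w' w₁ c₁ c₂ l k k' d d₁ el _ d₄ d₅ dm dμ]

theorem IsLeftUnit.quo {e : Hom 𝓛' 𝓛'} {f f₁ : Hom 𝓛 𝓛'} {U : UnitCell e} {T : Tri f e f₁}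
    {J : Two f f₁} (H : IsLeftUnit U T J) : IsLeftUnit (U.quo hq) (T.quo hq) (J.quo hq) := by
  obtain ⟨s, t, r, rfl, rfl, rfl, H⟩ := H
  refine ⟨s.quo hq, t.quo hq, r.quo hq, rfl, rfl, rfl,
    fun w w' w₁ e₁ e₂ m k k' l h h₁ h₂ h₃ h₄ h₅ hm hμ hα => ?_⟩
  obtain ⟨m, rfl⟩ := (𝓛.isQuo_qL hq).principal.surjective m
  have hp := ((𝓛.isQuo_qL hq).comm m).symm
  obtain ⟨k, pk, rfl⟩ := (f.isQuo_qK hq).exists_lift hq (x := k)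
    (hp.trans (congr_arg (𝓛.quoπ hq) h))
  obtain ⟨k', pk', rfl⟩ := (f.isQuo_qK hq).exists_lift hq (x := k')
    (hp.trans ((𝓛.quoπ_quoSnd hq _).symm.trans (congr_arg (𝓛.quoπ hq) h₁)))
  have d := (Hom.fst_eq_iff hq pk.symm).1 h
  have d₁ := (Hom.snd_eq_iff hq pk'.symm).1 h₁
  have eα := Hom.quoα_eq hq d d₁ rfl rfl rfl h h₁
  obtain rfl : 𝓛'.qL hq (f.α m k' k d d₁) = l := eα.symm.trans hα
  have pl : 𝓛'.π (𝓛'.fst (𝓛'.L.proj (f.α m k' k d d₁))) = 𝓛.π (𝓛.fst (𝓛.L.proj m)) := by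
    rw [f.α_fst, ← f.comm, pk]
  obtain ⟨w, pw, rfl⟩ := (s.isQuo_qW hq).exists_lift hq (x := w)
    (((𝓛'.isQuo_qL hq).comm _).symm.trans
      (congr_arg (fun x => 𝓛'.quoπ hq (𝓛'.quoFst hq x)) h₂))
  have el := (UnitRep.proj_eq_iff hq pw.symm).1 h₂
  obtain ⟨w', pw', rfl⟩ := (t.isQuo_qW hq).exists_lift hq (x := w')
    (((f.isQuo_qK hq).comm k).symm.trans (congr_arg (fun x => 𝓛.quoπ hq (f.quoζ₁ hq x)) h₃))
  have d₃ := (TriRep.proj_eq_iff hq pw'.symm).1 h₃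
  obtain ⟨w₁, pw₁, rfl⟩ := (r.isQuo_qW hq).exists_lift hq (x := w₁)
    (((f.isQuo_qK hq).comm k').symm.trans (congr_arg (fun x => 𝓛.quoπ hq (f.quoζ₁ hq x)) h₅))
  have d₅ := (TwoRep.proj_eq_iff hq pw₁.symm).1 h₅
  have c₁ : s.w₂ w = t.w₁₂ w' := (e.isQuo_qZ hq).eq_of_eq hq
    (by rw [s.base₂, t.base₁₂, pw, pw', pl, pk])
    ((s.quow₂_mk hq _).symm.trans (Eq.trans e₁ (t.quow₁₂_mk hq _)))
  have c₂ : t.w₀₂ w' = r.w₂ w₁ := (f₁.isQuo_qZ hq).eq_of_eq hq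
    (by rw [t.base₀₂, r.base₂, pw', pw₁, pk', pk])
    ((t.quow₀₂_mk hq _).symm.trans (Eq.trans e₂ (r.quow₂_mk hq _)))
  have dm : 𝓛.snd (𝓛.L.proj m) = 𝓛.fst (𝓛.L.proj m) := (Gerbe.composable_iff hq rfl).1 hm
  have dμ : 𝓛.μ m m dm = m := by
    apply (𝓛.isQuo_qL hq).eq_of_eq hq
    · rw [𝓛.μ_fst]
    · exact (Gerbe.quoμ_eq hq dm rfl rfl hm).symm.trans hμ
  refine (TriRep.quoβ_eq hq d₃ (by rw [s.β_proj, c₁]) rfl rfl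
    (UnitRep.quoβ_eq hq el rfl rfl h₂).symm h₃ h₄).trans
    (Eq.trans ?_ (TwoRep.quoβ_eq hq d₅ rfl rfl h₅).symm)
  rw [H w w' w₁ c₁ c₂ m k k' _ d d₁ el d₃ _ d₅ dm dμ rfl]

/-- The functor that takes quotients by `G`. -/
def quoFunctor : TwoFunctor (GGrb P) (GGrb X.triv) where
  obj := fun 𝓛 => 𝓛.quo hq
  map := fun f => f.quo hq
  two := fun J => J.quo hq
  tri := fun T => T.quo hq
  unit := fun U => U.quo hq
  isId := fun _ h => h.quo hq
  isVComp := fun _ _ _ h => h.quo hq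
  isNatural := fun _ _ _ _ _ h => h.quo hq
  isTet := fun _ _ _ _ h => h.quo hq
  isUnitComp := fun _ _ _ h => h.quo hq
  isRightUnit := fun _ _ _ h => h.quo hq
  isLeftUnit := fun _ _ _ h => h.quo hq

theorem Two.isTwoQuotient {f g : Hom 𝓛 𝓛'} (J : Two f g) :
    IsTwoQuotient (X := X) (f.homQuotient hq) (g.homQuotient hq) J (J.quo hq) := by
  rintro r rfl
  exact ⟨r.quo hq, rfl, r.qW hq, (r.isQuo_qW hq).principal, r.quow₁_mk hq, r.quow₂_mk hq,
    fun w k h h₁ => TwoRep.quoβ_eq hq h rfl rfl h₁⟩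

theorem Tri.isTriQuotient {f : Hom 𝓛 𝓛'} {g : Hom 𝓛' 𝓛''} {h : Hom 𝓛 𝓛''} (T : Tri f g h) :
    IsTriQuotient (X := X) (f.homQuotient hq) (g.homQuotient hq) (h.homQuotient hq) T
      (T.quo hq) := by
  rintro r rfl
  exact ⟨r.quo hq, rfl, r.qW hq, (r.isQuo_qW hq).principal, r.quow₀₁_mk hq, r.quow₁₂_mk hq,
    r.quow₀₂_mk hq, fun w a b ha hb ha₁ hb₁ => TriRep.quoβ_eq hq ha hb rfl rfl rfl ha₁ hb₁⟩

theorem UnitCell.isUnitQuotient {e : Hom 𝓛 𝓛} (U : UnitCell e) :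
    IsUnitQuotient (X := X) (e.homQuotient hq) U (U.quo hq) := by
  rintro r rfl
  exact ⟨r.quo hq, rfl, r.qW hq, (r.isQuo_qW hq).principal, r.quow₁_mk hq, r.quow₂_mk hq,
    fun w k h h₁ => UnitRep.quoβ_eq hq h rfl rfl h₁⟩

/-- The projections that exhibit `quoFunctor` as the quotient functor. -/
def quotientData : QuotientData (X := X) q (quoFunctor hq) where
  obj := fun 𝓛 => 𝓛.objQuotient hq
  hom := fun f => f.homQuotient hq
  two := fun J => J.isTwoQuotient hq
  tri := fun T => T.isTriQuotient hq
  unit := fun U => U.isUnitQuotient hq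

end QuoFunctor

/-! ### Smooth families of alternating maps -/

section Alternating

variable {V W W' F : Type*} [NormedAddCommGroup V] [NormedSpace ℝ V]
  [NormedAddCommGroup W] [NormedSpace ℝ W] [FiniteDimensional ℝ W]
  [NormedAddCommGroup W'] [NormedSpace ℝ W'] [FiniteDimensional ℝ W']
  [NormedAddCommGroup F] [NormedSpace ℝ F] {k : ℕ}

/-- A family of alternating maps is smooth as soon as its values on constant vectors are: the
values on tuples of basis vectors determine the map, and the reconstruction is linear, hence
continuous in finite dimension. -/
theorem contDiffAt_alternating [FiniteDimensional ℝ F] {f : V → W [⋀^Fin k]→L[ℝ] F} {y : V}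
    (h : ∀ v, ContDiffAt ℝ ∞ (fun z => f z v) y) : ContDiffAt ℝ ∞ f y := by
  let b := Module.finBasis ℝ W
  let ev : (W [⋀^Fin k]→L[ℝ] F) →ₗ[ℝ] ((Fin k → Fin (Module.finrank ℝ W)) → F) :=
    { toFun := fun g r => g (fun i => b (r i))
      map_add' := fun _ _ => rfl
      map_smul' := fun _ _ => rfl }
  have hev : LinearMap.ker ev = ⊥ := by
    refine LinearMap.ker_eq_bot.2 fun g₁ g₂ hg => ?_
    have : (g₁.toAlternatingMap.toMultilinearMap) = g₂.toAlternatingMap.toMultilinearMap :=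
      Module.Basis.ext_multilinear (fun _ => b) fun r => congr_fun hg r
    ext v
    exact congr_arg (fun m : MultilinearMap ℝ (fun _ : Fin k => W) F => m v) this
  obtain ⟨R, hR⟩ := ev.exists_leftInverse_of_injective hev
  let R' : ((Fin k → Fin (Module.finrank ℝ W)) → F) →L[ℝ] (W [⋀^Fin k]→L[ℝ] F) :=
    ⟨R, R.continuous_of_finiteDimensional⟩
  have e : f = fun z => R' (fun r => f z (fun i => b (r i))) := by
    ext1 z
    exact (LinearMap.congr_fun hR (f z)).symm
  rw [e]
  exact R'.contDiff.contDiffAt.comp y (contDiffAt_pi.2 fun r => h _)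

/-- Smooth families of alternating maps may be evaluated on smooth families of vectors. -/
theorem contDiffAt_alternating_apply {f : V → W [⋀^Fin k]→L[ℝ] F} {v : Fin k → V → W} {y : V}
    (hf : ContDiffAt ℝ ∞ f y) (hv : ∀ i, ContDiffAt ℝ ∞ (v i) y) :
    ContDiffAt ℝ ∞ (fun z => f z (fun i => v i z)) y := by
  let b := Module.finBasis ℝ W
  have e : (fun z => f z (fun i => v i z)) = fun z =>
      ∑ r : Fin k → Fin (Module.finrank ℝ W), (∏ i, b.coord (r i) (v i z)) • f z (fun i => b (r i)) := by
    ext1 z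
    conv_lhs => arg 2; ext i; rw [← b.sum_repr (v i z)]
    have h1 := MultilinearMap.map_sum (f z).toAlternatingMap.toMultilinearMap
      (fun i j => b.repr (v i z) j • b j)
    have h2 : ∀ r : Fin k → Fin (Module.finrank ℝ W),
        (f z).toAlternatingMap.toMultilinearMap (fun i => b.repr (v i z) (r i) • b (r i)) =
          (∏ i, b.coord (r i) (v i z)) • f z (fun i => b (r i)) := fun r =>
      (f z).toAlternatingMap.toMultilinearMap.map_smul_univ _ _
    simp only [h2] at h1
    exact h1
  rw [e]
  refine ContDiffAt.sum fun r _ => ContDiffAt.smul (contDiffAt_prod fun i _ => ?_) ?_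
  · let c : W →L[ℝ] ℝ := LinearMap.toContinuousLinearMap (b.coord (r i))
    exact c.contDiff.contDiffAt.comp y (hv i)
  · let c : (W [⋀^Fin k]→L[ℝ] F) →L[ℝ] F := ContinuousAlternatingMap.apply ℝ W F (fun i => b (r i))
    exact c.contDiff.contDiffAt.comp y hf

theorem contDiffAt_alternating_comp [FiniteDimensional ℝ F] {f : V → W [⋀^Fin k]→L[ℝ] F} {g : V → W' →L[ℝ] W} {y : V}
    (hf : ContDiffAt ℝ ∞ f y) (hg : ContDiffAt ℝ ∞ g y) :
    ContDiffAt ℝ ∞ (fun z => (f z).compContinuousLinearMap (g z)) y :=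
  contDiffAt_alternating fun v => contDiffAt_alternating_apply (v := fun i z => g z (v i)) hf
    fun _ => hg.clm_apply contDiffAt_const

theorem contDiffAt_clm [FiniteDimensional ℝ F] {f : V → W →L[ℝ] F} {y : V}
    (h : ∀ v, ContDiffAt ℝ ∞ (fun z => f z v) y) : ContDiffAt ℝ ∞ f y := by
  have h1 : ContDiffAt ℝ ∞ (fun z => ContinuousAlternatingMap.ofSubsingleton ℝ W F (0 : Fin 1) (f z)) y :=
    contDiffAt_alternating fun v => h (v 0)
  exact ((ContinuousAlternatingMap.ofSubsingletonLIE (𝕜 := ℝ) (E := W) (F := F)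
    (0 : Fin 1)).symm.toContinuousLinearEquiv.contDiff.contDiffAt.comp y h1 :)

end Alternating

/-! ### Differential forms -/

section Forms

variable {M : Mfd.{u}} {N : Mfd.{v}} {V : Type*} [NormedAddCommGroup V] [NormedSpace ℝ V]
  {F : Type*} [NormedAddCommGroup F] [NormedSpace ℝ F] {k : ℕ}

/-- The differential of a map from a vector space to a manifold. -/
def plotD (u : V → M) (y : V) : V →L[ℝ] M.E := mfderiv 𝓘(ℝ, V) (𝓡 M.dim) u y

theorem contMDiffAt_symm {x₀ : M} {y : M.E} (hy : y ∈ (extChartAt (𝓡 M.dim) x₀).target) :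
    ContMDiffAt 𝓘(ℝ, M.E) (𝓡 M.dim) ∞ (extChartAt (𝓡 M.dim) x₀).symm y :=
  (contMDiffOn_extChartAt_symm x₀).contMDiffAt ((isOpen_extChartAt_target x₀).mem_nhds hy)

/-- The expression of a plot in the preferred chart around its value at `y₀`. -/
def plotChart (u : V → M) (y₀ y : V) : M.E := extChartAt (𝓡 M.dim) (u y₀) (u y)

theorem contDiffAt_plotChart {u : V → M} {y₀ : V}
    (hu : ContMDiffAt 𝓘(ℝ, V) (𝓡 M.dim) ∞ u y₀) : ContDiffAt ℝ ∞ (plotChart u y₀) y₀ := by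
  rw [← contMDiffAt_iff_contDiffAt]
  exact ContMDiffAt.comp (x := y₀) (contMDiffAt_extChartAt (I := 𝓡 M.dim) (n := ∞)) hu

theorem eventually_plotD {u : V → M} {y₀ : V} (hu : ContMDiffAt 𝓘(ℝ, V) (𝓡 M.dim) ∞ u y₀) :
    ∀ᶠ y in 𝓝 y₀, (extChartAt (𝓡 M.dim) (u y₀)).symm (plotChart u y₀ y) = u y ∧
      plotD u y = (chartD M (u y₀) (plotChart u y₀ y)).comp (fderiv ℝ (plotChart u y₀) y) := by
  have h1 : ∀ᶠ y in 𝓝 y₀, u y ∈ (extChartAt (𝓡 M.dim) (u y₀)).source :=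
    hu.continuousAt.eventually (extChartAt_source_mem_nhds (I := 𝓡 M.dim) (u y₀))
  have h3 : ∀ᶠ y in 𝓝 y₀, ContDiffAt ℝ 1 (plotChart u y₀) y :=
    ((contDiffAt_plotChart hu).of_le (m := 1) (by simp)).eventually (by simp)
  filter_upwards [h1.eventually_nhds, h1, h3] with y hy hy' hd
  have he : u =ᶠ[𝓝 y] fun z => (extChartAt (𝓡 M.dim) (u y₀)).symm (plotChart u y₀ z) := by
    filter_upwards [hy] with z hz
    exact ((extChartAt (𝓡 M.dim) (u y₀)).left_inv hz).symm
  refine ⟨(extChartAt (𝓡 M.dim) (u y₀)).left_inv hy', ?_⟩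
  unfold plotD
  rw [he.mfderiv_eq]
  have hs : MDifferentiableAt 𝓘(ℝ, M.E) (𝓡 M.dim) (extChartAt (𝓡 M.dim) (u y₀)).symm
      (plotChart u y₀ y) :=
    (contMDiffAt_symm ((extChartAt (𝓡 M.dim) (u y₀)).map_source hy')).mdifferentiableAt (by simp)
  have hp : MDifferentiableAt 𝓘(ℝ, V) 𝓘(ℝ, M.E) (plotChart u y₀) y :=
    (hd.differentiableAt (by simp)).mdifferentiableAt
  have := mfderiv_comp (I := 𝓘(ℝ, V)) (I' := 𝓘(ℝ, M.E)) (I'' := 𝓡 M.dim) y hs hp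
  rw [mfderiv_eq_fderiv] at this
  exact this

theorem fderiv_plotChart {u : V → M} {y₀ : V} (hu : ContMDiffAt 𝓘(ℝ, V) (𝓡 M.dim) ∞ u y₀) :
    fderiv ℝ (plotChart u y₀) y₀ = plotD u y₀ := by
  have h := (eventually_plotD hu).self_of_nhds.2
  have h2 : chartD M (u y₀) (plotChart u y₀ y₀) = ContinuousLinearMap.id ℝ M.E :=
    chartD_eq_id M (u y₀)
  rw [h, h2]; rfl

theorem plotD_comp {f : M → N} {u : V → M} {y : V}
    (hf : ContMDiffAt (𝓡 M.dim) (𝓡 N.dim) ∞ f (u y)) (hu : ContMDiffAt 𝓘(ℝ, V) (𝓡 M.dim) ∞ u y) :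
    plotD (fun z => f (u z)) y = (D f (u y)).comp (plotD u y) :=
  mfderiv_comp (I := 𝓘(ℝ, V)) (I' := 𝓡 M.dim) (I'' := 𝓡 N.dim) y
    (hf.mdifferentiableAt (by simp)) (hu.mdifferentiableAt (by simp))

theorem plotD_comp_left {V' : Type*} [NormedAddCommGroup V'] [NormedSpace ℝ V']
    {u : V → M} {w : V' → V} {y : V'} (hu : ContMDiffAt 𝓘(ℝ, V) (𝓡 M.dim) ∞ u (w y))
    (hw : DifferentiableAt ℝ w y) :
    plotD (fun z => u (w z)) y = (plotD u (w y)).comp (fderiv ℝ w y) := by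
  have := mfderiv_comp (I := 𝓘(ℝ, V')) (I' := 𝓘(ℝ, V)) (I'' := 𝓡 M.dim) y
    (hu.mdifferentiableAt (by simp)) hw.mdifferentiableAt
  rw [mfderiv_eq_fderiv] at this
  exact this

theorem minSmoothness_two_le : minSmoothness ℝ 2 ≤ (∞ : WithTop ℕ∞) := by
  rw [minSmoothness_of_isRCLikeNormedField]
  exact WithTop.coe_le_coe.2 (le_top : (2 : ℕ∞) ≤ ⊤)

/-- Families of alternating `k`-linear maps on tangent spaces, with values in `F`. -/
abbrev Form (k : ℕ) (F : Type*) [NormedAddCommGroup F] [NormedSpace ℝ F] (M : Mfd.{u}) :=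
  ∀ _ : M, M.E [⋀^Fin k]→L[ℝ] F

namespace Form

/-- The expression of a form in the preferred chart around `x₀`. -/
def chart (σ : Form k F M) (x₀ : M) (y : M.E) : M.E [⋀^Fin k]→L[ℝ] F :=
  (σ ((extChartAt (𝓡 M.dim) x₀).symm y)).compContinuousLinearMap (chartD M x₀ y)

/-- Smoothness of a form. -/
def IsSmooth (σ : Form k F M) : Prop :=
  ∀ x₀ : M, ∀ y ∈ (extChartAt (𝓡 M.dim) x₀).target, ContDiffAt ℝ ∞ (σ.chart x₀) y

/-- The exterior derivative of a form, computed at each point in the preferred chart there. -/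
def d (σ : Form k F M) : Form (k + 1) F M := fun x =>
  extDeriv (σ.chart x) (extChartAt (𝓡 M.dim) x x)

/-- The pullback of a form along a map from a vector space. -/
def plot (u : V → M) (σ : Form k F M) (y : V) : V [⋀^Fin k]→L[ℝ] F :=
  (σ (u y)).compContinuousLinearMap (plotD u y)

/-- The pullback of a form. -/
def pull (f : N → M) (σ : Form k F M) : Form k F N := fun x =>
  (σ (f x)).compContinuousLinearMap (D f x)

theorem plot_eventuallyEq (σ : Form k F M) {u : V → M} {y₀ : V}
    (hu : ContMDiffAt 𝓘(ℝ, V) (𝓡 M.dim) ∞ u y₀) :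
    σ.plot u =ᶠ[𝓝 y₀] fun y => (σ.chart (u y₀) (plotChart u y₀ y)).compContinuousLinearMap
      (fderiv ℝ (plotChart u y₀) y) := by
  filter_upwards [eventually_plotD hu] with y hy
  unfold plot chart
  rw [hy.1, hy.2]
  rfl

theorem IsSmooth.plot {σ : Form k F M} [FiniteDimensional ℝ V] [FiniteDimensional ℝ F]
    (hσ : σ.IsSmooth) {u : V → M} {y₀ : V} (hu : ContMDiffAt 𝓘(ℝ, V) (𝓡 M.dim) ∞ u y₀) :
    ContDiffAt ℝ ∞ (σ.plot u) y₀ := by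
  refine ContDiffAt.congr_of_eventuallyEq ?_ (σ.plot_eventuallyEq hu)
  have h := contDiffAt_plotChart hu
  exact contDiffAt_alternating_comp (f := fun y => σ.chart (u y₀) (plotChart u y₀ y))
    (ContDiffAt.comp (g := σ.chart (u y₀)) y₀ (hσ (u y₀) _ (mem_extChartAt_target _)) h) (h.fderiv_right (m := ∞) (by simp))

theorem extDeriv_plot {σ : Form k F M} (hσ : σ.IsSmooth) {u : V → M} {y₀ : V}
    (hu : ContMDiffAt 𝓘(ℝ, V) (𝓡 M.dim) ∞ u y₀) :
    extDeriv (σ.plot u) y₀ = σ.d.plot u y₀ := by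
  rw [(σ.plot_eventuallyEq hu).extDeriv_eq]
  have h1 : DifferentiableAt ℝ (σ.chart (u y₀)) (plotChart u y₀ y₀) :=
    (hσ (u y₀) _ (mem_extChartAt_target _)).differentiableAt (by simp)
  have h := extDeriv_pullback h1 (contDiffAt_plotChart hu) minSmoothness_two_le
  rw [h, fderiv_plotChart hu]
  rfl

theorem chart_eq_plot (σ : Form k F M) (x₀ : M) :
    σ.chart x₀ = σ.plot (extChartAt (𝓡 M.dim) x₀).symm := rfl

theorem chart_d {σ : Form k F M} (hσ : σ.IsSmooth) {x₀ : M} {y : M.E}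
    (hy : y ∈ (extChartAt (𝓡 M.dim) x₀).target) : σ.d.chart x₀ y = extDeriv (σ.chart x₀) y := by
  rw [chart_eq_plot, chart_eq_plot, extDeriv_plot hσ (contMDiffAt_symm hy)]

theorem IsSmooth.d {σ : Form k F M} (hσ : σ.IsSmooth) : σ.d.IsSmooth := by
  intro x₀ y hy
  have he : σ.d.chart x₀ =ᶠ[𝓝 y] extDeriv (σ.chart x₀) := by
    filter_upwards [(isOpen_extChartAt_target x₀).mem_nhds hy] with z hz
    exact chart_d hσ hz
  refine ContDiffAt.congr_of_eventuallyEq ?_ he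
  exact (ContinuousAlternatingMap.alternatizeUncurryFinCLM ℝ M.E F).contDiff.contDiffAt.comp y
    ((hσ x₀ y hy).fderiv_right (m := ∞) (by simp))

theorem d_d {σ : Form k F M} (hσ : σ.IsSmooth) (x : M) : σ.d.d x = 0 := by
  have he : σ.d.chart x =ᶠ[𝓝 (extChartAt (𝓡 M.dim) x x)] extDeriv (σ.chart x) := by
    filter_upwards [extChartAt_target_mem_nhds (I := 𝓡 M.dim) x] with z hz
    exact chart_d hσ hz
  refine he.extDeriv_eq.trans ?_
  exact extDeriv_extDeriv_apply (hσ x _ (mem_extChartAt_target x)) minSmoothness_two_le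

theorem chart_pull (σ : Form k F M) {f : N → M} (hf : Smooth f) {x₀ : N} {y : N.E}
    (hy : y ∈ (extChartAt (𝓡 N.dim) x₀).target) :
    (σ.pull f).chart x₀ y = σ.plot (fun z => f ((extChartAt (𝓡 N.dim) x₀).symm z)) y := by
  unfold plot
  rw [plotD_comp (hf.contMDiffAt _) (contMDiffAt_symm hy)]
  rfl

theorem chart_pull_eventuallyEq (σ : Form k F M) {f : N → M} (hf : Smooth f) {x₀ : N} {y : N.E}
    (hy : y ∈ (extChartAt (𝓡 N.dim) x₀).target) :
    (σ.pull f).chart x₀ =ᶠ[𝓝 y] σ.plot (fun z => f ((extChartAt (𝓡 N.dim) x₀).symm z)) := by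
  filter_upwards [(isOpen_extChartAt_target x₀).mem_nhds hy] with z hz
  exact σ.chart_pull hf hz

theorem IsSmooth.pull [FiniteDimensional ℝ F] {σ : Form k F M} (hσ : σ.IsSmooth) {f : N → M}
    (hf : Smooth f) : (σ.pull f).IsSmooth := fun _ y hy =>
  (hσ.plot ((hf.contMDiffAt _).comp y (contMDiffAt_symm hy))).congr_of_eventuallyEq
    (σ.chart_pull_eventuallyEq hf hy)

theorem d_pull {σ : Form k F M} (hσ : σ.IsSmooth) {f : N → M} (hf : Smooth f) :
    (σ.pull f).d = σ.d.pull f := by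
  ext1 x
  have hx := mem_extChartAt_target (I := 𝓡 N.dim) x
  have hc := (hf.contMDiffAt _).comp _ (contMDiffAt_symm hx)
  change extDeriv _ _ = _
  rw [(σ.chart_pull_eventuallyEq hf hx).extDeriv_eq]
  refine (extDeriv_plot hσ hc).trans ?_
  have h := σ.d.chart_pull hf hx
  refine h.symm.trans ?_
  unfold chart
  rw [chartD_eq_id, extChartAt_to_inv]
  rfl

end Form

end Forms

/-! ### Forms of low degree and their descent -/

section LowDegree

variable {V F : Type*} [NormedAddCommGroup V] [NormedSpace ℝ V] [NormedAddCommGroup F]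
  [NormedSpace ℝ F]

theorem extDeriv_ofSubsingleton {α : V → V →L[ℝ] F} {y : V} (hα : DifferentiableAt ℝ α y)
    (a b : V) : extDeriv (fun z => ContinuousAlternatingMap.ofSubsingleton ℝ V F (0 : Fin 1) (α z)) y
      ![a, b] = fderiv ℝ α y a b - fderiv ℝ α y b a := by
  have hd : DifferentiableAt ℝ
      (fun z => ContinuousAlternatingMap.ofSubsingleton ℝ V F (0 : Fin 1) (α z)) y :=
    (ContinuousAlternatingMap.ofSubsingletonLIE (𝕜 := ℝ) (E := V) (F := F)
      (0 : Fin 1)).toContinuousLinearEquiv.differentiableAt.comp y hα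
  have hv : ∀ v : V, fderiv ℝ (fun z => α z v) y = (fderiv ℝ α y).flip v := fun v => by
    ext w
    rw [fderiv_clm_apply hα (differentiableAt_const v)]
    simp
  rw [extDeriv_apply hd, Fin.sum_univ_two]
  simp [Fin.removeNth, hv, sub_eq_add_neg]

theorem extDeriv_two {T : V → V [⋀^Fin 2]→L[ℝ] F} {y : V} (hT : DifferentiableAt ℝ T y)
    (a b c : V) : extDeriv T y ![a, b, c] =
      fderiv ℝ T y a ![b, c] - fderiv ℝ T y b ![a, c] + fderiv ℝ T y c ![a, b] := by
  have hv : ∀ (v : Fin 2 → V) w, fderiv ℝ (fun z => T z v) y w = fderiv ℝ T y w v := fun v w =>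
    fderiv_continuousAlternatingMap_apply_const_apply hT v w
  have h0 : (0 : Fin 3).removeNth ![a, b, c] = ![b, c] := by
    ext1 i; fin_cases i <;> rfl
  have h1 : (1 : Fin 3).removeNth ![a, b, c] = ![a, c] := by
    ext1 i; fin_cases i <;> rfl
  have h2 : (2 : Fin 3).removeNth ![a, b, c] = ![a, b] := by
    ext1 i; fin_cases i <;> rfl
  rw [extDeriv_apply hT, Fin.sum_univ_three, h0, h1, h2]
  simp only [hv]
  simp [sub_eq_add_neg]

end LowDegree

section OneForms

variable {M : Mfd.{u}} {N : Mfd.{v}} {F : Type*} [NormedAddCommGroup F] [NormedSpace ℝ F] {k : ℕ}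

/-- A function, as a 0-form. -/
def funForm (f : M → F) : Form 0 F M := fun x =>
  ContinuousAlternatingMap.constOfIsEmpty ℝ M.E (Fin 0) (f x)

/-- A family of linear maps on tangent spaces, as a 1-form. -/
def oneForm (A : M → (M.E →L[ℝ] F)) : Form 1 F M := fun x =>
  ContinuousAlternatingMap.ofSubsingleton ℝ M.E F (0 : Fin 1) (A x)

theorem oneFormChart_eq (A : M → (M.E →L[ℝ] F)) (x₀ : M) : oneFormChart A x₀ = fun y =>
    (ContinuousAlternatingMap.ofSubsingletonLIE (𝕜 := ℝ) (E := M.E) (F := F)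
      (0 : Fin 1)).symm ((oneForm A).chart x₀ y) := by
  ext1 y
  exact ((ContinuousAlternatingMap.ofSubsingletonLIE (0 : Fin 1)).symm_apply_apply
    (oneFormChart A x₀ y)).symm

theorem smoothOneForm_iff {A : M → (M.E →L[ℝ] F)} : SmoothOneForm A ↔ (oneForm A).IsSmooth := by
  constructor
  · intro h x₀ y hy
    exact (ContinuousAlternatingMap.ofSubsingletonLIE (𝕜 := ℝ) (E := M.E) (F := F)
      (0 : Fin 1)).toContinuousLinearEquiv.contDiff.contDiffAt.comp y
      ((h x₀).contDiffAt ((isOpen_extChartAt_target x₀).mem_nhds hy))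
  · intro h x₀ y hy
    rw [oneFormChart_eq]
    exact ((ContinuousAlternatingMap.ofSubsingletonLIE (𝕜 := ℝ) (E := M.E) (F := F)
      (0 : Fin 1)).symm.toContinuousLinearEquiv.contDiff.contDiffAt.comp y
      (h x₀ y hy)).contDiffWithinAt

theorem SmoothOneForm.contDiffAt {A : M → (M.E →L[ℝ] F)} (hA : SmoothOneForm A) (x : M) :
    ContDiffAt ℝ ∞ (oneFormChart A x) (extChartAt (𝓡 M.dim) x x) :=
  (hA x).contDiffAt (extChartAt_target_mem_nhds (I := 𝓡 M.dim) x)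

theorem d_oneForm {A : M → (M.E →L[ℝ] F)} (hA : SmoothOneForm A) (x : M) (a b : M.E) :
    (oneForm A).d x ![a, b] = fderiv ℝ (oneFormChart A x) (extChartAt (𝓡 M.dim) x x) a b -
      fderiv ℝ (oneFormChart A x) (extChartAt (𝓡 M.dim) x x) b a :=
  extDeriv_ofSubsingleton ((hA.contDiffAt x).differentiableAt (by simp)) a b

theorem dOneForm_eq {A : M → (M.E →L[ℝ] F)} (hA : SmoothOneForm A) (x : M) (a b : M.E) :
    dOneForm A x a b = (oneForm A).d x ![a, b] := by
  rw [d_oneForm hA]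
  simp only [dOneForm, chartT_eq_id]
  rfl

theorem d_funForm (f : M → ℝ) (hf : (funForm f).IsSmooth) (x : M) (a : M.E) :
    (funForm f).d x ![a] = dFun f x a := by
  have h1 : (funForm f).d x = ContinuousAlternatingMap.ofSubsingleton ℝ M.E ℝ (0 : Fin 1)
      (fderiv ℝ (fun y => f ((extChartAt (𝓡 M.dim) x).symm y)) (extChartAt (𝓡 M.dim) x x)) :=
    extDeriv_constOfIsEmpty (fun y => f ((extChartAt (𝓡 M.dim) x).symm y)) _
  have h2 : ContDiffAt ℝ ∞ (fun y => f ((extChartAt (𝓡 M.dim) x).symm y))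
      (extChartAt (𝓡 M.dim) x x) :=
    (ContinuousAlternatingMap.apply ℝ M.E ℝ (ι := Fin 0) ![]).contDiff.contDiffAt.comp _
      (hf x _ (mem_extChartAt_target x))
  have h3 : MDifferentiableAt (𝓡 M.dim) 𝓘(ℝ, ℝ) f x := by
    have h4 : MDifferentiableAt (𝓡 M.dim) 𝓘(ℝ, ℝ)
        (fun z => f ((extChartAt (𝓡 M.dim) x).symm (extChartAt (𝓡 M.dim) x z))) x :=
      (h2.differentiableAt (by simp)).mdifferentiableAt.comp x
        ((contMDiffAt_extChartAt (I := 𝓡 M.dim) (n := ∞)).mdifferentiableAt (by simp))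
    refine h4.congr_of_eventuallyEq ?_
    filter_upwards [extChartAt_source_mem_nhds (I := 𝓡 M.dim) x] with z hz
    rw [(extChartAt (𝓡 M.dim) x).left_inv hz]
  rw [h1]
  unfold dFun
  rw [h3.mfderiv]
  simp only [modelWithCornersSelf_coe, range_id, fderivWithin_univ]
  rfl

namespace Form

theorem pull_apply (σ : Form k F M) (f : N → M) (x : N) (v : Fin k → N.E) :
    σ.pull f x v = σ (f x) (fun i => D f x (v i)) := rfl

/-- The form on the target whose pullback along a surjective submersion is a given one. -/
theorem exists_descend [FiniteDimensional ℝ F] {p : N → M} (hp : Smooth p)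
    (hsurj : Function.Surjective p) (hs : ∀ n, Function.Surjective (D p n)) {β : Form k F N}
    (hβ : β.IsSmooth) (h : ∀ n n' v v', p n = p n' → (∀ i, D p n (v i) = D p n' (v' i)) →
      β n v = β n' v') : ∃ β₁ : Form k F M, β₁.IsSmooth ∧ β₁.pull p = β := by
  choose r hr using hsurj
  have hR : ∀ x, ∃ R : M.E →L[ℝ] N.E, ∀ w, D p (r x) (R w) = w := fun x => by
    obtain ⟨R₀, hR₀⟩ := LinearMap.exists_rightInverse_of_surjective
      (D p (r x) : N.E →ₗ[ℝ] M.E) (LinearMap.range_eq_top.2 (hs (r x)))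
    exact ⟨LinearMap.toContinuousLinearMap R₀, fun w => LinearMap.congr_fun hR₀ w⟩
  choose R hR using hR
  let β₁ : Form k F M := fun x => (β (r x)).compContinuousLinearMap (R x)
  have hpull : β₁.pull p = β := by
    ext n v
    exact h _ _ _ _ (hr _) fun i => hR _ _
  refine ⟨β₁, fun x₀ y hy => ?_, hpull⟩
  have hcs := contMDiffAt_symm hy
  set x := (extChartAt (𝓡 M.dim) x₀).symm y with hx
  obtain ⟨U, s, hU, hxU, hsm, hps, -⟩ := exists_local_section hp (r x) (hs _)
  rw [hr] at hxU
  have hsx : ∀ z ∈ U, ContMDiffAt (𝓡 M.dim) (𝓡 N.dim) ∞ s z := fun z hz =>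
    hsm.contMDiffAt (hU.mem_nhds hz)
  have hu : ContMDiffAt 𝓘(ℝ, M.E) (𝓡 N.dim) ∞
      (fun z => s ((extChartAt (𝓡 M.dim) x₀).symm z)) y :=
    ContMDiffAt.comp (x := y) (hsx x hxU) hcs
  refine (hβ.plot hu).congr_of_eventuallyEq ?_
  filter_upwards [(isOpen_extChartAt_target x₀).mem_nhds hy,
    hcs.continuousAt.eventually (hU.mem_nhds hxU)] with z hz hzU
  unfold plot
  rw [plotD_comp (hsx _ hzU) (contMDiffAt_symm hz)]
  have hid : ∀ w, D p (s ((extChartAt (𝓡 M.dim) x₀).symm z))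
      (D s ((extChartAt (𝓡 M.dim) x₀).symm z) w) = w := fun w => by
    rw [← D_comp_at (hp.contMDiffAt _) (hsx _ hzU)]
    have : (fun t => p (s t)) =ᶠ[𝓝 ((extChartAt (𝓡 M.dim) x₀).symm z)] fun t => t := by
      filter_upwards [hU.mem_nhds hzU] with t ht using hps t ht
    rw [D_congr this, D_id]
  ext v
  refine h _ _ _ _ ((hr _).trans (hps _ hzU).symm) fun i => ?_
  refine (hR _ _).trans (hid _).symm

theorem pull_injective {p : N → M} (hsurj : Function.Surjective p)
    (hs : ∀ n, Function.Surjective (D p n)) {σ τ : Form k F M} (h : σ.pull p = τ.pull p) :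
    σ = τ := by
  ext x v
  obtain ⟨n, rfl⟩ := hsurj x
  choose w hw using fun i => hs n (v i)
  have := DFunLike.congr_fun (congr_fun h n) w
  simpa only [pull_apply, hw] using this

end Form

/-- An alternating map that vanishes when one of its arguments is in a kernel depends only on the
images of its arguments. -/
theorem alternating_eq_of_map_eq {V W : Type*} [NormedAddCommGroup V] [NormedSpace ℝ V]
    [NormedAddCommGroup W] [NormedSpace ℝ W] {p : V →L[ℝ] W} {f : V [⋀^Fin k]→L[ℝ] F}
    (hf : ∀ v, (∃ i, p (v i) = 0) → f v = 0) {v v' : Fin k → V} (h : ∀ i, p (v i) = p (v' i)) :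
    f v = f v' := by
  classical
  have e := MultilinearMap.map_add_univ f.toAlternatingMap.toMultilinearMap v' (v - v')
  rw [add_sub_cancel, Finset.sum_eq_single Finset.univ] at e
  · rw [Finset.piecewise_univ] at e; exact e
  · intro s _ hs
    obtain ⟨i, hi⟩ : ∃ i, i ∉ s := by
      by_contra! hc
      exact hs (Finset.eq_univ_iff_forall.2 hc)
    refine hf _ ⟨i, ?_⟩
    rw [Finset.piecewise_eq_of_notMem _ _ _ hi, Pi.sub_apply, map_sub, h, sub_self]
  · simp

end OneForms

section PrincipalForms

variable {G : LieGrp.{v}} {N : GMfd.{v, u} G} {Q : Mfd.{w}} {F : Type*} [NormedAddCommGroup F]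
  [NormedSpace ℝ F] [FiniteDimensional ℝ F] {k : ℕ}

/-- Invariant horizontal forms on a principal bundle descend to the base. -/
theorem IsPrincipal.exists_descend {q : N → Q} (hq : IsPrincipal G (P := N.toMfd) N.act q)
    {β : Form k F N.toMfd} (hβ : β.IsSmooth)
    (hinv : ∀ g n v, β (N.act g n) (fun i => D (N.act g) n (v i)) = β n v)
    (hhor : ∀ n v (ξ : G.E), (∃ i, v i = N.fund n ξ) → β n v = 0) :
    ∃ β₁ : Form k F Q, β₁.IsSmooth ∧ β₁.pull q = β := by
  refine Form.exists_descend hq.smooth_proj hq.surjective hq.submersion hβ ?_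
  intro n n' v v' hn hv
  obtain ⟨g, rfl⟩ := hq.exists_act hn
  rw [← hinv g n v]
  refine alternating_eq_of_map_eq (p := D q (N.act g n)) ?_ fun i => ?_
  · rintro w ⟨i, hi⟩
    obtain ⟨ξ, hξ⟩ := hq.exists_fund _ hi
    exact hhor _ _ ξ ⟨i, hξ.symm⟩
  · rw [← hv i, ← D_comp hq.smooth_proj (hq.isAction.smooth_left g)]
    simp only [hq.proj_act]

end PrincipalForms

/-! ### Evaluation of exterior derivatives in low degree -/

section LowDegreeEval

variable {V W F : Type*} [NormedAddCommGroup V] [NormedSpace ℝ V] [NormedAddCommGroup W]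
  [NormedSpace ℝ W] [NormedAddCommGroup F] [NormedSpace ℝ F]

theorem extDeriv_zero_form {σ : V → V [⋀^Fin 0]→L[ℝ] F} {y : V} (hσ : DifferentiableAt ℝ σ y)
    (a : V) : extDeriv σ y ![a] = fderiv ℝ (fun z => σ z ![]) y a := by
  have e : (0 : Fin 1).removeNth ![a] = ![] := Subsingleton.elim _ _
  rw [extDeriv_apply hσ]
  refine (Fin.sum_univ_one _).trans ?_
  rw [Fin.val_zero, pow_zero, one_smul, e]
  rfl

theorem extDeriv_one_form {σ : V → V [⋀^Fin 1]→L[ℝ] F} {y : V} (hσ : DifferentiableAt ℝ σ y)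
    (a b : V) : extDeriv σ y ![a, b] =
      fderiv ℝ (fun z => σ z ![b]) y a - fderiv ℝ (fun z => σ z ![a]) y b := by
  have h0 : (0 : Fin 2).removeNth ![a, b] = ![b] := by
    ext1 i; fin_cases i; rfl
  have h1 : (1 : Fin 2).removeNth ![a, b] = ![a] := by
    ext1 i; fin_cases i; rfl
  rw [extDeriv_apply hσ, Fin.sum_univ_two, h0, h1]
  simp [sub_eq_add_neg]

theorem fderiv_prod_left {f : V × W → F} {y : V × W} (hf : DifferentiableAt ℝ f y) (a : V) :
    fderiv ℝ f y (a, 0) = fderiv ℝ (fun z => f (z, y.2)) y.1 a := by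
  have h := (HasFDerivAt.comp (g := f) (f := fun z => (z, y.2)) y.1 hf.hasFDerivAt
     (hasFDerivAt_prodMk_left y.1 y.2)).fderiv
  exact (DFunLike.congr_fun h a).symm

theorem fderiv_prod_right {f : V × W → F} {y : V × W} (hf : DifferentiableAt ℝ f y) (b : W) :
    fderiv ℝ f y (0, b) = fderiv ℝ (fun z => f (y.1, z)) y.2 b := by
  have h := (HasFDerivAt.comp (g := f) (f := fun z => (y.1, z)) y.2 hf.hasFDerivAt
     (hasFDerivAt_prodMk_right y.1 y.2)).fderiv
  exact (DFunLike.congr_fun h b).symm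

end LowDegreeEval

section FormComp

variable {M : Mfd.{u}} {F F' : Type*} [NormedAddCommGroup F] [NormedSpace ℝ F]
  [NormedAddCommGroup F'] [NormedSpace ℝ F'] {k : ℕ}

/-- The composition of a form with a linear map of the coefficients. -/
def Form.map (L : F →L[ℝ] F') (σ : Form k F M) : Form k F' M := fun x =>
  L.compContinuousAlternatingMap (σ x)

theorem Form.map_apply (L : F →L[ℝ] F') (σ : Form k F M) (x : M) (v : Fin k → M.E) :
    σ.map L x v = L (σ x v) := rfl

theorem Form.d_map (L : F →L[ℝ] F') {σ : Form k F M} (hσ : σ.IsSmooth) :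
    (σ.map L).d = σ.d.map L := by
  ext x v
  have h := (hσ x _ (mem_extChartAt_target x)).differentiableAt (by simp)
  have h' : DifferentiableAt ℝ ((σ.map L).chart x) (extChartAt (𝓡 M.dim) x x) :=
    (L.compContinuousAlternatingMapCLM ℝ M.E F F' (Fin k)).differentiableAt.comp _ h
  change extDeriv _ _ v = L (extDeriv _ _ v)
  rw [extDeriv_apply h', extDeriv_apply h, map_sum]
  refine Finset.sum_congr rfl fun i _ => ?_
  rw [map_zsmul]
  congr 1
  have h2 : HasFDerivAt (fun y => σ.chart x y (i.removeNth v)) _ (extChartAt (𝓡 M.dim) x x) :=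
    (h.continuousAlternatingMap_apply_const (i.removeNth v)).hasFDerivAt
  exact DFunLike.congr_fun (L.hasFDerivAt.comp _ h2).fderiv (v i)

end FormComp

/-! ### The Maurer--Cartan form -/

section MaurerCartan

variable {V V' : Type*} [NormedAddCommGroup V] [NormedSpace ℝ V]
  [NormedAddCommGroup V'] [NormedSpace ℝ V'] {N : Mfd.{w}}

/-- The differential of a plot is smooth along a family of parameters on which the plot is
constant; there is no dependence on charts here, as only one tangent space is involved. -/
theorem contDiffAt_plotD {f : V' → N} {c : V → V'} {y : V} (hc : ContDiffAt ℝ ∞ c y)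
    (hconst : ∀ z, f (c z) = f (c y))
    (hf : ∀ᶠ z in 𝓝 y, ContMDiffAt 𝓘(ℝ, V') (𝓡 N.dim) ∞ f (c z)) :
    ContDiffAt ℝ ∞ (fun z => plotD f (c z)) y := by
  have h1 : ContDiffAt ℝ ∞ (fderiv ℝ (plotChart f (c y))) (c y) :=
    (contDiffAt_plotChart hf.self_of_nhds).fderiv_right (by simp)
  refine (ContDiffAt.comp y h1 hc).congr_of_eventuallyEq ?_
  filter_upwards [hf] with z hz
  have h2 : plotChart f (c z) = plotChart f (c y) := by unfold plotChart; rw [hconst z]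
  rw [← fderiv_plotChart hz, h2]
  rfl

variable (G : LieGrp.{v})

/-- The inverse of the preferred chart of `G` around `1`. -/
def LieGrp.coord : G.E → G := (extChartAt (𝓡 G.dim) (1 : G)).symm

/-- The coordinates of `1 ∈ G` in the preferred chart. -/
def LieGrp.coordOne : G.E := extChartAt (𝓡 G.dim) (1 : G) 1

/-- The Maurer--Cartan form, which takes `v ∈ T_gG` to `g⁻¹ v ∈ 𝔤`. -/
def LieGrp.mc (g : G) : G.E →L[ℝ] G.E :=
  D (M := G.toMfd) (N := G.toMfd) (fun h : G => g⁻¹ * h) g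

theorem LieGrp.coord_coordOne : G.coord G.coordOne = 1 := extChartAt_to_inv 1

theorem LieGrp.coordOne_mem : G.coordOne ∈ (extChartAt (𝓡 G.dim) (1 : G)).target :=
  mem_extChartAt_target (1 : G)

theorem LieGrp.mc_one : G.mc 1 = ContinuousLinearMap.id ℝ G.E := by
  unfold mc
  simp only [inv_one, one_mul]
  ext1 v
  exact D_id (M := G.toMfd) 1 v

/-- The Maurer--Cartan form in coordinates. -/
def LieGrp.mcChart (z : G.E) : G.E →L[ℝ] G.E := oneFormChart (M := G.toMfd) G.mc (1 : G) z

theorem LieGrp.mcChart_eq (z : G.E) :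
    G.mcChart z = (G.mc (G.coord z)).comp (chartD G.toMfd (1 : G) z) := rfl

theorem LieGrp.mcChart_coordOne : G.mcChart G.coordOne = ContinuousLinearMap.id ℝ G.E := by
  rw [mcChart_eq, coord_coordOne, mc_one]
  exact chartD_eq_id G.toMfd (1 : G)

variable {G}

theorem smooth_mc : SmoothOneForm (M := G.toMfd) G.mc := by
  intro x₀ y hy
  let u : G.E → G := fun z => (extChartAt (𝓡 G.dim) (x₀ : G)).symm z
  have hus : ∀ z ∈ (extChartAt (𝓡 G.dim) (x₀ : G)).target, ContMDiffAt 𝓘(ℝ, G.E) (𝓡 G.dim) ∞ u z :=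
    fun z hz => contMDiffAt_symm (M := G.toMfd) hz
  let f : G.E × G.E → G := fun p => (u p.1)⁻¹ * u p.2
  have hf : ∀ z ∈ (extChartAt (𝓡 G.dim) (x₀ : G)).target,
      ContMDiffAt 𝓘(ℝ, G.E × G.E) (𝓡 G.dim) ∞ f (z, z) := fun z hz => by
    have h1 : ContMDiffAt 𝓘(ℝ, G.E × G.E) (𝓡 G.dim) ∞ (fun p : G.E × G.E => u p.1) (z, z) :=
      ContMDiffAt.comp (x := ((z, z) : G.E × G.E)) (hus z hz) contDiff_fst.contMDiff.contMDiffAt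
    have h2 : ContMDiffAt 𝓘(ℝ, G.E × G.E) (𝓡 G.dim) ∞ (fun p : G.E × G.E => u p.2) (z, z) :=
      ContMDiffAt.comp (x := ((z, z) : G.E × G.E)) (hus z hz) contDiff_snd.contMDiff.contMDiffAt
    exact h1.inv.mul h2
  have key := contDiffAt_plotD (N := G.toMfd) (f := f) (c := fun z => (z, z)) (y := y)
    (contDiffAt_id.prodMk contDiffAt_id) (fun z => by simp [f]) (by
      filter_upwards [(isOpen_extChartAt_target (x₀ : G)).mem_nhds hy] with z hz using hf z hz)
  have h3 : ContDiffAt ℝ ∞ (fun z => (plotD (M := G.toMfd) f (z, z)).comp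
      (ContinuousLinearMap.inr ℝ G.E G.E)) y := key.clm_comp contDiffAt_const
  refine (h3.congr_of_eventuallyEq ?_).contDiffWithinAt
  filter_upwards [(isOpen_extChartAt_target (x₀ : G)).mem_nhds hy] with z hz
  have h4 := plotD_comp_left (M := G.toMfd) (u := f) (w := fun w : G.E => (z, w)) (y := z) (hf z hz)
    (hasFDerivAt_prodMk_right z z).differentiableAt
  rw [(hasFDerivAt_prodMk_right z z).fderiv] at h4
  rw [← h4]
  have h5 := plotD_comp (M := G.toMfd) (N := G.toMfd) (f := fun h : G => (u z)⁻¹ * h) (u := u)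
    (y := z) (((isSmoothAction_mul G).smooth_left (u z)⁻¹).contMDiffAt _) (hus z hz)
  exact h5.symm

theorem IsSmoothAction.D_orbit_mc {P : Mfd.{u}} {a : G → P → P} (ha : IsSmoothAction G P a) (x : P)
    (g : G) (v : G.E) : D (M := G.toMfd) (fun h : G => a h x) g v =
      D (a g) x (D (M := G.toMfd) (fun h : G => a h x) 1 (G.mc g v)) := by
  have h1 := D_comp (M := G.toMfd) (N := G.toMfd) (ha.smooth_orbit x)
    ((isSmoothAction_mul G).smooth_left g⁻¹) g v
  have h2 := D_comp (M := G.toMfd) (ha.smooth_left g)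
    ((ha.smooth_orbit x).comp ((isSmoothAction_mul G).smooth_left g⁻¹)) g v
  simp only [ha.mul_act, ha.act_inv] at h2
  rw [inv_mul_cancel] at h1
  rw [h2]
  have h3 : a g⁻¹ (a g x) = x := ha.inv_act g x
  rw [h3]
  simp only [ha.mul_act] at h1
  rw [h1]
  rfl

theorem isInvertible_chartD (M : Mfd.{u}) (x : M) {z : M.E}
    (hz : z ∈ (extChartAt (𝓡 M.dim) x).target) : (chartD M x z).IsInvertible := by
  have := isInvertible_mfderivWithin_extChartAt_symm (I := 𝓡 M.dim) (x := x) hz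
  simp only [modelWithCornersSelf_coe, range_id, mfderivWithin_univ] at this
  exact this

/-- The Maurer--Cartan equation at `1`. -/
theorem d_mc (ξ η : G.E) :
    (oneForm (M := G.toMfd) G.mc).d (1 : G) ![ξ, η] = -G.bracket ξ η := by
  rw [d_oneForm smooth_mc]
  change fderiv ℝ G.mcChart G.coordOne ξ η - fderiv ℝ G.mcChart G.coordOne η ξ = _
  have hmc : ContDiffAt ℝ ∞ G.mcChart G.coordOne := smooth_mc.contDiffAt (M := G.toMfd) (1 : G)
  -- the left invariant vector field in coordinates
  let lam : G.E → G.E → G.E := fun ζ z => (chartD G.toMfd (1 : G) z).inverse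
    (D (M := G.toMfd) (N := G.toMfd) (fun h : G => G.coord z * h) 1 ζ)
  have hlam : ∀ ζ, ∀ z ∈ (extChartAt (𝓡 G.dim) (1 : G)).target,
      lam ζ z = (G.mcChart z).inverse ζ := by
    intro ζ z hz
    obtain ⟨e, he⟩ := isInvertible_chartD G.toMfd (1 : G) hz
    have hl : ∀ g h : G, ∀ v, D (M := G.toMfd) (N := G.toMfd) (fun k : G => g⁻¹ * k) (g * h)
        (D (M := G.toMfd) (N := G.toMfd) (fun k : G => g * k) h v) = v := fun g h v => by
      rw [← D_comp (M := G.toMfd) (N := G.toMfd) (Q := G.toMfd)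
        ((isSmoothAction_mul G).smooth_left g⁻¹) ((isSmoothAction_mul G).smooth_left g)]
      simp only [inv_mul_cancel_left]
      exact D_id (M := G.toMfd) h v
    let d₁ : G.E →L[ℝ] G.E := D (M := G.toMfd) (N := G.toMfd) (fun h : G => G.coord z * h) 1
    have hinv : (G.mcChart z).inverse = (e.symm : G.E →L[ℝ] G.E).comp d₁ := by
      refine ContinuousLinearMap.inverse_eq ?_ ?_
      · ext1 v
        rw [LieGrp.mcChart_eq, ← he]
        simp only [ContinuousLinearMap.comp_apply, ContinuousLinearEquiv.coe_coe,
          ContinuousLinearEquiv.apply_symm_apply, ContinuousLinearMap.id_apply]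
        have := hl (G.coord z) 1 v
        rw [mul_one] at this
        exact this
      · ext1 v
        rw [LieGrp.mcChart_eq, ← he]
        simp only [ContinuousLinearMap.comp_apply, ContinuousLinearEquiv.coe_coe,
          ContinuousLinearMap.id_apply]
        rw [ContinuousLinearEquiv.symm_apply_eq]
        have := hl (G.coord z)⁻¹ (G.coord z) (e v)
        rw [inv_mul_cancel, inv_inv] at this
        exact this
    rw [hinv]
    change (chartD G.toMfd (1 : G) z).inverse (d₁ ζ) = e.symm (d₁ ζ)
    rw [← he, ContinuousLinearMap.inverse_equiv]
    rfl
  have hmem := extChartAt_target_mem_nhds (I := 𝓡 G.dim) (1 : G)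
  have hlam' : ∀ ζ, lam ζ =ᶠ[𝓝 G.coordOne] fun z => (G.mcChart z).inverse ζ := fun ζ => by
    filter_upwards [hmem] with z hz using hlam ζ z hz
  have hinvs : ContDiffAt ℝ ∞ (fun z => (G.mcChart z).inverse) G.coordOne := by
    refine ContDiffAt.comp _ (ContinuousLinearMap.IsInvertible.contDiffAt_map_inverse ?_) hmc
    rw [G.mcChart_coordOne]
    exact ⟨ContinuousLinearEquiv.refl ℝ G.E, rfl⟩
  have hlam_one : ∀ ζ, lam ζ G.coordOne = ζ := fun ζ => by
    refine (hlam' ζ).self_of_nhds.trans ?_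
    change (G.mcChart G.coordOne).inverse ζ = ζ
    rw [G.mcChart_coordOne, ContinuousLinearMap.inverse_id]; rfl
  have hder : ∀ ζ v, fderiv ℝ (lam ζ) G.coordOne v = -fderiv ℝ G.mcChart G.coordOne v ζ := by
    intro ζ v
    have hls : DifferentiableAt ℝ (lam ζ) G.coordOne :=
      ((hinvs.clm_apply contDiffAt_const).congr_of_eventuallyEq (hlam' ζ)).differentiableAt (by simp)
    have hc : (fun z => G.mcChart z (lam ζ z)) =ᶠ[𝓝 G.coordOne] fun _ => ζ := by
      have hi : ∀ᶠ z in 𝓝 G.coordOne, ∃ e : G.E ≃L[ℝ] G.E, (e : G.E →L[ℝ] G.E) = G.mcChart z := by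
        have := hmc.continuousAt.eventually ((ContinuousLinearEquiv.isOpen (𝕜 := ℝ) (E := G.E) (F := G.E)).mem_nhds
          (by rw [G.mcChart_coordOne]; exact ⟨ContinuousLinearEquiv.refl ℝ G.E, rfl⟩ :
            G.mcChart G.coordOne ∈ range ((↑) : (G.E ≃L[ℝ] G.E) → G.E →L[ℝ] G.E)))
        filter_upwards [this] with z hz using hz
      filter_upwards [hlam' ζ, hi] with z hz ⟨e, he⟩
      rw [hz, ← he, ContinuousLinearMap.inverse_equiv]
      exact e.apply_symm_apply ζ
    have h1 := hc.fderiv_eq (𝕜 := ℝ)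
    rw [fderiv_clm_apply (hmc.differentiableAt (by simp)) hls, fderiv_fun_const] at h1
    have h2 := DFunLike.congr_fun h1 v
    simp only [Pi.zero_apply, zero_apply, add_apply, ContinuousLinearMap.comp_apply,
      ContinuousLinearMap.flip_apply, hlam_one, G.mcChart_coordOne, ContinuousLinearMap.id_apply] at h2
    exact eq_neg_of_add_eq_zero_left h2
  have hbr : G.bracket ξ η = VectorField.lieBracket ℝ (lam ξ) (lam η) G.coordOne := by
    have e1 : ∀ ζ, VectorField.mpullbackWithin 𝓘(ℝ, G.E) (𝓡 G.dim)
        (extChartAt (𝓡 G.dim) (1 : G)).symm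
        (mulInvariantVectorField (I := 𝓡 G.dim) (G := G.carrier) ζ) (range (𝓡 G.dim)) = lam ζ := by
      intro ζ
      ext1 z
      rw [VectorField.mpullbackWithin_apply]
      simp only [modelWithCornersSelf_coe, range_id, mfderivWithin_univ]
      rfl
    have e2 : G.bracket ξ η = (chartT G.toMfd (1 : G)).inverse
        (VectorField.lieBracketWithin ℝ
          (VectorField.mpullbackWithin 𝓘(ℝ, G.E) (𝓡 G.dim) (extChartAt (𝓡 G.dim) (1 : G)).symm
            (mulInvariantVectorField (I := 𝓡 G.dim) (G := G.carrier) ξ) (range (𝓡 G.dim)))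
          (VectorField.mpullbackWithin 𝓘(ℝ, G.E) (𝓡 G.dim) (extChartAt (𝓡 G.dim) (1 : G)).symm
            (mulInvariantVectorField (I := 𝓡 G.dim) (G := G.carrier) η) (range (𝓡 G.dim)))
          ((extChartAt (𝓡 G.dim) (1 : G)).symm ⁻¹' univ ∩ range (𝓡 G.dim)) G.coordOne) := rfl
    have e3 : (extChartAt (𝓡 G.dim) (1 : G)).symm ⁻¹' univ ∩ range (𝓡 G.dim) = univ := by
      simp only [preimage_univ, modelWithCornersSelf_coe, range_id, inter_univ]
    have e4 : ∀ (V V₁ W W₁ : G.E → G.E) (s : Set G.E) (L : G.E →L[ℝ] G.E), V = V₁ → W = W₁ →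
        s = univ → L = ContinuousLinearMap.id ℝ G.E →
        L.inverse (VectorField.lieBracketWithin ℝ V W s G.coordOne) =
          VectorField.lieBracket ℝ V₁ W₁ G.coordOne := by
      rintro V _ W _ _ _ rfl rfl rfl rfl
      rw [ContinuousLinearMap.inverse_id, VectorField.lieBracketWithin_univ]; rfl
    exact e2.trans (e4 _ _ _ _ _ _ (e1 ξ) (e1 η) e3 (chartT_eq_id G.toMfd (1 : G)))
  rw [hbr, VectorField.lieBracket, hlam_one, hlam_one, hder, hder]
  abel

variable (G) in
/-- The Lie bracket, as an alternating map. -/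
def LieGrp.bracketForm : G.E [⋀^Fin 2]→L[ℝ] G.E := -(oneForm (M := G.toMfd) G.mc).d (1 : G)

theorem bracketForm_apply (ξ η : G.E) : G.bracketForm ![ξ, η] = G.bracket ξ η := by
  change -((oneForm (M := G.toMfd) G.mc).d (1 : G) ![ξ, η]) = _
  rw [d_mc, neg_neg]

theorem bracketForm_apply' (v : Fin 2 → G.E) : G.bracketForm v = G.bracket (v 0) (v 1) := by
  rw [← bracketForm_apply]
  congr 1
  ext1 i; fin_cases i <;> rfl

theorem bracket_jacobi (ξ η ζ : G.E) : G.bracket ξ (G.bracket η ζ) =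
    G.bracket (G.bracket ξ η) ζ + G.bracket η (G.bracket ξ ζ) := by
  have : LieGroup (𝓡 G.dim) (minSmoothness ℝ 3) G.carrier :=
    LieGroup.of_le (n := ∞) (by
      rw [minSmoothness_of_isRCLikeNormedField]
      exact WithTop.coe_le_coe.2 (le_top : (3 : ℕ∞) ≤ ⊤))
  exact leibniz_lie (L₁ := GroupLieAlgebra (𝓡 G.dim) G.carrier)
    (L₂ := GroupLieAlgebra (𝓡 G.dim) G.carrier) (M := GroupLieAlgebra (𝓡 G.dim) G.carrier) ξ η ζ

theorem bracket_skew (ξ η : G.E) : G.bracket ξ η = -G.bracket η ξ := by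
  rw [← bracketForm_apply, ← bracketForm_apply]
  have h := G.bracketForm.toAlternatingMap.map_swap ![η, ξ] (i := 0) (j := 1) (by decide)
  have e : ![η, ξ] ∘ Equiv.swap 0 1 = ![ξ, η] := by
    ext1 i; fin_cases i <;> rfl
  rw [e] at h
  exact h

/-- The adjoint action preserves brackets, since conjugation takes the Maurer--Cartan form to its
image under the adjoint action. -/
theorem Ad_bracket (g : G) (ξ η : G.E) :
    G.Ad g (G.bracket ξ η) = G.bracket (G.Ad g ξ) (G.Ad g η) := by
  let c : G → G := fun h => g * h * g⁻¹
  have hc : Smooth (M := G.toMfd) (N := G.toMfd) c :=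
    ((smooth_const g).mul smooth_id).mul (smooth_const g⁻¹)
  have hL : ∀ h : G, Smooth (M := G.toMfd) (N := G.toMfd) (fun k : G => h * k) :=
    fun h => (isSmoothAction_mul G).smooth_left h
  have h1 : (oneForm (M := G.toMfd) G.mc).pull (N := G.toMfd) c =
      (oneForm (M := G.toMfd) G.mc).map (G.Ad g) := by
    ext1 h
    ext1 v
    change G.mc (c h) (D (M := G.toMfd) (N := G.toMfd) c h (v 0)) = G.Ad g (G.mc h (v 0))
    have e1 := D_comp (M := G.toMfd) (N := G.toMfd) (Q := G.toMfd) (hL (c h)⁻¹) hc h (v 0)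
    have e2 := D_comp (M := G.toMfd) (N := G.toMfd) (Q := G.toMfd) hc (hL h⁻¹) h (v 0)
    have e3 : (fun x : G => (c h)⁻¹ * c x) = fun x : G => c (h⁻¹ * x) := by
      ext1 x; simp only [c]; group
    rw [e3, e2, inv_mul_cancel] at e1
    exact e1.symm
  have hs := smoothOneForm_iff.1 (smooth_mc (G := G))
  have h2 := congr_arg (fun σ : Form 1 G.E G.toMfd => σ.d (1 : G) ![ξ, η]) h1
  simp only [Form.d_pull hs hc, Form.d_map _ hs] at h2
  have h3 : c 1 = 1 := by simp [c]
  rw [Form.map_apply, d_mc, Form.pull_apply, h3] at h2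
  have h4 : (fun i => D (M := G.toMfd) (N := G.toMfd) c 1 (![ξ, η] i)) = ![G.Ad g ξ, G.Ad g η] := by
    ext1 i; fin_cases i <;> rfl
  rw [h4, d_mc, map_neg, neg_inj] at h2
  exact h2.symm

theorem contDiffAt_Ad {y : G.E} (hy : y ∈ (extChartAt (𝓡 G.dim) (1 : G)).target) :
    ContDiffAt ℝ ∞ (fun z => G.Ad (G.coord z)) y := by
  have hus : ∀ z ∈ (extChartAt (𝓡 G.dim) (1 : G)).target,
      ContMDiffAt 𝓘(ℝ, G.E) (𝓡 G.dim) ∞ G.coord z :=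
    fun z hz => contMDiffAt_symm (M := G.toMfd) hz
  let f : G.E × G.E → G := fun p => G.coord p.1 * G.coord p.2 * (G.coord p.1)⁻¹
  have hf : ∀ z ∈ (extChartAt (𝓡 G.dim) (1 : G)).target,
      ContMDiffAt 𝓘(ℝ, G.E × G.E) (𝓡 G.dim) ∞ f (z, G.coordOne) := fun z hz => by
    have h1 : ContMDiffAt 𝓘(ℝ, G.E × G.E) (𝓡 G.dim) ∞ (fun p : G.E × G.E => G.coord p.1)
        (z, G.coordOne) :=
      ContMDiffAt.comp (x := ((z, G.coordOne) : G.E × G.E)) (hus z hz)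
        contDiff_fst.contMDiff.contMDiffAt
    have h2 : ContMDiffAt 𝓘(ℝ, G.E × G.E) (𝓡 G.dim) ∞ (fun p : G.E × G.E => G.coord p.2)
        (z, G.coordOne) :=
      ContMDiffAt.comp (x := ((z, G.coordOne) : G.E × G.E)) (hus _ G.coordOne_mem)
        contDiff_snd.contMDiff.contMDiffAt
    exact (h1.mul h2).mul h1.inv
  have key := contDiffAt_plotD (N := G.toMfd) (f := f) (c := fun z => (z, G.coordOne)) (y := y)
    (contDiffAt_id.prodMk contDiffAt_const) (fun z => by simp [f, G.coord_coordOne]) (by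
      filter_upwards [(isOpen_extChartAt_target (1 : G)).mem_nhds hy] with z hz using hf z hz)
  have h3 : ContDiffAt ℝ ∞ (fun z => (plotD (M := G.toMfd) f (z, G.coordOne)).comp
      (ContinuousLinearMap.inr ℝ G.E G.E)) y := key.clm_comp contDiffAt_const
  refine h3.congr_of_eventuallyEq ?_
  filter_upwards [(isOpen_extChartAt_target (1 : G)).mem_nhds hy] with z hz
  have h4 := plotD_comp_left (M := G.toMfd) (u := f) (w := fun w : G.E => (z, w)) (y := G.coordOne)
    (hf z hz) (hasFDerivAt_prodMk_right z G.coordOne).differentiableAt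
  rw [(hasFDerivAt_prodMk_right z G.coordOne).fderiv] at h4
  rw [← h4]
  have h5 := plotD_comp (M := G.toMfd) (N := G.toMfd)
    (f := fun h : G => G.coord z * h * (G.coord z)⁻¹) (u := G.coord) (y := G.coordOne)
    ((((smooth_const (G.coord z)).mul smooth_id).mul
      (smooth_const (G.coord z)⁻¹) : Smooth (M := G.toMfd) (N := G.toMfd) _).contMDiffAt _)
    (hus _ G.coordOne_mem)
  refine Eq.trans ?_ h5.symm
  have h6 : plotD (M := G.toMfd) G.coord G.coordOne = ContinuousLinearMap.id ℝ G.E :=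
    chartD_eq_id G.toMfd (1 : G)
  rw [h6, G.coord_coordOne]
  rfl

end MaurerCartan

/-! ### Forms along an action -/

section ActPlot

variable {G : LieGrp.{v}} (M : GMfd.{v, u} G)

/-- The action of `G` on `M` in coordinates around `1 ∈ G` and `x ∈ M`. -/
def GMfd.actPlot (x : M) (p : G.E × M.E) : M :=
  M.act (G.coord p.1) ((extChartAt (𝓡 M.dim) x).symm p.2)

/-- The map `(ξ, a) ↦ a - ξ_M`, whose kernel consists of the pairs that are contracted with the
basic equivariant forms. -/
def GMfd.hor (x : M) : (G.E × M.E) →L[ℝ] M.E :=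
  ContinuousLinearMap.snd ℝ G.E M.E - (M.fund x).comp (ContinuousLinearMap.fst ℝ G.E M.E)

variable {M}

theorem GMfd.hor_apply (x : M) (e : G.E × M.E) : M.hor x e = e.2 - M.fund x e.1 := rfl

theorem GMfd.hor_fund (x : M) (ξ : G.E) : M.hor x (ξ, M.fund x ξ) = 0 := sub_self _

theorem GMfd.hor_act (g : G) (x : M) (e : G.E × M.E) :
    M.hor (M.act g x) (G.Ad g e.1, D (M.act g) x e.2) = D (M.act g) x (M.hor x e) := by
  rw [hor_apply, hor_apply, map_sub, M.D_act_fund]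

theorem IsGMap.D_hor {N : GMfd.{v, u} G} {f : N → M} (hf : IsGMap f) (x : N) (e : G.E × N.E) :
    M.hor (f x) (e.1, D f x e.2) = D f x (N.hor x e) := by
  rw [GMfd.hor_apply, GMfd.hor_apply, map_sub, hf.D_fund]

theorem contMDiffAt_coord {z : G.E} (hz : z ∈ (extChartAt (𝓡 G.dim) (1 : G)).target) :
    ContMDiffAt 𝓘(ℝ, G.E) (𝓡 G.dim) ∞ G.coord z :=
  contMDiffAt_symm (M := G.toMfd) hz

theorem contMDiffAt_actPlot {x : M} {z : G.E} {y : M.E}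
    (hz : z ∈ (extChartAt (𝓡 G.dim) (1 : G)).target)
    (hy : y ∈ (extChartAt (𝓡 M.dim) x).target) :
    ContMDiffAt 𝓘(ℝ, G.E × M.E) (𝓡 M.dim) ∞ (M.actPlot x) (z, y) := by
  refine M.isAction.contMDiffAt ?_ ?_
  · exact ContMDiffAt.comp (x := ((z, y) : G.E × M.E)) (contMDiffAt_coord hz)
      contDiff_fst.contMDiff.contMDiffAt
  · exact ContMDiffAt.comp (x := ((z, y) : G.E × M.E)) (contMDiffAt_symm hy)
      contDiff_snd.contMDiff.contMDiffAt

theorem plotD_actPlot {x : M} {z : G.E} {y : M.E}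
    (hz : z ∈ (extChartAt (𝓡 G.dim) (1 : G)).target)
    (hy : y ∈ (extChartAt (𝓡 M.dim) x).target) (w : G.E × M.E) :
    plotD (M.actPlot x) (z, y) w =
      D (M.act (G.coord z)) ((extChartAt (𝓡 M.dim) x).symm y)
        (M.hor ((extChartAt (𝓡 M.dim) x).symm y) (G.mcChart z w.1, chartD M.toMfd x y w.2)) := by
  have h1 : ContMDiffAt 𝓘(ℝ, G.E × M.E) (𝓡 G.dim) ∞ (fun p : G.E × M.E => G.coord p.1) (z, y) :=
    ContMDiffAt.comp (x := ((z, y) : G.E × M.E)) (contMDiffAt_coord hz)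
      contDiff_fst.contMDiff.contMDiffAt
  have h2 : ContMDiffAt 𝓘(ℝ, G.E × M.E) (𝓡 M.dim) ∞
      (fun p : G.E × M.E => (extChartAt (𝓡 M.dim) x).symm p.2) (z, y) :=
    ContMDiffAt.comp (x := ((z, y) : G.E × M.E)) (contMDiffAt_symm hy)
      contDiff_snd.contMDiff.contMDiffAt
  have h3 := M.isAction.mfderiv_act (h1.mdifferentiableAt (by simp)) (h2.mdifferentiableAt (by simp))
    w
  have h4 := plotD_comp_left (M := G.toMfd) (u := G.coord) (w := fun p : G.E × M.E => p.1)
    (y := (z, y)) (contMDiffAt_coord hz) differentiableAt_fst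
  have h5 := plotD_comp_left (M := M.toMfd) (u := (extChartAt (𝓡 M.dim) x).symm)
    (w := fun p : G.E × M.E => p.2) (y := (z, y)) (contMDiffAt_symm hy) differentiableAt_snd
  rw [hasFDerivAt_fst.fderiv] at h4
  rw [hasFDerivAt_snd.fderiv] at h5
  refine h3.trans ?_
  have h4' : (mfderiv 𝓘(ℝ, G.E × M.E) (𝓡 G.dim) (fun p : G.E × M.E => G.coord p.1) (z, y) :
      G.E × M.E →L[ℝ] G.E) w = chartD G.toMfd (1 : G) z w.1 := DFunLike.congr_fun h4 w
  have h5' : (mfderiv 𝓘(ℝ, G.E × M.E) (𝓡 M.dim)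
      (fun p : G.E × M.E => (extChartAt (𝓡 M.dim) x).symm p.2) (z, y) :
      G.E × M.E →L[ℝ] M.E) w = chartD M.toMfd x y w.2 := DFunLike.congr_fun h5 w
  rw [h4', h5', M.isAction.D_orbit_mc, GMfd.hor_apply, map_sub, M.fund_eq_neg, map_neg, sub_neg_eq_add]
  rfl

theorem GMfd.act_coordOne : M.act (G.coord G.coordOne) = fun x => x := by
  rw [G.coord_coordOne]
  ext1 x
  exact M.isAction.one_act x

theorem GMfd.actPlot_coordOne (x : M) (y : M.E) :
    M.actPlot x (G.coordOne, y) = (extChartAt (𝓡 M.dim) x).symm y :=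
  congr_fun M.act_coordOne _

theorem plotD_actPlot_one {x : M} {y : M.E} (hy : y ∈ (extChartAt (𝓡 M.dim) x).target)
    (w : G.E × M.E) : plotD (M.actPlot x) (G.coordOne, y) w =
      M.hor ((extChartAt (𝓡 M.dim) x).symm y) (w.1, chartD M.toMfd x y w.2) := by
  rw [plotD_actPlot G.coordOne_mem hy, G.mcChart_coordOne, M.act_coordOne]
  exact D_id _ _

theorem plotD_actPlot_self (x : M) (w : G.E × M.E) :
    plotD (M.actPlot x) (G.coordOne, extChartAt (𝓡 M.dim) x x) w = M.hor x w := by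
  rw [plotD_actPlot_one (mem_extChartAt_target x), chartD_eq_id, extChartAt_to_inv]
  rfl

variable {F : Type*} [NormedAddCommGroup F] [NormedSpace ℝ F] {k : ℕ}

theorem plot_actPlot_self (σ : Form k F M.toMfd) (x : M) (v : Fin k → G.E × M.E) :
    σ.plot (M.actPlot x) (G.coordOne, extChartAt (𝓡 M.dim) x x) v = σ x (fun i => M.hor x (v i)) := by
  change σ (M.actPlot x _) (fun i => plotD (M.actPlot x) _ (v i)) = _
  simp only [plotD_actPlot_self]
  rw [M.actPlot_coordOne, extChartAt_to_inv]

theorem plot_actPlot_one (σ : Form k F M.toMfd) {x : M} {y : M.E}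
    (hy : y ∈ (extChartAt (𝓡 M.dim) x).target) (v : Fin k → G.E × M.E) :
    σ.plot (M.actPlot x) (G.coordOne, y) v = σ ((extChartAt (𝓡 M.dim) x).symm y)
      (fun i => M.hor ((extChartAt (𝓡 M.dim) x).symm y) ((v i).1, chartD M.toMfd x y (v i).2)) := by
  change σ (M.actPlot x _) (fun i => plotD (M.actPlot x) _ (v i)) = _
  simp only [plotD_actPlot_one hy]
  rw [M.actPlot_coordOne]

theorem plot_actPlot {σ : Form k F M.toMfd}
    (hσ : ∀ g x v, σ (M.act g x) (fun i => D (M.act g) x (v i)) = σ x v) {x : M} {z : G.E} {y : M.E}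
    (hz : z ∈ (extChartAt (𝓡 G.dim) (1 : G)).target)
    (hy : y ∈ (extChartAt (𝓡 M.dim) x).target) (v : Fin k → G.E × M.E) :
    σ.plot (M.actPlot x) (z, y) v = σ ((extChartAt (𝓡 M.dim) x).symm y)
      (fun i => M.hor ((extChartAt (𝓡 M.dim) x).symm y)
        (G.mcChart z (v i).1, chartD M.toMfd x y (v i).2)) := by
  change σ (M.actPlot x _) (fun i => plotD (M.actPlot x) _ (v i)) = _
  simp only [plotD_actPlot hz hy]
  exact hσ _ _ _

theorem eventually_target (x : M) : ∀ᶠ p : G.E × M.E in 𝓝 (G.coordOne, extChartAt (𝓡 M.dim) x x),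
    p.1 ∈ (extChartAt (𝓡 G.dim) (1 : G)).target ∧ p.2 ∈ (extChartAt (𝓡 M.dim) x).target :=
  prod_mem_nhds (extChartAt_target_mem_nhds (I := 𝓡 G.dim) (1 : G))
    (extChartAt_target_mem_nhds (I := 𝓡 M.dim) x)

/-- The contraction of `dA` with the vector field generated by `ξ`, for an equivariant 1-form `A`
with values in a representation `ρ`, that takes constant values on generating vector fields. -/
theorem d_oneForm_fund [FiniteDimensional ℝ F] {A : M → M.E →L[ℝ] F} (hA : SmoothOneForm A)
    {ρ : G → F →L[ℝ] F}
    (hρ : DifferentiableAt ℝ (fun z => ρ (G.coord z)) G.coordOne) {L : G.E → F}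
    (hL : ∀ x ξ, A x (M.fund x ξ) = L ξ)
    (hAρ : ∀ g x a, A (M.act g x) (D (M.act g) x a) = ρ g (A x a)) (x : M) (ξ : G.E) (b : M.E) :
    (oneForm A).d x ![M.fund x ξ, b] =
      -fderiv ℝ (fun z => ρ (G.coord z)) G.coordOne ξ (A x b) := by
  have hs := smoothOneForm_iff.1 hA
  have hc := contMDiffAt_actPlot G.coordOne_mem (mem_extChartAt_target (I := 𝓡 M.dim) x)
  have hd := (hs.plot hc).differentiableAt (by simp)
  have h1 := DFunLike.congr_fun (Form.extDeriv_plot hs hc) ![((-ξ, 0) : G.E × M.E), (0, b)]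
  rw [plot_actPlot_self, extDeriv_one_form hd] at h1
  have e0 : (fun i => M.hor x (![((-ξ, 0) : G.E × M.E), (0, b)] i)) = ![M.fund x ξ, b] := by
    ext1 i
    fin_cases i
    · change M.hor x (-ξ, 0) = M.fund x ξ
      rw [GMfd.hor_apply, map_neg, zero_sub, neg_neg]
    · change M.hor x (0, b) = b
      rw [GMfd.hor_apply, map_zero, sub_zero]
  have hval : ∀ p ∈ {p : G.E × M.E | p.1 ∈ (extChartAt (𝓡 G.dim) (1 : G)).target ∧
      p.2 ∈ (extChartAt (𝓡 M.dim) x).target}, ∀ w : G.E × M.E,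
      (oneForm A).plot (M.actPlot x) p ![w] = ρ (G.coord p.1)
        (oneFormChart A x p.2 w.2 - L (G.mcChart p.1 w.1)) := by
    rintro ⟨z, y⟩ ⟨hz, hy⟩ w
    change A (M.actPlot x (z, y)) (plotD (M.actPlot x) (z, y) w) = _
    rw [plotD_actPlot hz hy]
    refine (hAρ _ _ _).trans ?_
    rw [GMfd.hor_apply, map_sub, hL]
    rfl
  have hev := eventually_target (G := G) x
  have t1 : fderiv ℝ (fun p => (oneForm A).plot (M.actPlot x) p ![(0, b)])
      (G.coordOne, extChartAt (𝓡 M.dim) x x) (-ξ, 0) =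
      -fderiv ℝ (fun z => ρ (G.coord z)) G.coordOne ξ (A x b) := by
    rw [fderiv_prod_left (hd.continuousAlternatingMap_apply_const _)]
    have he : (fun z => (oneForm A).plot (M.actPlot x) (z, extChartAt (𝓡 M.dim) x x) ![(0, b)])
        =ᶠ[𝓝 G.coordOne] fun z => ρ (G.coord z) (A x b) := by
      filter_upwards [extChartAt_target_mem_nhds (I := 𝓡 G.dim) (1 : G)] with z hz
      rw [hval _ ⟨hz, mem_extChartAt_target (I := 𝓡 M.dim) x⟩]
      have hL0 : L 0 = 0 := by rw [← hL x 0, map_zero, map_zero]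
      simp only [map_zero, hL0, sub_zero]
      congr 1
      change A _ (chartD M.toMfd x _ b) = _
      rw [chartD_eq_id, extChartAt_to_inv]
      rfl
    rw [he.fderiv_eq, fderiv_clm_apply hρ (differentiableAt_const _)]
    simp
  have t2 : fderiv ℝ (fun p => (oneForm A).plot (M.actPlot x) p ![(-ξ, 0)])
      (G.coordOne, extChartAt (𝓡 M.dim) x x) (0, b) = 0 := by
    rw [fderiv_prod_right (hd.continuousAlternatingMap_apply_const _)]
    have he : (fun y => (oneForm A).plot (M.actPlot x) (G.coordOne, y) ![(-ξ, 0)])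
        =ᶠ[𝓝 (extChartAt (𝓡 M.dim) x x)]
          fun _ => ρ (G.coord G.coordOne) (-L (G.mcChart G.coordOne (-ξ))) := by
      filter_upwards [extChartAt_target_mem_nhds (I := 𝓡 M.dim) x] with y hy
      rw [hval _ ⟨G.coordOne_mem, hy⟩, map_zero, zero_sub]
    rw [he.fderiv_eq, fderiv_fun_const]
    rfl
  rw [t1, t2, sub_zero, e0] at h1
  exact h1.symm

end ActPlot

section Adjoint

variable (G : LieGrp.{v})

/-- `G` with its action on itself by right translations, in the form `g · h = h g⁻¹`. -/
def LieGrp.rightMfd : GMfd.{v, v} G where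
  toMfd := G.toMfd
  act := fun g h => h * g⁻¹
  isAction :=
    { one_act := fun p => by rw [inv_one, mul_one]
      mul_act := fun g h p => by rw [mul_inv_rev, mul_assoc]
      smooth_act := contMDiff_snd.mul contMDiff_fst.inv }

variable {G}

/-- The derivative of the adjoint action is the bracket, by the Maurer--Cartan equation. -/
theorem fderiv_Ad (ξ η : G.E) :
    fderiv ℝ (fun z => G.Ad (G.coord z)) G.coordOne ξ η = G.bracket ξ η := by
  have hL : ∀ h : G, Smooth (M := G.toMfd) (N := G.toMfd) (fun k : G => h * k) :=
    fun h => (isSmoothAction_mul G).smooth_left h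
  have hfund : ∀ (x : G) (ζ : G.E), G.mc x (G.rightMfd.fund x ζ) = ζ := by
    intro x ζ
    have hs : Smooth (M := G.toMfd) (N := G.toMfd) (fun g : G => G.rightMfd.act g⁻¹ x) :=
      (G.rightMfd.isAction.smooth_orbit x).comp (smooth_inv G)
    have h : D (M := G.toMfd) (N := G.toMfd) (fun g : G => x⁻¹ * (x * g⁻¹⁻¹)) 1 ζ =
        D (M := G.toMfd) (N := G.toMfd) (fun k : G => x⁻¹ * k) (x * (1 : G)⁻¹⁻¹)
          (G.rightMfd.fund x ζ) :=
      D_comp (M := G.toMfd) (N := G.toMfd) (Q := G.toMfd) (hL x⁻¹) hs 1 ζ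
    have e1 : (fun g : G => x⁻¹ * (x * g⁻¹⁻¹)) = fun g => g := by
      ext1 g
      group
    have e2 : x * (1 : G)⁻¹⁻¹ = x := by group
    rw [e1, D_id (M := G.toMfd), e2] at h
    exact h.symm
  have hequi : ∀ (g : G) (x : G) (a : G.E), G.mc (G.rightMfd.act g x) (D (M := G.toMfd)
      (N := G.toMfd) (G.rightMfd.act g) x a) = G.Ad g (G.mc x a) := by
    intro g x a
    have hc : Smooth (M := G.toMfd) (N := G.toMfd) (fun h : G => g * h * g⁻¹) :=
      ((smooth_const g).mul smooth_id).mul (smooth_const g⁻¹)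
    have h1 : D (M := G.toMfd) (N := G.toMfd) (fun y : G => (x * g⁻¹)⁻¹ * (y * g⁻¹)) x a =
        D (M := G.toMfd) (N := G.toMfd) (fun k : G => (x * g⁻¹)⁻¹ * k) (x * g⁻¹)
          (D (M := G.toMfd) (N := G.toMfd) (G.rightMfd.act g) x a) :=
      D_comp (M := G.toMfd) (N := G.toMfd) (Q := G.toMfd) (hL (x * g⁻¹)⁻¹)
        (G.rightMfd.isAction.smooth_left g) x a
    have h2 := D_comp (M := G.toMfd) (N := G.toMfd) (Q := G.toMfd) hc (hL x⁻¹) x a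
    have e1 : (fun y : G => (x * g⁻¹)⁻¹ * (y * g⁻¹)) = fun y => g * (x⁻¹ * y) * g⁻¹ := by
      ext1 y
      group
    rw [e1, h2, inv_mul_cancel] at h1
    exact h1.symm
  have h := d_oneForm_fund (M := G.rightMfd) (A := G.mc) smooth_mc (ρ := G.Ad)
    ((contDiffAt_Ad G.coordOne_mem).differentiableAt (by simp)) (L := fun ξ => ξ) hfund hequi
    (1 : G) ξ η
  have e1 : G.rightMfd.fund (1 : G) ξ = ξ := by
    have := hfund 1 ξ
    rw [G.mc_one] at this
    exact this
  rw [e1, G.mc_one] at h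
  have h2 := h.symm.trans (d_mc ξ η)
  exact neg_injective h2

end Adjoint

/-! ### Connections and their curvature -/

section Curvature

variable {G : LieGrp.{v}} {P Y : GMfd.{v, u} G} {Θ : P → P.E →L[ℝ] G.E}

theorem IsConnection.d_fund (hΘ : IsConnection P Θ) (p : P) (ξ : G.E) (b : P.E) :
    (oneForm Θ).d p ![P.fund p ξ, b] = -G.bracket ξ (Θ p b) := by
  rw [d_oneForm_fund hΘ.smooth (ρ := G.Ad)
    ((contDiffAt_Ad G.coordOne_mem).differentiableAt (by simp)) (L := fun ξ => ξ) hΘ.vertical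
    hΘ.equivariant, fderiv_Ad]

/-- The curvature of a connection as a 2-form. -/
def curvForm (Θ : P → P.E →L[ℝ] G.E) : Form 2 G.E P.toMfd := fun p =>
  (oneForm Θ).d p + G.bracketForm.compContinuousLinearMap (Θ p)

theorem curvForm_apply (Θ : P → P.E →L[ℝ] G.E) (p : P) (a b : P.E) : curvForm Θ p ![a, b] =
    (oneForm Θ).d p ![a, b] + G.bracket (Θ p a) (Θ p b) := by
  change _ + G.bracketForm _ = _
  rw [bracketForm_apply']
  rfl

theorem curvature_eq (hΘ : SmoothOneForm Θ) (p : P) (a b : P.E) :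
    curvature Θ p a b = curvForm Θ p ![a, b] := by
  rw [curvForm_apply, curvature, dOneForm_eq hΘ]

theorem eq_cons_two {α : Type*} (v : Fin 2 → α) : v = ![v 0, v 1] := by
  ext1 i; fin_cases i <;> rfl

theorem isSmooth_curvForm (hΘ : SmoothOneForm Θ) : (curvForm Θ).IsSmooth := by
  intro x₀ y hy
  have h1 := (smoothOneForm_iff.1 hΘ).d x₀ y hy
  have h2 : ContDiffAt ℝ ∞ (oneFormChart Θ x₀) y :=
    (hΘ x₀).contDiffAt ((isOpen_extChartAt_target x₀).mem_nhds hy)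
  have h3 := contDiffAt_alternating_comp (f := fun _ : P.E => G.bracketForm) contDiffAt_const h2
  exact h1.add h3

theorem curvForm_act (hΘ : IsConnection P Θ) (g : G) (p : P) (v : Fin 2 → P.E) :
    curvForm Θ (P.act g p) (fun i => D (P.act g) p (v i)) = G.Ad g (curvForm Θ p v) := by
  have hs := smoothOneForm_iff.1 hΘ.smooth
  have h1 : (oneForm Θ).pull (P.act g) = (oneForm Θ).map (G.Ad g) := by
    ext1 p
    ext1 v
    exact hΘ.equivariant g p (v 0)
  have h2 := congr_arg (fun σ : Form 1 G.E P.toMfd => σ.d p v) h1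
  simp only [Form.d_pull hs (P.isAction.smooth_left g), Form.d_map _ hs] at h2
  have h3 : curvForm Θ (P.act g p) (fun i => D (P.act g) p (v i)) =
      (oneForm Θ).d (P.act g p) (fun i => D (P.act g) p (v i)) +
        G.bracketForm (fun i => Θ (P.act g p) (D (P.act g) p (v i))) := rfl
  have h4 : curvForm Θ p v = (oneForm Θ).d p v + G.bracketForm (fun i => Θ p (v i)) := rfl
  rw [h3, h4, map_add, bracketForm_apply', bracketForm_apply', Ad_bracket]
  simp only [hΘ.equivariant]
  congr 1

theorem curvForm_fund (hΘ : IsConnection P Θ) (p : P) (ξ : G.E) (v : Fin 2 → P.E)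
    (hv : ∃ i, v i = P.fund p ξ) : curvForm Θ p v = 0 := by
  have h0 : ∀ b, curvForm Θ p ![P.fund p ξ, b] = 0 := fun b => by
    rw [curvForm_apply, hΘ.d_fund, hΘ.vertical, neg_add_cancel]
  obtain ⟨i, hi⟩ := hv
  rw [eq_cons_two v]
  fin_cases i
  · have hi' : v 0 = P.fund p ξ := hi
    rw [hi']
    exact h0 _
  · have hi' : v 1 = P.fund p ξ := hi
    have h1 := (curvForm Θ p).toAlternatingMap.map_swap ![v 1, v 0] (i := 0) (j := 1) (by decide)
    have e : ![v 1, v 0] ∘ Equiv.swap 0 1 = ![v 0, v 1] := by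
      ext1 i; fin_cases i <;> rfl
    rw [e] at h1
    refine h1.trans ?_
    rw [hi']
    exact neg_eq_zero.2 (h0 _)

/-- The pullback of a connection. -/
def pullConn (Θ : P → P.E →L[ℝ] G.E) (f : Y → P) (y : Y) : Y.E →L[ℝ] G.E := (Θ (f y)).comp (D f y)

theorem oneForm_pullConn (f : Y → P) : oneForm (pullConn Θ f) = (oneForm Θ).pull f := rfl

theorem IsConnection.pullConn (hΘ : IsConnection P Θ) {f : Y → P} (hf : IsGMap f) :
    IsConnection Y (pullConn Θ f) where
  smooth := by
    rw [smoothOneForm_iff, oneForm_pullConn]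
    exact (smoothOneForm_iff.1 hΘ.smooth).pull hf.smooth
  vertical := fun y ξ => by
    change Θ (f y) (D f y _) = ξ
    rw [hf.D_fund, hΘ.vertical]
  equivariant := fun g y a => by
    change Θ (f (Y.act g y)) (D f (Y.act g y) _) = G.Ad g (Θ (f y) (D f y a))
    rw [← hΘ.equivariant, ← D_comp (hf.smooth) (Y.isAction.smooth_left g),
      ← D_comp (P.isAction.smooth_left g) hf.smooth]
    simp only [hf.equivariant]

theorem curvForm_pullConn (hΘ : SmoothOneForm Θ) {f : Y → P} (hf : Smooth f) :
    curvForm (pullConn Θ f) = (curvForm Θ).pull f := by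
  ext1 y
  have h := congr_fun (Form.d_pull (smoothOneForm_iff.1 hΘ) hf) y
  change (oneForm (pullConn Θ f)).d y + _ = _
  rw [oneForm_pullConn, h]
  rfl

theorem curvature_pull (hΘ : SmoothOneForm Θ) {f : Y → P} (hf : Smooth f) (y : Y) (a b : Y.E) :
    curvature Θ (f y) (D f y a) (D f y b) = curvForm (pullConn Θ f) y ![a, b] := by
  rw [curvature_eq hΘ, curvForm_pullConn hΘ hf, Form.pull_apply]
  congr 1
  ext1 i; fin_cases i <;> rfl

end Curvature

/-! ### Substitution of 1-forms into forms with constant coefficients -/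

section Substitution

variable {V E 𝔤 F : Type*} [NormedAddCommGroup V] [NormedSpace ℝ V] [NormedAddCommGroup E]
  [NormedSpace ℝ E] [NormedAddCommGroup 𝔤] [NormedSpace ℝ 𝔤] [NormedAddCommGroup F]
  [NormedSpace ℝ F]

theorem alternating_swap {W : Type*} [NormedAddCommGroup W] [NormedSpace ℝ W]
    (T : W [⋀^Fin 2]→L[ℝ] F) (x y : W) : T ![x, y] = -T ![y, x] := by
  have h := T.toAlternatingMap.map_swap ![y, x] (i := 0) (j := 1) (by decide)
  have e : ![y, x] ∘ Equiv.swap 0 1 = ![x, y] := by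
    ext1 i; fin_cases i <;> rfl
  rw [e] at h
  exact h

theorem alternating_sub_left {W : Type*} [NormedAddCommGroup W] [NormedSpace ℝ W]
    (T : W [⋀^Fin 2]→L[ℝ] F) (x x' y : W) : T ![x - x', y] = T ![x, y] - T ![x', y] := by
  have h := T.toAlternatingMap.map_update_sub ![x, y] 0 x x'
  have e : ∀ z : W, Function.update ![x, y] 0 z = ![z, y] := fun z => by
    ext1 i; fin_cases i <;> rfl
  rw [e, e, e] at h
  exact h

theorem comp_cons_two {W W' : Type*} (h : W → W') (a b : W) :
    (fun i => h (![a, b] i)) = ![h a, h b] := by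
  ext1 i; fin_cases i <;> rfl

/-- The exterior derivative of the 2-form obtained from a family `T` of 2-forms on `𝔤 × E` by
substitution of a `𝔤`-valued 1-form `Θ`: the substitution of `Θ` into the derivative of `T`, and
the terms with `dΘ`. -/
theorem extDeriv_substitution {T : E → (𝔤 × E) [⋀^Fin 2]→L[ℝ] F} {p : V →L[ℝ] E}
    {Θ : V → V →L[ℝ] 𝔤} {v : V} (hT : DifferentiableAt ℝ T (p v)) (hΘ : DifferentiableAt ℝ Θ v)
    (a b c : V) :
    let h : V → 𝔤 × E := fun a => (Θ v a, p a)
    let dΘ : V → V → 𝔤 := fun a b => fderiv ℝ Θ v a b - fderiv ℝ Θ v b a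
    extDeriv (fun z => (T (p z)).compContinuousLinearMap ((Θ z).prod p)) v ![a, b, c] =
      extDeriv (fun q : 𝔤 × E => T q.2) (0, p v) ![h a, h b, h c] +
        T (p v) ![(dΘ a b, 0), h c] - T (p v) ![(dΘ a c, 0), h b] +
          T (p v) ![(dΘ b c, 0), h a] := by
  intro h dΘ
  have hTp : DifferentiableAt ℝ (fun z => T (p z)) v := hT.comp v p.differentiableAt
  have hh : DifferentiableAt ℝ (fun z => (Θ z).prod p) v := by
    have e : (fun z => (Θ z).prod p) = fun z => (ContinuousLinearMap.inl ℝ 𝔤 E).comp (Θ z) +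
        (ContinuousLinearMap.inr ℝ 𝔤 E).comp p := by
      ext1 z
      ext1 w
      simp
    rw [e]
    exact ((differentiableAt_const _).clm_comp hΘ).add_const _
  have hcomp : DifferentiableAt ℝ (fun z => (T (p z)).compContinuousLinearMap ((Θ z).prod p)) v :=
    hTp.continuousAlternatingMapCompContinuousLinearMap hh
  have hv : ∀ b, HasFDerivAt (fun z => (Θ z b, p b)) (((fderiv ℝ Θ v).flip b).prod 0) v := fun b =>
    HasFDerivAt.prodMk (by simpa using hΘ.hasFDerivAt.clm_apply (hasFDerivAt_const b v))
      (hasFDerivAt_const _ _)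
  have key : ∀ a b c, fderiv ℝ (fun z => (T (p z)).compContinuousLinearMap ((Θ z).prod p)) v a
      ![b, c] = fderiv ℝ T (p v) (p a) ![h b, h c] + T (p v) ![(fderiv ℝ Θ v a b, 0), h c] -
        T (p v) ![(fderiv ℝ Θ v a c, 0), h b] := by
    intro a b c
    rw [← fderiv_continuousAlternatingMap_apply_const_apply hcomp]
    have e1 : (fun z => (T (p z)).compContinuousLinearMap ((Θ z).prod p) ![b, c]) =
        fun z => T (p z) (fun i => (Θ z (![b, c] i), p (![b, c] i))) := rfl
    rw [e1, fderiv_continuousAlternatingMap_apply_apply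
      (g := fun i z => (Θ z (![b, c] i), p (![b, c] i))) hTp fun i => (hv _).differentiableAt]
    rw [Fin.sum_univ_two]
    have e2 : (fun i => (Θ v (![b, c] i), p (![b, c] i))) = ![h b, h c] := comp_cons_two h b c
    have e3 : fderiv ℝ (fun z => T (p z)) v a = fderiv ℝ T (p v) (p a) :=
      DFunLike.congr_fun (hT.hasFDerivAt.comp v p.hasFDerivAt).fderiv a
    have e4 : ∀ x y z : 𝔤 × E, Function.update ![x, y] 0 z = ![z, y] := fun x y z => by
      ext1 i; fin_cases i <;> rfl
    have e5 : ∀ x y z : 𝔤 × E, Function.update ![x, y] 1 z = ![x, z] := fun x y z => by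
      ext1 i; fin_cases i <;> rfl
    rw [e2, e3, e4, e5]
    rw [show fderiv ℝ (fun z => (Θ z (![b, c] 0), p (![b, c] 0))) v a = (fderiv ℝ Θ v a b, 0) from
      DFunLike.congr_fun (hv b).fderiv a]
    rw [show fderiv ℝ (fun z => (Θ z (![b, c] 1), p (![b, c] 1))) v a = (fderiv ℝ Θ v a c, 0) from
      DFunLike.congr_fun (hv c).fderiv a]
    rw [alternating_swap (T (p v)) (h b)]
    abel
  have hT2 : HasFDerivAt (fun q : 𝔤 × E => T q.2)
      ((fderiv ℝ T (p v)).comp (ContinuousLinearMap.snd ℝ 𝔤 E)) (0, p v) :=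
    HasFDerivAt.comp (g := T) (f := fun q : 𝔤 × E => q.2) ((0, p v) : 𝔤 × E) hT.hasFDerivAt
      hasFDerivAt_snd
  rw [extDeriv_two hcomp, extDeriv_two hT2.differentiableAt, key, key, key, hT2.fderiv]
  have e6 : ∀ x y : 𝔤, ((x - y, 0) : 𝔤 × E) = (x, 0) - (y, 0) := fun x y => by simp
  simp only [dΘ, e6, alternating_sub_left]
  have e7 : ∀ x, ((fderiv ℝ T (p v)).comp (ContinuousLinearMap.snd ℝ 𝔤 E)) (h x) =
      fderiv ℝ T (p v) (p x) := fun x => rfl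
  rw [e7, e7, e7]
  abel

theorem fderiv_substitution {α : E → (𝔤 × E) →L[ℝ] F} {Θ : E → E →L[ℝ] 𝔤} {v : E}
    (hα : DifferentiableAt ℝ α v) (hΘ : DifferentiableAt ℝ Θ v) (a b : E) :
    fderiv ℝ (fun z => (α z).comp ((Θ z).prod (ContinuousLinearMap.id ℝ E))) v a b =
      fderiv ℝ α v a (Θ v b, b) + α v (fderiv ℝ Θ v a b, 0) := by
  have hv : HasFDerivAt (fun z => (Θ z b, b)) (((fderiv ℝ Θ v).flip b).prod 0) v :=
    HasFDerivAt.prodMk (by simpa using hΘ.hasFDerivAt.clm_apply (hasFDerivAt_const b v))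
      (hasFDerivAt_const _ _)
  have hh : DifferentiableAt ℝ (fun z => (Θ z).prod (ContinuousLinearMap.id ℝ E)) v := by
    have e : (fun z => (Θ z).prod (ContinuousLinearMap.id ℝ E)) = fun z =>
        (ContinuousLinearMap.inl ℝ 𝔤 E).comp (Θ z) + ContinuousLinearMap.inr ℝ 𝔤 E := by
      ext1 z
      ext1 w
      simp
    rw [e]
    exact ((differentiableAt_const _).clm_comp hΘ).add_const _
  have h1 := ((hα.clm_comp hh).hasFDerivAt.clm_apply (hasFDerivAt_const b v)).fderiv
  have h2 := (hα.hasFDerivAt.clm_apply hv).fderiv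
  have h3 := DFunLike.congr_fun (h1.symm.trans h2) a
  simpa [add_comm] using h3

end Substitution

/-! ### Equivariant forms of degree 2 -/

namespace WeilForm

variable {G : LieGrp.{v}} {M N : GMfd.{v, u} G}

theorem pull_top {m : ℕ} (B : WeilForm M m) (f : N → M) (x : N) (e : Fin (m + 2) → G.E × N.E) :
    (B.pull f).top x e = B.top (f x) (fun i => ((e i).1, D f x (e i).2)) := rfl

theorem pull_lin {m : ℕ} (B : WeilForm M m) (f : N → M) (x : N) (u : G.E) (e : Fin m → G.E × N.E) :
    (B.pull f).lin x u e = B.lin (f x) u (fun i => ((e i).1, D f x (e i).2)) := rfl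

theorem sub_top {m : ℕ} (B C : WeilForm M m) (x : M) (e : Fin (m + 2) → G.E × M.E) :
    (B - C).top x e = B.top x e - C.top x e := rfl

theorem sub_lin {m : ℕ} (B C : WeilForm M m) (x : M) (u : G.E) (e : Fin m → G.E × M.E) :
    (B - C).lin x u e = B.lin x u e - C.lin x u e := rfl

/-- The component in `Ω²(M)`. -/
def body (B : WeilForm M 0) : Form 2 ℝ M.toMfd := fun x =>
  (B.top x).compContinuousLinearMap (ContinuousLinearMap.inr ℝ G.E M.E)

theorem body_apply (B : WeilForm M 0) (x : M) (v : Fin 2 → M.E) :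
    B.body x v = B.top x (fun i => (0, v i)) := rfl

/-- The component in `S¹𝔤* ⊗ Ω⁰(M)`, evaluated at `u`. -/
def moment (B : WeilForm M 0) (u : G.E) : Form 0 ℝ M.toMfd := funForm fun x => B.lin x u ![]

/-- The contraction of the component in `Λ²(𝔤 × TM)*` with `u ∈ 𝔤`, restricted to `TM`. -/
def contr (B : WeilForm M 0) (u : G.E) : Form 1 ℝ M.toMfd := oneForm fun x =>
  ((B.top x).toContinuousLinearMap ![(u, 0), 0] 1).comp (ContinuousLinearMap.inr ℝ G.E M.E)

theorem contr_apply (B : WeilForm M 0) (u : G.E) (x : M) (v : Fin 1 → M.E) :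
    B.contr u x v = B.top x ![(u, 0), (0, v 0)] := by
  change B.top x (Function.update ![(u, 0), 0] 1 (0, v 0)) = _
  congr 1
  ext1 i; fin_cases i <;> rfl

/-- The component in `S¹𝔤* ⊗ Ω¹(M)` of `d_G B`, evaluated at `u`. -/
def dMoment (B : WeilForm M 0) (u : G.E) : Form 1 ℝ M.toMfd := fun x =>
  (B.moment u).d x + B.contr u x

theorem dMoment_apply (B : WeilForm M 0) (u : G.E) (x : M) (v : Fin 1 → M.E) :
    B.dMoment u x v = (B.moment u).d x v + B.contr u x v := rfl

namespace IsEquivForm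

variable {B : WeilForm M 0}

theorem contDiffAt_top (hB : B.IsEquivForm) {x₀ : M} {y : M.E} (hy : y ∈ (extChartAt (𝓡 M.dim) x₀).target) :
    ContDiffAt ℝ ∞ (B.topChart x₀) y :=
  (hB.smooth_top x₀).contDiffAt ((isOpen_extChartAt_target x₀).mem_nhds hy)

theorem isSmooth_body (hB : B.IsEquivForm) : B.body.IsSmooth := fun _ _ hy =>
  contDiffAt_alternating_comp (g := fun _ => ContinuousLinearMap.inr ℝ G.E M.E)
    (hB.contDiffAt_top hy) contDiffAt_const

theorem isSmooth_moment (hB : B.IsEquivForm) (u : G.E) : (B.moment u).IsSmooth := by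
  intro x₀ y hy
  refine contDiffAt_alternating fun v => ?_
  have h := (hB.smooth_lin x₀).contDiffAt ((isOpen_extChartAt_target x₀).mem_nhds hy)
  have h2 := (ContinuousAlternatingMap.apply ℝ (G.E × M.E) ℝ (ι := Fin 0) ![]).contDiff.contDiffAt.comp
    y (h.clm_apply (contDiffAt_const (c := u)))
  refine h2.congr_of_eventuallyEq (Eventually.of_forall fun z => ?_)
  change B.lin _ u ![] = B.lin _ u _
  congr 1
  exact Subsingleton.elim _ _

theorem isSmooth_contr (hB : B.IsEquivForm) (u : G.E) : (B.contr u).IsSmooth := by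
  intro x₀ y hy
  refine contDiffAt_alternating fun v => ?_
  have h := (ContinuousAlternatingMap.apply ℝ (G.E × M.E) ℝ
    ![(u, 0), (0, v 0)]).contDiff.contDiffAt.comp y (hB.contDiffAt_top hy)
  refine h.congr_of_eventuallyEq (Eventually.of_forall fun z => ?_)
  change B.contr u ((extChartAt (𝓡 M.dim) x₀).symm z) (fun i => chartD M.toMfd x₀ z (v i)) = _
  rw [contr_apply]
  change _ = B.top _ _
  congr 1
  ext1 i
  fin_cases i
  · change (u, (0 : M.E)) = (u, chartD M.toMfd x₀ z 0)
    rw [map_zero]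
  · rfl

theorem isSmooth_dMoment (hB : B.IsEquivForm) (u : G.E) : (B.dMoment u).IsSmooth := fun x₀ y hy =>
  ((hB.isSmooth_moment u).d x₀ y hy).add (hB.isSmooth_contr u x₀ y hy)

theorem top_eq (hB : B.IsEquivForm) (x : M) (e e' : Fin 2 → G.E × M.E) (h : ∀ i, M.hor x (e i) = M.hor x (e' i)) :
    B.top x e = B.top x e' := by
  refine alternating_eq_of_map_eq (p := M.hor x) ?_ h
  rintro v ⟨i, hi⟩
  refine hB.horizontal_top x (v i).1 v ⟨i, ?_⟩
  rw [GMfd.hor_apply, sub_eq_zero] at hi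
  exact Prod.ext rfl hi

theorem top_eq_body (hB : B.IsEquivForm) (x : M) (e : Fin 2 → G.E × M.E) :
    B.top x e = B.body x (fun i => M.hor x (e i)) := by
  rw [body_apply]
  refine hB.top_eq x _ _ fun i => ?_
  simp only [GMfd.hor_apply, map_zero, sub_zero]

theorem body_act (hB : B.IsEquivForm) (g : G) (x : M) (v : Fin 2 → M.E) :
    B.body (M.act g x) (fun i => D (M.act g) x (v i)) = B.body x v := by
  have h := hB.invariant_top g x (fun i => (0, v i))
  simp only [map_zero] at h
  exact h

theorem contr_act (hB : B.IsEquivForm) (g : G) (u : G.E) (x : M) (v : Fin 1 → M.E) :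
    B.contr (G.Ad g u) (M.act g x) (fun i => D (M.act g) x (v i)) = B.contr u x v := by
  rw [contr_apply, contr_apply, ← hB.invariant_top g x]
  congr 1
  ext1 i
  fin_cases i
  · change (G.Ad g u, (0 : M.E)) = (G.Ad g u, D (M.act g) x 0)
    rw [map_zero]
  · change ((0 : G.E), _) = (G.Ad g 0, _)
    rw [map_zero]
    rfl

theorem moment_act (hB : B.IsEquivForm) (g : G) (u : G.E) (x : M) :
    B.lin (M.act g x) (G.Ad g u) ![] = B.lin x u ![] := by
  rw [← hB.invariant_lin g x u ![]]
  congr 1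
  exact Subsingleton.elim _ _

theorem dMoment_act (hB : B.IsEquivForm) (g : G) (u : G.E) (x : M) (v : Fin 1 → M.E) :
    B.dMoment (G.Ad g u) (M.act g x) (fun i => D (M.act g) x (v i)) = B.dMoment u x v := by
  rw [dMoment_apply, dMoment_apply, hB.contr_act]
  congr 1
  have h1 : (B.moment (G.Ad g u)).pull (M.act g) = B.moment u := by
    change funForm _ = funForm _
    congr 1
    ext1 x
    exact hB.moment_act g u x
  have h2 := Form.d_pull (hB.isSmooth_moment (G.Ad g u)) (M.isAction.smooth_left g)
  rw [h1] at h2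
  exact (DFunLike.congr_fun (congr_fun h2 x) v).symm

/-- The infinitesimal form of the invariance of the component in `S¹𝔤* ⊗ Ω⁰(M)`. -/
theorem d_moment_fund (hB : B.IsEquivForm) (u ξ : G.E) (x : M) :
    (B.moment u).d x ![M.fund x ξ] = -B.lin x (G.bracket u ξ) ![] := by
  let c : (G.E →L[ℝ] ((G.E × M.E) [⋀^Fin 0]→L[ℝ] ℝ)) →L[ℝ] (G.E →L[ℝ] ℝ) :=
    (ContinuousLinearMap.compL ℝ G.E _ ℝ) (ContinuousAlternatingMap.apply ℝ (G.E × M.E) ℝ ![])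
  have hc := contMDiffAt_actPlot G.coordOne_mem (mem_extChartAt_target (I := 𝓡 M.dim) x)
  -- the moment along the action, as a function on `G` in coordinates
  let f : G.E → G.E →L[ℝ] ℝ := fun z =>
    c (B.lin (M.actPlot x (z, extChartAt (𝓡 M.dim) x x)))
  have hplot : ∀ w, DifferentiableAt ℝ (fun p => (B.moment w).plot (M.actPlot x) p)
      (G.coordOne, extChartAt (𝓡 M.dim) x x) := fun w =>
    ((hB.isSmooth_moment w).plot hc).differentiableAt (by simp)
  have hfw : ∀ w, ContDiffAt ℝ ∞ (fun z => f z w) G.coordOne := fun w => by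
    have h1 : ContDiffAt ℝ ∞ (fun p => (B.moment w).plot (M.actPlot x) p ![])
        (G.coordOne, extChartAt (𝓡 M.dim) x x) :=
      ContDiffAt.comp (f := (B.moment w).plot (M.actPlot x)) _
        (ContinuousAlternatingMap.apply ℝ (G.E × M.E) ℝ (ι := Fin 0) ![]).contDiff.contDiffAt
        ((hB.isSmooth_moment w).plot hc)
    exact ContDiffAt.comp (f := fun z : G.E => (z, extChartAt (𝓡 M.dim) x x)) G.coordOne h1
      (contDiffAt_id.prodMk contDiffAt_const)
  have hf : DifferentiableAt ℝ f G.coordOne := (contDiffAt_clm hfw).differentiableAt (by simp)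
  have hder : ∀ w, fderiv ℝ f G.coordOne ξ w = -(B.moment w).d x ![M.fund x ξ] := by
    intro w
    have h1 : (B.moment w).d x ![M.fund x (-ξ)] = fderiv ℝ (fun z => f z w) G.coordOne (-ξ) * (-1) := by
      have h2 := DFunLike.congr_fun (Form.extDeriv_plot (hB.isSmooth_moment w) hc) ![((ξ, 0) : G.E × M.E)]
      rw [plot_actPlot_self, extDeriv_zero_form (hplot w),
        fderiv_prod_left ((hplot w).continuousAlternatingMap_apply_const _)] at h2
      have e0 : (fun i => M.hor x (![((ξ, 0) : G.E × M.E)] i)) = ![M.fund x (-ξ)] := by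
        ext1 i
        fin_cases i
        change M.hor x (ξ, 0) = M.fund x (-ξ)
        rw [GMfd.hor_apply, map_neg, zero_sub]
      rw [e0] at h2
      rw [← h2, map_neg]
      simp only [mul_neg, mul_one, neg_neg]
      rfl
    have h3 : (B.moment w).d x ![M.fund x (-ξ)] = -(B.moment w).d x ![M.fund x ξ] := by
      have h4 := ((B.moment w).d x).map_update_smul ![M.fund x ξ] 0 (-1) (M.fund x ξ)
      have e : ∀ z : M.E, Function.update ![M.fund x ξ] 0 z = ![z] := fun z => by
        ext1 i; fin_cases i; rfl
      rw [e, e, neg_one_smul, neg_one_smul] at h4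
      rw [map_neg]
      exact h4
    have h5 : fderiv ℝ (fun z => f z w) G.coordOne ξ = fderiv ℝ f G.coordOne ξ w := by
      have := (hf.hasFDerivAt.clm_apply (hasFDerivAt_const w G.coordOne)).fderiv
      simpa using DFunLike.congr_fun this ξ
    rw [← h5, ← h3, h1, map_neg]
    ring
  have hconst : (fun z => f z (G.Ad (G.coord z) u)) = fun _ => B.lin x u ![] := by
    ext1 z
    change B.lin (M.act (G.coord z) ((extChartAt (𝓡 M.dim) x).symm _)) _ ![] = _
    rw [hB.moment_act, extChartAt_to_inv]
  have hAd := (contDiffAt_Ad (G := G) G.coordOne_mem).differentiableAt (by simp)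
  have h6 := DFunLike.congr_fun ((hf.hasFDerivAt.clm_apply
    (hAd.hasFDerivAt.clm_apply (hasFDerivAt_const u G.coordOne))).fderiv) ξ
  rw [hconst, fderiv_fun_const] at h6
  have hf1 : f G.coordOne = c (B.lin x) := by
    change c (B.lin (M.actPlot x _)) = _
    rw [M.actPlot_coordOne, extChartAt_to_inv]
  have hAd1 : G.Ad (G.coord G.coordOne) u = u := by
    have h7 : G.Ad (1 : G) u = D (M := G.toMfd) (N := G.toMfd) (fun h : G => 1 * h * 1⁻¹) 1 u := rfl
    simp only [one_mul, inv_one, mul_one] at h7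
    rw [G.coord_coordOne, h7, D_id (M := G.toMfd)]
  have h8 : 0 = c (B.lin x) (fderiv ℝ (fun z => G.Ad (G.coord z)) G.coordOne ξ u) +
      fderiv ℝ f G.coordOne ξ u := by
    simpa [hf1, hAd1] using h6
  rw [fderiv_Ad, hder] at h8
  have h9 : c (B.lin x) (G.bracket ξ u) = -B.lin x (G.bracket u ξ) ![] := by
    change B.lin x (G.bracket ξ u) ![] = _
    rw [bracket_skew, map_neg]
    rfl
  linarith

/-- The component of `d_G B` in `Λ³(𝔤 × TM)*` is basic, and its restriction to `TM` is the exterior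
derivative of the component of `B` in `Ω²(M)`. -/
theorem dTop_eq (hB : B.IsEquivForm) (x : M) (a b c : G.E × M.E) :
    B.dTop x a b c = B.body.d x ![M.hor x a, M.hor x b, M.hor x c] := by
  have hc := contMDiffAt_actPlot G.coordOne_mem (mem_extChartAt_target (I := 𝓡 M.dim) x)
  have h1 := DFunLike.congr_fun (Form.extDeriv_plot hB.isSmooth_body hc) ![a, b, c]
  rw [plot_actPlot_self] at h1
  have e0 : (fun i => M.hor x (![a, b, c] i)) = ![M.hor x a, M.hor x b, M.hor x c] := by
    ext1 i; fin_cases i <;> rfl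
  rw [e0] at h1
  rw [← h1]
  have he : B.body.plot (M.actPlot x) =ᶠ[𝓝 (G.coordOne, extChartAt (𝓡 M.dim) x x)] fun p =>
      (B.topChart x (ContinuousLinearMap.snd ℝ G.E M.E p)).compContinuousLinearMap
        (((G.mcChart p.1).comp (ContinuousLinearMap.fst ℝ G.E M.E)).prod
          (ContinuousLinearMap.snd ℝ G.E M.E)) := by
    filter_upwards [eventually_target (G := G) x] with p hp
    ext1 w
    refine (plot_actPlot hB.body_act hp.1 hp.2 w).trans ?_
    exact (hB.top_eq_body _ _).symm
  have hmc : DifferentiableAt ℝ G.mcChart G.coordOne :=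
    (smooth_mc.contDiffAt (M := G.toMfd) (1 : G)).differentiableAt (by simp)
  have hΘ : HasFDerivAt (fun p : G.E × M.E => (G.mcChart p.1).comp (ContinuousLinearMap.fst ℝ G.E M.E))
      (((ContinuousLinearMap.compL ℝ (G.E × M.E) G.E G.E).flip
        (ContinuousLinearMap.fst ℝ G.E M.E)).comp ((fderiv ℝ G.mcChart G.coordOne).comp
          (ContinuousLinearMap.fst ℝ G.E M.E))) (G.coordOne, extChartAt (𝓡 M.dim) x x) :=
    ((ContinuousLinearMap.compL ℝ (G.E × M.E) G.E G.E).flip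
      (ContinuousLinearMap.fst ℝ G.E M.E)).hasFDerivAt.comp _
      (HasFDerivAt.comp (g := G.mcChart) (f := fun p : G.E × M.E => p.1)
        ((G.coordOne, extChartAt (𝓡 M.dim) x x) : G.E × M.E) hmc.hasFDerivAt hasFDerivAt_fst)
  have hT : DifferentiableAt ℝ (B.topChart x) (extChartAt (𝓡 M.dim) x x) :=
    (hB.contDiffAt_top (mem_extChartAt_target x)).differentiableAt (by simp)
  have h2 := extDeriv_substitution (p := ContinuousLinearMap.snd ℝ G.E M.E)
    (v := (G.coordOne, extChartAt (𝓡 M.dim) x x)) hT hΘ.differentiableAt a b c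
  rw [he.extDeriv_eq, h2]
  have hd : ∀ ξ η : G.E × M.E, fderiv ℝ (fun p : G.E × M.E =>
      (G.mcChart p.1).comp (ContinuousLinearMap.fst ℝ G.E M.E))
        (G.coordOne, extChartAt (𝓡 M.dim) x x) ξ η - fderiv ℝ (fun p : G.E × M.E =>
      (G.mcChart p.1).comp (ContinuousLinearMap.fst ℝ G.E M.E))
        (G.coordOne, extChartAt (𝓡 M.dim) x x) η ξ = -G.bracket ξ.1 η.1 := by
    intro ξ η
    rw [hΘ.fderiv, ← d_mc, d_oneForm smooth_mc]
    rfl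
  have hid : ∀ ξ : G.E × M.E, (((G.mcChart G.coordOne).comp (ContinuousLinearMap.fst ℝ G.E M.E)) ξ,
      ContinuousLinearMap.snd ℝ G.E M.E ξ) = ξ := by
    intro ξ
    rw [G.mcChart_coordOne]
    rfl
  have htop : B.topChart x (extChartAt (𝓡 M.dim) x x) = B.top x := by
    unfold topChart
    rw [chartD_eq_id, extChartAt_to_inv]
    rfl
  have hneg : ∀ (ξ : G.E) (w : G.E × M.E), B.top x ![(-ξ, 0), w] = -B.top x ![(ξ, 0), w] := by
    intro ξ w
    have e : ((-ξ, 0) : G.E × M.E) = 0 - (ξ, 0) := by simp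
    have e0 : B.top x ![0, w] = 0 := (B.top x).map_coord_zero 0 rfl
    rw [e, alternating_sub_left, e0, zero_sub]
  simp only [hd, hid, dTop, chartT_eq_id]
  change _ = _ + B.topChart x (extChartAt (𝓡 M.dim) x x) _ -
    B.topChart x (extChartAt (𝓡 M.dim) x x) _ + B.topChart x (extChartAt (𝓡 M.dim) x x) _
  rw [htop, hneg, hneg, hneg]
  change extDeriv _ _ ![a, b, c] - _ + _ - _ = _
  simp only [ContinuousLinearMap.coe_snd']
  ring

/-- The component of `d_G B` in `S¹𝔤* ⊗ Λ¹(𝔤 × TM)*` is basic. -/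
theorem dLin_eq (hB : B.IsEquivForm) (x : M) (u : G.E) (e : G.E × M.E) :
    B.dLin x u e = B.dMoment u x ![M.hor x e] := by
  have h1 : (B.moment u).d x ![M.hor x e] = (B.moment u).d x ![e.2] -
      (B.moment u).d x ![M.fund x e.1] := by
    have h2 := ((B.moment u).d x).toAlternatingMap.map_update_sub ![e.2] 0 e.2 (M.fund x e.1)
    have e : ∀ z : M.E, Function.update ![e.2] 0 z = ![z] := fun z => by
      ext1 i; fin_cases i; rfl
    rw [e, e, e] at h2
    exact h2
  have h2 : (B.moment u).d x ![e.2] = dFun (fun y : M => B.lin y u ![]) x e.2 :=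
    d_funForm _ (hB.isSmooth_moment u) x e.2
  rw [dMoment_apply, h1, hB.d_moment_fund, contr_apply, h2, dLin,
    hB.top_eq x ![(u, 0), e] ![(u, 0), (0, M.hor x e)] fun i => ?_]
  · change _ + _ + _ = _ - -_ + B.top x ![(u, 0), (0, M.hor x e)]
    ring
  · fin_cases i
    · rfl
    · change M.hor x e = M.hor x (0, M.hor x e)
      simp only [GMfd.hor_apply, map_zero, sub_zero]

end IsEquivForm

end WeilForm

namespace Form

variable {M : Mfd.{u}} {N : Mfd.{v}} {F : Type*} [NormedAddCommGroup F] [NormedSpace ℝ F] {k : ℕ}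

theorem d_add {σ τ : Form k F M} (hσ : σ.IsSmooth) (hτ : τ.IsSmooth) :
    Form.d (σ + τ) = σ.d + τ.d := by
  ext1 x
  exact extDeriv_add ((hσ x _ (mem_extChartAt_target x)).differentiableAt (by simp))
    ((hτ x _ (mem_extChartAt_target x)).differentiableAt (by simp))

theorem d_smul (σ : Form k F M) (c : ℝ) : Form.d (c • σ) = c • σ.d := by
  ext1 x
  exact extDeriv_smul (𝕜 := ℝ) c (σ.chart x)

end Form

/-! ### Equivariant curvature of circle bundles -/

namespace GBun

variable {G : LieGrp.{v}} {Z : GMfd.{v, u} G} (K : GBun Z) {A : K.tot → K.tot.E →L[ℝ] ℝ}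
  {F : WeilForm Z 0}

/-- The equivariant extension of a connection, in the preferred chart around `k`. -/
def extChart (A : K.tot → K.tot.E →L[ℝ] ℝ) (k : K.tot) (y : K.tot.E) :
    (G.E × K.tot.E) →L[ℝ] ℝ :=
  (K.equivExt A ((extChartAt (𝓡 K.tot.dim) k).symm y)).comp
    ((ContinuousLinearMap.id ℝ G.E).prodMap (chartD K.tot.toMfd k y))

theorem equivExt_eq (A : K.tot → K.tot.E →L[ℝ] ℝ) (k : K.tot) (e : G.E × K.tot.E) :
    K.equivExt A k e = A k (K.tot.hor k e) := by
  rw [GMfd.hor_apply, map_sub]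
  rfl

theorem extChart_inr (A : K.tot → K.tot.E →L[ℝ] ℝ) (k : K.tot) (y : K.tot.E) (a : K.tot.E) :
    K.extChart A k y (0, a) = oneFormChart A k y a := by
  change K.equivExt A _ (0, _) = _
  rw [equivExt_eq, GMfd.hor_apply, map_zero, sub_zero]
  rfl

theorem extChart_inl (A : K.tot → K.tot.E →L[ℝ] ℝ) (k : K.tot) (y : K.tot.E) (u : G.E) :
    K.extChart A k y (u, 0) = K.equivExt A ((extChartAt (𝓡 K.tot.dim) k).symm y) (u, 0) := by
  change K.equivExt A _ (u, chartD K.tot.toMfd k y 0) = _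
  rw [map_zero]

theorem extChart_self (A : K.tot → K.tot.E →L[ℝ] ℝ) (k : K.tot) :
    K.extChart A k (extChartAt (𝓡 K.tot.dim) k k) = K.equivExt A k := by
  unfold extChart
  rw [chartD_eq_id, extChartAt_to_inv]
  rfl

theorem contDiffAt_extChart (hA : SmoothOneForm A) (k : K.tot) {y : K.tot.E}
    (hy : y ∈ (extChartAt (𝓡 K.tot.dim) k).target) : ContDiffAt ℝ ∞ (K.extChart A k) y := by
  refine contDiffAt_clm fun w => ?_
  have h1 := (smoothOneForm_iff.1 hA).plot (contMDiffAt_actPlot (x := k) G.coordOne_mem hy)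
  have h2 : ContDiffAt ℝ ∞ (fun p => (oneForm A).plot (K.tot.actPlot k) p ![w]) (G.coordOne, y) :=
    ContDiffAt.comp (f := (oneForm A).plot (K.tot.actPlot k)) _
      (ContinuousAlternatingMap.apply ℝ (G.E × K.tot.E) ℝ ![w]).contDiff.contDiffAt h1
  have h3 : ContDiffAt ℝ ∞ (fun z => (oneForm A).plot (K.tot.actPlot k) (G.coordOne, z) ![w]) y :=
    ContDiffAt.comp (f := fun z : K.tot.E => (G.coordOne, z)) y h2
      (contDiffAt_const.prodMk contDiffAt_id)
  refine h3.congr_of_eventuallyEq ?_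
  filter_upwards [(isOpen_extChartAt_target k).mem_nhds hy] with z hz
  rw [plot_actPlot_one _ hz]
  change K.equivExt A _ _ = _
  rw [equivExt_eq]
  rfl

theorem differentiableAt_extChart (hA : SmoothOneForm A) (k : K.tot) :
    DifferentiableAt ℝ (K.extChart A k) (extChartAt (𝓡 K.tot.dim) k k) :=
  (K.contDiffAt_extChart hA k (mem_extChartAt_target k)).differentiableAt (by simp)

variable {K}

theorem IsCurv.lin_eq (h : K.IsCurv A F) (k : K.tot) (u : G.E) :
    F.lin (K.proj k) u ![] = K.equivExt A k (u, 0) := by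
  rw [← h.1 k u, WeilForm.pull_lin]
  congr 1
  exact Subsingleton.elim _ _

theorem IsCurv.top_eq (h : K.IsCurv A F) (k : K.tot) (a b : G.E × K.tot.E) :
    F.top (K.proj k) ![(a.1, D K.proj k a.2), (b.1, D K.proj k b.2)] =
      fderiv ℝ (K.extChart A k) (extChartAt (𝓡 K.tot.dim) k k) a.2 b -
        fderiv ℝ (K.extChart A k) (extChartAt (𝓡 K.tot.dim) k k) b.2 a -
          K.equivExt A k (G.bracket a.1 b.1, 0) := by
  have h1 := h.2 k a b
  simp only [chartT_eq_id] at h1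
  refine Eq.trans ?_ h1
  rw [WeilForm.pull_top]
  congr 1
  ext1 i; fin_cases i <;> rfl

theorem fderiv_extChart_inr (hA : SmoothOneForm A) (k : K.tot) (a b : K.tot.E) :
    fderiv ℝ (K.extChart A k) (extChartAt (𝓡 K.tot.dim) k k) a (0, b) =
      fderiv ℝ (oneFormChart A k) (extChartAt (𝓡 K.tot.dim) k k) a b := by
  have hd := K.differentiableAt_extChart hA k
  have e1 := (hd.hasFDerivAt.clm_apply (hasFDerivAt_const ((0, b) : G.E × K.tot.E) _)).fderiv
  have e2 := ((hA.contDiffAt k).differentiableAt (by simp)).hasFDerivAt.clm_apply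
    (hasFDerivAt_const b _) |>.fderiv
  simp only [extChart_inr] at e1
  simpa using DFunLike.congr_fun (e1.symm.trans e2) a

theorem IsCurv.top_inr (h : K.IsCurv A F) (hA : SmoothOneForm A) (k : K.tot) (a b : K.tot.E) :
    F.top (K.proj k) ![(0, D K.proj k a), (0, D K.proj k b)] = (oneForm A).d k ![a, b] := by
  have h1 := h.top_eq k (0, a) (0, b)
  have e3 : G.bracket (0 : G.E) 0 = 0 := by
    rw [← bracketForm_apply]
    exact G.bracketForm.map_coord_zero 0 rfl
  rw [h1, d_oneForm hA, fderiv_extChart_inr hA, fderiv_extChart_inr hA, e3]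
  change _ - K.equivExt A k 0 = _
  rw [map_zero, sub_zero]

/-- The values of a connection on a generating vector field, up to sign. -/
def extForm (K : GBun Z) (A : K.tot → K.tot.E →L[ℝ] ℝ) (u : G.E) : Form 0 ℝ K.tot.toMfd :=
  funForm fun k => K.equivExt A k (u, 0)

theorem isSmooth_extForm (hA : SmoothOneForm A) (u : G.E) : (K.extForm A u).IsSmooth := by
  intro k y hy
  refine contDiffAt_alternating fun _ => ?_
  refine ((K.contDiffAt_extChart hA k hy).clm_apply
    (contDiffAt_const (c := ((u, 0) : G.E × K.tot.E)))).congr_of_eventuallyEq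
      (Eventually.of_forall fun z => ?_)
  exact (K.extChart_inl A k z u).symm

theorem IsCurv.top_inl (h : K.IsCurv A F) (hA : SmoothOneForm A) (k : K.tot) (u : G.E)
    (a : K.tot.E) : F.top (K.proj k) ![(u, 0), (0, D K.proj k a)] = -(K.extForm A u).d k ![a] := by
  have h1 := h.top_eq k (u, 0) (0, a)
  have hd := K.differentiableAt_extChart hA k
  have e3 : G.bracket u 0 = 0 := by
    rw [← bracketForm_apply]
    exact G.bracketForm.map_coord_zero 1 rfl
  have e4 : (K.extForm A u).d k ![a] =
      fderiv ℝ (K.extChart A k) (extChartAt (𝓡 K.tot.dim) k k) a (u, 0) := by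
    refine (extDeriv_zero_form ((isSmooth_extForm hA u k _
      (mem_extChartAt_target k)).differentiableAt (by simp)) a).trans ?_
    have e1 := (hd.hasFDerivAt.clm_apply (hasFDerivAt_const ((u, 0) : G.E × K.tot.E) _)).fderiv
    have e2 : (fun z => (K.extForm A u).chart k z ![]) = fun z => K.extChart A k z (u, 0) := by
      ext1 z
      rw [extChart_inl]
      rfl
    rw [e2]
    simpa using DFunLike.congr_fun e1 a
  rw [e4]
  simp only [map_zero, e3, zero_apply, zero_sub] at h1
  rw [h1]
  change _ - K.equivExt A k 0 = _
  rw [map_zero, sub_zero]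

end GBun

/-! ### The curvature of an equivariant gerbe -/

section GerbeCurvature

variable {G : LieGrp.{v}} {M : GMfd.{v, u} G}

theorem Gerbe.isGMap_fst_proj (𝓛 : Gerbe M) : IsGMap fun l => 𝓛.fst (𝓛.L.proj l) :=
  𝓛.square.fst_map.comp 𝓛.L.proj_map

theorem Gerbe.isGMap_snd_proj (𝓛 : Gerbe M) : IsGMap fun l => 𝓛.snd (𝓛.L.proj l) :=
  𝓛.square.snd_map.comp 𝓛.L.proj_map

/-- A form on `Y` with equal pullbacks to `L` along the two projections descends to `M`. -/
theorem Gerbe.exists_descend (𝓛 : Gerbe M) {F : Type*} [NormedAddCommGroup F] [NormedSpace ℝ F]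
    [FiniteDimensional ℝ F] {k : ℕ} {σ : Form k F 𝓛.Y.toMfd} (hσ : σ.IsSmooth)
    (h : σ.pull (N := 𝓛.L.tot.toMfd) (fun l => 𝓛.snd (𝓛.L.proj l)) =
      σ.pull (N := 𝓛.L.tot.toMfd) (fun l => 𝓛.fst (𝓛.L.proj l))) :
    ∃ σ₁ : Form k F M.toMfd, σ₁.IsSmooth ∧ σ₁.pull (N := 𝓛.Y.toMfd) 𝓛.π = σ := by
  refine Form.exists_descend 𝓛.cover.smooth 𝓛.cover.surjective 𝓛.cover.submersion hσ ?_
  intro y y' v v' hy hv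
  obtain ⟨p, ⟨rfl, rfl⟩, -⟩ := 𝓛.square.points y y' hy
  choose c hc using fun i => (𝓛.square.tangent p (v i) (v' i) (hv i)).exists
  obtain ⟨l, rfl⟩ := 𝓛.L.principal.surjective p
  choose b hb using fun i => 𝓛.L.principal.submersion l (c i)
  have h1 := DFunLike.congr_fun (congr_fun h l) b
  rw [Form.pull_apply, Form.pull_apply] at h1
  have e1 : ∀ i, D (M := 𝓛.L.tot.toMfd) (fun l => 𝓛.snd (𝓛.L.proj l)) l (b i) = v' i := fun i => by
    rw [D_comp 𝓛.square.snd_map.smooth 𝓛.L.proj_map.smooth, hb, (hc i).2]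
  have e2 : ∀ i, D (M := 𝓛.L.tot.toMfd) (fun l => 𝓛.fst (𝓛.L.proj l)) l (b i) = v i := fun i => by
    rw [D_comp 𝓛.square.fst_map.smooth 𝓛.L.proj_map.smooth, hb, (hc i).1]
  simp only [e1, e2] at h1
  exact h1.symm

namespace Gerbe.Conn

variable {𝓛 : Gerbe M} (c : 𝓛.Conn)

theorem body_pull : c.B.body.pull (N := 𝓛.L.tot.toMfd) (fun l => 𝓛.snd (𝓛.L.proj l)) =
    c.B.body.pull (N := 𝓛.L.tot.toMfd) (fun l => 𝓛.fst (𝓛.L.proj l)) + (oneForm c.A).d := by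
  ext1 l
  ext1 v
  have h := c.curv.top_inr c.isConn.smooth l (v 0) (v 1)
  rw [WeilForm.sub_top, WeilForm.pull_top, WeilForm.pull_top, ← eq_cons_two v] at h
  refine eq_add_of_sub_eq' (Eq.trans ?_ h)
  change c.B.body _ _ - c.B.body _ _ = _
  rw [WeilForm.body_apply, WeilForm.body_apply]
  congr 2
  · ext1 i
    fin_cases i
    · exact congr_arg (Prod.mk 0) (D_comp 𝓛.square.snd_map.smooth 𝓛.L.proj_map.smooth l (v 0))
    · exact congr_arg (Prod.mk 0) (D_comp 𝓛.square.snd_map.smooth 𝓛.L.proj_map.smooth l (v 1))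
  · ext1 i
    fin_cases i
    · exact congr_arg (Prod.mk 0) (D_comp 𝓛.square.fst_map.smooth 𝓛.L.proj_map.smooth l (v 0))
    · exact congr_arg (Prod.mk 0) (D_comp 𝓛.square.fst_map.smooth 𝓛.L.proj_map.smooth l (v 1))

theorem moment_pull (u : G.E) :
    (c.B.moment u).pull (N := 𝓛.L.tot.toMfd) (fun l => 𝓛.snd (𝓛.L.proj l)) =
      (c.B.moment u).pull (N := 𝓛.L.tot.toMfd) (fun l => 𝓛.fst (𝓛.L.proj l)) +
        𝓛.L.extForm c.A u := by
  have h : ∀ l, c.B.lin (𝓛.snd (𝓛.L.proj l)) u ![] =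
      c.B.lin (𝓛.fst (𝓛.L.proj l)) u ![] + 𝓛.L.equivExt c.A l (u, 0) := fun l => by
    have h := c.curv.lin_eq l u
    rw [WeilForm.sub_lin, WeilForm.pull_lin, WeilForm.pull_lin] at h
    rw [← h]
    have e : ∀ f : Fin 0 → G.E × 𝓛.Y.E, f = ![] := fun f => Subsingleton.elim _ _
    rw [e (fun i => _), e (fun i => _)]
    ring
  ext l v
  exact h l

theorem contr_pull (u : G.E) :
    (c.B.contr u).pull (N := 𝓛.L.tot.toMfd) (fun l => 𝓛.fst (𝓛.L.proj l)) =
      (c.B.contr u).pull (N := 𝓛.L.tot.toMfd) (fun l => 𝓛.snd (𝓛.L.proj l)) +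
        (𝓛.L.extForm c.A u).d := by
  ext l v
  have h := c.curv.top_inl c.isConn.smooth l u (v 0)
  have ev : ![v 0] = v := by ext1 i; fin_cases i; rfl
  rw [WeilForm.sub_top, WeilForm.pull_top, WeilForm.pull_top, ev] at h
  change (c.B.contr u).pull _ l v = (c.B.contr u).pull _ l v + (𝓛.L.extForm c.A u).d l v
  rw [Form.pull_apply, Form.pull_apply, WeilForm.contr_apply, WeilForm.contr_apply,
    D_comp 𝓛.square.snd_map.smooth 𝓛.L.proj_map.smooth,
    D_comp 𝓛.square.fst_map.smooth 𝓛.L.proj_map.smooth]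
  have e : ∀ (f : 𝓛.Y₂ → 𝓛.Y) (p : 𝓛.Y₂) (a : 𝓛.Y₂.E), (fun i => (((![(u, 0), (0, a)] :
      Fin 2 → G.E × 𝓛.Y₂.E) i).1, D f p ((![(u, 0), (0, a)] : Fin 2 → G.E × 𝓛.Y₂.E) i).2)) =
        ![(u, 0), (0, D f p a)] := by
    intro f p a
    ext1 i
    fin_cases i
    · change (u, D f p 0) = (u, 0)
      rw [map_zero]
    · rfl
  rw [e, e] at h
  linarith

theorem d_body_pull : c.B.body.d.pull (N := 𝓛.L.tot.toMfd) (fun l => 𝓛.snd (𝓛.L.proj l)) =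
    c.B.body.d.pull (N := 𝓛.L.tot.toMfd) (fun l => 𝓛.fst (𝓛.L.proj l)) := by
  have hs := c.isEquivForm.isSmooth_body
  have hA := smoothOneForm_iff.1 c.isConn.smooth
  rw [← Form.d_pull hs 𝓛.isGMap_snd_proj.smooth, ← Form.d_pull hs 𝓛.isGMap_fst_proj.smooth,
    c.body_pull, Form.d_add (hs.pull 𝓛.isGMap_fst_proj.smooth) hA.d]
  have h0 : (oneForm c.A).d.d = 0 := by ext1 l; exact Form.d_d hA l
  rw [h0, add_zero]

theorem dMoment_pull (u : G.E) :
    (c.B.dMoment u).pull (N := 𝓛.L.tot.toMfd) (fun l => 𝓛.snd (𝓛.L.proj l)) =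
      (c.B.dMoment u).pull (N := 𝓛.L.tot.toMfd) (fun l => 𝓛.fst (𝓛.L.proj l)) := by
  have hs := c.isEquivForm.isSmooth_moment u
  have h : ∀ f : 𝓛.L.tot → 𝓛.Y, (c.B.dMoment u).pull (N := 𝓛.L.tot.toMfd) f =
      (c.B.moment u).d.pull (N := 𝓛.L.tot.toMfd) f + (c.B.contr u).pull (N := 𝓛.L.tot.toMfd) f :=
    fun f => rfl
  rw [h, h, c.contr_pull, ← Form.d_pull hs 𝓛.isGMap_snd_proj.smooth,
    ← Form.d_pull hs 𝓛.isGMap_fst_proj.smooth, c.moment_pull,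
    Form.d_add (hs.pull 𝓛.isGMap_fst_proj.smooth) (GBun.isSmooth_extForm c.isConn.smooth u)]
  abel

end Gerbe.Conn

theorem WeilForm.IsEquivForm.dMoment_add {B : WeilForm M 0} (hB : B.IsEquivForm) (u u' : G.E) :
    B.dMoment (u + u') = B.dMoment u + B.dMoment u' := by
  have h1 : B.moment (u + u') = B.moment u + B.moment u' := by
    have : ∀ x, B.lin x (u + u') ![] = B.lin x u ![] + B.lin x u' ![] := fun x => by
      rw [map_add]; rfl
    ext x v
    exact this x
  have h2 : B.contr (u + u') = B.contr u + B.contr u' := by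
    ext x v
    change B.contr (u + u') x v = B.contr u x v + B.contr u' x v
    simp only [contr_apply]
    have h := (B.top x).toAlternatingMap.map_update_add ![(u, 0), (0, v 0)] 0 (u, 0) (u', 0)
    have e : ∀ z : G.E × M.E, Function.update ![(u, 0), (0, v 0)] 0 z = ![z, (0, v 0)] := fun z => by
      ext1 i; fin_cases i <;> rfl
    rw [e, e, e] at h
    rw [← add_zero (0 : M.E)] at h
    simpa using h
  change (B.moment (u + u')).d + B.contr (u + u') = ((B.moment u).d + B.contr u) +
    ((B.moment u').d + B.contr u')
  rw [h1, h2, Form.d_add (hB.isSmooth_moment u) (hB.isSmooth_moment u')]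
  abel

theorem WeilForm.dMoment_smul (B : WeilForm M 0) (t : ℝ) (u : G.E) :
    B.dMoment (t • u) = t • B.dMoment u := by
  have h1 : B.moment (t • u) = t • B.moment u := by
    have : ∀ x, B.lin x (t • u) ![] = t • B.lin x u ![] := fun x => by
      rw [map_smul]; rfl
    ext x v
    exact this x
  have h2 : B.contr (t • u) = t • B.contr u := by
    ext x v
    change B.contr (t • u) x v = t • B.contr u x v
    simp only [contr_apply]
    have h := (B.top x).toAlternatingMap.map_update_smul ![(u, 0), (0, v 0)] 0 t (u, 0)
    have e : ∀ z : G.E × M.E, Function.update ![(u, 0), (0, v 0)] 0 z = ![z, (0, v 0)] := fun z => by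
      ext1 i; fin_cases i <;> rfl
    rw [e, e] at h
    simpa using h
  change (B.moment (t • u)).d + B.contr (t • u) = t • ((B.moment u).d + B.contr u)
  rw [h1, h2, Form.d_smul, smul_add]

/-- The equivariant 3-form with given basic components. -/
def basicForm (z : Form 3 ℝ M.toMfd) (k : G.E →ₗ[ℝ] Form 1 ℝ M.toMfd) : WeilForm M 1 where
  lin := fun x =>
    let l : G.E →ₗ[ℝ] ((G.E × M.E) [⋀^Fin 1]→L[ℝ] ℝ) :=
      { toFun := fun u => (k u x).compContinuousLinearMap (M.hor x)
        map_add' := fun u u' => by rw [k.map_add]; rfl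
        map_smul' := fun t u => by rw [k.map_smul]; rfl }
    ⟨l, LinearMap.continuous_of_finiteDimensional l⟩
  top := fun x => (z x).compContinuousLinearMap (M.hor x)

theorem isEquivForm_basicForm {z : Form 3 ℝ M.toMfd} {k : G.E →ₗ[ℝ] Form 1 ℝ M.toMfd}
    (hz : z.IsSmooth) (hk : ∀ u, (k u).IsSmooth)
    (hz' : ∀ g x v, z (M.act g x) (fun i => D (M.act g) x (v i)) = z x v)
    (hk' : ∀ g u x v, k (G.Ad g u) (M.act g x) (fun i => D (M.act g) x (v i)) = k u x v) :
    (basicForm z k).IsEquivForm where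
  smooth_lin := fun x₀ y hy => by
    have : FiniteDimensional ℝ ((G.E × M.E) [⋀^Fin 1]→L[ℝ] ℝ) :=
      LinearEquiv.finiteDimensional (ContinuousAlternatingMap.ofSubsingletonLIE (𝕜 := ℝ)
        (E := G.E × M.E) (F := ℝ) (0 : Fin 1)).toLinearEquiv
    refine ContDiffAt.contDiffWithinAt (contDiffAt_clm fun u => contDiffAt_alternating fun v => ?_)
    have h1 := (hk u).plot (contMDiffAt_actPlot (x := x₀) G.coordOne_mem hy)
    have h2 : ContDiffAt ℝ ∞ (fun q => (k u).plot (M.actPlot x₀) q v) (G.coordOne, y) :=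
      ContDiffAt.comp (f := (k u).plot (M.actPlot x₀)) _
        (ContinuousAlternatingMap.apply ℝ (G.E × M.E) ℝ v).contDiff.contDiffAt h1
    refine (ContDiffAt.comp (f := fun z : M.E => (G.coordOne, z)) y h2
      (contDiffAt_const.prodMk contDiffAt_id)).congr_of_eventuallyEq ?_
    filter_upwards [(isOpen_extChartAt_target x₀).mem_nhds hy] with w hw
    exact (plot_actPlot_one (k u) hw v).symm
  smooth_top := fun x₀ y hy => by
    refine ContDiffAt.contDiffWithinAt (contDiffAt_alternating fun v => ?_)
    have h1 := hz.plot (contMDiffAt_actPlot (x := x₀) G.coordOne_mem hy)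
    have h2 : ContDiffAt ℝ ∞ (fun q => z.plot (M.actPlot x₀) q v) (G.coordOne, y) :=
      ContDiffAt.comp (f := z.plot (M.actPlot x₀)) _
        (ContinuousAlternatingMap.apply ℝ (G.E × M.E) ℝ v).contDiff.contDiffAt h1
    refine (ContDiffAt.comp (f := fun z : M.E => (G.coordOne, z)) y h2
      (contDiffAt_const.prodMk contDiffAt_id)).congr_of_eventuallyEq ?_
    filter_upwards [(isOpen_extChartAt_target x₀).mem_nhds hy] with w hw
    exact (plot_actPlot_one z hw v).symm
  invariant_lin := fun g x u e => by
    change k _ _ (fun i => M.hor _ (G.Ad g (e i).1, D (M.act g) x (e i).2)) =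
      k u x (fun i => M.hor x (e i))
    simp only [GMfd.hor_act]
    exact hk' g u x _
  invariant_top := fun g x e => by
    change z _ (fun i => M.hor _ (G.Ad g (e i).1, D (M.act g) x (e i).2)) =
      z x (fun i => M.hor x (e i))
    simp only [GMfd.hor_act]
    exact hz' g x _
  horizontal_lin := fun x u ξ e ⟨i, hi⟩ => by
    refine (k u x).map_coord_zero i ?_
    change M.hor x (e i) = 0
    rw [hi, GMfd.hor_fund]
  horizontal_top := fun x ξ e ⟨i, hi⟩ => by
    refine (z x).map_coord_zero i ?_
    change M.hor x (e i) = 0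
    rw [hi, GMfd.hor_fund]

theorem exists_isGerbeCurv (𝓛 : GerbeC M) : ∃ η : WeilForm M 1, IsGerbeCurv 𝓛 η := by
  set c := 𝓛.conn
  have hB := c.isEquivForm
  have hπ := 𝓛.gerbe.cover
  obtain ⟨z, hz, hzp⟩ := 𝓛.gerbe.exists_descend hB.isSmooth_body.d c.d_body_pull
  choose k₀ hk hkp using fun u => 𝓛.gerbe.exists_descend (hB.isSmooth_dMoment u) (c.dMoment_pull u)
  let k : G.E →ₗ[ℝ] Form 1 ℝ M.toMfd :=
    { toFun := k₀
      map_add' := fun u u' => by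
        refine Form.pull_injective (p := 𝓛.gerbe.π) hπ.surjective hπ.submersion ?_
        rw [hkp, hB.dMoment_add, ← hkp u, ← hkp u']
        rfl
      map_smul' := fun t u => by
        refine Form.pull_injective (p := 𝓛.gerbe.π) hπ.surjective hπ.submersion ?_
        rw [hkp, WeilForm.dMoment_smul, ← hkp u]
        rfl }
  have hact : ∀ (g : G) y (a : 𝓛.gerbe.Y.E), D (M.act g) (𝓛.gerbe.π y) (D 𝓛.gerbe.π y a) =
      D 𝓛.gerbe.π (𝓛.gerbe.Y.act g y) (D (𝓛.gerbe.Y.act g) y a) := fun g y a => by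
    rw [← D_comp (M.isAction.smooth_left g) hπ.smooth,
      ← D_comp hπ.smooth (𝓛.gerbe.Y.isAction.smooth_left g)]
    simp only [hπ.equivariant]
  refine ⟨basicForm z k, isEquivForm_basicForm hz hk ?_ ?_, ?_, ?_⟩
  · intro g x v
    obtain ⟨y, rfl⟩ := hπ.surjective x
    choose w hw using fun i => hπ.submersion y (v i)
    obtain rfl : (fun i => D 𝓛.gerbe.π y (w i)) = v := funext hw
    simp only [hact]
    rw [← hπ.equivariant]
    change z.pull 𝓛.gerbe.π _ _ = z.pull 𝓛.gerbe.π y w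
    rw [hzp]
    have h1 : (c.B.body.pull (𝓛.gerbe.Y.act g)) = c.B.body := by
      ext1 y; ext1 v; exact hB.body_act g y v
    have h2 := Form.d_pull hB.isSmooth_body (𝓛.gerbe.Y.isAction.smooth_left g)
    rw [h1] at h2
    exact (DFunLike.congr_fun (congr_fun h2 y) w).symm
  · intro g u x v
    obtain ⟨y, rfl⟩ := hπ.surjective x
    choose w hw using fun i => hπ.submersion y (v i)
    obtain rfl : (fun i => D 𝓛.gerbe.π y (w i)) = v := funext hw
    simp only [hact]
    rw [← hπ.equivariant]
    change (k₀ _).pull 𝓛.gerbe.π _ _ = (k₀ u).pull 𝓛.gerbe.π y w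
    rw [hkp, hkp]
    exact hB.dMoment_act g u y w
  · intro y u e
    rw [hB.dLin_eq, ← hkp, Form.pull_apply]
    change k₀ u (𝓛.gerbe.π y) (fun i => M.hor _ ((![e] i).1, D 𝓛.gerbe.π y (![e] i).2)) = _
    simp only [hπ.toIsGMap.D_hor]
    congr 1
    ext1 i; fin_cases i; rfl
  · intro y a b c'
    rw [hB.dTop_eq, ← hzp, Form.pull_apply]
    change z (𝓛.gerbe.π y) (fun i => M.hor _ ((![a, b, c'] i).1, D 𝓛.gerbe.π y (![a, b, c'] i).2)) = _
    simp only [hπ.toIsGMap.D_hor]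
    congr 1
    ext1 i; fin_cases i <;> rfl

theorem IsGerbeCurv.unique {𝓛 : GerbeC M} {η η' : WeilForm M 1} (h : IsGerbeCurv 𝓛 η)
    (h' : IsGerbeCurv 𝓛 η') : η = η' := by
  have hπ := 𝓛.gerbe.cover
  have hl : ∀ x u e, η.lin x u e = η'.lin x u e := by
    intro x u e
    obtain ⟨y, rfl⟩ := hπ.surjective x
    obtain ⟨a, ha⟩ := hπ.submersion y (e 0).2
    have h1 := (h.2.1 y u ((e 0).1, a)).trans (h'.2.1 y u ((e 0).1, a)).symm
    rw [WeilForm.pull_lin, WeilForm.pull_lin] at h1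
    have e1 : (fun i => ((![((e 0).1, a)] i).1, D 𝓛.gerbe.π y (![((e 0).1, a)] i).2)) = e := by
      ext1 i
      fin_cases i
      exact Prod.ext rfl ha
    rwa [e1] at h1
  have ht : ∀ x e, η.top x e = η'.top x e := by
    intro x e
    obtain ⟨y, rfl⟩ := hπ.surjective x
    choose a ha using fun i => hπ.submersion y (e i).2
    have h1 := (h.2.2 y ((e 0).1, a 0) ((e 1).1, a 1) ((e 2).1, a 2)).trans
      (h'.2.2 y ((e 0).1, a 0) ((e 1).1, a 1) ((e 2).1, a 2)).symm
    rw [WeilForm.pull_top, WeilForm.pull_top] at h1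
    have e1 : (fun i => ((![((e 0).1, a 0), ((e 1).1, a 1), ((e 2).1, a 2)] i).1,
        D 𝓛.gerbe.π y (![((e 0).1, a 0), ((e 1).1, a 1), ((e 2).1, a 2)] i).2)) = e := by
      ext1 i
      fin_cases i
      · exact Prod.ext rfl (ha 0)
      · exact Prod.ext rfl (ha 1)
      · exact Prod.ext rfl (ha 2)
    rwa [e1] at h1
  obtain ⟨l, t⟩ := η
  obtain ⟨l', t'⟩ := η'
  congr 1
  · ext1 x
    ext u e
    exact hl x u e
  · ext x e
    exact ht x e

theorem existsUnique_isGerbeCurv (𝓛 : GerbeC M) : ∃! η : WeilForm M 1, IsGerbeCurv 𝓛 η := by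
  obtain ⟨η, hη⟩ := exists_isGerbeCurv 𝓛
  exact ⟨η, hη, fun _ h => h.unique hη⟩

end GerbeCurvature

/-! ### The Weil homomorphism in degree 2 -/

section WeilTwo

variable {G : LieGrp.{v}} {M N : GMfd.{v, u} G}

/-- The component in `S¹𝔤* ⊗ Ω⁰(M)`, at a point. -/
def WeilForm.momentMap (B : WeilForm M 0) (x : M) : G.E →L[ℝ] ℝ :=
  (ContinuousAlternatingMap.apply ℝ (G.E × M.E) ℝ (ι := Fin 0) ![]).comp (B.lin x)

/-- The form obtained from an equivariant form of degree 2 by substitution of `Θ` for the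
generators in `Λ¹𝔤*`, and of its curvature for the ones in `S¹𝔤*`. -/
def weilTwo (Θ : M → M.E →L[ℝ] G.E) (B : WeilForm M 0) : Form 2 ℝ M.toMfd := fun x =>
  (B.top x).compContinuousLinearMap ((Θ x).prod (ContinuousLinearMap.id ℝ M.E)) +
    (B.momentMap x).compContinuousAlternatingMap (curvForm Θ x)

variable {Θ : M → M.E →L[ℝ] G.E} {B C : WeilForm M 0}

theorem weilTwo_apply (x : M) (v : Fin 2 → M.E) : weilTwo Θ B x v =
    B.top x (fun i => (Θ x (v i), v i)) + B.lin x (curvForm Θ x v) ![] := rfl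

theorem weilTwo_sub : weilTwo Θ (B - C) = weilTwo Θ B - weilTwo Θ C := by
  ext1 x
  ext1 v
  change weilTwo Θ (B - C) x v = weilTwo Θ B x v - weilTwo Θ C x v
  rw [weilTwo_apply, weilTwo_apply, weilTwo_apply, WeilForm.sub_top, WeilForm.sub_lin]
  ring

theorem weilTwo_pull (hΘ : SmoothOneForm Θ) {f : N → M} (hf : Smooth f) :
    weilTwo (pullConn Θ f) (B.pull f) = (weilTwo Θ B).pull f := by
  ext1 x
  ext1 v
  rw [Form.pull_apply, weilTwo_apply, weilTwo_apply, WeilForm.pull_top, WeilForm.pull_lin,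
    curvForm_pullConn hΘ hf, Form.pull_apply]
  congr 2
  exact Subsingleton.elim _ _

theorem weilTwo_act (hB : B.IsEquivForm) (hΘ : IsConnection M Θ) (g : G) (x : M)
    (v : Fin 2 → M.E) :
    weilTwo Θ B (M.act g x) (fun i => D (M.act g) x (v i)) = weilTwo Θ B x v := by
  rw [weilTwo_apply, weilTwo_apply, curvForm_act hΘ, hB.moment_act]
  simp only [hΘ.equivariant]
  rw [hB.invariant_top g x (fun i => (Θ x (v i), v i))]

theorem weilTwo_fund (hB : B.IsEquivForm) (hΘ : IsConnection M Θ) (x : M) (v : Fin 2 → M.E)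
    (ξ : G.E) (hv : ∃ i, v i = M.fund x ξ) : weilTwo Θ B x v = 0 := by
  rw [weilTwo_apply, curvForm_fund hΘ x ξ v hv, map_zero]
  obtain ⟨i, hi⟩ := hv
  rw [hB.horizontal_top x ξ _ ⟨i, by rw [hi, hΘ.vertical]⟩]
  exact add_zero _

theorem isSmooth_weilTwo (hB : B.IsEquivForm) (hΘ : SmoothOneForm Θ) : (weilTwo Θ B).IsSmooth := by
  intro x₀ y hy
  have hO := (isOpen_extChartAt_target x₀).mem_nhds hy
  refine contDiffAt_alternating fun v => ?_
  have h1 : ContDiffAt ℝ ∞ (oneFormChart Θ x₀) y := (hΘ x₀).contDiffAt hO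
  have h2 : ContDiffAt ℝ ∞ (fun z => B.topChart x₀ z (fun i => (oneFormChart Θ x₀ z (v i), v i))) y :=
    contDiffAt_alternating_apply (hB.contDiffAt_top hy) fun i =>
      (h1.clm_apply contDiffAt_const).prodMk contDiffAt_const
  have h3 : ContDiffAt ℝ ∞ (fun z => (curvForm Θ).chart x₀ z v) y :=
    ContDiffAt.comp (f := (curvForm Θ).chart x₀) y
      (ContinuousAlternatingMap.apply ℝ M.E G.E v).contDiff.contDiffAt (isSmooth_curvForm hΘ x₀ y hy)
  have h4 : ContDiffAt ℝ ∞ (fun z => B.linChart x₀ z ((curvForm Θ).chart x₀ z v) ![]) y :=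
    ContDiffAt.comp (f := fun z => B.linChart x₀ z ((curvForm Θ).chart x₀ z v)) y
      (ContinuousAlternatingMap.apply ℝ (G.E × M.E) ℝ (ι := Fin 0) ![]).contDiff.contDiffAt
      (((hB.smooth_lin x₀).contDiffAt hO).clm_apply h3)
  refine (h2.add h4).congr_of_eventuallyEq (Eventually.of_forall fun z => ?_)
  change B.top _ _ + B.lin _ _ ![] = B.top _ _ + B.lin _ _ _
  congr 2
  exact Subsingleton.elim _ _

theorem pullConn_comp {Q : GMfd.{v, u} G} {f : N → M} {g : Q → N} (hf : Smooth f) (hg : Smooth g) :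
    pullConn Θ (fun x => f (g x)) = pullConn (pullConn Θ f) g := by
  ext1 x
  ext1 a
  change Θ _ (D _ x a) = Θ _ (D f _ (D g x a))
  rw [D_comp hf hg]

end WeilTwo

/-! ### The horizontal part of a connection on a circle bundle -/

section HorizontalPart

variable {G : LieGrp.{v}} {Z : GMfd.{v, u} G} (K : GBun Z)

/-- The 1-form `(1 - ι_Θ) A` on the total space of `K → Z`, for a connection `Θ` on the principal
bundle `Z → Z/G`: the substitution of `Θ` into the equivariant extension of `A`. -/
def GBun.horPart (Θ : Z → Z.E →L[ℝ] G.E) (A : K.tot → K.tot.E →L[ℝ] ℝ) (k : K.tot) :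
    K.tot.E →L[ℝ] ℝ :=
  (K.equivExt A k).comp ((pullConn Θ K.proj k).prod (ContinuousLinearMap.id ℝ K.tot.E))

namespace GBun

variable {K} {Θ : Z → Z.E →L[ℝ] G.E} {A : K.tot → K.tot.E →L[ℝ] ℝ}

theorem horPart_apply (k : K.tot) (a : K.tot.E) :
    K.horPart Θ A k a = A k (K.tot.hor k (pullConn Θ K.proj k a, a)) := equivExt_eq K A k _

theorem horPart_apply' (k : K.tot) (a : K.tot.E) :
    K.horPart Θ A k a = A k a - A k (K.tot.fund k (pullConn Θ K.proj k a)) := by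
  rw [horPart_apply, GMfd.hor_apply, map_sub]

theorem oneFormChart_horPart (k : K.tot) : oneFormChart (K.horPart Θ A) k = fun y =>
    (K.extChart A k y).comp ((oneFormChart (pullConn Θ K.proj) k y).prod
      (ContinuousLinearMap.id ℝ K.tot.E)) := rfl

theorem smooth_horPart (hA : SmoothOneForm A) (hΘ : IsConnection Z Θ) :
    SmoothOneForm (K.horPart Θ A) := by
  intro k y hy
  refine ContDiffAt.contDiffWithinAt (contDiffAt_clm fun a => ?_)
  have h1 := ((hΘ.pullConn K.proj_map).smooth k).contDiffAt
    ((isOpen_extChartAt_target k).mem_nhds hy)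
  exact (K.contDiffAt_extChart hA k hy).clm_apply
    ((h1.clm_apply (contDiffAt_const (c := a))).prodMk contDiffAt_const)

theorem horPart_act (hA : K.IsConn A) (hΘ : IsConnection Z Θ) (g : G) (k : K.tot) (a : K.tot.E) :
    K.horPart Θ A (K.tot.act g k) (D (K.tot.act g) k a) = K.horPart Θ A k a := by
  rw [horPart_apply, horPart_apply, (hΘ.pullConn K.proj_map).equivariant,
    K.tot.hor_act g k (_, a), hA.invariant]

theorem horPart_fund (hΘ : IsConnection Z Θ) (k : K.tot) (ξ : G.E) :
    K.horPart Θ A k (K.tot.fund k ξ) = 0 := by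
  rw [horPart_apply, (hΘ.pullConn K.proj_map).vertical, GMfd.hor_fund, map_zero]

theorem horPart_circ (hA : K.IsConn A) (c : circleGrp) (k : K.tot) (a : K.tot.E) :
    K.horPart Θ A (K.circ c k) (D (K.circ c) k a) = K.horPart Θ A k a := by
  have h1 : pullConn Θ K.proj (K.circ c k) (D (K.circ c) k a) = pullConn Θ K.proj k a := by
    change Θ _ (D K.proj (K.circ c k) (D (K.circ c) k a)) = Θ _ _
    rw [← D_comp K.proj_map.smooth (isGMap_circ K c).smooth]
    simp only [K.principal.proj_act]
    rfl
  rw [horPart_apply, horPart_apply, h1, (isGMap_circ K c).D_hor k (_, a), hA.invariant_circ]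

/-- The exterior derivative of the horizontal part of a connection is the image of its equivariant
curvature under the Weil homomorphism. -/
theorem d_horPart {F : WeilForm Z 0} (hA : SmoothOneForm A) (hF : K.IsCurv A F)
    (hΘ : IsConnection Z Θ) :
    (oneForm (K.horPart Θ A)).d = (weilTwo Θ F).pull (N := K.tot.toMfd) K.proj := by
  have hΘK := hΘ.pullConn K.proj_map
  have key : ∀ k a b, (oneForm (K.horPart Θ A)).d k ![a, b] =
      (weilTwo Θ F).pull (N := K.tot.toMfd) K.proj k ![a, b] := by
    intro k a b
    have hd := ((hΘK.smooth.contDiffAt k).differentiableAt (by simp))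
    have h1 := hF.top_eq k (pullConn Θ K.proj k a, a) (pullConn Θ K.proj k b, b)
    have e1 : oneFormChart (pullConn Θ K.proj) k (extChartAt (𝓡 K.tot.dim) k k) =
        pullConn Θ K.proj k := by
      unfold oneFormChart
      rw [chartD_eq_id, extChartAt_to_inv]
      rfl
    rw [d_oneForm (smooth_horPart hA hΘ), oneFormChart_horPart,
      fderiv_substitution (K.differentiableAt_extChart hA k) hd,
      fderiv_substitution (K.differentiableAt_extChart hA k) hd, e1, extChart_self, Form.pull_apply,
      weilTwo_apply]
    have e2 : (fun i => (Θ (K.proj k) (D K.proj k (![a, b] i)), D K.proj k (![a, b] i))) =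
        ![(pullConn Θ K.proj k a, D K.proj k a), (pullConn Θ K.proj k b, D K.proj k b)] :=
      comp_cons_two (fun z => (Θ (K.proj k) (D K.proj k z), D K.proj k z)) a b
    have e3 : curvForm Θ (K.proj k) (fun i => D K.proj k (![a, b] i)) =
        curvForm (pullConn Θ K.proj) k ![a, b] := by
      rw [curvForm_pullConn hΘ.smooth K.proj_map.smooth, Form.pull_apply]
    have e4 : ∀ ξ η : G.E, K.equivExt A k (ξ - η, 0) = K.equivExt A k (ξ, 0) - K.equivExt A k (η, 0) :=
      fun ξ η => by rw [← map_sub]; simp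
    have e5 : ∀ ξ η : G.E, K.equivExt A k (ξ + η, 0) = K.equivExt A k (ξ, 0) + K.equivExt A k (η, 0) :=
      fun ξ η => by rw [← map_add]; simp
    rw [e2, e3, h1, hF.lin_eq, curvForm_apply, d_oneForm hΘK.smooth, e5, e4]
    ring
  ext1 k
  ext1 v
  rw [eq_cons_two v]
  exact key k _ _

theorem contMDiff_circ_exp (K : GBun Z) (k : K.tot) :
    ContMDiff 𝓘(ℝ, ℝ) (𝓡 K.tot.dim) ∞ (fun t : ℝ => K.circ (Circle.exp t) k) := by
  have h1 : ContMDiff (M' := circleGrp.carrier) 𝓘(ℝ, ℝ) (𝓡 circleGrp.dim) ∞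
      (fun t : ℝ => Circle.exp t) := contMDiff_circleExp (m := ∞)
  exact ContMDiff.comp (I' := 𝓡 circleGrp.dim) (K.principal.isAction.smooth_orbit k) h1

theorem D_proj_vert (K : GBun Z) (k : K.tot) : D K.proj k (K.vert k) = 0 := by
  have h0 : K.circ (Circle.exp 0) k = k := by
    rw [Circle.exp_zero]; exact K.principal.isAction.one_act k
  have hc := K.contMDiff_circ_exp k
  have h1 := mfderiv_comp (I := 𝓘(ℝ, ℝ)) (I' := 𝓡 K.tot.dim) (I'' := 𝓡 Z.dim) (0 : ℝ) (g := K.proj)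
    (f := fun t : ℝ => K.circ (Circle.exp t) k) (K.proj_map.smooth.mdiff _)
    (hc.mdifferentiableAt (by simp))
  have h2 : (K.proj ∘ fun t : ℝ => K.circ (Circle.exp t) k) = fun _ => K.proj k := by
    ext1 t; exact K.principal.proj_act _ _
  rw [h2, mfderiv_const] at h1
  have h3 := (DFunLike.congr_fun h1 (1 : ℝ)).symm
  change D K.proj (K.circ (Circle.exp 0) k) (K.vert k) = 0 at h3
  rwa [h0] at h3

theorem horPart_vert (hA : K.IsConn A) (k : K.tot) : K.horPart Θ A k (K.vert k) = 1 := by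
  have h : pullConn Θ K.proj k (K.vert k) = 0 := by
    change Θ _ (D K.proj k (K.vert k)) = 0
    rw [K.D_proj_vert, map_zero]
  rw [horPart_apply', h, map_zero, map_zero, sub_zero, hA.vertical]

end GBun

end HorizontalPart

/-! ### Descent of connections -/

section DescendConn

theorem subsingleton_trivialGrp (u : trivialGrp.E) : u = 0 := by
  ext i
  exact Fin.elim0 i

theorem GMfd.trivialGrp_D_act (M : GMfd.{0, u} trivialGrp) (g : trivialGrp) (x : M) (a : M.E) :
    D (M.act g) x a = a := by
  have h : M.act g = fun x => x := funext (M.trivialGrp_act g)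
  rw [h]
  exact D_id x a

theorem GBun.isCurv_triv {Z : GMfd.{0, u} trivialGrp} {K : GBun Z} {A : K.tot → K.tot.E →L[ℝ] ℝ}
    {F : WeilForm Z 0} (hA : SmoothOneForm A)
    (h : (oneForm A).d = F.body.pull (N := K.tot.toMfd) K.proj) : K.IsCurv A F := by
  constructor
  · intro k u
    rw [subsingleton_trivialGrp u, map_zero]
    exact (map_zero (K.equivExt A k)).symm
  · rintro k ⟨u, a⟩ ⟨u', b⟩
    obtain rfl := subsingleton_trivialGrp u
    obtain rfl := subsingleton_trivialGrp u'
    have hd := K.differentiableAt_extChart hA k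
    have e : ∀ a b : K.tot.E, fderiv ℝ (K.extChart A k) (extChartAt (𝓡 K.tot.dim) k k) a (0, b) =
        fderiv ℝ (oneFormChart A k) (extChartAt (𝓡 K.tot.dim) k k) a b := fun a b =>
      fderiv_extChart_inr hA k a b
    have h1 := DFunLike.congr_fun (congr_fun h k) ![a, b]
    rw [d_oneForm hA, ← e, ← e, Form.pull_apply, WeilForm.body_apply] at h1
    simp only [chartT_eq_id]
    rw [subsingleton_trivialGrp (trivialGrp.bracket _ _)]
    change _ = fderiv ℝ (K.extChart A k) _ a (0, b) - fderiv ℝ (K.extChart A k) _ b (0, a) -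
      K.equivExt A k 0
    rw [map_zero, sub_zero, h1, WeilForm.pull_top]
    congr 1
    ext1 i; fin_cases i <;> rfl

variable {G : LieGrp.{v}} {Z : GMfd.{v, u} G} {K : GBun Z} {Z₁ : GMfd.{0, u} trivialGrp}
  {K₁ : GBun Z₁} {qZ : Z → Z₁} {qK : K.tot → K₁.tot} {Θ : Z → Z.E →L[ℝ] G.E}
  {A : K.tot → K.tot.E →L[ℝ] ℝ} {A₁ : K₁.tot → K₁.tot.E →L[ℝ] ℝ}

/-- The horizontal part of a connection descends to the quotient by `G`. -/
theorem GBun.IsConn.exists_descend (hA : K.IsConn A) (hΘ : IsConnection Z Θ)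
    (hqK : IsPrincipal G (P := K.tot.toMfd) (X := K₁.tot.toMfd) K.tot.act qK) :
    ∃ A₁ : K₁.tot → K₁.tot.E →L[ℝ] ℝ, SmoothOneForm A₁ ∧
      (oneForm A₁).pull (N := K.tot.toMfd) qK = oneForm (K.horPart Θ A) := by
  obtain ⟨β, hβ, hβp⟩ := hqK.exists_descend
    (smoothOneForm_iff.1 (GBun.smooth_horPart hA.smooth hΘ))
    (fun g k v => GBun.horPart_act hA hΘ g k (v 0)) (fun k v ξ ⟨i, hi⟩ => by
      have hi' : v 0 = K.tot.fund k ξ := by rwa [Subsingleton.elim 0 i]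
      change K.horPart Θ A k (v 0) = 0
      rw [hi', GBun.horPart_fund hΘ])
  have e : oneForm (fun x => (ContinuousAlternatingMap.ofSubsingletonLIE (𝕜 := ℝ) (E := K₁.tot.E)
      (F := ℝ) (0 : Fin 1)).symm (β x)) = β := by
    ext1 x
    exact (ContinuousAlternatingMap.ofSubsingletonLIE (𝕜 := ℝ) (E := K₁.tot.E)
      (F := ℝ) (0 : Fin 1)).apply_symm_apply (β x)
  refine ⟨_, ?_, (congr_arg _ e).trans hβp⟩
  rw [smoothOneForm_iff, e]
  exact hβ

theorem horPart_eq (hp : (oneForm A₁).pull (N := K.tot.toMfd) qK = oneForm (K.horPart Θ A))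
    (k : K.tot) (a : K.tot.E) : A₁ (qK k) (D (M := K.tot.toMfd) qK k a) = K.horPart Θ A k a :=
  DFunLike.congr_fun (congr_fun hp k) ![a]

theorem D_vert (hs : Smooth (M := K.tot.toMfd) (N := K₁.tot.toMfd) qK)
    (hcirc : ∀ c k, K₁.circ c (qK k) = qK (K.circ c k)) (k : K.tot) :
    D (M := K.tot.toMfd) qK k (K.vert k) = K₁.vert (qK k) := by
  have h0 : K.circ (Circle.exp 0) k = k := by
    rw [Circle.exp_zero]; exact K.principal.isAction.one_act k
  have hc := K.contMDiff_circ_exp k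
  have h1 := mfderiv_comp (I := 𝓘(ℝ, ℝ)) (I' := 𝓡 K.tot.dim) (I'' := 𝓡 K₁.tot.dim) (0 : ℝ) (g := qK)
    (f := fun t : ℝ => K.circ (Circle.exp t) k) (hs.mdiff _) (hc.mdifferentiableAt (by simp))
  have h2 : (qK ∘ fun t : ℝ => K.circ (Circle.exp t) k) =
      fun t : ℝ => K₁.circ (Circle.exp t) (qK k) := by
    ext1 t; exact (hcirc _ _).symm
  rw [h2] at h1
  have h3 := (DFunLike.congr_fun h1 (1 : ℝ)).symm
  change D (M := K.tot.toMfd) qK (K.circ (Circle.exp 0) k) (K.vert k) = K₁.vert (qK k) at h3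
  rwa [h0] at h3

theorem GBun.IsConn.descend (hA : K.IsConn A)
    (hqK : IsPrincipal G (P := K.tot.toMfd) (X := K₁.tot.toMfd) K.tot.act qK)
    (hcirc : ∀ c k, K₁.circ c (qK k) = qK (K.circ c k)) (hA₁ : SmoothOneForm A₁)
    (hp : (oneForm A₁).pull (N := K.tot.toMfd) qK = oneForm (K.horPart Θ A)) : K₁.IsConn A₁ where
  smooth := hA₁
  vertical := fun k => by
    obtain ⟨k, rfl⟩ := hqK.surjective k
    rw [← D_vert hqK.smooth_proj hcirc, horPart_eq hp, GBun.horPart_vert hA]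
  invariant_circ := fun c k a => by
    obtain ⟨k, rfl⟩ := hqK.surjective k
    obtain ⟨a, rfl⟩ := hqK.submersion k a
    have e : D (K₁.circ c) (qK k) (D (M := K.tot.toMfd) qK k a) =
        D (M := K.tot.toMfd) qK (K.circ c k) (D (K.circ c) k a) := by
      rw [← D_comp (isGMap_circ K₁ c).smooth hqK.smooth_proj,
        ← D_comp hqK.smooth_proj (isGMap_circ K c).smooth]
      simp only [hcirc]
    rw [horPart_eq hp, e, hcirc, horPart_eq hp, GBun.horPart_circ hA]
  invariant := fun g k a => by
    rw [GMfd.trivialGrp_D_act, GMfd.trivialGrp_act]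

theorem GBun.IsCurv.descend {F : WeilForm Z 0} {F₁ : WeilForm Z₁ 0} (hF : K.IsCurv A F)
    (hA : K.IsConn A) (hΘ : IsConnection Z Θ)
    (hqK : IsPrincipal G (P := K.tot.toMfd) (X := K₁.tot.toMfd) K.tot.act qK)
    (hqZ : Smooth (M := Z.toMfd) (N := Z₁.toMfd) qZ)
    (hproj : ∀ k, K₁.proj (qK k) = qZ (K.proj k)) (hA₁ : SmoothOneForm A₁)
    (hp : (oneForm A₁).pull (N := K.tot.toMfd) qK = oneForm (K.horPart Θ A))
    (hF₁ : F₁.body.pull (N := Z.toMfd) qZ = weilTwo Θ F) : K₁.IsCurv A₁ F₁ := by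
  refine GBun.isCurv_triv hA₁ (Form.pull_injective (p := qK) hqK.surjective hqK.submersion ?_)
  rw [← Form.d_pull (smoothOneForm_iff.1 hA₁) hqK.smooth_proj, hp, GBun.d_horPart hA.smooth hF hΘ,
    ← hF₁]
  ext1 k
  ext1 v
  have e : ∀ i, D K₁.proj (qK k) (D (M := K.tot.toMfd) qK k (v i)) =
      D (M := Z.toMfd) qZ (K.proj k) (D K.proj k (v i)) := fun i => by
    rw [← D_comp K₁.proj_map.smooth hqK.smooth_proj, ← D_comp hqZ K.proj_map.smooth]
    simp only [hproj]
  simp only [Form.pull_apply, e, hproj]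

end DescendConn

/-! ### Descent of curvings -/

section DescendCurving

/-- The equivariant form for the trivial group that is given by an ordinary 2-form. -/
def ofBody {M : GMfd.{0, u} trivialGrp} (β : Form 2 ℝ M.toMfd) : WeilForm M 0 where
  lin := 0
  top := fun x => (β x).compContinuousLinearMap (ContinuousLinearMap.snd ℝ trivialGrp.E M.E)

theorem body_ofBody {M : GMfd.{0, u} trivialGrp} (β : Form 2 ℝ M.toMfd) : (ofBody β).body = β := by
  ext1 x; ext1 v; rfl

theorem isEquivForm_ofBody {M : GMfd.{0, u} trivialGrp} {β : Form 2 ℝ M.toMfd} (hβ : β.IsSmooth) :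
    (ofBody β).IsEquivForm where
  smooth_lin := fun x₀ => by
    have h : (ofBody β).linChart x₀ = fun _ => 0 := by
      ext1 y
      exact ContinuousLinearMap.comp_zero _
    rw [h]
    exact contDiffOn_const
  smooth_top := fun x₀ y hy => (contDiffAt_alternating_comp
    (g := fun _ => ContinuousLinearMap.snd ℝ trivialGrp.E M.E) (hβ x₀ y hy)
      contDiffAt_const).contDiffWithinAt
  invariant_lin := fun g x u e => rfl
  invariant_top := fun g x e => by
    change β _ (fun i => D (M.act g) x (e i).2) = β x fun i => (e i).2
    simp only [GMfd.trivialGrp_D_act]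
    rw [GMfd.trivialGrp_act]
  horizontal_lin := fun x u ξ e _ => rfl
  horizontal_top := fun x ξ e ⟨i, hi⟩ => by
    refine (β x).map_coord_zero i ?_
    change (e i).2 = 0
    rw [hi, subsingleton_trivialGrp ξ]
    exact map_zero _

variable {G : LieGrp.{v}} {P Y : GMfd.{v, u} G} {Y₁ : GMfd.{0, u} trivialGrp} {mk : Y → Y₁}

theorem exists_curving {Θ : Y → Y.E →L[ℝ] G.E} (hΘ : IsConnection Y Θ) {B : WeilForm Y 0}
    (hB : B.IsEquivForm) (hmk : IsPrincipal G (P := Y.toMfd) (X := Y₁.toMfd) Y.act mk) :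
    ∃ B₁ : WeilForm Y₁ 0, B₁.IsEquivForm ∧ B₁.body.pull (N := Y.toMfd) mk = weilTwo Θ B := by
  obtain ⟨β, hβ, hβp⟩ := hmk.exists_descend (isSmooth_weilTwo hB hΘ.smooth)
    (fun g x v => weilTwo_act hB hΘ g x v) (fun x v ξ hv => weilTwo_fund hB hΘ x v ξ hv)
  exact ⟨ofBody β, isEquivForm_ofBody hβ, by rw [body_ofBody, hβp]⟩

theorem isWeilImageTwo_of_pull {Θ : P → P.E →L[ℝ] G.E} (hΘ : SmoothOneForm Θ) {f : Y → P}
    (hf : Smooth f) {B : WeilForm Y 0} {B₁ : WeilForm Y₁ 0}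
    (h : B₁.body.pull (N := Y.toMfd) mk = weilTwo (pullConn Θ f) B) :
    IsWeilImageTwo Θ f mk B₁ B := by
  intro y a b
  have h1 := DFunLike.congr_fun (congr_fun h y) ![a, b]
  rw [curvature_pull hΘ hf]
  refine Eq.trans ?_ (h1.trans ?_)
  · rw [Form.pull_apply, WeilForm.body_apply]
    congr 1
    ext1 i; fin_cases i <;> rfl
  · rw [weilTwo_apply]
    congr 2
    ext1 i; fin_cases i <;> rfl

end DescendCurving

/-! ### Horizontal lifts of families -/

section HorizontalLift

variable {G : LieGrp.{v}} {P : GMfd.{v, u} G} {X : Mfd.{u}} {q : P → X} {Θ : P → P.E →L[ℝ] G.E}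

theorem IsConnection.exists_horizontal (hΘ : IsConnection P Θ)
    (hq : IsPrincipal G (P := P.toMfd) P.act q) (p : P) :
    ∃ R : X.E →L[ℝ] P.E, (∀ v, D q p (R v) = v) ∧ ∀ v, Θ p (R v) = 0 := by
  obtain ⟨R, hR⟩ := exists_rightInverse (hq.submersion p)
  refine ⟨R - (P.fund p).comp ((Θ p).comp R), fun v => ?_, fun v => ?_⟩
  · change D q p (R v - P.fund p (Θ p (R v))) = v
    rw [map_sub, hR, hq.D_fund_eq_zero, sub_zero]
  · change Θ p (R v - P.fund p (Θ p (R v))) = 0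
    rw [map_sub, hΘ.vertical, sub_self]

/-- Families of points of `X` lift locally to `P`, with horizontal derivative at a given parameter
value. -/
theorem IsConnection.exists_horizontal_lift_family (hΘ : IsConnection P Θ)
    (hq : IsPrincipal G (P := P.toMfd) P.act q) {T : Mfd.{u}} {b : T → X} (hb : Smooth b) (t₀ : T) :
    ∃ (U : TopologicalSpace.Opens T) (t' : T.restr U) (c : T.restr U → P), T.incl U t' = t₀ ∧
      Smooth c ∧ (∀ t, q (c t) = b (T.incl U t)) ∧ ∀ e, Θ (c t') (D c t' e) = 0 := by
  obtain ⟨p, hp⟩ := hq.surjective (b t₀)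
  obtain ⟨R, hR, hR0⟩ := hΘ.exists_horizontal hq p
  obtain ⟨U, t', c, ht', hc, hcb, rfl, he⟩ :=
    exists_lift_family_of_rightInverse hq.smooth_proj hb hp hR
  refine ⟨U, t', c, ht', hc, hcb, fun e => ?_⟩
  obtain ⟨v, hv⟩ := he e
  rw [hv, hR0]

variable {Z : GMfd.{v, u} G} {K : GBun Z} {Z₁ : GMfd.{0, u} trivialGrp} {K₁ : GBun Z₁}
  {qK : K.tot → K₁.tot} {A : K.tot → K.tot.E →L[ℝ] ℝ} {A₁ : K₁.tot → K₁.tot.E →L[ℝ] ℝ} {f : Z → P}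

/-- A descended connection takes the same values as the original one on families over a family in
`P` with horizontal derivative. -/
theorem descended_eq_of_horizontal
    (hqK : IsPrincipal G (P := K.tot.toMfd) (X := K₁.tot.toMfd) K.tot.act qK)
    (hp : (oneForm A₁).pull (N := K.tot.toMfd) qK = oneForm (K.horPart (pullConn Θ f) A))
    (hf : Smooth f) {T T' : Mfd.{u}} {j : T' → T} (hj : Smooth j) {k₁ : T → K₁.tot}
    (hk₁ : Smooth k₁) {k : T' → K.tot} (hk : Smooth k) (e : ∀ t, qK (k t) = k₁ (j t)) {c : T' → P}
    (hc : ∀ t, f (K.proj (k t)) = c t) {t : T'} {a : T'.E} (h0 : Θ (c t) (D c t a) = 0) :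
    A₁ (k₁ (j t)) (D k₁ (j t) (D j t a)) = A (k t) (D k t a) := by
  have h1 : pullConn (pullConn Θ f) K.proj (k t) (D k t a) = 0 := by
    change Θ (f (K.proj (k t))) (D f (K.proj (k t)) (D K.proj (k t) (D k t a))) = 0
    rw [← D_comp (f := k) K.proj_map.smooth hk, ← D_comp (f := fun t => K.proj (k t)) hf
      (K.proj_map.smooth.comp hk)]
    simp only [hc]
    exact h0
  have h2 := horPart_eq hp (k t) (D k t a)
  rw [GBun.horPart_apply', h1, map_zero, map_zero, sub_zero,
    ← D_comp (f := k) hqK.smooth_proj hk] at h2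
  rw [← h2, ← D_comp (f := j) hk₁ hj]
  simp only [e]

theorem isDescendedConn_of_pull (hf : Smooth f)
    (hp : (oneForm A₁).pull (N := K.tot.toMfd) qK = oneForm (K.horPart (pullConn Θ f) A)) :
    IsDescendedConn Θ (fun k => f (K.proj k)) qK A₁ A := by
  intro k a
  rw [horPart_eq hp, GBun.horPart_apply', ← pullConn_comp hf K.proj_map.smooth]
  rfl

end HorizontalLift

section DescendPull

variable {G : LieGrp.{v}} {P Y N : GMfd.{v, u} G} {Y₁ N₁ : GMfd.{0, u} trivialGrp}
  {Θ : P → P.E →L[ℝ] G.E} {f : Y → P} {g : N → Y} {g₁ : N₁ → Y₁} {mY : Y → Y₁} {mN : N → N₁}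
  {B : WeilForm Y 0} {B₁ : WeilForm Y₁ 0}

/-- The Weil homomorphism is compatible with pullbacks. -/
theorem body_pull_descend (hΘ : IsConnection P Θ) (hf : IsGMap f) (hg : Smooth g)
    (hg₁ : Smooth g₁) (hmY : Smooth (M := Y.toMfd) (N := Y₁.toMfd) mY)
    (hmN : Smooth (M := N.toMfd) (N := N₁.toMfd) mN) (hc : ∀ n, g₁ (mN n) = mY (g n))
    (h : B₁.body.pull (N := Y.toMfd) mY = weilTwo (pullConn Θ f) B) :
    (B₁.pull g₁).body.pull (N := N.toMfd) mN =
      weilTwo (pullConn Θ (fun n => f (g n))) (B.pull g) := by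
  rw [pullConn_comp hf.smooth hg, weilTwo_pull (hΘ.pullConn hf).smooth hg, ← h]
  ext1 n
  ext1 v
  have e : ∀ i, D g₁ (mN n) (D (M := N.toMfd) mN n (v i)) =
      D (M := Y.toMfd) mY (g n) (D g n (v i)) := fun i => by
    rw [← D_comp hg₁ hmN, ← D_comp hmY hg]
    simp only [hc]
  simp only [Form.pull_apply, WeilForm.body_apply, WeilForm.pull_top, e, hc]

end DescendPull

/-! ### Quotients of connections on gerbes and on 1-morphisms -/

section QuoConn

variable {G : LieGrp.{v}} {P : GMfd.{v, u} G} {X : Mfd.{u}} {q : P → X.triv}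
  (hq : IsPrincipal G (P := P.toMfd) (X := X.triv.toMfd) P.act q) {Θ : P → P.E →L[ℝ] G.E}
  {𝓛 𝓛' 𝓛'' : Gerbe P}

/-- `c₁ = Θ^*c`, for a connection `c` on `𝓛` and a connection `c₁` on `𝓛/G`. -/
structure Gerbe.Conn.IsQuo (Θ : P → P.E →L[ℝ] G.E) (c : 𝓛.Conn) (c₁ : (𝓛.quo hq).Conn) : Prop where
  conn : (oneForm c₁.A).pull (N := 𝓛.L.tot.toMfd) (𝓛.qL hq) =
    oneForm (𝓛.L.horPart (pullConn Θ fun y => 𝓛.π (𝓛.fst y)) c.A)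
  curving : c₁.B.body.pull (N := 𝓛.Y.toMfd) (𝓛.qY hq) = weilTwo (pullConn Θ 𝓛.π) c.B

/-- `d₁ = Θ^*d`, for a connection `d` on `𝓚` and a connection `d₁` on `𝓚/G`. -/
def Hom.Conn.IsQuo (Θ : P → P.E →L[ℝ] G.E) {c : 𝓛.Conn} {c' : 𝓛'.Conn} {c₁ : (𝓛.quo hq).Conn}
    {c₁' : (𝓛'.quo hq).Conn} {𝓚 : Hom 𝓛 𝓛'} (d : Hom.Conn c c' 𝓚)
    (d₁ : Hom.Conn c₁ c₁' (𝓚.quo hq)) : Prop :=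
  (oneForm d₁.A).pull (N := 𝓚.K.tot.toMfd) (𝓚.qK hq) =
    oneForm (𝓚.K.horPart (pullConn Θ fun z => 𝓛.π (𝓚.ζ₁ z)) d.A)

variable {hq}

/-- A connection on a gerbe descends by means of `Θ`. -/
theorem Gerbe.Conn.exists_isQuo (hΘ : IsConnection P Θ) (c : 𝓛.Conn) :
    ∃ c₁ : (𝓛.quo hq).Conn, c.IsQuo hq Θ c₁ := by
  have hf := 𝓛.isGMap_base₂
  have hqL := (𝓛.isQuo_qL hq).principal
  have hqY := (𝓛.isQuo_qY hq).principal
  have hqY₂ := (𝓛.isQuo_qY₂ hq).principal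
  obtain ⟨A₁, hA₁, hp⟩ := c.isConn.exists_descend (K₁ := 𝓛.quoL hq) (hΘ.pullConn hf) hqL
  obtain ⟨B₁, hB₁, hBp⟩ := exists_curving (hΘ.pullConn 𝓛.cover.toIsGMap) c.isEquivForm hqY
  have e : (fun y => 𝓛.π (𝓛.snd y)) = fun y => 𝓛.π (𝓛.fst y) :=
    funext fun y => (𝓛.square.comm y).symm
  have hsq := (𝓛.quo hq).square
  refine ⟨⟨A₁, c.isConn.descend hqL (𝓛.circ_qL hq) hA₁ hp, B₁, hB₁, ?_, ?_⟩, ⟨hp, hBp⟩⟩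
  · refine c.curv.descend c.isConn (hΘ.pullConn hf) hqL hqY₂.smooth_proj (𝓛.proj_qL hq) hA₁ hp ?_
    rw [weilTwo_sub]
    have h1 := body_pull_descend hΘ 𝓛.cover.toIsGMap 𝓛.square.fst_map.smooth hsq.fst_map.smooth
      hqY.smooth_proj hqY₂.smooth_proj (𝓛.quoFst_mk hq) hBp
    have h2 := body_pull_descend hΘ 𝓛.cover.toIsGMap 𝓛.square.snd_map.smooth hsq.snd_map.smooth
      hqY.smooth_proj hqY₂.smooth_proj (𝓛.quoSnd_mk hq) hBp
    rw [e] at h2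
    rw [← h1, ← h2]
    rfl
  · -- along lifts over a horizontal family in `P`, all three values are the ones upstairs
    intro T a₁ b₁ h ha hb t v
    obtain ⟨U, t', p, rfl, hps, hpb, h0⟩ := hΘ.exists_horizontal_lift_family hq
      (((𝓛.isQuo_qL hq).smooth_base hq).comp ha) t
    obtain ⟨a, b, has, hbs, ham, hbm, hap, hbp, hab⟩ := exists_lift_family_composable hq
      (fun t => h (T.incl U t)) (ha.comp (smooth_incl T U)) (hb.comp (smooth_incl T U)) hps hpb
    obtain ⟨v, rfl⟩ := surjective_D_incl T U t' v
    refine (descended_eq_of_horizontal hqL hp hf.smooth (smooth_incl T U)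
      ((𝓛.quo hq).μ_smooth T a₁ b₁ h ha hb) (𝓛.μ_smooth _ a b hab has hbs)
      (fun t => (quoμ_eq hq (hab t) (ham t) (hbm t) (h (T.incl U t))).symm)
      (fun t => (congr_arg 𝓛.π (𝓛.μ_fst _ _ _)).trans (hap t)) (h0 v)).trans
      ((c.μ_conn _ a b hab has hbs t' v).trans (congr_arg₂ _ ?_ ?_).symm)
    · exact descended_eq_of_horizontal hqL hp hf.smooth (smooth_incl T U) ha has ham hap (h0 v)
    · exact descended_eq_of_horizontal hqL hp hf.smooth (smooth_incl T U) hb hbs hbm hbp (h0 v)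

/-- A connection on a 1-morphism descends by means of `Θ`. -/
theorem Hom.Conn.exists_isQuo (hΘ : IsConnection P Θ) {c : 𝓛.Conn} {c' : 𝓛'.Conn}
    {c₁ : (𝓛.quo hq).Conn} {c₁' : (𝓛'.quo hq).Conn} (hc : c.IsQuo hq Θ c₁)
    (hc' : c'.IsQuo hq Θ c₁') {𝓚 : Hom 𝓛 𝓛'} (d : Hom.Conn c c' 𝓚) :
    ∃ d₁ : Hom.Conn c₁ c₁' (𝓚.quo hq), d.IsQuo hq Θ d₁ := by
  have hf := 𝓚.isGMap_base
  have hqK := (𝓚.isQuo_qK hq).principal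
  have hqZ := (𝓚.isQuo_qZ hq).principal
  have hqL := (𝓛.isQuo_qL hq).principal
  have hqL' := (𝓛'.isQuo_qL hq).principal
  have hfL := 𝓛.isGMap_base₂.smooth
  have hfL' := 𝓛'.isGMap_base₂.smooth
  obtain ⟨A₁, hA₁, hp⟩ := d.isConn.exists_descend (K₁ := 𝓚.quoK hq) (hΘ.pullConn hf) hqK
  have e : (fun z => 𝓛'.π (𝓚.ζ₂ z)) = fun z => 𝓛.π (𝓚.ζ₁ z) := funext fun z => (𝓚.comm z).symm
  refine ⟨⟨A₁, d.isConn.descend hqK (𝓚.circ_qK hq) hA₁ hp, ?_, ?_⟩, hp⟩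
  · refine d.curv.descend d.isConn (hΘ.pullConn hf) hqK hqZ.smooth_proj (𝓚.proj_qK hq) hA₁ hp ?_
    rw [weilTwo_sub]
    have h1 := body_pull_descend hΘ 𝓛.cover.toIsGMap 𝓚.ζ₁_map.smooth (𝓚.smooth_quoζ₁ hq)
      (𝓛.isQuo_qY hq).smooth_mk hqZ.smooth_proj (𝓚.quoζ₁_mk hq) hc.curving
    have h2 := body_pull_descend hΘ 𝓛'.cover.toIsGMap 𝓚.ζ₂_map.smooth (𝓚.smooth_quoζ₂ hq)
      (𝓛'.isQuo_qY hq).smooth_mk hqZ.smooth_proj (𝓚.quoζ₂_mk hq) hc'.curving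
    rw [e] at h2
    rw [← h1, ← h2]
    rfl
  · intro T l₁ k₁' k₁ h h' hl hk' hk t v
    obtain ⟨U, t', p, rfl, hps, hpb, h0⟩ := hΘ.exists_horizontal_lift_family hq
      (((𝓛.isQuo_qL hq).smooth_base hq).comp hl) t
    obtain ⟨l, k', k, hls, hks', hks, hlm, hkm', hkm, hlp, hkp', hkp, hlk, hlk'⟩ :=
      exists_lift_family_α hq (fun t => h (T.incl U t)) (fun t => h' (T.incl U t))
        (hl.comp (smooth_incl T U)) (hk'.comp (smooth_incl T U)) (hk.comp (smooth_incl T U)) hps hpb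
    obtain ⟨v, rfl⟩ := surjective_D_incl T U t' v
    have e₁ := descended_eq_of_horizontal hqL hc.conn hfL (smooth_incl T U) hl hls hlm hlp (h0 v)
    have e₂ := descended_eq_of_horizontal hqK hp hf.smooth (smooth_incl T U) hk' hks' hkm' hkp' (h0 v)
    have e₃ := descended_eq_of_horizontal hqK hp hf.smooth (smooth_incl T U) hk hks hkm hkp (h0 v)
    have e₄ := descended_eq_of_horizontal hqL' hc'.conn hfL' (smooth_incl T U)
      ((𝓚.quo hq).α_smooth T l₁ k₁' k₁ h h' hl hk' hk) (𝓚.α_smooth _ l k' k hlk hlk' hls hks' hks)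
      (fun t => (quoα_eq hq (hlk t) (hlk' t) (hlm t) (hkm' t) (hkm t) (h (T.incl U t))
        (h' (T.incl U t))).symm)
      (fun t => (congr_arg 𝓛'.π (𝓚.α_fst _ _ _ _ _)).trans ((𝓚.comm _).symm.trans (hkp t))) (h0 v)
    exact (congr_arg₂ _ e₁ e₂).trans
      ((d.α_conn _ l k' k hlk hlk' hls hks' hks t' v).trans (congr_arg₂ _ e₃ e₄).symm)

/-! ### Quotients of 2-morphisms that preserve connections -/

section Pres

variable {c : 𝓛.Conn} {c' : 𝓛'.Conn} {c'' : 𝓛''.Conn} {c₁ : (𝓛.quo hq).Conn}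
  {c₁' : (𝓛'.quo hq).Conn} {c₁'' : (𝓛''.quo hq).Conn}

theorem TwoRep.Pres.quo (hΘ : IsConnection P Θ) {f g : Hom 𝓛 𝓛'} {d : Hom.Conn c c' f}
    {d' : Hom.Conn c c' g} {d₁ : Hom.Conn c₁ c₁' (f.quo hq)} {d₁' : Hom.Conn c₁ c₁' (g.quo hq)}
    (hd : d.IsQuo hq Θ d₁) (hd' : d'.IsQuo hq Θ d₁') {r : TwoRep f g} (hr : r.Pres d d') :
    (r.quo hq).Pres d₁ d₁' := by
  intro T w₁ k₁ h hw hk t v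
  obtain ⟨U, t', p, rfl, hps, hpb, h0⟩ := hΘ.exists_horizontal_lift_family hq
    (((r.isQuo_qW hq).smooth_base hq).comp hw) t
  obtain ⟨w, k, hws, hks, hwm, hkm, hkp, e⟩ := exists_lift_family_β hq (fun t => h (T.incl U t))
    (hw.comp (smooth_incl T U)) (hk.comp (smooth_incl T U)) hps hpb
  obtain ⟨v, rfl⟩ := surjective_D_incl T U t' v
  have e₁ := descended_eq_of_horizontal (f.isQuo_qK hq).principal hd f.isGMap_base.smooth
    (smooth_incl T U) hk hks hkm hkp (h0 v)
  have e₂ := descended_eq_of_horizontal (g.isQuo_qK hq).principal hd' g.isGMap_base.smooth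
    (smooth_incl T U) ((r.quo hq).β_smooth T w₁ k₁ h hw hk) (r.β_smooth _ w k e hws hks)
    (fun t => (quoβ_eq hq (e t) (hwm t) (hkm t) (h (T.incl U t))).symm)
    (fun t => by rw [r.β_proj, r.base₂, ← e, hkp]) (h0 v)
  exact e₂.trans ((hr _ w k e hws hks t' v).trans e₁.symm)

theorem TriRep.Pres.quo (hΘ : IsConnection P Θ) {f : Hom 𝓛 𝓛'} {g : Hom 𝓛' 𝓛''} {h : Hom 𝓛 𝓛''}
    {d : Hom.Conn c c' f} {d' : Hom.Conn c' c'' g} {d'' : Hom.Conn c c'' h}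
    {d₁ : Hom.Conn c₁ c₁' (f.quo hq)} {d₁' : Hom.Conn c₁' c₁'' (g.quo hq)}
    {d₁'' : Hom.Conn c₁ c₁'' (h.quo hq)} (hd : d.IsQuo hq Θ d₁) (hd' : d'.IsQuo hq Θ d₁')
    (hd'' : d''.IsQuo hq Θ d₁'') {r : TriRep f g h} (hr : r.Pres d d' d'') :
    (r.quo hq).Pres d₁ d₁' d₁'' := by
  intro T w₁ a₁ b₁ ha hb sw sa sb t v
  obtain ⟨U, t', p, rfl, hps, hpb, h0⟩ := hΘ.exists_horizontal_lift_family hq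
    (((r.isQuo_qW hq).smooth_base hq).comp sw) t
  obtain ⟨w, a, b, hws, has, hbs, hwm, ham, hbm, hap, hbp, ea, eb⟩ :=
    exists_lift_family_β hq (fun t => ha (T.incl U t)) (fun t => hb (T.incl U t))
      (sw.comp (smooth_incl T U)) (sa.comp (smooth_incl T U)) (sb.comp (smooth_incl T U)) hps hpb
  obtain ⟨v, rfl⟩ := surjective_D_incl T U t' v
  have e₁ := descended_eq_of_horizontal (f.isQuo_qK hq).principal hd f.isGMap_base.smooth
    (smooth_incl T U) sa has ham hap (h0 v)
  have e₂ := descended_eq_of_horizontal (g.isQuo_qK hq).principal hd' g.isGMap_base.smooth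
    (smooth_incl T U) sb hbs hbm hbp (h0 v)
  have e₃ := descended_eq_of_horizontal (h.isQuo_qK hq).principal hd'' h.isGMap_base.smooth
    (smooth_incl T U) ((r.quo hq).β_smooth T w₁ a₁ b₁ ha hb sw sa sb)
    (r.β_smooth _ w a b ea eb hws has hbs)
    (fun t => (quoβ_eq hq (ea t) (eb t) (hwm t) (ham t) (hbm t) (ha (T.incl U t))
      (hb (T.incl U t))).symm)
    (fun t => by rw [r.β_proj, ← r.comm₀, ← ea, hap]) (h0 v)
  exact e₃.trans ((hr _ w a b ea eb hws has hbs t' v).trans (congr_arg₂ _ e₁ e₂).symm)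

theorem UnitRep.Pres.quo (hΘ : IsConnection P Θ) {g : Hom 𝓛 𝓛} {d : Hom.Conn c c g}
    {d₁ : Hom.Conn c₁ c₁ (g.quo hq)} (hc : c.IsQuo hq Θ c₁) (hd : d.IsQuo hq Θ d₁) {r : UnitRep g}
    (hr : r.Pres d) : (r.quo hq).Pres d₁ := by
  intro T w₁ k₁ h hw hk t v
  obtain ⟨U, t', p, rfl, hps, hpb, h0⟩ := hΘ.exists_horizontal_lift_family hq
    (((r.isQuo_qW hq).smooth_base hq).comp hw) t
  obtain ⟨w, k, hws, hks, hwm, hkm, hkp, e⟩ := exists_lift_family_β hq (fun t => h (T.incl U t))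
    (hw.comp (smooth_incl T U)) (hk.comp (smooth_incl T U)) hps hpb
  obtain ⟨v, rfl⟩ := surjective_D_incl T U t' v
  have e₁ := descended_eq_of_horizontal (𝓛.isQuo_qL hq).principal hc.conn 𝓛.isGMap_base₂.smooth
    (smooth_incl T U) hk hks hkm hkp (h0 v)
  have e₂ := descended_eq_of_horizontal (g.isQuo_qK hq).principal hd g.isGMap_base.smooth
    (smooth_incl T U) ((r.quo hq).β_smooth T w₁ k₁ h hw hk) (r.β_smooth _ w k e hws hks)
    (fun t => (quoβ_eq hq (e t) (hwm t) (hkm t) (h (T.incl U t))).symm)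
    (fun t => by rw [r.β_proj, ← r.comm₁, ← e, hkp]) (h0 v)
  exact e₂.trans ((hr _ w k e hws hks t' v).trans e₁.symm)

end Pres

end QuoConn

/-! ### The Weil homomorphism and differentials -/

section WeilDifferential

theorem extDeriv_compContinuousAlternatingMap {E 𝔤 F : Type*} [NormedAddCommGroup E]
    [NormedSpace ℝ E] [NormedAddCommGroup 𝔤] [NormedSpace ℝ 𝔤] [NormedAddCommGroup F]
    [NormedSpace ℝ F] {L : E → 𝔤 →L[ℝ] F} {σ : E → E [⋀^Fin 2]→L[ℝ] 𝔤} {v : E}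
    (hL : DifferentiableAt ℝ L v) (hσ : DifferentiableAt ℝ σ v)
    (h : DifferentiableAt ℝ (fun z => (L z).compContinuousAlternatingMap (σ z)) v) (a b c : E) :
    extDeriv (fun z => (L z).compContinuousAlternatingMap (σ z)) v ![a, b, c] =
      fderiv ℝ L v a (σ v ![b, c]) - fderiv ℝ L v b (σ v ![a, c]) + fderiv ℝ L v c (σ v ![a, b]) +
        L v (extDeriv σ v ![a, b, c]) := by
  have key : ∀ w (x y : E),
      fderiv ℝ (fun z => (L z).compContinuousAlternatingMap (σ z)) v w ![x, y] =
        fderiv ℝ L v w (σ v ![x, y]) + L v (fderiv ℝ σ v w ![x, y]) := by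
    intro w x y
    have h1 := fderiv_continuousAlternatingMap_apply_const_apply h ![x, y] w
    have h2 : HasFDerivAt (fun z => σ z ![x, y])
        ((ContinuousAlternatingMap.apply ℝ E 𝔤 ![x, y]).comp (fderiv ℝ σ v)) v :=
      (ContinuousAlternatingMap.apply ℝ E 𝔤 ![x, y]).hasFDerivAt.comp v hσ.hasFDerivAt
    have h3 := (hL.hasFDerivAt.clm_apply h2).fderiv
    rw [← h1]
    refine (DFunLike.congr_fun h3 w).trans ?_
    rw [add_comm]
    rfl
  rw [extDeriv_two h, extDeriv_two hσ, key, key, key, map_add, map_sub]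
  abel

variable {G : LieGrp.{v}} {M : GMfd.{v, u} G} {Θ : M → M.E →L[ℝ] G.E}

theorem LieGrp.bracket_sub_left (ξ ξ' η : G.E) :
    G.bracket (ξ - ξ') η = G.bracket ξ η - G.bracket ξ' η := by
  simp only [← bracketForm_apply, alternating_sub_left]

/-- The Bianchi identity `dΩ = [Ω, Θ]`. -/
theorem d_curvForm (hΘ : SmoothOneForm Θ) (x : M) (a b c : M.E) :
    (curvForm Θ).d x ![a, b, c] = G.bracket (curvForm Θ x ![a, b]) (Θ x c) -
      G.bracket (curvForm Θ x ![a, c]) (Θ x b) + G.bracket (curvForm Θ x ![b, c]) (Θ x a) := by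
  let β : Form 2 G.E M.toMfd := fun p => G.bracketForm.compContinuousLinearMap (Θ p)
  have hΘs := smoothOneForm_iff.1 hΘ
  have hβ : β.IsSmooth := fun x₀ y hy => contDiffAt_alternating_comp
    (f := fun _ : M.E => G.bracketForm) contDiffAt_const
    ((hΘ x₀).contDiffAt ((isOpen_extChartAt_target x₀).mem_nhds hy))
  have h0 : (curvForm Θ).d = β.d := by
    refine (Form.d_add hΘs.d hβ).trans ?_
    have : (oneForm Θ).d.d = 0 := by ext1 l; exact Form.d_d hΘs l
    rw [this, zero_add]
  have e1 : oneFormChart Θ x (extChartAt (𝓡 M.dim) x x) = Θ x := by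
    unfold oneFormChart
    rw [chartD_eq_id, extChartAt_to_inv]
    rfl
  have h1 := extDeriv_substitution (p := ContinuousLinearMap.id ℝ M.E)
    (T := fun _ : M.E => G.bracketForm.compContinuousLinearMap (ContinuousLinearMap.fst ℝ G.E M.E))
    (Θ := oneFormChart Θ x) (v := extChartAt (𝓡 M.dim) x x) (differentiableAt_const _)
    ((hΘ.contDiffAt x).differentiableAt (by simp)) a b c
  have e2 : ∀ ξ η : G.E × M.E, (G.bracketForm.compContinuousLinearMap
      (ContinuousLinearMap.fst ℝ G.E M.E)) ![ξ, η] = G.bracket ξ.1 η.1 := fun ξ η =>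
    bracketForm_apply' _
  have e3 : ∀ w, extDeriv (fun _ : G.E × M.E => G.bracketForm.compContinuousLinearMap
      (ContinuousLinearMap.fst ℝ G.E M.E)) (0, extChartAt (𝓡 M.dim) x x) w = 0 := fun w => by
    rw [extDeriv_apply (differentiableAt_const _)]
    simp
  have e4 : ∀ a b : M.E, fderiv ℝ (oneFormChart Θ x) (extChartAt (𝓡 M.dim) x x) a b -
      fderiv ℝ (oneFormChart Θ x) (extChartAt (𝓡 M.dim) x x) b a =
        curvForm Θ x ![a, b] - G.bracket (Θ x a) (Θ x b) := fun a b => by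
    rw [← d_oneForm hΘ, curvForm_apply, add_sub_cancel_right]
  simp only [e1, e2, e4] at h1
  rw [ContinuousLinearMap.coe_id'] at h1
  simp only [id, e3] at h1
  rw [h0]
  refine Eq.trans ?_ (h1.trans ?_)
  · rfl
  · rw [LieGrp.bracket_sub_left, LieGrp.bracket_sub_left, LieGrp.bracket_sub_left,
      bracket_skew (LieGrp.bracket G (Θ x a) (Θ x c)),
      bracket_skew (LieGrp.bracket G (Θ x b) (Θ x c)),
      bracket_jacobi (Θ x a) (Θ x b) (Θ x c)]
    rw [zero_add, bracket_skew (Θ x b) (LieGrp.bracket G (Θ x a) (Θ x c))]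
    abel

theorem dFun_eq_fderiv {f : M → ℝ} (hf : (funForm (M := M.toMfd) f).IsSmooth) (x : M) (a : M.E) :
    dFun (M := M.toMfd) f x a =
      fderiv ℝ (fun y => f ((extChartAt (𝓡 M.dim) x).symm y)) (extChartAt (𝓡 M.dim) x x) a :=
  (d_funForm f hf x a).symm.trans (DFunLike.congr_fun (extDeriv_constOfIsEmpty
    (fun y => f ((extChartAt (𝓡 M.dim) x).symm y)) _) ![a])

theorem WeilForm.IsEquivForm.dTop_zero {B : WeilForm M 0} (hB : B.IsEquivForm) (x : M)
    (a b c : M.E) : B.dTop x (0, a) (0, b) (0, c) = B.body.d x ![a, b, c] := by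
  rw [hB.dTop_eq]
  simp only [GMfd.hor_apply, map_zero, sub_zero]

/-- The Weil homomorphism takes `d_G` to the exterior derivative. -/
theorem d_weilTwo {B : WeilForm M 0} (hB : B.IsEquivForm) (hΘ : SmoothOneForm Θ) (x : M)
    (a b c : M.E) :
    let h : M.E → G.E × M.E := fun z => (Θ x z, z)
    (weilTwo Θ B).d x ![a, b, c] = B.dTop x (h a) (h b) (h c) +
      B.dLin x (curvForm Θ x ![a, b]) (h c) - B.dLin x (curvForm Θ x ![a, c]) (h b) +
        B.dLin x (curvForm Θ x ![b, c]) (h a) := by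
  intro h
  set v := extChartAt (𝓡 M.dim) x x with hv
  have hvt := mem_extChartAt_target (I := 𝓡 M.dim) x
  have hT : DifferentiableAt ℝ (B.topChart x) v := (hB.contDiffAt_top hvt).differentiableAt (by simp)
  have hΘd : DifferentiableAt ℝ (oneFormChart Θ x) v := (hΘ.contDiffAt x).differentiableAt (by simp)
  have hσ : DifferentiableAt ℝ ((curvForm Θ).chart x) v :=
    (isSmooth_curvForm hΘ x v hvt).differentiableAt (by simp)
  let L : M.E → G.E →L[ℝ] ℝ := fun z => B.momentMap ((extChartAt (𝓡 M.dim) x).symm z)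
  have hLs : ContDiffAt ℝ ∞ L v := contDiffAt_clm fun u =>
    (ContinuousAlternatingMap.apply ℝ M.E ℝ (ι := Fin 0) ![]).contDiff.contDiffAt.comp v
      (hB.isSmooth_moment u x v hvt)
  have hL : DifferentiableAt ℝ L v := hLs.differentiableAt (by simp)
  have hS : DifferentiableAt ℝ
      (fun z => (L z).compContinuousAlternatingMap ((curvForm Θ).chart x z)) v := by
    refine (contDiffAt_alternating fun w => ?_ : ContDiffAt ℝ ∞ _ v).differentiableAt (by simp)
    exact hLs.clm_apply ((ContinuousAlternatingMap.apply ℝ M.E G.E w).contDiff.contDiffAt.comp v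
      (isSmooth_curvForm hΘ x v hvt))
  have hchart : (weilTwo Θ B).chart x = fun z =>
      (B.topChart x z).compContinuousLinearMap ((oneFormChart Θ x z).prod
        (ContinuousLinearMap.id ℝ M.E)) +
      (L z).compContinuousAlternatingMap ((curvForm Θ).chart x z) := rfl
  have hW : DifferentiableAt ℝ ((weilTwo Θ B).chart x) v :=
    (isSmooth_weilTwo hB hΘ x v hvt).differentiableAt (by simp)
  have hU : DifferentiableAt ℝ (fun z => (B.topChart x z).compContinuousLinearMap
      ((oneFormChart Θ x z).prod (ContinuousLinearMap.id ℝ M.E))) v := by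
    have := hW.sub hS
    rw [hchart] at this
    refine this.congr_of_eventuallyEq (Eventually.of_forall fun z => ?_)
    exact (add_sub_cancel_right _ _).symm
  have e1 : oneFormChart Θ x v = Θ x := by
    unfold oneFormChart
    rw [hv, chartD_eq_id, extChartAt_to_inv]
    rfl
  have e2 : B.topChart x v = B.top x := by
    unfold WeilForm.topChart
    rw [hv, chartD_eq_id, extChartAt_to_inv]
    rfl
  have e3 : (curvForm Θ).chart x v = curvForm Θ x := by
    unfold Form.chart
    rw [hv, chartD_eq_id, extChartAt_to_inv]
    rfl
  have e4 : L v = B.momentMap x := by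
    change B.momentMap _ = _
    rw [hv, extChartAt_to_inv]
  have e5 : ∀ a b : M.E, fderiv ℝ (oneFormChart Θ x) v a b - fderiv ℝ (oneFormChart Θ x) v b a =
      curvForm Θ x ![a, b] - G.bracket (Θ x a) (Θ x b) := fun a b => by
    rw [← d_oneForm hΘ, curvForm_apply, add_sub_cancel_right]
  have e6 : ∀ w u, fderiv ℝ L v w u = dFun (fun y : M => B.lin y u ![]) x w := fun w u => by
    have h1 := (hL.hasFDerivAt.clm_apply (hasFDerivAt_const u v)).fderiv
    have h2 := dFun_eq_fderiv (hB.isSmooth_moment u) x w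
    refine Eq.trans ?_ h2.symm
    refine Eq.trans ?_ (DFunLike.congr_fun h1 w).symm
    simp
  have h1 := extDeriv_substitution (p := ContinuousLinearMap.id ℝ M.E) (v := v) hT hΘd a b c
  have h2 := extDeriv_compContinuousAlternatingMap hL hσ hS a b c
  have h3 : extDeriv ((curvForm Θ).chart x) v = (curvForm Θ).d x := rfl
  have e7 : ∀ (u u' : G.E) (w : G.E × M.E), B.top x ![(u - u', 0), w] =
      B.top x ![(u, 0), w] - B.top x ![(u', 0), w] := fun u u' w => by
    rw [← alternating_sub_left]
    simp
  have e8 : ∀ u, B.momentMap x u = B.lin x u ![] := fun u => rfl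
  rw [h3, d_curvForm hΘ, e3, e4, e6, e6, e6, map_add, map_sub, e8, e8, e8] at h2
  simp only [e1, e5] at h1
  rw [ContinuousLinearMap.coe_id'] at h1
  simp only [id] at h1
  rw [e2, e7, e7, e7] at h1
  have h4 : (weilTwo Θ B).d x = extDeriv ((weilTwo Θ B).chart x) v := rfl
  rw [h4, hchart]
  have h5 := extDeriv_add hU hS
  refine (DFunLike.congr_fun h5 ![a, b, c]).trans ?_
  refine (congr_arg₂ (· + ·) h1 h2).trans ?_
  simp only [WeilForm.dTop, WeilForm.dLin, chartT_eq_id, h]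
  change extDeriv _ _ ![h a, h b, h c] + _ - _ + _ + _ = extDeriv _ _ ![h a, h b, h c] - _ + _ - _ +
    _ - _ + _
  simp only [h, ← hv]
  ring

end WeilDifferential

/-! ### The functor on gerbes with connection -/

section QuoFunctorConn

variable {G : LieGrp.{v}} {P : GMfd.{v, u} G} {X : Mfd.{u}} {q : P → X.triv}
  (hq : IsPrincipal G (P := P.toMfd) (X := X.triv.toMfd) P.act q) {Θ : P → P.E →L[ℝ] G.E}
  (hΘ : IsConnection P Θ) {𝓛 𝓛' 𝓛'' : GerbeC P}

/-- The quotient of a gerbe with connection, with a connection descended by means of `Θ`. -/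
def GerbeC.quo (𝓛 : GerbeC P) : GerbeC X.triv :=
  ⟨𝓛.gerbe.quo hq, (𝓛.conn.exists_isQuo (hq := hq) hΘ).choose⟩

theorem GerbeC.isQuo (𝓛 : GerbeC P) : 𝓛.conn.IsQuo hq Θ (𝓛.quo hq hΘ).conn :=
  (𝓛.conn.exists_isQuo hΘ).choose_spec

/-- The quotient of a 1-morphism with connection, with a connection descended by means of `Θ`. -/
def HomC.quo (f : HomC 𝓛 𝓛') : HomC (𝓛.quo hq hΘ) (𝓛'.quo hq hΘ) :=
  ⟨f.hom.quo hq, (f.conn.exists_isQuo hΘ (𝓛.isQuo hq hΘ) (𝓛'.isQuo hq hΘ)).choose⟩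

theorem HomC.isQuo (f : HomC 𝓛 𝓛') : f.conn.IsQuo hq Θ (f.quo hq hΘ).conn :=
  (f.conn.exists_isQuo hΘ (𝓛.isQuo hq hΘ) (𝓛'.isQuo hq hΘ)).choose_spec

/-- The functor `Θ^*`. -/
def quoFunctorConn : TwoFunctor (GGrbC P) (GGrbC X.triv) where
  obj := fun 𝓛 => 𝓛.quo hq hΘ
  map := fun f => f.quo hq hΘ
  two := fun {_ _ f g} J => ⟨J.1.quo hq, by
    obtain ⟨r, h, hr⟩ := J.2
    exact ⟨r.quo hq, by rw [← h]; rfl, hr.quo hΘ (f.isQuo hq hΘ) (g.isQuo hq hΘ)⟩⟩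
  tri := fun {_ _ _ f g h} T => ⟨T.1.quo hq, by
    obtain ⟨r, h', hr⟩ := T.2
    exact ⟨r.quo hq, by rw [← h']; rfl,
      hr.quo hΘ (f.isQuo hq hΘ) (g.isQuo hq hΘ) (h.isQuo hq hΘ)⟩⟩
  unit := fun {𝓛 e} U => ⟨U.1.quo hq, by
    obtain ⟨r, h, hr⟩ := U.2
    exact ⟨r.quo hq, by rw [← h]; rfl, hr.quo hΘ (𝓛.isQuo hq hΘ) (e.isQuo hq hΘ)⟩⟩
  isId := fun _ h => h.quo hq
  isVComp := fun _ _ _ h => h.quo hq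
  isNatural := fun _ _ _ _ _ h => h.quo hq
  isTet := fun _ _ _ _ h => h.quo hq
  isUnitComp := fun _ _ _ h => h.quo hq
  isRightUnit := fun _ _ _ h => h.quo hq
  isLeftUnit := fun _ _ _ h => h.quo hq

/-- The projections that exhibit `quoFunctorConn` as the functor `Θ^*`. -/
def quotientDataC : QuotientDataC (X := X) q Θ (quoFunctorConn hq hΘ) where
  obj := fun 𝓛 => 𝓛.gerbe.objQuotient hq
  obj_conn := fun 𝓛 => isDescendedConn_of_pull 𝓛.gerbe.isGMap_base₂.smooth (𝓛.isQuo hq hΘ).conn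
  obj_curving := fun 𝓛 => isWeilImageTwo_of_pull hΘ.smooth 𝓛.gerbe.cover.smooth
    (𝓛.isQuo hq hΘ).curving
  hom := fun f => f.hom.homQuotient hq
  hom_conn := fun f => isDescendedConn_of_pull f.hom.isGMap_base.smooth (f.isQuo hq hΘ)
  two := fun J => J.1.isTwoQuotient hq
  tri := fun T => T.1.isTriQuotient hq
  unit := fun U => U.1.isUnitQuotient hq

/-- The Weil homomorphism takes the equivariant curvature to the curvature of the quotient. -/
theorem isWeilImageThree_curv {𝓛 : GerbeC P} {η : WeilForm P 1} {η₁ : WeilForm X.triv 1}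
    (h : IsGerbeCurv 𝓛 η) (h₁ : IsGerbeCurv (𝓛.quo hq hΘ) η₁) :
    IsWeilImageThree (Y₁ := X.triv) Θ id q η₁ η := by
  intro p a b c
  have hπ := 𝓛.gerbe.cover
  have hB := 𝓛.conn.isEquivForm
  have hY := 𝓛.gerbe.isQuo_qY hq
  have hc := 𝓛.isQuo hq hΘ
  set c₁ := (𝓛.quo hq hΘ).conn with hc₁
  obtain ⟨y, rfl⟩ := hπ.surjective p
  obtain ⟨a, rfl⟩ := hπ.submersion y a
  obtain ⟨b, rfl⟩ := hπ.submersion y b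
  obtain ⟨c, rfl⟩ := hπ.submersion y c
  have hid : ∀ (x : P) (w : P.E), D (M := P.toMfd) (N := P.toMfd) id x w = w := D_id
  simp only [hid]
  -- the right-hand side is the Weil homomorphism on `d_G B`
  have hΩ : ∀ a b : 𝓛.gerbe.Y.E, curvature Θ (id (𝓛.gerbe.π y)) (D 𝓛.gerbe.π y a)
      (D 𝓛.gerbe.π y b) = curvForm (pullConn Θ 𝓛.gerbe.π) y ![a, b] :=
    fun a b => curvature_pull hΘ.smooth hπ.smooth y a b
  have hΩ' : curvForm (pullConn Θ 𝓛.gerbe.π) y ![c, a] =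
      -curvForm (pullConn Θ 𝓛.gerbe.π) y ![a, c] := alternating_swap _ _ _
  have htop := h.2.2 y (pullConn Θ 𝓛.gerbe.π y a, a) (pullConn Θ 𝓛.gerbe.π y b, b)
    (pullConn Θ 𝓛.gerbe.π y c, c)
  have hlin : ∀ u w, η.lin (𝓛.gerbe.π y) u ![(Θ (𝓛.gerbe.π y) (D 𝓛.gerbe.π y w),
      D 𝓛.gerbe.π y w)] = 𝓛.conn.B.dLin y u (pullConn Θ 𝓛.gerbe.π y w, w) := fun u w => by
    rw [← h.2.1 y u, WeilForm.pull_lin]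
    congr 1
    ext1 i; fin_cases i; rfl
  have hd := d_weilTwo hB (hΘ.pullConn hπ.toIsGMap).smooth y a b c
  simp only [] at hd
  rw [← htop, ← hlin, ← hlin, ← hlin, WeilForm.pull_top] at hd
  -- the left-hand side is the exterior derivative of the descended curving
  have hd₁ := (congr_arg Form.d hc.curving).symm.trans
    (Form.d_pull c₁.isEquivForm.isSmooth_body hY.smooth_mk)
  have hd₂ := DFunLike.congr_fun (congr_fun hd₁ y) ![a, b, c]
  have htop₁ := h₁.2.2 (𝓛.gerbe.qY hq y) (0, D (M := 𝓛.gerbe.Y.toMfd) (𝓛.gerbe.qY hq) y a)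
    (0, D (M := 𝓛.gerbe.Y.toMfd) (𝓛.gerbe.qY hq) y b)
    (0, D (M := 𝓛.gerbe.Y.toMfd) (𝓛.gerbe.qY hq) y c)
  have hdT := c₁.isEquivForm.dTop_zero (𝓛.gerbe.qY hq y)
    (D (M := 𝓛.gerbe.Y.toMfd) (𝓛.gerbe.qY hq) y a) (D (M := 𝓛.gerbe.Y.toMfd) (𝓛.gerbe.qY hq) y b)
    (D (M := 𝓛.gerbe.Y.toMfd) (𝓛.gerbe.qY hq) y c)
  have hbase : ∀ w, D (𝓛.gerbe.quoπ hq) (𝓛.gerbe.qY hq y)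
      (D (M := 𝓛.gerbe.Y.toMfd) (𝓛.gerbe.qY hq) y w) =
        D (M := P.toMfd) (N := X.triv.toMfd) q (𝓛.gerbe.π y) (D 𝓛.gerbe.π y w) :=
    hY.D_base hq y
  have hL : η₁.top (q (𝓛.gerbe.π y)) ![(0, D (M := P.toMfd) (N := X.triv.toMfd) q (𝓛.gerbe.π y)
      (D 𝓛.gerbe.π y a)), (0, D (M := P.toMfd) (N := X.triv.toMfd) q (𝓛.gerbe.π y)
      (D 𝓛.gerbe.π y b)), (0, D (M := P.toMfd) (N := X.triv.toMfd) q (𝓛.gerbe.π y)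
      (D 𝓛.gerbe.π y c))] = (weilTwo (pullConn Θ 𝓛.gerbe.π) 𝓛.conn.B).d y ![a, b, c] := by
    refine Eq.trans ?_ hd₂.symm
    have e : (fun i => D (M := 𝓛.gerbe.Y.toMfd) (𝓛.gerbe.qY hq) y (![a, b, c] i)) =
        ![D (M := 𝓛.gerbe.Y.toMfd) (𝓛.gerbe.qY hq) y a,
          D (M := 𝓛.gerbe.Y.toMfd) (𝓛.gerbe.qY hq) y b,
          D (M := 𝓛.gerbe.Y.toMfd) (𝓛.gerbe.qY hq) y c] := by
      ext1 i; fin_cases i <;> rfl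
    refine Eq.trans ?_ ((htop₁.trans hdT).trans (congr_arg (c₁.B.body.d _) e.symm))
    rw [← hbase, ← hbase, ← hbase, ← hY.comm]
    refine congr_arg (η₁.top (𝓛.gerbe.quoπ hq (𝓛.gerbe.qY hq y))) ?_
    ext1 i; fin_cases i <;> rfl
  refine hL.trans (hd.trans ?_)
  simp only [hΩ, hΩ']
  have eneg : ∀ u w, η.lin (𝓛.gerbe.π y) (-u) w = -η.lin (𝓛.gerbe.π y) u w := fun u w => by
    rw [map_neg]; rfl
  have etop : (fun i => ((![(pullConn Θ 𝓛.gerbe.π y a, a), (pullConn Θ 𝓛.gerbe.π y b, b),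
      (pullConn Θ 𝓛.gerbe.π y c, c)] i).1, D 𝓛.gerbe.π y (![(pullConn Θ 𝓛.gerbe.π y a, a),
        (pullConn Θ 𝓛.gerbe.π y b, b), (pullConn Θ 𝓛.gerbe.π y c, c)] i).2)) =
      ![(Θ (𝓛.gerbe.π y) (D 𝓛.gerbe.π y a), D 𝓛.gerbe.π y a),
        (Θ (𝓛.gerbe.π y) (D 𝓛.gerbe.π y b), D 𝓛.gerbe.π y b),
        (Θ (𝓛.gerbe.π y) (D 𝓛.gerbe.π y c), D 𝓛.gerbe.π y c)] := by
    ext1 i; fin_cases i <;> rfl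
  rw [etop, eneg]
  simp only [id]
  ring

end QuoFunctorConn

end GerbeQuot

end

theorem proposition4 (G : LieGrp.{v}) [CompactSpace G] (P : GMfd.{v, u} G) (X : Mfd.{u})
    (q : P → X) (hq : IsPrincipal G (P := P.toMfd) P.act q) :
    ∃ F : TwoFunctor (GGrb P) (GGrb X.triv), Nonempty (QuotientData q F) ∧
      ∀ Θ : P → (P.E →L[ℝ] G.E), IsConnection P Θ →
        ∃ FΘ : TwoFunctor (GGrbC P) (GGrbC X.triv), Nonempty (QuotientDataC q Θ FΘ) ∧
          FΘ.comp (forget X.triv) = (forget P).comp F ∧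
          ∀ 𝓛 : GerbeC P,
            (∃! η : WeilForm P 1, IsGerbeCurv 𝓛 η) ∧
            (∃! η₁ : WeilForm X.triv 1, IsGerbeCurv (FΘ.obj 𝓛) η₁) ∧
            ∀ (η : WeilForm P 1) (η₁ : WeilForm X.triv 1),
              IsGerbeCurv 𝓛 η → IsGerbeCurv (FΘ.obj 𝓛) η₁ →
              IsWeilImageThree Θ id q η₁ η := by
  have hq' : IsPrincipal G (P := P.toMfd) (X := X.triv.toMfd) P.act q := hq
  refine ⟨quoFunctor hq', ⟨quotientData hq'⟩, fun Θ hΘ => ?_⟩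
  exact ⟨quoFunctorConn hq' hΘ, ⟨quotientDataC hq' hΘ⟩, rfl, fun 𝓛 =>
    ⟨existsUnique_isGerbeCurv 𝓛, existsUnique_isGerbeCurv _,
      fun _ _ h h₁ => isWeilImageThree_curv hq' hΘ h h₁⟩⟩
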